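/- Let $d\ge 2$ be an integer, write $\langle\xi\rangle=(1+|\xi|^2)^{1/2}$, and for $0<h\le 1$ and a function $a(x,\xi)$ on $\mathbb{R}^{d-1}\times\mathbb{R}^{d-1}$ let $$(\mathrm{Op}_h(a)f)(x)=(2\pi h)^{-d+1}\int\!\!\int e^{-\frac ih\langle x-y,\xi\rangle}a(x,\xi)f(y)\,dy\,d\xi ,$$ defined on Schwartz functions $f$ and extended by continuity. Let $H_h^{s}=H_h^s(\mathbb{R}^{d-1})$ be the Sobolev space with the norm $\|u\|_{H_h^s}=\|\mathrm{Op}_h(\langle\xi\rangle^s)u\|_{L^2}$. For $k\in\mathbb{R}$ and an integer $\mu\ge1$ we say that $a$ belongs to $S^k_\mu$ with constants $C_{\alpha,\beta}$ if $a$ is $C^\infty$ in $\xi$ and $$|\partial_\xi^\alpha\partial_x^\beta a(x,\xi)|\le C_{\alpha,\beta}\langle\xi\rangle^{k-|\alpha|}$$ for all multi-indices $\alpha$ and all $\beta$ with $|\beta|\le\mu$, where the $x$-derivatives are weak derivatives and the bound holds for every $\xi$ and almost every $x$. There is an integer $s_d\ge 0$ depending only on $d$ such that, with $s'_d=2d+5+s_d$,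 the following holds. Let $\mu_1,\mu_2\ge 1$ be integers. (i) Let $k_1<0$ and $k_2<k'$ be real numbers. There is a constant $K$ depending only on $d,k_1,k_2,k',\mu_1,\mu_2$ such that for all $h\in(0,1]$, all $a_1\in S^{k_1}_{\mu_1}$ with constants $C^{(1)}_{\alpha,\beta}$ and all $a_2\in S^{k_2}_{\mu_2}$ with constants $C^{(2)}_{\alpha,\beta}$, the operators $\mathrm{Op}_h(a_1):L^2\to L^2$ and $\mathrm{Op}_h(a_2),\mathrm{Op}_h(a_1a_2):H_h^{k'}\to L^2$ are bounded and $$\begin{aligned} &\left\|\mathrm{Op}_h(a_1)\mathrm{Op}_h(a_2)-\mathrm{Op}_h(a_1a_2)\right\|_{H_h^{k'}\to L^2}\\ &\le K\Big(\sum_{\substack{|\alpha_1|+|\beta_1|+|\alpha_2|+|\beta_2|\le s'_d,\ |\beta_1|\le\mu_1,\ |\beta_2|\le\mu_2\\ |\alpha_1|+|\beta_1|\ge1,\ |\alpha_2|+|\beta_2|\ge1}}h^{\frac{|\alpha_1|+|\beta_1|+|\alpha_2|+|\beta_2|}{2}}C^{(1)}_{\alpha_1,\beta_1}C^{(2)}_{\alpha_2,\beta_2}\\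 &+h^{\mu_1/2}\log(1+h^{-1})\sum_{\substack{|\alpha_1|\le d,\ |\beta_1|=\mu_1\\ |\alpha_2|+|\beta_2|\le s_d,\ |\beta_2|\le\mu_2}}h^{\frac{|\alpha_2|+|\beta_2|}{2}}C^{(1)}_{\alpha_1,\beta_1}C^{(2)}_{\alpha_2,\beta_2} +h^{\mu_1/2}\log(1+h^{-1})\sum_{\substack{|\alpha_1|+|\alpha_2|\le d\\ |\beta_1|=\mu_1,\ \beta_2=0}}C^{(1)}_{\alpha_1,\beta_1}C^{(2)}_{\alpha_2,\beta_2}\\ &+h^{\mu_2/2}\log(1+h^{-1})\sum_{\substack{|\alpha_1|+|\beta_1|\le s_d,\ |\beta_1|\le\mu_1\\ |\alpha_2|\le d,\ |\beta_2|=\mu_2}}h^{\frac{|\alpha_1|+|\beta_1|}{2}}C^{(1)}_{\alpha_1,\beta_1}C^{(2)}_{\alpha_2,\beta_2} +h^{\mu_2/2}\log(1+h^{-1})\sum_{\substack{|\alpha_1|+|\alpha_2|\le d\\ \beta_1=0,\ |\beta_2|=\mu_2}}C^{(1)}_{\alpha_1,\beta_1}C^{(2)}_{\alpha_2,\beta_2}\\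 &+h^{(\mu_1+\mu_2)/2}\log^2(1+h^{-1})\sum_{\substack{|\alpha_1|\le d,\ |\beta_1|=\mu_1\\ |\alpha_2|\le d,\ |\beta_2|=\mu_2}}C^{(1)}_{\alpha_1,\beta_1}C^{(2)}_{\alpha_2,\beta_2}\Big). \end{aligned}$$ (ii) Let $k_1<0$. There is a constant $K$ depending only on $d,k_1,\mu_1,\mu_2$ such that for all $h\in(0,1]$, all $a_1\in S^{k_1}_{\mu_1}$ with constants $C^{(1)}_{\alpha,\beta}$ and all functions $a_2=a_2(x)$ independent of $\xi$ with $|\partial_x^\beta a_2(x)|\le C^{(2)}_\beta$ for $|\beta|\le\mu_2$ (weak derivatives, almost every $x$), the operators $\mathrm{Op}_h(a_1)$, $\mathrm{Op}_h(a_2)$, $\mathrm{Op}_h(a_1a_2)$ are bounded on $L^2$ and $$\begin{aligned} &\left\|\mathrm{Op}_h(a_1)\mathrm{Op}_h(a_2)-\mathrm{Op}_h(a_1a_2)\right\|_{L^2\to L^2}\\ &\le K\Big(\sum_{\substack{|\alpha_1|+|\beta_1|+|\beta_2|\le s'_d,\ |\alpha_1|+|\beta_1|\ge1\\ |\beta_1|\le\mu_1,\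 1\le|\beta_2|\le\mu_2}}h^{\frac{|\alpha_1|+|\beta_1|+|\beta_2|}{2}}C^{(1)}_{\alpha_1,\beta_1}C^{(2)}_{\beta_2} +h^{\mu_1/2}\log(1+h^{-1})\sum_{|\alpha_1|\le d,\ |\beta_1|=\mu_1}C^{(1)}_{\alpha_1,\beta_1}C^{(2)}_0\\ &\qquad+h^{\mu_2/2}\sum_{\substack{|\alpha_1|+|\beta_1|\le s_d,\ |\beta_1|\le\mu_1\\ |\beta_2|=\mu_2}}h^{\frac{|\alpha_1|+|\beta_1|}{2}}C^{(1)}_{\alpha_1,\beta_1}C^{(2)}_{\beta_2}\Big). \end{aligned}$$ -/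

import Mathlib

open MeasureTheory FourierTransform
open scoped SchwartzMap ContDiff ENNReal

noncomputable section

/-- The Euclidean space `ℝⁿ`. -/
abbrev EucSp (n : ℕ) : Type := EuclideanSpace ℝ (Fin n)

/-- The complex Hilbert space `L²(ℝⁿ)`. -/
abbrev L2Sp (n : ℕ) : Type := Lp ℂ 2 (volume : Measure (EucSp n))

/-! ### Multi-indices and derivatives -/

/-- Multi-indices in dimension `n`. -/
abbrev MultiIdx (n : ℕ) : Type := Fin n → ℕ

/-- The length `|α| = α₁ + ⋯ + αₙ`. -/
def MultiIdx.len {n : ℕ} (α : MultiIdx n) : ℕ := ∑ i, α i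

/-- The finite set of the multi-indices of length exactly `m`. -/
def idxEq (n m : ℕ) : Finset (MultiIdx n) := Finset.piAntidiag Finset.univ m

/-- The finite set of the multi-indices of length at most `m`. -/
def idxLE (n m : ℕ) : Finset (MultiIdx n) := (Finset.range (m + 1)).biUnion (idxEq n)

theorem mem_idxEq {n m : ℕ} {α : MultiIdx n} : α ∈ idxEq n m ↔ α.len = m := by
  simp [idxEq, MultiIdx.len, Finset.mem_piAntidiag]

theorem mem_idxLE {n m : ℕ} {α : MultiIdx n} : α ∈ idxLE n m ↔ α.len ≤ m := by
  simp [idxLE, mem_idxEq]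

/-- The classical partial derivative `∂ᵢ f`. -/
def partialD {n : ℕ} {F : Type*} [NormedAddCommGroup F] [NormedSpace ℝ F]
    (i : Fin n) (f : EucSp n → F) : EucSp n → F :=
  fun x => fderiv ℝ f x (EuclideanSpace.single i 1)

/-- The classical derivative `∂^α f = ∂₁^{α₁} ⋯ ∂ₙ^{αₙ} f`. -/
def multiD {n : ℕ} {F : Type*} [NormedAddCommGroup F] [NormedSpace ℝ F]
    (α : MultiIdx n) (f : EucSp n → F) : EucSp n → F :=
  (List.finRange n).foldr (fun i g => (partialD i)^[α i] g) f

/-- `v` is the weak (distributional) derivative `∂^β u` on `ℝⁿ`. -/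
structure HasWeakDeriv {n : ℕ} (β : MultiIdx n) (u v : EucSp n → ℂ) : Prop where
  locallyIntegrable_left : LocallyIntegrable u
  locallyIntegrable_right : LocallyIntegrable v
  integral_eq : ∀ φ : EucSp n → ℝ, ContDiff ℝ ∞ φ → HasCompactSupport φ →
    ∫ x, multiD β φ x • u x = (-1) ^ β.len * ∫ x, φ x • v x

/-! ### Symbols of limited regularity in `x` -/

/-- `⟨ξ⟩ = (1 + |ξ|²)^{1/2}`. -/
def japBr {n : ℕ} (ξ : EucSp n) : ℝ := Real.sqrt (1 + ‖ξ‖ ^ 2)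

/-- `a(x, ξ)` is smooth in `ξ`, and for all `α` and all `|β| ≤ μ` the derivative
`∂_ξ^α ∂_x^β a` satisfies `|∂_ξ^α ∂_x^β a(x, ξ)| ≤ C α β ⟨ξ⟩^{k - |α|}`. As `C^μ` means here that
the derivatives of order `μ` are bounded functions (`W^{μ,∞}`), the derivatives in `x` are taken
in the weak sense and the bounds hold for almost every `x`. -/
structure IsSymbol {n : ℕ} (k : ℝ) (μ : ℕ) (C : MultiIdx n → MultiIdx n → ℝ)
    (a : EucSp n → EucSp n → ℂ) : Prop where
  smooth : ∀ x, ContDiff ℝ ∞ (a x)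
  bound : ∀ α β : MultiIdx n, β.len ≤ μ → ∀ ξ : EucSp n, ∃ v : EucSp n → ℂ,
    HasWeakDeriv β (fun x => multiD α (a x) ξ) v ∧
    ∀ᵐ x, ‖v x‖ ≤ C α β * japBr ξ ^ (k - (α.len : ℝ))

/-- `a(x)` satisfies `|∂_x^β a(x)| ≤ C β` for all `|β| ≤ μ`, derivatives being weak ones. -/
def IsFunSymbol {n : ℕ} (μ : ℕ) (C : MultiIdx n → ℝ) (a : EucSp n → ℂ) : Prop :=
  ∀ β : MultiIdx n, β.len ≤ μ → ∃ v : EucSp n → ℂ,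
    HasWeakDeriv β a v ∧ ∀ᵐ x, ‖v x‖ ≤ C β

/-! ### Semiclassical Sobolev spaces -/

/-- The operator `Op_h(⟨ξ⟩^s)` on tempered distributions. In the convention of Mathlib the Fourier
variable `η` corresponds to `ξ = ± 2 π h η`. -/
def scBessel (n : ℕ) (h s : ℝ) : 𝓢'(EucSp n, ℂ) →L[ℂ] 𝓢'(EucSp n, ℂ) :=
  TemperedDistribution.fourierMultiplierCLM ℂ
    (fun η => ((japBr ((2 * Real.pi * h) • η) ^ s : ℝ) : ℂ))

/-- The embedding `L² ⊂ 𝓢'`. -/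
def l2ToDistr (n : ℕ) : L2Sp n →ₗ[ℂ] 𝓢'(EucSp n, ℂ) :=
  (Lp.toTemperedDistributionCLM ℂ (volume : Measure (EucSp n)) 2).toLinearMap

theorem l2ToDistr_injective (n : ℕ) : Function.Injective (l2ToDistr n) := by
  have h := Lp.ker_toTemperedDistributionCLM_eq_bot (F := ℂ) (μ := (volume : Measure (EucSp n)))
    (p := 2)
  exact LinearMap.ker_eq_bot.mp h

theorem hasTemperateGrowth_japBr (n : ℕ) (h s : ℝ) :
    (fun η : EucSp n => ((japBr ((2 * Real.pi * h) • η) ^ s : ℝ) : ℂ)).HasTemperateGrowth := by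
  have h1 := Function.hasTemperateGrowth_one_add_norm_sq_rpow (EucSp n) (s / 2)
  have h2 : (fun η : EucSp n => (2 * Real.pi * h) • η).HasTemperateGrowth := by fun_prop
  have h3 := h1.comp h2
  have h4 : (fun η : EucSp n => japBr ((2 * Real.pi * h) • η) ^ s)
      = (fun x : EucSp n => (1 + ‖x‖ ^ 2) ^ (s / 2)) ∘ fun η => (2 * Real.pi * h) • η := by
    funext η
    simp only [japBr, Function.comp, Real.sqrt_eq_rpow]
    rw [← Real.rpow_mul (by positivity)]
    ring_nf
  rw [← h4] at h3
  fun_prop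

theorem scBessel_neg_scBessel (n : ℕ) (h s : ℝ) (u : 𝓢'(EucSp n, ℂ)) :
    scBessel n h (-s) (scBessel n h s u) = u := by
  unfold scBessel
  rw [TemperedDistribution.fourierMultiplierCLM_fourierMultiplierCLM_apply
    (hasTemperateGrowth_japBr n h s) (hasTemperateGrowth_japBr n h (-s))]
  have : ((fun η : EucSp n => ((japBr ((2 * Real.pi * h) • η) ^ s : ℝ) : ℂ)) *
      fun η : EucSp n => ((japBr ((2 * Real.pi * h) • η) ^ (-s) : ℝ) : ℂ)) = fun _ => 1 := by
    funext η
    have hp : 0 < japBr ((2 * Real.pi * h) • η) := Real.sqrt_pos.mpr (by positivity)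
    simp only [Pi.mul_apply]
    rw [← Complex.ofReal_mul, ← Real.rpow_add hp]
    simp
  rw [this]
  simp

/-- The tempered distributions `u` with `Op_h(⟨ξ⟩^s) u ∈ L²`. -/
def scSobolevSubmodule (n : ℕ) (h s : ℝ) : Submodule ℂ 𝓢'(EucSp n, ℂ) :=
  (LinearMap.range (l2ToDistr n)).comap (scBessel n h s).toLinearMap

/-- The Sobolev space `H_h^s(ℝⁿ)`; it carries the norm `‖Op_h(⟨ξ⟩^s) u‖_{L²}` (not the topology of
the tempered distributions). -/
def ScSobolev (n : ℕ) (h s : ℝ) : Type := scSobolevSubmodule n h s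

instance (n : ℕ) (h s : ℝ) : AddCommGroup (ScSobolev n h s) :=
  inferInstanceAs (AddCommGroup (scSobolevSubmodule n h s))

instance (n : ℕ) (h s : ℝ) : Module ℂ (ScSobolev n h s) :=
  inferInstanceAs (Module ℂ (scSobolevSubmodule n h s))

/-- The map `u ↦ Op_h(⟨ξ⟩^s) u` from `H_h^s` to `L²`. -/
def ScSobolev.toL2 (n : ℕ) (h s : ℝ) : ScSobolev n h s →ₗ[ℂ] L2Sp n :=
  (LinearEquiv.ofInjective (l2ToDistr n) (l2ToDistr_injective n)).symm.toLinearMap ∘ₗ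
    ((scBessel n h s).toLinearMap.restrict
      (p := scSobolevSubmodule n h s) (q := LinearMap.range (l2ToDistr n)) fun _ hu => hu)

theorem ScSobolev.l2ToDistr_toL2 {n : ℕ} {h s : ℝ} (u : ScSobolev n h s) :
    l2ToDistr n (ScSobolev.toL2 n h s u) = scBessel n h s u.1 := by
  have := LinearEquiv.apply_symm_apply
    (LinearEquiv.ofInjective (l2ToDistr n) (l2ToDistr_injective n)) 
    ((scBessel n h s).toLinearMap.restrict
      (p := scSobolevSubmodule n h s) (q := LinearMap.range (l2ToDistr n)) (fun _ hu => hu) u)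
  exact congrArg Subtype.val this

theorem ScSobolev.toL2_injective (n : ℕ) (h s : ℝ) :
    Function.Injective (ScSobolev.toL2 n h s) := by
  intro u v huv
  have h1 : scBessel n h s u.1 = scBessel n h s v.1 := by
    rw [← ScSobolev.l2ToDistr_toL2, ← ScSobolev.l2ToDistr_toL2, huv]
  apply Subtype.ext
  rw [← scBessel_neg_scBessel n h s u.1, h1, scBessel_neg_scBessel]

instance (n : ℕ) (h s : ℝ) : NormedAddCommGroup (ScSobolev n h s) :=
  NormedAddCommGroup.induced _ _ (ScSobolev.toL2 n h s) (ScSobolev.toL2_injective n h s)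

instance (n : ℕ) (h s : ℝ) : NormedSpace ℂ (ScSobolev n h s) :=
  NormedSpace.induced ℂ _ _ (ScSobolev.toL2 n h s)

theorem ScSobolev.norm_eq {n : ℕ} {h s : ℝ} (u : ScSobolev n h s) :
    ‖u‖ = ‖ScSobolev.toL2 n h s u‖ := rfl

theorem scSobolev_schwartz_mem (n : ℕ) (h s : ℝ) (f : 𝓢(EucSp n, ℂ)) :
    (f : 𝓢'(EucSp n, ℂ)) ∈ scSobolevSubmodule n h s := by
  refine ⟨(SchwartzMap.fourierMultiplierCLM ℂ
    (fun η => ((japBr ((2 * Real.pi * h) • η) ^ s : ℝ) : ℂ)) f).toLp 2, ?_⟩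
  change ((_ : L2Sp n) : 𝓢'(EucSp n, ℂ)) = scBessel n h s f
  rw [scBessel, Lp.toTemperedDistribution_toLp_eq,
    TemperedDistribution.fourierMultiplierCLM_toTemperedDistributionCLM_eq
      (hasTemperateGrowth_japBr n h s)]

/-- The embedding `𝓢 ⊂ H_h^s`. -/
def ScSobolev.ofSchwartz {n : ℕ} (h s : ℝ) (f : 𝓢(EucSp n, ℂ)) : ScSobolev n h s :=
  ⟨f, scSobolev_schwartz_mem n h s f⟩

/-! ### Semiclassical pseudodifferential operators -/

/-- `(Op_h(a) f)(x) = (2 π h)^{-n} ∬ e^{-(i/h) ⟨x - y, ξ⟩} a(x, ξ) f(y) dy dξ` for a Schwartz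
function `f`, the integral in `y` being the inner one. -/
def opFun {n : ℕ} (h : ℝ) (a : EucSp n → EucSp n → ℂ) (f : 𝓢(EucSp n, ℂ)) : EucSp n → ℂ :=
  fun x => (((2 * Real.pi * h) ^ n)⁻¹ : ℝ) •
    ∫ ξ, ∫ y, Complex.exp (-(Complex.I / (h : ℂ)) * ((inner ℝ (x - y) ξ : ℝ) : ℂ)) * a x ξ * f y

/-- On Schwartz functions the multiplier in the norm of `H_h^s` is `Op_h(⟨ξ⟩^s)`. -/
theorem opFun_japBr {n : ℕ} {h : ℝ} (hh : 0 < h) (s : ℝ) (f : 𝓢(EucSp n, ℂ)) (x : EucSp n) :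
    opFun h (fun _ ξ => ((japBr ξ ^ s : ℝ) : ℂ)) f x =
      SchwartzMap.fourierMultiplierCLM ℂ
        (fun η => ((japBr ((2 * Real.pi * h) • η) ^ s : ℝ) : ℂ)) f x := by
  have hc : 0 < 2 * Real.pi * h := by positivity
  rw [SchwartzMap.fourierMultiplierCLM_apply, SchwartzMap.fourierInv_coe, Real.fourierInv_eq']
  set G : EucSp n → ℂ := fun ξ => ∫ y, Complex.exp (-(Complex.I / (h : ℂ)) *
    ((inner ℝ (x - y) ξ : ℝ) : ℂ)) * ((japBr ξ ^ s : ℝ) : ℂ) * f y with hG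
  have key : ∀ η : EucSp n, G ((-(2 * Real.pi * h)) • η) =
      Complex.exp (((2 * Real.pi * inner ℝ η x : ℝ) : ℂ) * Complex.I) •
        (SchwartzMap.smulLeftCLM ℂ (fun η => ((japBr ((2 * Real.pi * h) • η) ^ s : ℝ) : ℂ))
          (𝓕 f)) η := by
    intro η
    rw [SchwartzMap.smulLeftCLM_apply_apply (hasTemperateGrowth_japBr n h s),
      SchwartzMap.fourier_coe, Real.fourier_eq', hG]
    have hj : japBr ((-(2 * Real.pi * h)) • η) = japBr ((2 * Real.pi * h) • η) := by
      simp [japBr, norm_smul]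
    simp only [hj, smul_eq_mul]
    rw [← integral_const_mul, ← integral_const_mul]
    congr 1
    funext y
    have he : Complex.exp (-(Complex.I / (h : ℂ)) *
          ((inner ℝ (x - y) ((-(2 * Real.pi * h)) • η) : ℝ) : ℂ)) =
        Complex.exp (((2 * Real.pi * inner ℝ η x : ℝ) : ℂ) * Complex.I) *
          Complex.exp (((-2 * Real.pi * inner ℝ y η : ℝ) : ℂ) * Complex.I) := by
      rw [← Complex.exp_add]
      congr 1
      rw [real_inner_smul_right, inner_sub_left, real_inner_comm x η]
      have : (h : ℂ) ≠ 0 := by exact_mod_cast hh.ne'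
      push_cast
      field_simp
      ring
    rw [he]
    ring
  have h2 := Measure.integral_comp_smul (volume : Measure (EucSp n)) G (-(2 * Real.pi * h))
  simp_rw [key] at h2
  rw [h2]
  simp only [opFun, finrank_euclideanSpace, Fintype.card_fin]
  congr 1
  rw [abs_inv, abs_pow, abs_neg, abs_of_pos hc]

/-- On Schwartz functions the norm of `H_h^s` is `‖Op_h(⟨ξ⟩^s) f‖_{L²}`. -/
theorem ScSobolev.norm_ofSchwartz {n : ℕ} {h : ℝ} (hh : 0 < h) (s : ℝ) (f : 𝓢(EucSp n, ℂ)) :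
    ‖ScSobolev.ofSchwartz h s f‖ =
      (eLpNorm (opFun h (fun _ ξ => ((japBr ξ ^ s : ℝ) : ℂ)) f) 2 volume).toReal := by
  have h1 : ScSobolev.toL2 n h s (ScSobolev.ofSchwartz h s f) = (SchwartzMap.fourierMultiplierCLM ℂ
      (fun η => ((japBr ((2 * Real.pi * h) • η) ^ s : ℝ) : ℂ)) f).toLp 2 := by
    apply l2ToDistr_injective
    rw [ScSobolev.l2ToDistr_toL2]
    exact (TemperedDistribution.fourierMultiplierCLM_toTemperedDistributionCLM_eq
      (hasTemperateGrowth_japBr n h s) f).trans (Lp.toTemperedDistribution_toLp_eq _).symm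
  rw [ScSobolev.norm_eq, h1, Lp.norm_def]
  congr 1
  apply eLpNorm_congr_ae
  refine (SchwartzMap.coeFn_toLp _ 2 volume).trans (Filter.Eventually.of_forall fun x => ?_)
  exact (opFun_japBr hh s f x).symm

/-- `T : H_h^s → L²` is the bounded extension of `Op_h(a)`. As Schwartz functions are dense in
`H_h^s`, there is at most one such `T`. -/
def IsOpSobolev {n : ℕ} (h s : ℝ) (a : EucSp n → EucSp n → ℂ)
    (T : ScSobolev n h s →L[ℂ] L2Sp n) : Prop :=
  ∀ f : 𝓢(EucSp n, ℂ), T (ScSobolev.ofSchwartz h s f) =ᵐ[volume] opFun h a f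

/-- `T : L² → L²` is the bounded extension of `Op_h(a)`. As Schwartz functions are dense in `L²`,
there is at most one such `T`. -/
def IsOpL2 {n : ℕ} (h : ℝ) (a : EucSp n → EucSp n → ℂ) (T : L2Sp n →L[ℂ] L2Sp n) : Prop :=
  ∀ f : 𝓢(EucSp n, ℂ), T (f.toLp 2) =ᵐ[volume] opFun h a f

theorem scBessel_scBessel_neg (n : ℕ) (h s : ℝ) (u : 𝓢'(EucSp n, ℂ)) :
    scBessel n h s (scBessel n h (-s) u) = u := by
  simpa using scBessel_neg_scBessel n h (-s) u

theorem ScSobolev.toL2_ofSchwartz_multiplier (n : ℕ) (h s : ℝ) (g : 𝓢(EucSp n, ℂ)) :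
    ScSobolev.toL2 n h s (ScSobolev.ofSchwartz h s (SchwartzMap.fourierMultiplierCLM ℂ
      (fun η => ((japBr ((2 * Real.pi * h) • η) ^ (-s) : ℝ) : ℂ)) g)) = g.toLp 2 := by
  apply l2ToDistr_injective
  rw [ScSobolev.l2ToDistr_toL2]
  have h1 : l2ToDistr n (g.toLp 2) = (g : 𝓢'(EucSp n, ℂ)) := Lp.toTemperedDistribution_toLp_eq g
  have h2 : scBessel n h (-s) (g : 𝓢'(EucSp n, ℂ)) = _ :=
    TemperedDistribution.fourierMultiplierCLM_toTemperedDistributionCLM_eq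
      (hasTemperateGrowth_japBr n h (-s)) g
  rw [h1]
  unfold ScSobolev.ofSchwartz
  simp only
  rw [← h2]
  exact scBessel_scBessel_neg n h s _

theorem ScSobolev.denseRange_ofSchwartz (n : ℕ) (h s : ℝ) :
    DenseRange (ScSobolev.ofSchwartz (n := n) h s) := by
  intro u
  rw [Metric.mem_closure_range_iff]
  intro ε hε
  obtain ⟨g, hg⟩ := Metric.mem_closure_range_iff.mp
    (SchwartzMap.denseRange_toLpCLM (E := EucSp n) (F := ℂ) (μ := volume) (p := 2) (by simp)
      (ScSobolev.toL2 n h s u)) ε hε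
  refine ⟨SchwartzMap.fourierMultiplierCLM ℂ
    (fun η => ((japBr ((2 * Real.pi * h) • η) ^ (-s) : ℝ) : ℂ)) g, ?_⟩
  rw [dist_eq_norm, ScSobolev.norm_eq, map_sub, ScSobolev.toL2_ofSchwartz_multiplier,
    ← dist_eq_norm]
  exact hg

theorem IsOpSobolev.unique {n : ℕ} {h s : ℝ} {a : EucSp n → EucSp n → ℂ}
    {T T' : ScSobolev n h s →L[ℂ] L2Sp n} (hT : IsOpSobolev h s a T)
    (hT' : IsOpSobolev h s a T') : T = T' := by
  apply DFunLike.coe_injective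
  refine (ScSobolev.denseRange_ofSchwartz n h s).equalizer T.continuous T'.continuous ?_
  funext f
  exact Lp.ext ((hT f).trans (hT' f).symm)

theorem IsOpL2.unique {n : ℕ} {h : ℝ} {a : EucSp n → EucSp n → ℂ}
    {T T' : L2Sp n →L[ℂ] L2Sp n} (hT : IsOpL2 h a T) (hT' : IsOpL2 h a T') : T = T' := by
  apply DFunLike.coe_injective
  refine (SchwartzMap.denseRange_toLpCLM (E := EucSp n) (F := ℂ) (μ := volume) (p := 2)
    (by simp)).equalizer T.continuous T'.continuous ?_
  funext f
  exact Lp.ext ((hT f).trans (hT' f).symm)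

/-! ### The bounds -/

/-- The right-hand side of the bound for symbols `a₁`, `a₂` with constants `C₁`, `C₂`, regularities
`μ₁`, `μ₂`, in dimension `d - 1`, where `sd` and `sd'` are the numbers of derivatives. -/
def compBound (d sd sd' μ₁ μ₂ : ℕ) (C₁ C₂ : MultiIdx (d - 1) → MultiIdx (d - 1) → ℝ)
    (h : ℝ) : ℝ :=
  let LE := idxLE (d - 1)
  let EQ := idxEq (d - 1)
  let L := Real.log (1 + h⁻¹)
  (∑ α₁ ∈ LE sd', ∑ β₁ ∈ LE sd', ∑ α₂ ∈ LE sd',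
      ∑ β₂ ∈ LE sd' with
        α₁.len + β₁.len + α₂.len + β₂.len ≤ sd' ∧ β₁.len ≤ μ₁ ∧ β₂.len ≤ μ₂ ∧
        1 ≤ α₁.len + β₁.len ∧ 1 ≤ α₂.len + β₂.len,
      h ^ (((α₁.len + β₁.len + α₂.len + β₂.len : ℕ) : ℝ) / 2) * C₁ α₁ β₁ * C₂ α₂ β₂)
  + h ^ ((μ₁ : ℝ) / 2) * L *
    (∑ α₁ ∈ LE d, ∑ β₁ ∈ EQ μ₁, ∑ α₂ ∈ LE sd,
      ∑ β₂ ∈ LE sd with α₂.len + β₂.len ≤ sd ∧ β₂.len ≤ μ₂,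
      h ^ (((α₂.len + β₂.len : ℕ) : ℝ) / 2) * C₁ α₁ β₁ * C₂ α₂ β₂)
  + h ^ ((μ₁ : ℝ) / 2) * L *
    (∑ α₁ ∈ LE d, ∑ β₁ ∈ EQ μ₁, ∑ α₂ ∈ LE d with α₁.len + α₂.len ≤ d,
      C₁ α₁ β₁ * C₂ α₂ 0)
  + h ^ ((μ₂ : ℝ) / 2) * L *
    (∑ α₁ ∈ LE sd, ∑ β₁ ∈ LE sd with α₁.len + β₁.len ≤ sd ∧ β₁.len ≤ μ₁,
      ∑ α₂ ∈ LE d, ∑ β₂ ∈ EQ μ₂,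
      h ^ (((α₁.len + β₁.len : ℕ) : ℝ) / 2) * C₁ α₁ β₁ * C₂ α₂ β₂)
  + h ^ ((μ₂ : ℝ) / 2) * L *
    (∑ α₁ ∈ LE d, ∑ α₂ ∈ LE d with α₁.len + α₂.len ≤ d, ∑ β₂ ∈ EQ μ₂,
      C₁ α₁ 0 * C₂ α₂ β₂)
  + h ^ (((μ₁ + μ₂ : ℕ) : ℝ) / 2) * L ^ 2 *
    (∑ α₁ ∈ LE d, ∑ β₁ ∈ EQ μ₁, ∑ α₂ ∈ LE d, ∑ β₂ ∈ EQ μ₂,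
      C₁ α₁ β₁ * C₂ α₂ β₂)

/-- The right-hand side of the bound when `a₂` does not depend on `ξ`. -/
def compBoundFun (d sd sd' μ₁ μ₂ : ℕ) (C₁ : MultiIdx (d - 1) → MultiIdx (d - 1) → ℝ)
    (C₂ : MultiIdx (d - 1) → ℝ) (h : ℝ) : ℝ :=
  let LE := idxLE (d - 1)
  let EQ := idxEq (d - 1)
  let L := Real.log (1 + h⁻¹)
  (∑ α₁ ∈ LE sd', ∑ β₁ ∈ LE sd',
      ∑ β₂ ∈ LE sd' with
        α₁.len + β₁.len + β₂.len ≤ sd' ∧ 1 ≤ α₁.len + β₁.len ∧ β₁.len ≤ μ₁ ∧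
        1 ≤ β₂.len ∧ β₂.len ≤ μ₂,
      h ^ (((α₁.len + β₁.len + β₂.len : ℕ) : ℝ) / 2) * C₁ α₁ β₁ * C₂ β₂)
  + h ^ ((μ₁ : ℝ) / 2) * L * (∑ α₁ ∈ LE d, ∑ β₁ ∈ EQ μ₁, C₁ α₁ β₁ * C₂ 0)
  + h ^ ((μ₂ : ℝ) / 2) *
    (∑ α₁ ∈ LE sd, ∑ β₁ ∈ LE sd with α₁.len + β₁.len ≤ sd ∧ β₁.len ≤ μ₁, ∑ β₂ ∈ EQ μ₂,
      h ^ (((α₁.len + β₁.len : ℕ) : ℝ) / 2) * C₁ α₁ β₁ * C₂ β₂)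

end

/-! ### Calculus of iterated partial derivatives -/

section MultiIndexCalculus

variable {n : ℕ} {F : Type*} [NormedAddCommGroup F] [NormedSpace ℝ F]

/-! Put λ = √(2πh), so that λ ≤ 3√h and λ ≤ 3. Conjugation by the dilation x ↦ λx turns `Op_h(a)`
into the Kohn-Nirenberg quantization (the case h = 1/2π) of b(x, ξ) = a(λx, -λξ). Every derivative
of b in x or in ξ carries one factor λ; this is the origin of the half powers of h, and what remains
is an estimate at unit scale. In part (i) the weight ⟨ξ⟩^(-k') is moved into the second symbol,
which then has the negative order k₂ - k', and the operators act on L².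

Each scaled symbol is split as b = b♯ + r. Here b♯ is the convolution in x, at scale one, with a
kernel that reproduces functions up to finite differences of order μ. The function b♯ is smooth in
x: the first μ derivatives fall on b and all further ones on the kernel, so only constants with |β|
≤ μ appear (`IsScaledSymbol.norm_smoothedDeriv_le`). The remainder r has no regularity in x, but it
is controlled by λ^μ and the constants with |β| = μ (`IsFunSymbol.ae_norm_sub_le`,
`IsScaledSymbol.ae_hasFreqBounds_sub`). As the order in ξ is negative, a Littlewood-Paley
decomposition and Young's inequality bound the operator with symbol r by n + 1 = d derivatives in ξ,
where n = d - 1 (`eLpNorm_knFun_le`). Hence every term of the composition that contains a remainder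
is estimated directly, without any cancellation; these terms give all the sums with |β₁| = μ₁ or
|β₂| = μ₂ on the right-hand side.

For the smooth parts the operators are described by their matrices in wave packets, which decay away
from the diagonal of phase space (`norm_packetMatrix_le`); Schur's test then gives the theorem of
Calderón and Vaillancourt. The composition defect T₁T₂ - T₁₂ does not change if a function of x
alone is subtracted from b₁ and a function of ξ alone from b₂, because composition with a
multiplication on the left, or with a Fourier multiplier on the right, is exact
(`exists_isKN_centered`). For the packet at z = (x₀, ξ₀) one subtracts b₁(x, ξ₀) and b₂(x₀, ξ). The
centered symbols are bounded by M₁(1 + |ξ - ξ₀|) and M₂(1 + |x - x₀|), where M₁ involves only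
constants with at least one derivative in ξ and M₂ only constants with at least one derivative in x.
The linear growth is harmless against the decay of the matrices, and the defect is O(M₁M₂) without
an asymptotic expansion (`norm_comp_sub_le`). This is the first sum on the right-hand side.

In part (ii) multiplication by a₂ after the operator quantizes the product a₁a₂ exactly, so the
defect is a commutator, and the smoothing remainder of a₂ acts as a multiplication operator bounded
by its supremum.

The argument produces no logarithms: since h ≤ 1, 2 log(1 + 1/h) ≥ 1, and the logarithmic factors
are inserted for free. -/

theorem ContDiff.partialD {f : EucSp n → F} (hf : ContDiff ℝ ∞ f) (i : Fin n) :
    ContDiff ℝ ∞ (partialD i f) :=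
  (hf.fderiv_right (m := ∞) (by simp)).clm_apply contDiff_const

theorem ContDiff.iterate_partialD {f : EucSp n → F} (hf : ContDiff ℝ ∞ f) (i : Fin n) (m : ℕ) :
    ContDiff ℝ ∞ ((_root_.partialD i)^[m] f) := by
  induction m with
  | zero => exact hf
  | succ m ih => rw [Function.iterate_succ_apply']; exact ih.partialD i

theorem contDiff_foldr_partialD {f : EucSp n → F} (hf : ContDiff ℝ ∞ f) (α : MultiIdx n)
    (l : List (Fin n)) :
    ContDiff ℝ ∞ (l.foldr (fun i g => (partialD i)^[α i] g) f) := by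
  induction l with
  | nil => exact hf
  | cons a l ih => exact ih.iterate_partialD a (α a)

theorem ContDiff.multiD {f : EucSp n → F} (hf : ContDiff ℝ ∞ f) (α : MultiIdx n) :
    ContDiff ℝ ∞ (multiD α f) :=
  contDiff_foldr_partialD hf α _

theorem partialD_comm {f : EucSp n → F} (hf : ContDiff ℝ ∞ f) (i j : Fin n) :
    partialD i (partialD j f) = partialD j (partialD i f) := by
  have h1 : ∀ x, DifferentiableAt ℝ (fderiv ℝ f) x := fun x =>
    ((hf.fderiv_right (m := ∞) (by simp)).differentiable (by simp)) x
  have key : ∀ (i j : Fin n) (x : EucSp n), partialD i (partialD j f) x =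
      fderiv ℝ (fderiv ℝ f) x (EuclideanSpace.single i 1) (EuclideanSpace.single j 1) := by
    intro i j x
    have : HasFDerivAt (partialD j f)
        ((fderiv ℝ (fderiv ℝ f) x).flip (EuclideanSpace.single j 1)) x := by
      have := (h1 x).hasFDerivAt.clm_apply (hasFDerivAt_const (EuclideanSpace.single j (1:ℝ)) x)
      simp only [ContinuousLinearMap.comp_zero, zero_add] at this
      exact this
    rw [partialD, this.fderiv]
    rfl
  funext x
  rw [key, key]
  have hs : IsSymmSndFDerivAt ℝ f x :=
    hf.contDiffAt.isSymmSndFDerivAt (by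
      simp only [minSmoothness_of_isRCLikeNormedField]
      exact WithTop.coe_le_coe.mpr le_top)
  exact hs.eq _ _

theorem partialD_iterate_comm {f : EucSp n → F} (hf : ContDiff ℝ ∞ f) (i j : Fin n) (m : ℕ) :
    partialD i ((partialD j)^[m] f) = (partialD j)^[m] (partialD i f) := by
  induction m with
  | zero => rfl
  | succ m ih =>
    rw [Function.iterate_succ_apply', Function.iterate_succ_apply',
      partialD_comm (hf.iterate_partialD j m), ih]

theorem foldr_partialD_congr {f : EucSp n → F} {α β : MultiIdx n} {l : List (Fin n)}
    (h : ∀ i ∈ l, α i = β i) :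
    l.foldr (fun i g => (partialD i)^[α i] g) f = l.foldr (fun i g => (partialD i)^[β i] g) f := by
  induction l with
  | nil => rfl
  | cons a l ih =>
    simp only [List.foldr_cons]
    rw [ih fun i hi => h i (List.mem_cons_of_mem _ hi), h a List.mem_cons_self]

/-- `multiD` applies the partial derivatives in one fixed order. Since partials of a smooth function
commute, ∂ᵢ can be moved inwards until it meets the unique slot of index i; uniqueness is the
`Nodup` condition on the list. -/
theorem partialD_multiD {f : EucSp n → F} (hf : ContDiff ℝ ∞ f) (i : Fin n) (α : MultiIdx n) :
    partialD i (multiD α f) = multiD (α + Pi.single i 1) f := by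
  have key : ∀ l : List (Fin n), l.Nodup → i ∈ l →
      partialD i (l.foldr (fun i g => (partialD i)^[α i] g) f) =
        l.foldr (fun j g => (partialD j)^[(α + Pi.single i 1 : MultiIdx n) j] g) f := by
    intro l hl hi
    induction l with
    | nil => simp at hi
    | cons a l ih =>
      simp only [List.foldr_cons]
      rw [List.nodup_cons] at hl
      by_cases hia : i = a
      · subst hia
        have hc : l.foldr (fun j g => (partialD j)^[(α + Pi.single i 1 : MultiIdx n) j] g) f =
            l.foldr (fun i g => (partialD i)^[α i] g) f := by
          apply foldr_partialD_congr
          intro j hj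
          have : j ≠ i := fun h => hl.1 (h ▸ hj)
          simp [this]
        rw [hc]
        simp [Function.iterate_succ_apply']
      · rw [partialD_iterate_comm (contDiff_foldr_partialD hf α l),
          ih hl.2 (by simpa [hia] using hi)]
        have : (α + Pi.single i 1 : MultiIdx n) a = α a := by simp [Ne.symm hia]
        rw [this]
  exact key _ (List.nodup_finRange n) (List.mem_finRange i)

theorem foldr_id_of_zero (f : EucSp n → F) (l : List (Fin n)) :
    l.foldr (fun i g => (partialD i)^[(0 : MultiIdx n) i] g) f = f := by
  induction l with
  | nil => rfl
  | cons a l ih => simp only [List.foldr_cons, ih]; rfl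

@[simp] theorem multiD_zero (f : EucSp n → F) : multiD 0 f = f := foldr_id_of_zero f _

/-- A family of functions on which the partial derivatives act by shifting the index. -/
theorem multiD_family {c : MultiIdx n → EucSp n → F}
    (hc : ∀ α i, partialD i (c α) = c (α + Pi.single i 1)) (α γ : MultiIdx n) :
    multiD α (c γ) = c (γ + α) := by
  have hit : ∀ (i : Fin n) (m : ℕ) (γ : MultiIdx n),
      (partialD i)^[m] (c γ) = c (γ + Pi.single i m) := by
    intro i m γ
    induction m with
    | zero => simp
    | succ m ih =>
      rw [Function.iterate_succ_apply', ih, hc, add_assoc, ← Pi.single_add]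
  have key : ∀ l : List (Fin n), l.foldr (fun i g => (partialD i)^[α i] g) (c γ) =
      c (γ + (l.map fun i => Pi.single i (α i)).sum) := by
    intro l
    induction l with
    | nil => simp
    | cons a l ih =>
      simp only [List.foldr_cons, ih, hit, List.map_cons, List.sum_cons]
      congr 1
      abel
  rw [multiD, key]
  congr 2
  rw [← List.ofFn_eq_map, List.sum_ofFn]
  exact Finset.univ_sum_single α

theorem multiD_single {f : EucSp n → F} (i : Fin n) : multiD (Pi.single i 1) f = partialD i f := by
  have key : ∀ l : List (Fin n), l.Nodup →
      l.foldr (fun j g => (partialD j)^[(Pi.single i 1 : MultiIdx n) j] g) f =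
        if i ∈ l then partialD i f else f := by
    intro l hl
    induction l with
    | nil => simp
    | cons a l ih =>
      rw [List.nodup_cons] at hl
      simp only [List.foldr_cons, ih hl.2]
      by_cases hia : a = i
      · subst hia; simp [hl.1]
      · simp [hia, Ne.symm hia]
  rw [multiD, key _ (List.nodup_finRange n)]
  simp

@[simp] theorem MultiIdx.len_zero : (0 : MultiIdx n).len = 0 := by simp [MultiIdx.len]

@[simp] theorem MultiIdx.len_add (α β : MultiIdx n) : (α + β).len = α.len + β.len := by
  simp [MultiIdx.len, Finset.sum_add_distrib]

@[simp] theorem MultiIdx.len_single (i : Fin n) (m : ℕ) :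
    MultiIdx.len (Pi.single i m) = m := by
  simp [MultiIdx.len]

theorem MultiIdx.exists_eq_add_single {α : MultiIdx n} {m : ℕ} (h : α.len = m + 1) :
    ∃ (i : Fin n) (α' : MultiIdx n), α = α' + Pi.single i 1 ∧ α'.len = m := by
  have : ∃ i, α i ≠ 0 := by
    by_contra! hc
    simp [MultiIdx.len, hc] at h
  obtain ⟨i, hi⟩ := this
  have h1 : α = (α - Pi.single i 1) + Pi.single i 1 := by
    funext j
    by_cases hj : j = i
    · subst hj; simp; omega
    · simp [hj]
  refine ⟨i, _, h1, ?_⟩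
  rw [h1, MultiIdx.len_add, MultiIdx.len_single] at h
  omega

/-- Used to share out the derivatives of a convolution: β, of length at most μ, goes to the rough
function and δ to the smooth kernel. -/
theorem MultiIdx.exists_decomposition (γ : MultiIdx n) (μ : ℕ) :
    ∃ β δ : MultiIdx n, γ = β + δ ∧ β.len = min γ.len μ := by
  generalize hm : γ.len = m
  induction m generalizing γ with
  | zero => exact ⟨γ, 0, by simp, by simp [hm]⟩
  | succ m ih =>
    by_cases hμ : m + 1 ≤ μ
    · exact ⟨γ, 0, by simp, by omega⟩
    · obtain ⟨i, α', rfl, hα'⟩ := MultiIdx.exists_eq_add_single hm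
      obtain ⟨β, δ, rfl, hβ⟩ := ih α' hα'
      exact ⟨β, δ + Pi.single i 1, by abel, by omega⟩

/-- A general form of induction along partial derivatives. -/
theorem multiD_add_single {f : EucSp n → F} (hf : ContDiff ℝ ∞ f) (i : Fin n) (α : MultiIdx n) :
    multiD (α + Pi.single i 1) f = multiD α (partialD i f) := by
  have hc : ∀ (α : MultiIdx n) (i : Fin n),
      partialD i (multiD α f) = multiD (α + Pi.single i 1) f := fun α i => partialD_multiD hf i α
  have := multiD_family hc α (Pi.single i 1)
  rw [multiD_single] at this
  rw [this, add_comm]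

theorem EuclideanSpace.clm_eq_sum {G : Type*} [NormedAddCommGroup G] [NormedSpace ℝ G]
    (L : EucSp n →L[ℝ] G) :
    L = ∑ i, (EuclideanSpace.proj i : EucSp n →L[ℝ] ℝ).smulRight
      (L (EuclideanSpace.single i 1)) := by
  refine ContinuousLinearMap.ext fun x => ?_
  conv_lhs => rw [← (EuclideanSpace.basisFun (Fin n) ℝ).sum_repr x]
  simp [map_sum]

theorem EuclideanSpace.norm_proj_le (i : Fin n) :
    ‖(EuclideanSpace.proj i : EucSp n →L[ℝ] ℝ)‖ ≤ 1 :=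
  ContinuousLinearMap.opNorm_le_bound _ zero_le_one fun x => by
    simpa using EuclideanSpace.norm_eq x ▸ PiLp.norm_apply_le x i

theorem EuclideanSpace.norm_clm_le {G : Type*} [NormedAddCommGroup G] [NormedSpace ℝ G]
    (L : EucSp n →L[ℝ] G) : ‖L‖ ≤ ∑ i, ‖L (EuclideanSpace.single i 1)‖ := by
  conv_lhs => rw [EuclideanSpace.clm_eq_sum L]
  refine (norm_sum_le _ _).trans (Finset.sum_le_sum fun i _ => ?_)
  rw [ContinuousLinearMap.norm_smulRight_apply]
  exact mul_le_of_le_one_left (norm_nonneg _) (EuclideanSpace.norm_proj_le i)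

theorem norm_fderiv_le_sum_partialD (f : EucSp n → F) (x : EucSp n) :
    ‖fderiv ℝ f x‖ ≤ ∑ i, ‖partialD i f x‖ :=
  EuclideanSpace.norm_clm_le _

/-- Induction on k through Df = ∑ᵢ ∂ᵢf dxᵢ; each step costs the factor n, because every index of
length k + 1 may arise from each of the n coordinates. -/
theorem norm_iteratedFDeriv_le_sum_multiD (k : ℕ) {f : EucSp n → F} (hf : ContDiff ℝ ∞ f)
    (x : EucSp n) :
    ‖iteratedFDeriv ℝ k f x‖ ≤ (n : ℝ) ^ k * ∑ α ∈ idxEq n k, ‖multiD α f x‖ := by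
  induction k generalizing f with
  | zero =>
    have : (0 : MultiIdx n) ∈ idxEq n 0 := mem_idxEq.mpr (by simp)
    have h := Finset.single_le_sum (f := fun α => ‖multiD α f x‖) (fun α _ => norm_nonneg _) this
    simpa using h
  | succ k ih =>
    rw [← norm_iteratedFDeriv_fderiv]
    have h1 : fderiv ℝ f = fun y => ∑ i, (ContinuousLinearMap.smulRightL ℝ (EucSp n) F
        (EuclideanSpace.proj i : EucSp n →L[ℝ] ℝ)) (partialD i f y) := by
      funext y
      exact EuclideanSpace.clm_eq_sum (fderiv ℝ f y)
    have hp : ∀ i, ContDiff ℝ ∞ (partialD i f) := fun i => hf.partialD i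
    have hp' : ∀ i, ContDiff ℝ k fun y => (ContinuousLinearMap.smulRightL ℝ (EucSp n) F
        (EuclideanSpace.proj i : EucSp n →L[ℝ] ℝ)) (partialD i f y) := fun i =>
      (ContinuousLinearMap.contDiff _).comp ((hp i).of_le (by exact_mod_cast le_top))
    rw [h1, iteratedFDeriv_fun_sum_apply (fun i _ => (hp' i).contDiffAt)]
    have h2 : ∀ i, ‖iteratedFDeriv ℝ k (fun y => (ContinuousLinearMap.smulRightL ℝ (EucSp n) F
        (EuclideanSpace.proj i : EucSp n →L[ℝ] ℝ)) (partialD i f y)) x‖ ≤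
        (n : ℝ) ^ k * ∑ α ∈ idxEq n (k + 1), ‖multiD α f x‖ := by
      intro i
      have h3 := ContinuousLinearMap.norm_iteratedFDeriv_comp_left
        (ContinuousLinearMap.smulRightL ℝ (EucSp n) F
        (EuclideanSpace.proj i : EucSp n →L[ℝ] ℝ)) ((hp i).contDiffAt (x := x)) (n := k)
        (by exact_mod_cast le_top)
      have h4 : ‖ContinuousLinearMap.smulRightL ℝ (EucSp n) F
          (EuclideanSpace.proj i : EucSp n →L[ℝ] ℝ)‖ ≤ 1 := by
        refine ContinuousLinearMap.opNorm_le_bound _ zero_le_one fun v => ?_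
        rw [ContinuousLinearMap.smulRightL_apply_apply, ContinuousLinearMap.norm_smulRight_apply]
        gcongr
        exact EuclideanSpace.norm_proj_le i
      refine h3.trans ((mul_le_of_le_one_left (norm_nonneg _) h4).trans ((ih (hp i)).trans ?_))
      gcongr
      simp_rw [← multiD_add_single hf]
      have hinj : Set.InjOn (fun α : MultiIdx n => α + Pi.single i 1) (idxEq n k : Set _) :=
        fun a _ b _ hab => add_right_cancel hab
      rw [← Finset.sum_image (f := fun β => ‖multiD β f x‖) hinj]
      refine Finset.sum_le_sum_of_subset_of_nonneg ?_ fun _ _ _ => norm_nonneg _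
      intro β hβ
      obtain ⟨α, hα, rfl⟩ := Finset.mem_image.mp hβ
      rw [mem_idxEq] at hα ⊢
      simp [hα]
    refine (norm_sum_le _ _).trans ((Finset.sum_le_sum fun i _ => h2 i).trans_eq ?_)
    simp [pow_succ]
    ring

/-- The factor c is arbitrary: besides the dilations, c = -1 serves for reflections and c = 0 for
constant functions. -/
theorem multiD_comp_smul {c : ℝ} (f : EucSp n → F) (α : MultiIdx n) :
    multiD α (fun x => f (c • x)) = fun x => c ^ α.len • multiD α f (c • x) := by
  have h1 : ∀ (i : Fin n) (g : EucSp n → F) (b : ℝ),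
      partialD i (fun x => b • g (c • x)) = fun x => (b * c) • partialD i g (c • x) := by
    intro i g b
    funext x
    have := fderiv_comp_smul (f := g) c (x := x) (𝕜 := ℝ)
    simp only [partialD]
    rw [show (fun x => b • g (c • x)) = b • (fun x => g (c • x)) from rfl, fderiv_const_smul_field,
      Pi.smul_apply, this]
    simp [mul_smul]
  have h2 : ∀ (i : Fin n) (g : EucSp n → F) (b : ℝ) (m : ℕ),
      (partialD i)^[m] (fun x => b • g (c • x)) =
        fun x => (b * c ^ m) • ((partialD i)^[m] g) (c • x) := by
    intro i g b m
    induction m with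
    | zero => simp
    | succ m ih =>
      rw [Function.iterate_succ_apply', ih, h1, Function.iterate_succ_apply']
      funext x
      rw [pow_succ, mul_assoc]
  have key : ∀ l : List (Fin n), l.foldr (fun i g => (partialD i)^[α i] g) (fun x => f (c • x)) =
      fun x => c ^ (l.map α).sum • (l.foldr (fun i g => (partialD i)^[α i] g) f) (c • x) := by
    intro l
    induction l with
    | nil => simp
    | cons a l ih =>
      simp only [List.foldr_cons, ih, h2]
      funext x
      rw [List.map_cons, List.sum_cons, pow_add, mul_comm]
  rw [multiD, key]
  funext x
  rw [MultiIdx.len, ← List.ofFn_eq_map, List.sum_ofFn]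
  rfl

theorem multiD_comp_add (f : EucSp n → F) (α : MultiIdx n) (a : EucSp n) :
    multiD α (fun x => f (x + a)) = fun x => multiD α f (x + a) := by
  have h1 : ∀ (i : Fin n) (g : EucSp n → F),
      partialD i (fun x => g (x + a)) = fun x => partialD i g (x + a) := by
    intro i g
    funext x
    simp [partialD, fderiv_comp_add_right]
  have h2 : ∀ (i : Fin n) (g : EucSp n → F) (m : ℕ),
      (partialD i)^[m] (fun x => g (x + a)) = fun x => ((partialD i)^[m] g) (x + a) := by
    intro i g m
    induction m with
    | zero => simp
    | succ m ih => rw [Function.iterate_succ_apply', ih, h1, Function.iterate_succ_apply']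
  have key : ∀ l : List (Fin n), l.foldr (fun i g => (partialD i)^[α i] g) (fun x => f (x + a)) =
      fun x => (l.foldr (fun i g => (partialD i)^[α i] g) f) (x + a) := by
    intro l
    induction l with
    | nil => simp
    | cons b l ih => simp only [List.foldr_cons, ih, h2]
  exact key _

theorem multiD_comp_const_sub (f : EucSp n → F) (α : MultiIdx n) (a : EucSp n) :
    multiD α (fun x => f (a - x)) = fun x => (-1 : ℝ) ^ α.len • multiD α f (a - x) := by
  have h := multiD_comp_smul (c := -1) (fun x => f (x + a)) α
  rw [multiD_comp_add] at h
  simpa [neg_add_eq_sub] using h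

end MultiIndexCalculus

/-! ### Cauchy-Schwarz and Young inequalities for nonnegative functions -/

section Lintegral

variable {α : Type*} [MeasurableSpace α]

theorem lintegral_mul_sq_le (μ : Measure α) {f g : α → ℝ≥0∞} (hf : AEMeasurable f μ)
    (hg : AEMeasurable g μ) :
    (∫⁻ a, f a * g a ∂μ) ^ 2 ≤ (∫⁻ a, f a ^ 2 ∂μ) * ∫⁻ a, g a ^ 2 ∂μ := by
  have h := ENNReal.lintegral_mul_le_Lp_mul_Lq μ Real.HolderConjugate.two_two hf hg
  simp only [Pi.mul_apply, ENNReal.rpow_two] at h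
  calc (∫⁻ a, f a * g a ∂μ) ^ 2
      ≤ ((∫⁻ a, f a ^ 2 ∂μ) ^ (1 / 2 : ℝ) * (∫⁻ a, g a ^ 2 ∂μ) ^ (1 / 2 : ℝ)) ^ 2 := by gcongr
    _ = _ := by
      rw [mul_pow, ← ENNReal.rpow_mul_natCast, ← ENNReal.rpow_mul_natCast]
      norm_num

/-- Cauchy-Schwarz for the factors √k and √k · g. -/
theorem lintegral_mul_sq_le_weight (μ : Measure α) {k g : α → ℝ≥0∞} (hk : AEMeasurable k μ)
    (hg : AEMeasurable g μ) :
    (∫⁻ a, k a * g a ∂μ) ^ 2 ≤ (∫⁻ a, k a ∂μ) * ∫⁻ a, k a * g a ^ 2 ∂μ := by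
  have h2 : ∀ x : ℝ≥0∞, (x ^ (1 / 2 : ℝ)) ^ 2 = x := fun x => by
    rw [← ENNReal.rpow_mul_natCast]; norm_num
  have h := lintegral_mul_sq_le μ (f := fun a => k a ^ (1 / 2 : ℝ))
    (g := fun a => k a ^ (1 / 2 : ℝ) * g a) (hk.pow_const _) ((hk.pow_const _).mul hg)
  have e1 : ∀ a, k a ^ (1 / 2 : ℝ) * (k a ^ (1 / 2 : ℝ) * g a) = k a * g a := fun a => by
    rw [← mul_assoc, ← sq, h2]
  simpa only [e1, mul_pow, h2] using h

/-- Young's inequality `L¹ * L² ⊂ L²` for nonnegative functions. -/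
theorem lintegral_convolution_sq_le {G : Type*} [MeasurableSpace G] [AddCommGroup G]
    [MeasurableAdd₂ G] [MeasurableNeg G] (μ : Measure G) [SFinite μ] [μ.IsAddLeftInvariant]
    [μ.IsNegInvariant]
    {k g : G → ℝ≥0∞} (hk : Measurable k) (hg : AEMeasurable g μ) :
    ∫⁻ x, (∫⁻ y, k (x - y) * g y ∂μ) ^ 2 ∂μ ≤ (∫⁻ z, k z ∂μ) ^ 2 * ∫⁻ y, g y ^ 2 ∂μ := by
  have h1 : ∀ x, ∫⁻ y, k (x - y) ∂μ = ∫⁻ z, k z ∂μ := fun x => lintegral_sub_left_eq_self k x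
  have h2 : ∀ y, ∫⁻ x, k (x - y) ∂μ = ∫⁻ z, k z ∂μ := fun y => lintegral_sub_right_eq_self k y
  -- Cauchy-Schwarz with the weight k(x - ·), whose mass does not depend on x, followed by Tonelli.
  calc ∫⁻ x, (∫⁻ y, k (x - y) * g y ∂μ) ^ 2 ∂μ
      ≤ ∫⁻ x, (∫⁻ z, k z ∂μ) * ∫⁻ y, k (x - y) * g y ^ 2 ∂μ ∂μ := by
        refine lintegral_mono fun x => ?_
        rw [← h1 x]
        exact lintegral_mul_sq_le_weight μ
          (hk.comp (measurable_const.sub measurable_id)).aemeasurable hg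
    _ = (∫⁻ z, k z ∂μ) * ∫⁻ x, ∫⁻ y, k (x - y) * g y ^ 2 ∂μ ∂μ := by
        rw [lintegral_const_mul'']
        have : AEMeasurable (fun p : G × G => k (p.1 - p.2) * g p.2 ^ 2) (μ.prod μ) :=
          (hk.comp (measurable_fst.sub measurable_snd)).aemeasurable.mul
            ((hg.comp_quasiMeasurePreserving Measure.quasiMeasurePreserving_snd).pow_const 2)
        exact this.lintegral_prod_right'
    _ = (∫⁻ z, k z ∂μ) * ∫⁻ y, ∫⁻ x, k (x - y) * g y ^ 2 ∂μ ∂μ := by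
        rw [lintegral_lintegral_swap]
        exact (hk.comp (measurable_fst.sub measurable_snd)).aemeasurable.mul
            ((hg.comp_quasiMeasurePreserving Measure.quasiMeasurePreserving_snd).pow_const 2)
    _ = (∫⁻ z, k z ∂μ) * ∫⁻ y, (∫⁻ z, k z ∂μ) * g y ^ 2 ∂μ := by
        congr 1
        refine lintegral_congr fun y => ?_
        have hm : Measurable fun x => k (x - y) := hk.comp (measurable_id.sub measurable_const)
        rw [lintegral_mul_const _ hm, h2 y]
    _ = _ := by
        rw [lintegral_const_mul'' _ (hg.pow_const 2), sq, mul_assoc]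

theorem eLpNorm_two_sq {E : Type*} [NormedAddCommGroup E] (f : α → E) (μ : Measure α) :
    eLpNorm f 2 μ ^ 2 = ∫⁻ x, ‖f x‖ₑ ^ 2 ∂μ := by
  rw [eLpNorm_eq_lintegral_rpow_enorm_toReal (by simp) (by simp), ← ENNReal.rpow_mul_natCast]
  simp

/-- Young's inequality needs only a pointwise domination by a convolution. The true integral kernel
may therefore depend on x without any regularity. -/
theorem eLpNorm_le_of_kernel {n : ℕ} {k : EucSp n → ℝ≥0∞} (hk : Measurable k)
    {F f : EucSp n → ℂ} (hf : AEStronglyMeasurable f volume)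
    (h : ∀ᵐ x, ‖F x‖ₑ ≤ ∫⁻ y, k (x - y) * ‖f y‖ₑ) :
    eLpNorm F 2 volume ≤ (∫⁻ z, k z) * eLpNorm f 2 volume := by
  have h1 : eLpNorm F 2 volume ^ 2 ≤ ((∫⁻ z, k z) * eLpNorm f 2 volume) ^ 2 := by
    rw [mul_pow, eLpNorm_two_sq, eLpNorm_two_sq]
    refine le_trans (lintegral_mono_ae ?_)
      (lintegral_convolution_sq_le volume hk hf.enorm)
    filter_upwards [h] with x hx
    gcongr
  exact (ENNReal.pow_le_pow_left_iff two_ne_zero).mp h1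

end Lintegral

/-! ### Kohn-Nirenberg quantization and the exact cases of composition -/

noncomputable section Quantization

/-- The Kohn-Nirenberg quantization `∫ e^{2πi⟨x,ξ⟩} b(x, ξ) 𝓕f(ξ) dξ`. -/
def knFun {n : ℕ} (b : EucSp n → EucSp n → ℂ) (f : 𝓢(EucSp n, ℂ)) : EucSp n → ℂ :=
  fun x => 𝓕⁻ (fun ξ => b x ξ * 𝓕 (f : EucSp n → ℂ) ξ) x

/-- `T` is the bounded extension to `L²` of the Kohn-Nirenberg quantization of `b`. -/
def IsKN {n : ℕ} (b : EucSp n → EucSp n → ℂ) (T : L2Sp n →L[ℂ] L2Sp n) : Prop :=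
  ∀ f : 𝓢(EucSp n, ℂ), T (f.toLp 2) =ᵐ[volume] knFun b f

variable {n : ℕ}

/-- `b(x, ξ)` is bounded in `ξ`, for almost every `x`. -/
def IsAEBounded (b : EucSp n → EucSp n → ℂ) : Prop :=
  ∀ᵐ x, Continuous (b x) ∧ ∃ M : ℝ, ∀ ξ, ‖b x ξ‖ ≤ M

theorem integrable_bounded_mul {g F : EucSp n → ℂ} (hg : Continuous g) {M : ℝ}
    (hM : ∀ ξ, ‖g ξ‖ ≤ M) (hF : Integrable F) : Integrable fun ξ => g ξ * F ξ :=
  hF.bdd_mul (c := M) hg.aestronglyMeasurable (Filter.Eventually.of_forall hM)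

theorem integrable_fourier_schwartz (f : 𝓢(EucSp n, ℂ)) :
    Integrable (𝓕 (f : EucSp n → ℂ)) := by
  rw [← SchwartzMap.fourier_coe]
  exact (𝓕 f).integrable

theorem integrable_fourierInv_integrand {F : EucSp n → ℂ} (hF : Integrable F) (x : EucSp n) :
    Integrable fun ξ => Real.fourierChar (inner ℝ ξ x) • F ξ := by
  have := (Real.fourierIntegral_convergent_iff (f := F) (-x)).mpr hF
  simpa using this

theorem fourierInv_add_apply {F G : EucSp n → ℂ} (hF : Integrable F) (hG : Integrable G)
    (x : EucSp n) : 𝓕⁻ (fun ξ => F ξ + G ξ) x = 𝓕⁻ F x + 𝓕⁻ G x := by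
  simp only [Real.fourierInv_eq, smul_add]
  exact integral_add (integrable_fourierInv_integrand hF x) (integrable_fourierInv_integrand hG x)

theorem fourierInv_const_mul (c : ℂ) (F : EucSp n → ℂ) (x : EucSp n) :
    𝓕⁻ (fun ξ => c * F ξ) x = c * 𝓕⁻ F x := by
  simp only [Real.fourierInv_eq, ← integral_const_mul]
  congr 1
  funext ξ
  rw [mul_smul_comm]

/-- Splitting the ξ-integral requires both integrands to be integrable. This is why the algebra of
`IsKN` carries the condition `IsAEBounded` along. -/
theorem knFun_add_symbol {b c : EucSp n → EucSp n → ℂ} (hb : IsAEBounded b) (hc : IsAEBounded c)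
    (f : 𝓢(EucSp n, ℂ)) :
    knFun (fun x ξ => b x ξ + c x ξ) f =ᵐ[volume] fun x => knFun b f x + knFun c f x := by
  filter_upwards [hb, hc] with x ⟨hx1, M, hx2⟩ ⟨hx3, M', hx4⟩
  simp only [knFun, add_mul]
  exact fourierInv_add_apply (integrable_bounded_mul hx1 hx2 (integrable_fourier_schwartz f))
    (integrable_bounded_mul hx3 hx4 (integrable_fourier_schwartz f)) x

theorem knFun_mul_left (g : EucSp n → ℂ) (b : EucSp n → EucSp n → ℂ) (f : 𝓢(EucSp n, ℂ))
    (x : EucSp n) : knFun (fun x ξ => g x * b x ξ) f x = g x * knFun b f x := by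
  simp only [knFun, mul_assoc, fourierInv_const_mul]

theorem IsKN.add {b c : EucSp n → EucSp n → ℂ} {T S : L2Sp n →L[ℂ] L2Sp n}
    (hT : IsKN b T) (hS : IsKN c S) (hb : IsAEBounded b) (hc : IsAEBounded c) :
    IsKN (fun x ξ => b x ξ + c x ξ) (T + S) := by
  intro f
  filter_upwards [knFun_add_symbol hb hc f, hT f, hS f, Lp.coeFn_add (T (f.toLp 2)) (S (f.toLp 2))]
    with x h1 h2 h3 h4
  rw [add_apply, h4, Pi.add_apply, h1, h2, h3]

theorem IsKN.neg {b : EucSp n → EucSp n → ℂ} {T : L2Sp n →L[ℂ] L2Sp n}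
    (hT : IsKN b T) : IsKN (fun x ξ => - b x ξ) (-T) := by
  intro f
  filter_upwards [hT f, Lp.coeFn_neg (T (f.toLp 2))] with x h1 h2
  have := knFun_mul_left (fun _ => (-1 : ℂ)) b f x
  simp only [neg_mul, one_mul] at this
  rw [neg_apply, h2, Pi.neg_apply, h1, this]

theorem IsAEBounded.neg {b : EucSp n → EucSp n → ℂ} (hb : IsAEBounded b) :
    IsAEBounded (fun x ξ => - b x ξ) := by
  filter_upwards [hb] with x ⟨h1, M, h2⟩
  exact ⟨h1.neg, M, by simpa using h2⟩

theorem IsAEBounded.add {b c : EucSp n → EucSp n → ℂ} (hb : IsAEBounded b) (hc : IsAEBounded c) :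
    IsAEBounded (fun x ξ => b x ξ + c x ξ) := by
  filter_upwards [hb, hc] with x ⟨h1, M, h2⟩ ⟨h3, M', h4⟩
  exact ⟨h1.add h3, M + M', fun ξ => (norm_add_le _ _).trans (add_le_add (h2 ξ) (h4 ξ))⟩

theorem IsAEBounded.mul {b c : EucSp n → EucSp n → ℂ} (hb : IsAEBounded b) (hc : IsAEBounded c) :
    IsAEBounded (fun x ξ => b x ξ * c x ξ) := by
  filter_upwards [hb, hc] with x ⟨h1, M, h2⟩ ⟨h3, M', h4⟩
  refine ⟨h1.mul h3, M * M', fun ξ => ?_⟩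
  rw [norm_mul]
  exact mul_le_mul (h2 ξ) (h4 ξ) (norm_nonneg _) ((norm_nonneg _).trans (h2 ξ))

theorem IsKN.sub {b c : EucSp n → EucSp n → ℂ} {T S : L2Sp n →L[ℂ] L2Sp n}
    (hT : IsKN b T) (hS : IsKN c S) (hb : IsAEBounded b) (hc : IsAEBounded c) :
    IsKN (fun x ξ => b x ξ - c x ξ) (T - S) := by
  simpa only [sub_eq_add_neg] using hT.add hS.neg hb hc.neg

theorem IsKN.congr_ae {b c : EucSp n → EucSp n → ℂ} {T : L2Sp n →L[ℂ] L2Sp n} (hT : IsKN b T)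
    (h : ∀ᵐ x, ∀ ξ, b x ξ = c x ξ) : IsKN c T := by
  intro f
  filter_upwards [hT f, h] with x h1 h2
  rw [h1, knFun, knFun]
  simp only [h2]

/-- Extension by density of an operator which is bounded for the `L²` norm. -/
theorem exists_clm_of_eLpNorm_le (A : 𝓢(EucSp n, ℂ) → EucSp n → ℂ)
    (hadd : ∀ f g, A (f + g) =ᵐ[volume] fun x => A f x + A g x)
    (hsmul : ∀ (c : ℂ) f, A (c • f) =ᵐ[volume] fun x => c * A f x)
    (hmeas : ∀ f, AEStronglyMeasurable (A f) volume) {M : ℝ} (hM : 0 ≤ M)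
    (hb : ∀ f, eLpNorm (A f) 2 volume ≤ ENNReal.ofReal M * eLpNorm f 2 volume) :
    ∃ T : L2Sp n →L[ℂ] L2Sp n, (∀ f, T (f.toLp 2) =ᵐ[volume] A f) ∧ ‖T‖ ≤ M := by
  have hmem : ∀ f, MemLp (A f) 2 volume := fun f => ⟨hmeas f, (hb f).trans_lt
    (ENNReal.mul_lt_top ENNReal.ofReal_lt_top (f.memLp 2 volume).2)⟩
  let A' : 𝓢(EucSp n, ℂ) →ₗ[ℂ] L2Sp n :=
    { toFun := fun f => (hmem f).toLp
      map_add' := fun f g => by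
        rw [← MemLp.toLp_add]
        exact MemLp.toLp_congr _ _ (hadd f g)
      map_smul' := fun c f => by
        rw [RingHom.id_apply, ← MemLp.toLp_const_smul]
        exact MemLp.toLp_congr _ _ (hsmul c f) }
  let e : 𝓢(EucSp n, ℂ) →ₗ[ℂ] L2Sp n := (SchwartzMap.toLpCLM ℂ ℂ 2 volume).toLinearMap
  have he : DenseRange e := SchwartzMap.denseRange_toLpCLM (E := EucSp n) (F := ℂ) (μ := volume)
    (p := 2) (by simp)
  have hn : ∀ f, ‖A' f‖ ≤ M * ‖e f‖ := by
    intro f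
    have h1 : ‖A' f‖ = (eLpNorm (A f) 2 volume).toReal := Lp.norm_toLp _ (hmem f)
    have h2 : ‖e f‖ = (eLpNorm f 2 volume).toReal := SchwartzMap.norm_toLp
    rw [h1, h2]
    have := ENNReal.toReal_mono (ENNReal.mul_ne_top ENNReal.ofReal_ne_top (f.memLp 2 volume).2.ne)
      (hb f)
    rwa [ENNReal.toReal_mul, ENNReal.toReal_ofReal hM] at this
  refine ⟨A'.extendOfNorm e, fun f => ?_,
    ContinuousLinearMap.opNorm_le_bound _ hM (LinearMap.norm_extendOfNorm_apply_le he M hn)⟩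
  have : A'.extendOfNorm e (e f) = A' f := LinearMap.extendOfNorm_eq he ⟨M, hn⟩ f
  have h2 : A'.extendOfNorm e (f.toLp 2) = (hmem f).toLp := this
  rw [h2]
  exact (hmem f).coeFn_toLp

theorem exists_isKN {b : EucSp n → EucSp n → ℂ} (hbd : IsAEBounded b)
    (hmeas : ∀ f, AEStronglyMeasurable (knFun b f) volume) {M : ℝ} (hM : 0 ≤ M)
    (hb : ∀ f : 𝓢(EucSp n, ℂ),
      eLpNorm (knFun b f) 2 volume ≤ ENNReal.ofReal M * eLpNorm f 2 volume) :
    ∃ T : L2Sp n →L[ℂ] L2Sp n, IsKN b T ∧ ‖T‖ ≤ M := by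
  refine exists_clm_of_eLpNorm_le (knFun b) ?_ ?_ hmeas hM hb
  · intro f g
    filter_upwards [hbd] with x ⟨hx1, M, hx2⟩
    have : (𝓕 ((f + g : 𝓢(EucSp n, ℂ)) : EucSp n → ℂ)) =
        fun ξ => 𝓕 (f : EucSp n → ℂ) ξ + 𝓕 (g : EucSp n → ℂ) ξ := by
      have := FourierTransform.fourier_add f g
      funext ξ
      rw [← SchwartzMap.fourier_coe, this]
      rfl
    simp only [knFun, this, mul_add]
    exact fourierInv_add_apply (integrable_bounded_mul hx1 hx2 (integrable_fourier_schwartz f))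
      (integrable_bounded_mul hx1 hx2 (integrable_fourier_schwartz g)) x
  · intro c f
    refine Filter.Eventually.of_forall fun x => ?_
    have : (𝓕 ((c • f : 𝓢(EucSp n, ℂ)) : EucSp n → ℂ)) =
        fun ξ => c * 𝓕 (f : EucSp n → ℂ) ξ := by
      have := FourierTransform.fourier_smul c f
      funext ξ
      rw [← SchwartzMap.fourier_coe, this]
      rfl
    simp only [knFun, this, mul_left_comm _ c, fourierInv_const_mul]

theorem aestronglyMeasurable_knFun {b : EucSp n → EucSp n → ℂ}
    (hb : AEStronglyMeasurable (Function.uncurry b) (volume.prod volume)) (f : 𝓢(EucSp n, ℂ)) :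
    AEStronglyMeasurable (knFun b f) volume := by
  have h1 : AEStronglyMeasurable (fun p : EucSp n × EucSp n =>
      Real.fourierChar (inner ℝ p.2 p.1) • (b p.1 p.2 * 𝓕 (f : EucSp n → ℂ) p.2))
      (volume.prod volume) := by
    have hc : Continuous fun p : EucSp n × EucSp n =>
        (Real.fourierChar (inner ℝ p.2 p.1) : Circle) := by fun_prop
    refine hc.aestronglyMeasurable.smul (hb.mul ?_)
    have : Continuous (𝓕 (f : EucSp n → ℂ)) := by
      rw [← SchwartzMap.fourier_coe]; exact (𝓕 f).continuous
    exact (this.comp continuous_snd).aestronglyMeasurable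
  have h2 : knFun b f = fun x => ∫ ξ, Real.fourierChar (inner ℝ ξ x) •
      (b x ξ * 𝓕 (f : EucSp n → ℂ) ξ) := by
    funext x
    rw [knFun, Real.fourierInv_eq]
  rw [h2]
  exact h1.integral_prod_right'

/-- A factor depending on x alone can be pulled out of the ξ-integral, so this composition has no
error. Together with `isKN_comp_multiplier` it gives the freedom used in `exists_isKN_centered`. -/
theorem isKN_mul_left {g : EucSp n → ℂ} {G T : L2Sp n →L[ℂ] L2Sp n}
    {b : EucSp n → EucSp n → ℂ} (hG : ∀ u : L2Sp n, G u =ᵐ[volume] fun x => g x * u x)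
    (hT : IsKN b T) : IsKN (fun x ξ => g x * b x ξ) (G ∘L T) := by
  intro f
  filter_upwards [hG (T (f.toLp 2)), hT f] with x h1 h2
  rw [ContinuousLinearMap.comp_apply, h1, h2, knFun_mul_left]

theorem knFun_multiplier {H : EucSp n → ℂ} (hH : H.HasTemperateGrowth)
    (b : EucSp n → EucSp n → ℂ) (f : 𝓢(EucSp n, ℂ)) :
    knFun b (SchwartzMap.fourierMultiplierCLM ℂ H f) = knFun (fun x ξ => b x ξ * H ξ) f := by
  have : 𝓕 ((SchwartzMap.fourierMultiplierCLM ℂ H f : 𝓢(EucSp n, ℂ)) : EucSp n → ℂ) =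
      fun ξ => H ξ * 𝓕 (f : EucSp n → ℂ) ξ := by
    rw [SchwartzMap.fourierMultiplierCLM_apply, ← SchwartzMap.fourier_coe,
      FourierTransform.fourier_fourierInv_eq]
    funext ξ
    rw [SchwartzMap.smulLeftCLM_apply_apply hH]
    rfl
  funext x
  simp only [knFun, this, mul_assoc]

/-- A Fourier multiplier applied first only multiplies the transform of f by H(ξ), so this
composition is exact as well. -/
theorem isKN_comp_multiplier {H : EucSp n → ℂ} (hH : H.HasTemperateGrowth)
    {b : EucSp n → EucSp n → ℂ} {T S : L2Sp n →L[ℂ] L2Sp n} (hT : IsKN b T)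
    (hS : ∀ f : 𝓢(EucSp n, ℂ), S (f.toLp 2) = (SchwartzMap.fourierMultiplierCLM ℂ H f).toLp 2) :
    IsKN (fun x ξ => b x ξ * H ξ) (T ∘L S) := by
  intro f
  rw [ContinuousLinearMap.comp_apply, hS, ← knFun_multiplier hH]
  exact hT _

theorem knFun_of_fun (g : EucSp n → ℂ) (f : 𝓢(EucSp n, ℂ)) (x : EucSp n) :
    knFun (fun x _ => g x) f x = g x * f x := by
  have h := knFun_mul_left g (fun _ _ => 1) f x
  simp only [mul_one] at h
  rw [h, knFun]
  simp only [one_mul]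
  rw [← SchwartzMap.fourier_coe, ← SchwartzMap.fourierInv_coe,
    FourierTransform.fourierInv_fourier_eq]

theorem knFun_of_multiplier {H : EucSp n → ℂ} (hH : H.HasTemperateGrowth) (f : 𝓢(EucSp n, ℂ))
    (x : EucSp n) :
    knFun (fun _ ξ => H ξ) f x = SchwartzMap.fourierMultiplierCLM ℂ H f x := by
  have h := congrFun (knFun_multiplier hH (fun _ _ => 1) f) x
  simp only [one_mul] at h
  rw [← h, knFun_of_fun]
  simp

end Quantization

/-! ### L² bounds for symbols of negative order without regularity in x -/

noncomputable section SchurBound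

variable {n : ℕ}

theorem one_add_pow_le_two_pow {t : ℝ} (ht : 0 ≤ t) (N : ℕ) :
    (1 + t) ^ N ≤ 2 ^ N * (1 + t ^ N) := by
  rcases le_total t 1 with h | h
  · calc (1 + t) ^ N ≤ 2 ^ N := by gcongr; linarith
      _ ≤ 2 ^ N * (1 + t ^ N) := le_mul_of_one_le_right (by positivity) (by simp; positivity)
  · calc (1 + t) ^ N ≤ (2 * t) ^ N := by gcongr; linarith
      _ = 2 ^ N * t ^ N := mul_pow _ _ _
      _ ≤ 2 ^ N * (1 + t ^ N) := by gcongr; linarith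

/-- Decay of the Fourier transform of a function with integrable derivatives. -/
theorem one_add_norm_pow_mul_fourier_le (N : ℕ) {g : EucSp n → ℂ} (hg : ContDiff ℝ N g)
    (hint : ∀ j ≤ N, Integrable fun v => ‖iteratedFDeriv ℝ j g v‖) (w : EucSp n) :
    (1 + ‖w‖) ^ N * ‖𝓕 g w‖ ≤
      2 * 4 ^ N * ∑ j ∈ Finset.range (N + 1), ∫ v, ‖iteratedFDeriv ℝ j g v‖ := by
  have hint' : ∀ (k m : ℕ), (k : ℕ∞) ≤ (0 : ℕ∞) → (m : ℕ∞) ≤ (N : ℕ∞) →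
      Integrable (fun v => ‖v‖ ^ k * ‖iteratedFDeriv ℝ m g v‖) := by
    intro k m hk hm
    have : k = 0 := by simpa using hk
    subst this
    simpa using hint m (by exact_mod_cast hm)
  have key : ∀ m ≤ N, ‖w‖ ^ m * ‖𝓕 g w‖ ≤
      2 ^ m * ∑ j ∈ Finset.range (m + 1), ∫ v, ‖iteratedFDeriv ℝ j g v‖ := by
    intro m hm
    have h := Real.pow_mul_norm_iteratedFDeriv_fourier_le (K := 0) (N := (N : ℕ∞))
      (by exact_mod_cast hg) hint' (k := 0) (n := m) le_rfl (by exact_mod_cast hm) w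
    simp only [norm_iteratedFDeriv_zero] at h
    refine h.trans_eq ?_
    rw [Finset.sum_product]
    simp
  have hS : ∀ m ≤ N, ∑ j ∈ Finset.range (m + 1), ∫ v, ‖iteratedFDeriv ℝ j g v‖ ≤
      ∑ j ∈ Finset.range (N + 1), ∫ v, ‖iteratedFDeriv ℝ j g v‖ := fun m hm =>
    Finset.sum_le_sum_of_subset_of_nonneg (Finset.range_mono (by omega)) fun _ _ _ =>
      integral_nonneg fun _ => norm_nonneg _
  set S := ∑ j ∈ Finset.range (N + 1), ∫ v, ‖iteratedFDeriv ℝ j g v‖ with hSdef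
  have hS0 : 0 ≤ S := Finset.sum_nonneg fun _ _ => integral_nonneg fun _ => norm_nonneg _
  have h0 := key 0 (by omega)
  have hN := key N le_rfl
  have h0' := hS 0 (by omega)
  simp only [pow_zero, one_mul] at h0
  calc (1 + ‖w‖) ^ N * ‖𝓕 g w‖ ≤ 2 ^ N * (1 + ‖w‖ ^ N) * ‖𝓕 g w‖ := by
        gcongr
        exact one_add_pow_le_two_pow (norm_nonneg _) N
    _ = 2 ^ N * (‖𝓕 g w‖ + ‖w‖ ^ N * ‖𝓕 g w‖) := by ring
    _ ≤ 2 ^ N * (S + 2 ^ N * S) := by gcongr; exact h0.trans h0'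
    _ ≤ 2 ^ N * (2 ^ N * S + 2 ^ N * S) := by
        gcongr
        exact le_mul_of_one_le_left hS0 (one_le_pow₀ (by norm_num))
    _ = 2 * 4 ^ N * S := by
        rw [show (4 : ℝ) = 2 * 2 by norm_num, mul_pow]; ring

theorem fourier_bound_of_support (n N : ℕ) : ∃ C : ℝ, 0 ≤ C ∧ ∀ (g : EucSp n → ℂ) (A : ℝ),
    ContDiff ℝ N g → (∀ v, 2 < ‖v‖ → g v = 0) →
    (∀ j ≤ N, ∀ v, ‖iteratedFDeriv ℝ j g v‖ ≤ A) →
    ∀ w, (1 + ‖w‖) ^ N * ‖𝓕 g w‖ ≤ C * A := by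
  refine ⟨2 * 4 ^ N * ((N + 1 : ℕ) * (volume (Metric.closedBall (0 : EucSp n) 2)).toReal),
    by positivity, ?_⟩
  intro g A hg hsupp hA w
  have hts : tsupport g ⊆ Metric.closedBall 0 2 := by
    refine closure_minimal (fun v hv => ?_) Metric.isClosed_closedBall
    by_contra h
    exact hv (hsupp v (by simpa using h))
  have hvol : volume (Metric.closedBall (0 : EucSp n) 2) < ⊤ :=
    (isCompact_closedBall _ _).measure_lt_top
  have hle : ∀ j ≤ N, ∀ v, ‖iteratedFDeriv ℝ j g v‖ ≤
      (Metric.closedBall (0 : EucSp n) 2).indicator (fun _ => A) v := by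
    intro j hj v
    by_cases hv : v ∈ Metric.closedBall (0 : EucSp n) 2
    · rw [Set.indicator_of_mem hv]; exact hA j hj v
    · rw [Set.indicator_of_notMem hv]
      have : iteratedFDeriv ℝ j g v = 0 := by
        by_contra h
        exact hv (hts (support_iteratedFDeriv_subset j h))
      simp [this]
  have hi : Integrable ((Metric.closedBall (0 : EucSp n) 2).indicator fun _ => A) :=
    (integrable_indicator_iff Metric.isClosed_closedBall.measurableSet).mpr
      (integrableOn_const hvol.ne)
  have hcont : ∀ j ≤ N, Continuous fun v => ‖iteratedFDeriv ℝ j g v‖ := fun j hj =>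
    (hg.continuous_iteratedFDeriv (by exact_mod_cast hj)).norm
  have hint : ∀ j ≤ N, Integrable fun v => ‖iteratedFDeriv ℝ j g v‖ := fun j hj =>
    hi.mono' (hcont j hj).aestronglyMeasurable
      (Filter.Eventually.of_forall fun v => by simpa using hle j hj v)
  refine (one_add_norm_pow_mul_fourier_le N hg hint w).trans ?_
  rw [mul_assoc (2 * 4 ^ N : ℝ)]
  refine mul_le_mul_of_nonneg_left ?_ (by positivity)
  calc ∑ j ∈ Finset.range (N + 1), ∫ v, ‖iteratedFDeriv ℝ j g v‖
      ≤ ∑ j ∈ Finset.range (N + 1), (volume (Metric.closedBall (0 : EucSp n) 2)).toReal * A := by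
        refine Finset.sum_le_sum fun j hj => ?_
        have hj' : j ≤ N := by simpa [Nat.lt_succ_iff] using hj
        refine (integral_mono (hint j hj') hi (hle j hj')).trans_eq ?_
        rw [integral_indicator Metric.isClosed_closedBall.measurableSet, setIntegral_const]
        simp [Measure.real]
    _ = _ := by simp [mul_assoc]

theorem norm_iteratedFDeriv_comp_smul {F : Type*} [NormedAddCommGroup F] [NormedSpace ℝ F]
    (t : ℝ) {g : EucSp n → F} {j : ℕ} (hg : ContDiff ℝ j g) (x : EucSp n) :
    ‖iteratedFDeriv ℝ j (fun y => g (t • y)) x‖ = |t| ^ j * ‖iteratedFDeriv ℝ j g (t • x)‖ := by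
  rw [iteratedFDeriv_comp_const_smul t hg]
  simp [norm_smul]

/-- The factor t^n makes the mass invariant under dilation, so one constant serves all frequency
scales; n + 1 is the first integer power that is integrable. -/
theorem lintegral_schurKernel (n : ℕ) : ∃ C : ℝ, 0 ≤ C ∧ ∀ t : ℝ, 0 < t →
    ∫⁻ z : EucSp n, ENNReal.ofReal (t ^ n * ((1 + t * ‖z‖) ^ (n + 1))⁻¹) ≤ ENNReal.ofReal C := by
  have hi : Integrable fun z : EucSp n => ((1 + ‖z‖) ^ (n + 1))⁻¹ := by
    have := integrable_one_add_norm (E := EucSp n) (μ := volume) (r := (n + 1 : ℕ)) (by simp)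
    refine this.congr (Filter.Eventually.of_forall fun z => ?_)
    simp only
    rw [Real.rpow_neg (by positivity), Real.rpow_natCast]
  refine ⟨∫ z : EucSp n, ((1 + ‖z‖) ^ (n + 1))⁻¹, integral_nonneg fun z => by positivity, ?_⟩
  intro t ht
  have h1 : ∀ z : EucSp n, t ^ n * ((1 + t * ‖z‖) ^ (n + 1))⁻¹ =
      t ^ n * ((1 + ‖t • z‖) ^ (n + 1))⁻¹ := fun z => by
    rw [norm_smul, Real.norm_of_nonneg ht.le]
  simp_rw [h1]
  have hi2 : Integrable fun z : EucSp n => t ^ n * ((1 + ‖t • z‖) ^ (n + 1))⁻¹ :=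
    (hi.comp_smul ht.ne').const_mul _
  rw [← ofReal_integral_eq_lintegral_ofReal hi2
    (Filter.Eventually.of_forall fun z => by simp only [Pi.zero_apply]; positivity)]
  apply ENNReal.ofReal_le_ofReal
  rw [integral_const_mul, Measure.integral_comp_smul volume
    (fun z : EucSp n => ((1 + ‖z‖) ^ (n + 1))⁻¹) t]
  simp only [finrank_euclideanSpace, Fintype.card_fin, smul_eq_mul]
  rw [abs_of_pos (by positivity), ← mul_assoc, mul_inv_cancel₀ (by positivity), one_mul]

/-- The boundedness of an operator whose symbol is localized at the scale `t` in frequency. -/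
theorem eLpNorm_knFun_localized (n : ℕ) : ∃ C : ℝ, 0 ≤ C ∧ ∀ (σ : EucSp n → EucSp n → ℂ)
    (A t : ℝ), 0 < t → 0 ≤ A →
    (∀ᵐ x, ContDiff ℝ (n + 1 : ℕ) (σ x) ∧ (∀ v, 2 < ‖v‖ → σ x v = 0) ∧
      ∀ j ≤ n + 1, ∀ v, ‖iteratedFDeriv ℝ j (σ x) v‖ ≤ A) →
    ∀ f : 𝓢(EucSp n, ℂ), eLpNorm (knFun (fun x ξ => σ x (t⁻¹ • ξ)) f) 2 volume ≤
      ENNReal.ofReal (C * A) * eLpNorm f 2 volume := by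
  obtain ⟨C₁, hC₁, h₁⟩ := fourier_bound_of_support n (n + 1)
  obtain ⟨C₂, hC₂, h₂⟩ := lintegral_schurKernel n
  refine ⟨C₁ * C₂, by positivity, ?_⟩
  intro σ A t ht hA hσ f
  set k : EucSp n → ℝ≥0∞ := fun z =>
    ENNReal.ofReal (C₁ * A) * ENNReal.ofReal (t ^ n * ((1 + t * ‖z‖) ^ (n + 1))⁻¹) with hk
  have hkm : Measurable k := by
    apply Measurable.const_mul
    apply ENNReal.measurable_ofReal.comp
    fun_prop
  have hkint : ∫⁻ z, k z ≤ ENNReal.ofReal (C₁ * C₂ * A) := by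
    rw [hk, lintegral_const_mul' _ _ ENNReal.ofReal_ne_top]
    calc _ ≤ ENNReal.ofReal (C₁ * A) * ENNReal.ofReal C₂ := by gcongr; exact h₂ t ht
      _ = _ := by rw [← ENNReal.ofReal_mul (by positivity)]; ring_nf
  refine (eLpNorm_le_of_kernel hkm f.continuous.aestronglyMeasurable ?_).trans
    (mul_le_mul_left hkint _)
  filter_upwards [hσ] with x ⟨hsm, hsupp, hbd⟩
  set g : EucSp n → ℂ := fun ξ => Real.fourierChar (inner ℝ ξ x) • σ x (t⁻¹ • ξ) with hg
  have hcs : HasCompactSupport (fun ξ => σ x (t⁻¹ • ξ)) := by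
    refine HasCompactSupport.intro (isCompact_closedBall (0 : EucSp n) (2 * t)) fun ξ hξ => ?_
    apply hsupp
    rw [norm_smul, Real.norm_of_nonneg (by positivity)]
    have : 2 * t < ‖ξ‖ := by simpa using hξ
    rw [inv_mul_eq_div, lt_div_iff₀ ht]
    exact this
  have hσint : Integrable fun ξ => σ x (t⁻¹ • ξ) :=
    (hsm.continuous.comp (continuous_const_smul _)).integrable_of_hasCompactSupport hcs
  have hgint : Integrable g := integrable_fourierInv_integrand hσint x
  -- Moving the Fourier transform from f to the other factor exhibits the integral kernel: at x it
  -- is the Fourier transform of the modulated symbol.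
  have hself : knFun (fun x ξ => σ x (t⁻¹ • ξ)) f x = ∫ y, 𝓕 g y * f y := by
    rw [knFun, Real.fourierInv_eq]
    have h3 := VectorFourier.integral_fourierIntegral_smul_eq_flip (e := Real.fourierChar)
      (μ := volume) (ν := volume) (L := innerₗ (EucSp n)) (f := g) (g := f)
      Real.continuous_fourierChar continuous_inner hgint f.integrable
    simp only [flip_innerₗ, smul_eq_mul] at h3
    refine Eq.trans ?_ h3.symm
    congr 1
    funext ξ
    simp only [hg, Circle.smul_def, smul_eq_mul, mul_assoc]
    rfl
  -- The substitution ξ = tv turns the kernel into a unit-scale profile concentrated at distance 1/t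
  -- from the diagonal.
  have hker : ∀ y, 𝓕 g y = ((t ^ n : ℝ) : ℂ) * 𝓕 (σ x) (t • (y - x)) := by
    intro y
    rw [Real.fourier_eq, Real.fourier_eq]
    have h4 := Measure.integral_comp_smul volume
      (fun v => Real.fourierChar (-(inner ℝ v y)) • g v) t
    have h5 : ∀ v, Real.fourierChar (-(inner ℝ (t • v) y)) • g (t • v) =
        Real.fourierChar (-(inner ℝ v (t • (y - x)))) • σ x v := by
      intro v
      simp only [hg, smul_smul, inv_mul_cancel₀ ht.ne', one_smul]
      rw [← AddChar.map_add_eq_mul]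
      congr 2
      simp only [inner_smul_left, inner_smul_right, inner_sub_right]
      simp
      ring
    simp_rw [h5] at h4
    rw [h4]
    simp only [finrank_euclideanSpace, Fintype.card_fin]
    rw [abs_of_pos (by positivity), Complex.real_smul, ← mul_assoc, ← Complex.ofReal_mul,
      mul_inv_cancel₀ (by positivity)]
    simp
  rw [hself]
  refine (enorm_integral_le_lintegral_enorm _).trans (lintegral_mono fun y => ?_)
  rw [enorm_mul]
  gcongr
  simp only [hk]
  rw [← ENNReal.ofReal_mul (by positivity), ← ofReal_norm]
  apply ENNReal.ofReal_le_ofReal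
  rw [hker, norm_mul, Complex.norm_real, Real.norm_of_nonneg (by positivity)]
  have h6 := h₁ (σ x) A hsm hsupp hbd (t • (y - x))
  rw [norm_smul, Real.norm_of_nonneg ht.le, ← norm_neg (y - x), neg_sub] at h6
  have h7 : ‖𝓕 (σ x) (t • (y - x))‖ ≤ C₁ * A * ((1 + t * ‖x - y‖) ^ (n + 1))⁻¹ := by
    rw [← div_eq_mul_inv, le_div_iff₀ (by positivity)]
    linarith
  calc t ^ n * ‖𝓕 (σ x) (t • (y - x))‖ ≤ t ^ n * (C₁ * A * ((1 + t * ‖x - y‖) ^ (n + 1))⁻¹) := by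
        gcongr
    _ = _ := by ring

/-- The symbols with measurable dependence on `x` and the symbol estimates of order `κ` for the
derivatives of order at most `n + 1` in `λξ`. -/
structure IsSchurSymbol (lam κ M : ℝ) (b : EucSp n → EucSp n → ℂ) : Prop where
  meas : AEStronglyMeasurable (Function.uncurry b) (volume.prod volume)
  bound : ∀ᵐ x, ContDiff ℝ (n + 1 : ℕ) (b x) ∧ ∀ j ≤ n + 1, ∀ ξ,
    ‖iteratedFDeriv ℝ j (b x) ξ‖ ≤ M * lam ^ j * japBr (lam • ξ) ^ (κ - j)

theorem one_le_japBr (ξ : EucSp n) : 1 ≤ japBr ξ := by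
  rw [japBr, Real.one_le_sqrt]
  nlinarith [sq_nonneg ‖ξ‖]

theorem norm_le_japBr (ξ : EucSp n) : ‖ξ‖ ≤ japBr ξ :=
  Real.le_sqrt_of_sq_le (by linarith)

theorem japBr_pos (ξ : EucSp n) : 0 < japBr ξ := zero_lt_one.trans_le (one_le_japBr ξ)

theorem japBr_rpow_le_one (ξ : EucSp n) {s : ℝ} (hs : s ≤ 0) : japBr ξ ^ s ≤ 1 :=
  Real.rpow_le_one_of_one_le_of_nonpos (one_le_japBr ξ) hs

theorem IsSchurSymbol.isAEBounded {lam κ M : ℝ} {b : EucSp n → EucSp n → ℂ}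
    (hb : IsSchurSymbol lam κ M b) (hκ : κ ≤ 0) (hM : 0 ≤ M) :
    ∀ᵐ x, Continuous (b x) ∧ ∀ ξ, ‖b x ξ‖ ≤ M := by
  filter_upwards [hb.bound] with x ⟨h1, h2⟩
  refine ⟨h1.continuous, fun ξ => ?_⟩
  have := h2 0 (by omega) ξ
  simp only [norm_iteratedFDeriv_zero, pow_zero, mul_one] at this
  exact this.trans (mul_le_of_le_one_right hM (japBr_rpow_le_one _ (by simpa using hκ)))

/-- The standard cutoff, equal to `1` for `|ζ| ≤ 1` and to `0` for `|ζ| ≥ 2`. -/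
def freqBump (n : ℕ) : ContDiffBump (0 : EucSp n) := ⟨1, 2, by norm_num, by norm_num⟩

/-- The Littlewood-Paley profile of index `j`. -/
def dyadicProfile (n : ℕ) (j : ℕ) (ζ : EucSp n) : ℝ :=
  if j = 0 then freqBump n ζ else freqBump n ζ - freqBump n ((2 : ℝ) • ζ)

/-- The sum telescopes, since the inner bump of the profile of index j + 1 is the outer bump of
index j. -/
theorem sum_dyadicProfile (n J : ℕ) (ξ : EucSp n) :
    ∑ j ∈ Finset.range (J + 1), dyadicProfile n j ((2 ^ j : ℝ)⁻¹ • ξ) =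
      freqBump n ((2 ^ J : ℝ)⁻¹ • ξ) := by
  induction J with
  | zero => simp [dyadicProfile]
  | succ J ih =>
    rw [Finset.sum_range_succ, ih]
    simp only [dyadicProfile, Nat.succ_ne_zero, if_false, smul_smul]
    have : (2 : ℝ) * (2 ^ (J + 1))⁻¹ = (2 ^ J)⁻¹ := by
      rw [pow_succ]; field_simp
    rw [this]
    ring

theorem contDiff_dyadicProfile (n j : ℕ) : ContDiff ℝ ∞ (dyadicProfile n j) := by
  unfold dyadicProfile
  by_cases h : j = 0
  · simpa [h] using (freqBump n).contDiff
  · simp only [h, if_false]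
    exact (freqBump n).contDiff.sub ((freqBump n).contDiff.comp (contDiff_const_smul _))

theorem dyadicProfile_eq_zero_of_lt {j : ℕ} {ζ : EucSp n} (h : 2 < ‖ζ‖) :
    dyadicProfile n j ζ = 0 := by
  have h1 : freqBump n ζ = 0 := (freqBump n).zero_of_le_dist (by simpa [freqBump] using h.le)
  have h2 : freqBump n ((2 : ℝ) • ζ) = 0 :=
    (freqBump n).zero_of_le_dist (by simp [freqBump, norm_smul]; linarith)
  simp [dyadicProfile, h1, h2]

theorem dyadicProfile_eq_zero_of_le {j : ℕ} (hj : j ≠ 0) {ζ : EucSp n} (h : ‖ζ‖ ≤ 1 / 2) :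
    dyadicProfile n j ζ = 0 := by
  have h1 : freqBump n ζ = 1 :=
    (freqBump n).one_of_mem_closedBall (by simp [freqBump]; linarith)
  have h2 : freqBump n ((2 : ℝ) • ζ) = 1 :=
    (freqBump n).one_of_mem_closedBall (by simp [freqBump, norm_smul]; linarith)
  simp [dyadicProfile, hj, h1, h2]

theorem exists_bound_dyadicProfile (n N : ℕ) : ∃ C : ℝ, 0 ≤ C ∧ ∀ j, ∀ i ≤ N, ∀ ζ : EucSp n,
    ‖iteratedFDeriv ℝ i (fun ζ => (dyadicProfile n j ζ : ℂ)) ζ‖ ≤ C := by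
  have hcd : ∀ j, ContDiff ℝ ∞ fun ζ : EucSp n => (dyadicProfile n j ζ : ℂ) := fun j =>
    Complex.ofRealCLM.contDiff.comp (contDiff_dyadicProfile n j)
  have h1 : ∀ j i, ∃ C, ∀ ζ : EucSp n,
      ‖iteratedFDeriv ℝ i (fun ζ => (dyadicProfile n j ζ : ℂ)) ζ‖ ≤ C := by
    intro j i
    have hcs : HasCompactSupport fun ζ : EucSp n => (dyadicProfile n j ζ : ℂ) := by
      refine HasCompactSupport.intro (isCompact_closedBall (0 : EucSp n) 2) fun ζ hζ => ?_
      rw [dyadicProfile_eq_zero_of_lt (by simpa using hζ)]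
      simp
    exact (hcs.iteratedFDeriv i).exists_bound_of_continuous
      ((hcd j).continuous_iteratedFDeriv (by exact_mod_cast le_top))
  choose C hC using h1
  -- There are only two different profiles, those of index 0 and 1, so the bound is uniform in j.
  refine ⟨∑ i ∈ Finset.range (N + 1), (|C 0 i| + |C 1 i|), by positivity, ?_⟩
  intro j i hi ζ
  have hmem : i ∈ Finset.range (N + 1) := by simpa [Nat.lt_succ_iff] using hi
  refine le_trans ?_ (Finset.single_le_sum (f := fun i => |C 0 i| + |C 1 i|)
    (fun _ _ => by positivity) hmem)
  rcases Nat.eq_zero_or_pos j with rfl | hj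
  · exact ((hC 0 i ζ).trans (le_abs_self _)).trans (by simp)
  · have : dyadicProfile n j = dyadicProfile n 1 := by
      funext ζ; simp [dyadicProfile, hj.ne']
    rw [this]
    exact ((hC 1 i ζ).trans (le_abs_self _)).trans (by simp)

theorem norm_iteratedFDeriv_mul_le_of_le {N : ℕ} {f g : EucSp n → ℂ} (hf : ContDiff ℝ N f)
    (hg : ContDiff ℝ N g) {x : EucSp n} {A B : ℝ}
    (hA : ∀ j ≤ N, ‖iteratedFDeriv ℝ j f x‖ ≤ A) (hB : ∀ j ≤ N, ‖iteratedFDeriv ℝ j g x‖ ≤ B)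
    {j : ℕ} (hj : j ≤ N) : ‖iteratedFDeriv ℝ j (fun y => f y * g y) x‖ ≤ 2 ^ N * (A * B) := by
  have hA0 : 0 ≤ A := (norm_nonneg _).trans (hA 0 (by omega))
  have hB0 : 0 ≤ B := (norm_nonneg _).trans (hB 0 (by omega))
  refine (norm_iteratedFDeriv_mul_le hf hg x (by exact_mod_cast hj)).trans ?_
  calc _ ≤ ∑ i ∈ Finset.range (j + 1), (j.choose i : ℝ) * (A * B) := by
        refine Finset.sum_le_sum fun i hi => ?_
        have hi' : i ≤ j := by simpa [Nat.lt_succ_iff] using hi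
        rw [mul_assoc]
        gcongr
        · exact hA i (by omega)
        · exact hB (j - i) (by omega)
    _ = 2 ^ j * (A * B) := by
        rw [← Finset.sum_mul]
        congr 1
        exact_mod_cast Nat.sum_range_choose j
    _ ≤ _ := by gcongr; norm_num

/-- On the shell |λξ| ∼ 2^j each ξ-derivative of the symbol gains λ2^(-j), exactly what rescaling
the shell to unit size costs. The rescaled symbol thus has all derivatives of size 2^(κj), and the
bound for localized symbols applies at the scale t = 2^j/λ. -/
theorem eLpNorm_knFun_dyadic (n : ℕ) {κ : ℝ} (hκ : κ < 0) : ∃ C : ℝ, 0 ≤ C ∧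
    ∀ (lam M : ℝ) (b : EucSp n → EucSp n → ℂ), 0 < lam → 0 ≤ M → IsSchurSymbol lam κ M b →
    ∀ (j : ℕ) (f : 𝓢(EucSp n, ℂ)),
    eLpNorm (knFun (fun x ξ => b x ξ * dyadicProfile n j ((2 ^ j : ℝ)⁻¹ • lam • ξ)) f) 2 volume ≤
      ENNReal.ofReal (C * M * ((2 : ℝ) ^ κ) ^ j) * eLpNorm f 2 volume := by
  obtain ⟨C₁, hC₁, h₁⟩ := eLpNorm_knFun_localized n
  obtain ⟨C₂, hC₂, h₂⟩ := exists_bound_dyadicProfile n (n + 1)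
  refine ⟨C₁ * (2 ^ (n + 1) * ((2 : ℝ) ^ ((n + 1 : ℕ) - κ) * C₂)), by positivity, ?_⟩
  intro lam M b hlam hM hb j f
  have hchi : ContDiff ℝ (n + 1 : ℕ) fun ζ : EucSp n => (dyadicProfile n j ζ : ℂ) :=
    (Complex.ofRealCLM.contDiff.comp (contDiff_dyadicProfile n j)).of_le
      (by exact_mod_cast le_top)
  have h2κ : (0 : ℝ) < (2 : ℝ) ^ κ := by positivity
  have key := h₁ (fun x ζ => b x ((2 ^ j / lam) • ζ) * dyadicProfile n j ζ)
    (2 ^ (n + 1) * (M * (2 : ℝ) ^ ((n + 1 : ℕ) - κ) * ((2 : ℝ) ^ κ) ^ j * C₂)) (2 ^ j / lam)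
    (by positivity) (by positivity) ?_ f
  · have e1 : ∀ ξ : EucSp n, (2 ^ j / lam) • (2 ^ j / lam : ℝ)⁻¹ • ξ = ξ := fun ξ => by
      rw [smul_smul, mul_inv_cancel₀ (by positivity), one_smul]
    have e2 : ∀ ξ : EucSp n, (2 ^ j / lam : ℝ)⁻¹ • ξ = (2 ^ j : ℝ)⁻¹ • lam • ξ := fun ξ => by
      rw [smul_smul, inv_div, div_eq_inv_mul]
    simp only [e1] at key
    simp only [e2] at key
    refine key.trans_eq ?_
    congr 2
    ring
  · filter_upwards [hb.bound] with x ⟨hx1, hx2⟩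
    have hcomp : ContDiff ℝ (n + 1 : ℕ) fun ζ => b x ((2 ^ j / lam : ℝ) • ζ) :=
      hx1.comp (contDiff_const_smul _)
    refine ⟨hcomp.mul hchi, fun v hv => by simp [dyadicProfile_eq_zero_of_lt hv], ?_⟩
    intro i hi v
    by_cases hv : v ∈ tsupport fun ζ : EucSp n => b x ((2 ^ j / lam : ℝ) • ζ) * dyadicProfile n j ζ
    · have hv2 : 1 / 2 ≤ ‖v‖ ∨ j = 0 := by
        by_cases hj : j = 0
        · exact Or.inr hj
        left
        have : tsupport (fun ζ : EucSp n => b x ((2 ^ j / lam : ℝ) • ζ) * dyadicProfile n j ζ) ⊆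
            {v | 1 / 2 ≤ ‖v‖} := by
          refine closure_minimal (fun w hw => ?_) (isClosed_le continuous_const continuous_norm)
          by_contra hc
          simp only [Set.mem_ofPred_eq, not_le] at hc
          exact hw (by simp [dyadicProfile_eq_zero_of_le hj hc.le])
        exact this hv
      refine norm_iteratedFDeriv_mul_le_of_le hcomp hchi (fun m hm => ?_)
        (fun m hm => h₂ j m hm v) hi
      rw [norm_iteratedFDeriv_comp_smul _ (hx1.of_le (by exact_mod_cast hm)),
        abs_of_pos (by positivity)]
      have h3 := hx2 m hm ((2 ^ j / lam : ℝ) • v)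
      have e3 : lam • (2 ^ j / lam : ℝ) • v = (2 ^ j : ℝ) • v := by
        rw [smul_smul]; congr 1; field_simp
      rw [e3] at h3
      -- Since κ - m ≤ 0, a lower bound for the bracket suffices: |2^j v| ≥ 2^(j-1) on the shell,
      -- and 1 ≥ 2^(-1) when j = 0.
      have h4 : japBr ((2 ^ j : ℝ) • v) ^ (κ - m) ≤ ((2 : ℝ) ^ ((j : ℝ) - 1)) ^ (κ - m) := by
        have hneg : κ - m ≤ 0 := by have : (0 : ℝ) ≤ m := by positivity
                                    linarith
        refine Real.rpow_le_rpow_of_nonpos (by positivity) ?_ hneg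
        rcases hv2 with hv2 | rfl
        · refine le_trans ?_ (norm_le_japBr _)
          rw [norm_smul, Real.norm_of_nonneg (by positivity), Real.rpow_sub (by norm_num),
            Real.rpow_natCast, Real.rpow_one, div_eq_mul_one_div]
          gcongr
        · refine le_trans ?_ (one_le_japBr _)
          exact Real.rpow_le_one_of_one_le_of_nonpos (by norm_num) (by simp)
      calc (2 ^ j / lam) ^ m * ‖iteratedFDeriv ℝ m (b x) ((2 ^ j / lam : ℝ) • v)‖
          ≤ (2 ^ j / lam) ^ m * (M * lam ^ m * ((2 : ℝ) ^ ((j : ℝ) - 1)) ^ (κ - m)) := by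
            gcongr
            refine h3.trans ?_
            gcongr
        _ = M * ((2 ^ j : ℝ) ^ m * ((2 : ℝ) ^ ((j : ℝ) - 1)) ^ (κ - m)) := by
            rw [div_pow]; field_simp
        _ = M * ((2 : ℝ) ^ (m - κ) * ((2 : ℝ) ^ κ) ^ j) := by
            congr 1
            rw [← Real.rpow_mul (by norm_num), ← pow_mul, ← Real.rpow_natCast,
              ← Real.rpow_natCast, ← Real.rpow_mul (by norm_num), ← Real.rpow_add (by norm_num),
              ← Real.rpow_add (by norm_num)]
            congr 1
            push_cast
            ring
        _ ≤ M * (2 : ℝ) ^ ((n + 1 : ℕ) - κ) * ((2 : ℝ) ^ κ) ^ j := by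
            rw [mul_assoc]
            gcongr
            norm_num
    · have : iteratedFDeriv ℝ i (fun ζ : EucSp n => b x ((2 ^ j / lam : ℝ) • ζ) *
          dyadicProfile n j ζ) v = 0 := by
        by_contra h
        exact hv (support_iteratedFDeriv_subset i h)
      rw [this, norm_zero]
      positivity

/-- Boundedness on `L²` of the quantization of a symbol of negative order without regularity
in `x`. -/
theorem eLpNorm_knFun_le (n : ℕ) {κ : ℝ} (hκ : κ < 0) : ∃ K : ℝ, 0 ≤ K ∧
    ∀ (lam M : ℝ) (b : EucSp n → EucSp n → ℂ), 0 < lam → 0 ≤ M → IsSchurSymbol lam κ M b →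
    ∀ f : 𝓢(EucSp n, ℂ),
    eLpNorm (knFun b f) 2 volume ≤ ENNReal.ofReal (K * M) * eLpNorm f 2 volume := by
  obtain ⟨C, hC, hdy⟩ := eLpNorm_knFun_dyadic n hκ
  have hr0 : (0 : ℝ) ≤ (2 : ℝ) ^ κ := by positivity
  have hr1 : (2 : ℝ) ^ κ < 1 := Real.rpow_lt_one_of_one_lt_of_neg (by norm_num) hκ
  refine ⟨C * (1 - (2 : ℝ) ^ κ)⁻¹, mul_nonneg hC (inv_nonneg.mpr (by linarith)), ?_⟩
  intro lam M b hlam hM hb f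
  have hbdd := hb.isAEBounded hκ.le hM
  -- The operator truncated to |λξ| ≲ 2^J: the partial sums of the decomposition.
  set F : ℕ → EucSp n → ℂ := fun J =>
    knFun (fun x ξ => b x ξ * freqBump n ((2 ^ J : ℝ)⁻¹ • lam • ξ)) f with hF
  have hprof : ∀ j, Continuous fun ξ : EucSp n =>
      (dyadicProfile n j ((2 ^ j : ℝ)⁻¹ • lam • ξ) : ℂ) := fun j =>
    Complex.continuous_ofReal.comp ((contDiff_dyadicProfile n j).continuous.comp (by fun_prop))
  have hbump : ∀ J, Continuous fun ξ : EucSp n =>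
      (freqBump n ((2 ^ J : ℝ)⁻¹ • lam • ξ) : ℂ) := fun J =>
    Complex.continuous_ofReal.comp ((freqBump n).continuous.comp (by fun_prop))
  have hmeas : ∀ c : EucSp n → ℂ, Continuous c →
      AEStronglyMeasurable (knFun (fun x ξ => b x ξ * c ξ) f) volume := by
    intro c hc
    apply aestronglyMeasurable_knFun
    exact hb.meas.mul (hc.comp continuous_snd).aestronglyMeasurable
  have hFsum : ∀ J, F J =ᵐ[volume] ∑ j ∈ Finset.range (J + 1), knFun (fun x ξ =>
      b x ξ * dyadicProfile n j ((2 ^ j : ℝ)⁻¹ • lam • ξ)) f := by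
    intro J
    filter_upwards [hbdd] with x ⟨hx1, hx2⟩
    rw [Finset.sum_apply]
    simp only [hF, knFun, Real.fourierInv_eq]
    rw [← integral_finsetSum]
    · congr 1
      funext ξ
      rw [← Finset.smul_sum, ← Finset.sum_mul, ← Finset.mul_sum, ← Complex.ofReal_sum,
        sum_dyadicProfile]
    · intro j _
      apply integrable_fourierInv_integrand
      obtain ⟨C', -, hC'⟩ := exists_bound_dyadicProfile n 0
      refine integrable_bounded_mul (M := M * C') (hx1.mul (hprof j)) (fun ξ => ?_)
        (integrable_fourier_schwartz f)
      rw [norm_mul]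
      have := hC' j 0 le_rfl ((2 ^ j : ℝ)⁻¹ • lam • ξ)
      rw [norm_iteratedFDeriv_zero] at this
      exact mul_le_mul (hx2 ξ) this (norm_nonneg _) hM
  have hFle : ∀ J, eLpNorm (F J) 2 volume ≤
      ENNReal.ofReal (C * (1 - (2 : ℝ) ^ κ)⁻¹ * M) * eLpNorm f 2 volume := by
    intro J
    rw [eLpNorm_congr_ae (hFsum J)]
    refine (eLpNorm_sum_le (fun j _ => hmeas _ (hprof j)) (by norm_num)).trans ?_
    refine (Finset.sum_le_sum fun j _ => hdy lam M b hlam hM hb j f).trans ?_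
    rw [← Finset.sum_mul, ← ENNReal.ofReal_sum_of_nonneg (fun j _ => by positivity),
      ← Finset.mul_sum]
    -- Here the order must be strictly negative: the dyadic norms 2^(κj) are summable.
    have hgeo : ∑ j ∈ Finset.range (J + 1), ((2 : ℝ) ^ κ) ^ j ≤ (1 - (2 : ℝ) ^ κ)⁻¹ := by
      rw [← tsum_geometric_of_lt_one hr0 hr1]
      exact (summable_geometric_of_lt_one hr0 hr1).sum_le_tsum _ fun _ _ => by positivity
    refine mul_le_mul_left (ENNReal.ofReal_le_ofReal ?_) _
    calc C * M * ∑ j ∈ Finset.range (J + 1), ((2 : ℝ) ^ κ) ^ j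
        ≤ C * M * (1 - (2 : ℝ) ^ κ)⁻¹ := by gcongr
      _ = _ := by ring
  have hlim : ∀ᵐ x, Filter.Tendsto (fun J => F J x) Filter.atTop (nhds (knFun b f x)) := by
    filter_upwards [hbdd] with x ⟨hx1, hx2⟩
    simp only [hF, knFun, Real.fourierInv_eq]
    have hfc : Continuous (𝓕 (f : EucSp n → ℂ)) := by
      rw [← SchwartzMap.fourier_coe]; exact (𝓕 f).continuous
    have hch : Continuous fun ξ : EucSp n => (Real.fourierChar (inner ℝ ξ x) : Circle) := by
      fun_prop
    refine tendsto_integral_of_dominated_convergence (fun ξ => M * ‖𝓕 (f : EucSp n → ℂ) ξ‖)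
      (fun J => ?_) ((integrable_fourier_schwartz f).norm.const_mul M) (fun J => ?_) ?_
    · exact (hch.smul ((hx1.mul (hbump J)).mul hfc)).aestronglyMeasurable
    · refine Filter.Eventually.of_forall fun ξ => ?_
      rw [Circle.norm_smul, norm_mul, norm_mul]
      gcongr
      refine (mul_le_of_le_one_right (norm_nonneg _) ?_).trans (hx2 ξ)
      rw [Complex.norm_real, Real.norm_of_nonneg (freqBump n).nonneg]
      exact (freqBump n).le_one
    · refine Filter.Eventually.of_forall fun ξ => ?_
      apply tendsto_const_nhds.congr'
      have h0 : Filter.Tendsto (fun J : ℕ => (2 ^ J : ℝ)⁻¹ • lam • ξ) Filter.atTop (nhds 0) := by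
        have := (tendsto_inv_atTop_zero.comp
          (tendsto_pow_atTop_atTop_of_one_lt (one_lt_two (α := ℝ)))).smul_const (lam • ξ)
        simpa using this
      filter_upwards [h0.eventually (Metric.closedBall_mem_nhds 0 (zero_lt_one' ℝ))] with J hJ
      rw [(freqBump n).one_of_mem_closedBall (by simpa [freqBump] using hJ)]
      simp
  -- The truncations converge almost everywhere by dominated convergence, and Fatou's lemma
  -- transfers their uniform bound to the limit.
  refine (Lp.eLpNorm_lim_le_liminf_eLpNorm (fun J => hmeas _ (hbump J)) _ hlim).trans ?_
  refine Filter.liminf_le_of_le (by isBoundedDefault) fun y hy => ?_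
  obtain ⟨J, hJ⟩ := hy.exists
  exact hJ.trans (hFle J)

theorem exists_isKN_of_isSchurSymbol (n : ℕ) {κ : ℝ} (hκ : κ < 0) : ∃ K : ℝ, 0 ≤ K ∧
    ∀ (lam M : ℝ) (b : EucSp n → EucSp n → ℂ), 0 < lam → 0 ≤ M → IsSchurSymbol lam κ M b →
    ∃ T : L2Sp n →L[ℂ] L2Sp n, IsKN b T ∧ ‖T‖ ≤ K * M := by
  obtain ⟨K, hK, h⟩ := eLpNorm_knFun_le n hκ
  refine ⟨K, hK, fun lam M b hlam hM hb => ?_⟩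
  refine exists_isKN ?_ (aestronglyMeasurable_knFun hb.meas) (by positivity)
    (h lam M b hlam hM hb)
  filter_upwards [hb.isAEBounded hκ.le hM] with x ⟨h1, h2⟩
  exact ⟨h1, M, h2⟩

end SchurBound

/-! ### Wave packet transform and Schur's test in phase space -/

noncomputable section Packets

variable {n : ℕ}

/-- The Fourier transform on `L²` is given by the Fourier integral on `L¹ ∩ L²`. -/
theorem fourier_toLp_ae_eq {F : EucSp n → ℂ} (h1 : Integrable F) (h2 : MemLp F 2 volume) :
    (𝓕 (h2.toLp F) : L2Sp n) =ᵐ[volume] 𝓕 F := by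
  have hL : LocallyIntegrable ((𝓕 (h2.toLp F) : L2Sp n) : EucSp n → ℂ) :=
    (Lp.memLp (𝓕 (h2.toLp F) : L2Sp n)).locallyIntegrable (by norm_num)
  have hc : Continuous (𝓕 F) :=
    VectorFourier.fourierIntegral_continuous Real.continuous_fourierChar continuous_inner h1
  -- Both sides are locally integrable, so it suffices to test them against smooth functions of
  -- compact support: one pairing is the Fourier transform of tempered distributions, the other is
  -- the multiplication formula for integrable functions.
  refine ae_eq_of_integral_contDiff_smul_eq hL hc.locallyIntegrable fun g hg hgc => ?_
  set ψ : 𝓢(EucSp n, ℂ) := (hgc.comp_left (g := Complex.ofReal) Complex.ofReal_zero).toSchwartzMap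
    (Complex.ofRealCLM.contDiff.comp hg) with hψ
  have hψa : ∀ x, ψ x = (g x : ℂ) := fun x => rfl
  have h3 := congrArg (fun T : 𝓢'(EucSp n, ℂ) => T ψ)
    (Lp.fourier_toTemperedDistribution_eq (h2.toLp F))
  simp only [TemperedDistribution.fourier_apply, Lp.toTemperedDistribution_apply] at h3
  have h4 := VectorFourier.integral_fourierIntegral_smul_eq_flip (e := Real.fourierChar)
      (μ := volume) (ν := volume) (L := innerₗ (EucSp n)) (f := ψ) (g := F)
      Real.continuous_fourierChar continuous_inner ψ.integrable h1
  simp only [flip_innerₗ] at h4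
  have h5 : ∀ (x : EucSp n) (c : ℂ), g x • c = ψ x • c := fun x c => by
    rw [hψa, Complex.real_smul, smul_eq_mul]
  simp_rw [h5]
  rw [← h3]
  refine Eq.trans ?_ h4
  refine integral_congr_ae ?_
  filter_upwards [h2.coeFn_toLp] with x hx
  rw [hx]
  rfl

/-- A smooth compactly supported window with `L²` norm one. -/
def window (n : ℕ) (x : EucSp n) : ℝ :=
  (Real.sqrt (∫ y, freqBump n y ^ 2))⁻¹ * freqBump n x

theorem contDiff_window (n : ℕ) : ContDiff ℝ ∞ (window n) :=
  contDiff_const.mul (freqBump n).contDiff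

theorem continuous_window (n : ℕ) : Continuous (window n) := (contDiff_window n).continuous

theorem hasCompactSupport_window (n : ℕ) : HasCompactSupport (window n) :=
  (freqBump n).hasCompactSupport.mul_left

theorem integrable_window_sq (n : ℕ) : Integrable fun x => window n x ^ 2 := by
  refine ((continuous_window n).pow 2).integrable_of_hasCompactSupport ?_
  have := (hasCompactSupport_window n).comp_left (g := fun t : ℝ => t ^ 2) (by simp)
  exact this

theorem integral_window_sq (n : ℕ) : ∫ x, window n x ^ 2 = 1 := by
  have hpos : 0 < ∫ y, freqBump n y ^ 2 := by
    have hc : Continuous fun y => freqBump n y ^ 2 := (freqBump n).continuous.pow 2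
    have hcs : HasCompactSupport fun y => freqBump n y ^ 2 :=
      (freqBump n).hasCompactSupport.comp_left (g := fun t : ℝ => t ^ 2) (by simp)
    refine hc.integral_pos_of_hasCompactSupport_nonneg_nonzero hcs (fun y => sq_nonneg _)
      (x := 0) ?_
    have : freqBump n 0 = 1 := (freqBump n).one_of_mem_closedBall (by simp [freqBump])
    simp [this]
  simp only [window, mul_pow]
  rw [integral_const_mul, inv_pow, Real.sq_sqrt hpos.le, inv_mul_cancel₀ hpos.ne']

/-- The time-frequency shift of the window to the point `z` of phase space. -/
def packetFun (z : EucSp n × EucSp n) (x : EucSp n) : ℂ :=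
  Real.fourierChar (inner ℝ x z.2) • (window n (x - z.1) : ℂ)

theorem contDiff_fourierChar_inner (η : EucSp n) :
    ContDiff ℝ ∞ fun x : EucSp n => (Real.fourierChar (inner ℝ x η) : ℂ) := by
  simp only [Real.fourierChar_apply]
  refine Complex.contDiff_exp.comp ?_
  refine ContDiff.mul (Complex.ofRealCLM.contDiff.comp ?_) contDiff_const
  exact contDiff_const.mul (contDiff_id.inner ℝ contDiff_const)

/-- The wave packet at the point `z` of phase space, as a Schwartz function. -/
def packet (z : EucSp n × EucSp n) : 𝓢(EucSp n, ℂ) :=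
  HasCompactSupport.toSchwartzMap (f := packetFun z)
    (by
      refine HasCompactSupport.mul_left ?_
      refine HasCompactSupport.comp_left (g := Complex.ofReal) ?_ Complex.ofReal_zero
      exact (hasCompactSupport_window n).comp_homeomorph (Homeomorph.subRight z.1))
    ((contDiff_fourierChar_inner z.2).mul (Complex.ofRealCLM.contDiff.comp
      ((contDiff_window n).comp (contDiff_id.sub contDiff_const))))

theorem packet_apply (z : EucSp n × EucSp n) (x : EucSp n) :
    packet z x = Real.fourierChar (inner ℝ x z.2) • (window n (x - z.1) : ℂ) := rfl

/-- The wave packet transform of `u`. -/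
def packetTransform (u : L2Sp n) (z : EucSp n × EucSp n) : ℂ :=
  inner ℂ ((packet z).toLp 2 : L2Sp n) u

theorem packetTransform_eq_integral (u : L2Sp n) (z : EucSp n × EucSp n) :
    packetTransform u z =
      ∫ x, Real.fourierChar (-(inner ℝ x z.2)) • ((window n (x - z.1) : ℂ) * u x) := by
  rw [packetTransform, L2.inner_def]
  refine integral_congr_ae ?_
  filter_upwards [(packet z).coeFn_toLp 2 volume] with x hx
  rw [hx, packet_apply]
  simp only [RCLike.inner_apply, Circle.smul_def, smul_eq_mul, map_mul, Complex.conj_ofReal]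
  rw [← Circle.coe_inv_eq_conj, ← AddChar.map_neg_eq_inv]
  ring

theorem packetTransform_eq_fourier (u : L2Sp n) (z : EucSp n × EucSp n) :
    packetTransform u z = 𝓕 (fun x => (window n (x - z.1) : ℂ) * u x) z.2 := by
  rw [packetTransform_eq_integral, Real.fourier_eq]

theorem stronglyMeasurable_packetTransform (u : L2Sp n) :
    StronglyMeasurable (packetTransform u) := by
  have h1 : StronglyMeasurable (fun p : (EucSp n × EucSp n) × EucSp n =>
      Real.fourierChar (-(inner ℝ p.2 p.1.2)) • ((window n (p.2 - p.1.1) : ℂ) * u p.2)) := by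
    have hc : Continuous fun p : (EucSp n × EucSp n) × EucSp n =>
      (Real.fourierChar (-(inner ℝ p.2 p.1.2)) : Circle) := by fun_prop
    have hw : Continuous fun p : (EucSp n × EucSp n) × EucSp n =>
      (window n (p.2 - p.1.1) : ℂ) :=
        Complex.continuous_ofReal.comp ((continuous_window n).comp (by fun_prop))
    exact hc.stronglyMeasurable.smul (hw.stronglyMeasurable.mul
      ((Lp.stronglyMeasurable u).comp_measurable measurable_snd))
  have h2 : packetTransform u = fun z => ∫ x, Real.fourierChar (-(inner ℝ x z.2)) •
      ((window n (x - z.1) : ℂ) * u x) := by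
    funext z
    exact packetTransform_eq_integral u z
  rw [h2]
  exact h1.integral_prod_right'

theorem memLp_window_mul (u : L2Sp n) (y : EucSp n) :
    MemLp (fun x => (window n (x - y) : ℂ) * u x) 2 volume := by
  obtain ⟨C, hC⟩ := (hasCompactSupport_window n).exists_bound_of_continuous (continuous_window n)
  refine MemLp.of_le_mul (c := C) (Lp.memLp u) ?_ (Filter.Eventually.of_forall fun x => ?_)
  · exact (Complex.continuous_ofReal.comp ((continuous_window n).comp
      (by fun_prop))).aestronglyMeasurable.mul (Lp.aestronglyMeasurable u)
  · rw [norm_mul, Complex.norm_real]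
    gcongr
    exact hC _

theorem integrable_window_mul (u : L2Sp n) (y : EucSp n) :
    Integrable (fun x => (window n (x - y) : ℂ) * u x) := by
  refine MemLp.integrable_mul (p := 2) (q := 2) ?_ (Lp.memLp u)
  have hc : Continuous fun x : EucSp n => (window n (x - y) : ℂ) :=
    Complex.continuous_ofReal.comp ((continuous_window n).comp (by fun_prop))
  refine hc.memLp_of_hasCompactSupport ?_
  refine HasCompactSupport.comp_left (g := Complex.ofReal) ?_ Complex.ofReal_zero
  exact (hasCompactSupport_window n).comp_homeomorph (Homeomorph.subRight y)

theorem lintegral_window_sq (x : EucSp n) : ∫⁻ y, ‖(window n (x - y) : ℂ)‖ₑ ^ 2 = 1 := by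
  have h1 : ∀ y, ‖(window n (x - y) : ℂ)‖ₑ ^ 2 = ENNReal.ofReal (window n (x - y) ^ 2) := by
    intro y
    rw [← ofReal_norm, ← ENNReal.ofReal_pow (norm_nonneg _), Complex.norm_real, Real.norm_eq_abs,
      sq_abs]
  simp_rw [h1]
  rw [lintegral_sub_left_eq_self (fun y => ENNReal.ofReal (window n y ^ 2)) x,
    ← ofReal_integral_eq_lintegral_ofReal (integrable_window_sq n)
      (Filter.Eventually.of_forall fun _ => sq_nonneg _), integral_window_sq]
  simp

/-- For a fixed window position the transform is a Fourier transform in the frequency, so Plancherel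
applies; integrating over positions by Tonelli then reproduces u because the window has L² norm one.
-/
theorem lintegral_packetTransform_sq (u : L2Sp n) :
    ∫⁻ z, ‖packetTransform u z‖ₑ ^ 2 = ‖u‖ₑ ^ 2 := by
  have hu : AEMeasurable (fun x => ‖u x‖ₑ) volume := (Lp.aestronglyMeasurable u).enorm
  have hw : Measurable fun p : EucSp n × EucSp n => ‖(window n (p.2 - p.1) : ℂ)‖ₑ :=
    (Complex.continuous_ofReal.comp ((continuous_window n).comp
      (continuous_snd.sub continuous_fst))).measurable.enorm
  rw [Measure.volume_eq_prod, lintegral_prod _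
    ((stronglyMeasurable_packetTransform u).measurable.enorm.pow_const 2).aemeasurable]
  have h1 : ∀ y : EucSp n, ∫⁻ η, ‖packetTransform u (y, η)‖ₑ ^ 2 =
      ∫⁻ x, ‖(window n (x - y) : ℂ)‖ₑ ^ 2 * ‖u x‖ₑ ^ 2 := by
    intro y
    have hF1 := integrable_window_mul u y
    have hF2 := memLp_window_mul u y
    simp_rw [packetTransform_eq_fourier]
    rw [← eLpNorm_two_sq, ← eLpNorm_congr_ae (fourier_toLp_ae_eq hF1 hF2), ← Lp.enorm_def,
      ← ofReal_norm, Lp.norm_fourier_eq, ofReal_norm, Lp.enorm_def,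
      eLpNorm_congr_ae hF2.coeFn_toLp, eLpNorm_two_sq]
    simp only [enorm_mul, mul_pow]
  simp_rw [h1]
  rw [lintegral_lintegral_swap]
  · have h2 : ∀ x : EucSp n, ∫⁻ y, ‖(window n (x - y) : ℂ)‖ₑ ^ 2 * ‖u x‖ₑ ^ 2 = ‖u x‖ₑ ^ 2 := by
      intro x
      rw [lintegral_mul_const, lintegral_window_sq, one_mul]
      exact (hw.comp (measurable_id.prodMk measurable_const)).pow_const 2
    simp_rw [h2]
    rw [← eLpNorm_two_sq, ← Lp.enorm_def]
  · exact (hw.pow_const 2).aemeasurable.mul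
      ((hu.comp_quasiMeasurePreserving Measure.quasiMeasurePreserving_snd).pow_const 2)

/-- The polarized isometry: ⟨u, v⟩ is the integral over phase space of the product of the
transforms, by the normalization of the window in position and Plancherel in frequency. Absolute
values are then taken inside. -/
theorem enorm_inner_le_packetTransform (u v : L2Sp n) :
    ‖inner ℂ u v‖ₑ ≤ ∫⁻ z, ‖packetTransform u z‖ₑ * ‖packetTransform v z‖ₑ := by
  have hprod : Integrable (fun x => inner ℂ (u x) (v x)) volume := L2.integrable_inner u v
  have h1 : inner ℂ u v = ∫ y, ∫ x, inner ℂ ((window n (x - y) : ℂ) * u x)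
      ((window n (x - y) : ℂ) * v x) := by
    have e1 : ∀ x y : EucSp n, inner ℂ ((window n (x - y) : ℂ) * u x)
        ((window n (x - y) : ℂ) * v x) =
        ((window n (x - y) ^ 2 : ℝ) : ℂ) * inner ℂ (u x) (v x) := by
      intro x y
      simp only [RCLike.inner_apply, map_mul, Complex.conj_ofReal]
      push_cast
      ring
    simp_rw [e1]
    rw [L2.inner_def, integral_integral_swap]
    · congr 1
      funext x
      rw [integral_mul_const, integral_complex_ofReal,
        integral_sub_left_eq_self (fun y => window n y ^ 2) volume x, integral_window_sq]
      simp
    · have hm : AEStronglyMeasurable (fun p : EucSp n × EucSp n =>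
          ((window n (p.2 - p.1) ^ 2 : ℝ) : ℂ) * inner ℂ (u p.2) (v p.2))
          (volume.prod volume) := by
        refine Continuous.aestronglyMeasurable ?_ |>.mul ?_
        · exact Complex.continuous_ofReal.comp (((continuous_window n).comp
            (continuous_snd.sub continuous_fst)).pow 2)
        · exact hprod.aestronglyMeasurable.comp_quasiMeasurePreserving
            Measure.quasiMeasurePreserving_snd
      change Integrable (fun p : EucSp n × EucSp n =>
          ((window n (p.2 - p.1) ^ 2 : ℝ) : ℂ) * inner ℂ (u p.2) (v p.2)) (volume.prod volume)
      rw [integrable_prod_iff' hm]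
      refine ⟨Filter.Eventually.of_forall fun x => ?_, ?_⟩
      · exact (((integrable_window_sq n).comp_sub_left x).ofReal (𝕜 := ℂ)).mul_const
          (inner ℂ (u x) (v x))
      · refine hprod.norm.congr (Filter.Eventually.of_forall fun x => ?_)
        simp only [norm_mul, Complex.norm_real, Real.norm_eq_abs, abs_pow, sq_abs]
        rw [integral_mul_const,
          integral_sub_left_eq_self (fun y => window n y ^ 2) volume x, integral_window_sq,
          one_mul]
  have h2 : ∀ y : EucSp n, ∫ x, inner ℂ ((window n (x - y) : ℂ) * u x)
      ((window n (x - y) : ℂ) * v x) =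
      ∫ η, inner ℂ (packetTransform u (y, η)) (packetTransform v (y, η)) := by
    intro y
    have hF1 := integrable_window_mul u y
    have hF2 := memLp_window_mul u y
    have hG1 := integrable_window_mul v y
    have hG2 := memLp_window_mul v y
    have e1 := Lp.inner_fourier_eq (hF2.toLp) (hG2.toLp)
    rw [L2.inner_def, L2.inner_def] at e1
    simp_rw [packetTransform_eq_fourier]
    refine Eq.trans (integral_congr_ae ?_) (e1.symm.trans (integral_congr_ae ?_))
    · filter_upwards [hF2.coeFn_toLp, hG2.coeFn_toLp] with x hx1 hx2
      rw [hx1, hx2]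
    · filter_upwards [fourier_toLp_ae_eq hF1 hF2, fourier_toLp_ae_eq hG1 hG2] with x hx1 hx2
      rw [hx1, hx2]
  rw [h1, Measure.volume_eq_prod, lintegral_prod]
  · simp_rw [h2]
    refine (enorm_integral_le_lintegral_enorm _).trans (lintegral_mono fun y => ?_)
    refine (enorm_integral_le_lintegral_enorm _).trans (lintegral_mono fun η => ?_)
    rw [RCLike.inner_apply, enorm_mul, mul_comm]
    simp
  · exact ((stronglyMeasurable_packetTransform u).measurable.enorm.mul
      (stronglyMeasurable_packetTransform v).measurable.enorm).aemeasurable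

/-- The matrix of an operator in the wave packets. -/
def packetMatrix (R : L2Sp n →L[ℂ] L2Sp n) (w z : EucSp n × EucSp n) : ℂ :=
  inner ℂ ((packet w).toLp 2 : L2Sp n) (R ((packet z).toLp 2))

theorem enorm_packetTransform_adjoint (R : L2Sp n →L[ℂ] L2Sp n) (v : L2Sp n)
    (z : EucSp n × EucSp n) :
    ‖packetTransform (ContinuousLinearMap.adjoint R v) z‖ₑ =
      ‖inner ℂ (R ((packet z).toLp 2)) v‖ₑ := by
  rw [packetTransform, ContinuousLinearMap.adjoint_inner_right]

/-- The packet resolution of the identity is inserted between the two operators, so matrices compose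
like kernels. -/
theorem enorm_packetMatrix_comp_le (R S : L2Sp n →L[ℂ] L2Sp n) (w z : EucSp n × EucSp n) :
    ‖packetMatrix (R ∘L S) w z‖ₑ ≤ ∫⁻ u, ‖packetMatrix R w u‖ₑ * ‖packetMatrix S u z‖ₑ := by
  rw [packetMatrix, ContinuousLinearMap.comp_apply, ← ContinuousLinearMap.adjoint_inner_left]
  refine (enorm_inner_le_packetTransform _ _).trans_eq ?_
  refine lintegral_congr fun u => ?_
  congr 1
  rw [enorm_packetTransform_adjoint, packetMatrix, ← ofReal_norm, norm_inner_symm, ofReal_norm]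

instance : (volume : Measure (EucSp n × EucSp n)).IsAddHaarMeasure :=
  inferInstanceAs ((volume : Measure (EucSp n)).prod (volume : Measure (EucSp n))).IsAddHaarMeasure

instance : (volume : Measure (EucSp n × EucSp n)).IsNegInvariant where
  neg_eq_self := ((Measure.measurePreserving_neg (volume : Measure (EucSp n))).prod
    (Measure.measurePreserving_neg (volume : Measure (EucSp n)))).map_eq

/-- Schur's test in phase space. -/
theorem norm_le_of_packetMatrix {R : L2Sp n →L[ℂ] L2Sp n} {K : EucSp n × EucSp n → ℝ≥0∞}
    (hK : Measurable K) (h : ∀ w z, ‖packetMatrix R w z‖ₑ ≤ K (w - z)) {κ : ℝ} (hκ0 : 0 ≤ κ)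
    (hκ : ∫⁻ z, K z ≤ ENNReal.ofReal κ) : ‖R‖ ≤ κ := by
  have key : ∀ u v : L2Sp n, ‖inner ℂ v (R u)‖ ≤ κ * ‖u‖ * ‖v‖ := by
    intro u v
    -- The resolution of the identity is used twice, once for u and once for v. The sign inside K
    -- brings the inner integral into the form of a convolution.
    have e1 : ‖inner ℂ v (R u)‖ₑ ≤
        ∫⁻ z, (∫⁻ w, K (-(z - w)) * ‖packetTransform v w‖ₑ) * ‖packetTransform u z‖ₑ := by
      rw [← ContinuousLinearMap.adjoint_inner_left]
      refine (enorm_inner_le_packetTransform _ _).trans (lintegral_mono fun z => ?_)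
      rw [enorm_packetTransform_adjoint]
      gcongr
      refine (enorm_inner_le_packetTransform _ _).trans (lintegral_mono fun w => ?_)
      rw [neg_sub]
      gcongr
      exact h w z
    have hKn : Measurable fun z => K (-z) := hK.comp measurable_neg
    have hv : Measurable fun w => ‖packetTransform v w‖ₑ :=
      (stronglyMeasurable_packetTransform v).measurable.enorm
    have hu : Measurable fun w => ‖packetTransform u w‖ₑ :=
      (stronglyMeasurable_packetTransform u).measurable.enorm
    have e2 : ‖inner ℂ v (R u)‖ₑ ^ 2 ≤ (ENNReal.ofReal κ * ‖u‖ₑ * ‖v‖ₑ) ^ 2 := by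
      calc ‖inner ℂ v (R u)‖ₑ ^ 2 ≤ (∫⁻ z, (∫⁻ w, K (-(z - w)) * ‖packetTransform v w‖ₑ) *
            ‖packetTransform u z‖ₑ) ^ 2 := by gcongr
        _ ≤ (∫⁻ z, (∫⁻ w, K (-(z - w)) * ‖packetTransform v w‖ₑ) ^ 2) *
            ∫⁻ z, ‖packetTransform u z‖ₑ ^ 2 := by
          refine lintegral_mul_sq_le _ ?_ hu.aemeasurable
          have : Measurable (fun p : (EucSp n × EucSp n) × (EucSp n × EucSp n) =>
              K (-(p.1 - p.2)) * ‖packetTransform v p.2‖ₑ) :=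
            (hKn.comp (measurable_fst.sub measurable_snd)).mul (hv.comp measurable_snd)
          exact this.lintegral_prod_right'.aemeasurable
        _ ≤ ((∫⁻ z, K (-z)) ^ 2 * ∫⁻ z, ‖packetTransform v z‖ₑ ^ 2) *
            ∫⁻ z, ‖packetTransform u z‖ₑ ^ 2 := by
          gcongr
          exact lintegral_convolution_sq_le volume hKn hv.aemeasurable
        _ ≤ ((ENNReal.ofReal κ) ^ 2 * ‖v‖ₑ ^ 2) * ‖u‖ₑ ^ 2 := by
          rw [lintegral_packetTransform_sq, lintegral_packetTransform_sq,
            lintegral_neg_eq_self (μ := volume) K]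
          gcongr
        _ = _ := by ring
    have e3 := (ENNReal.pow_le_pow_left_iff two_ne_zero).mp e2
    rw [← ofReal_norm, ← ofReal_norm, ← ofReal_norm, ← ENNReal.ofReal_mul hκ0,
      ← ENNReal.ofReal_mul (by positivity)] at e3
    exact (ENNReal.ofReal_le_ofReal_iff (by positivity)).mp e3
  refine ContinuousLinearMap.opNorm_le_bound _ hκ0 fun u => ?_
  rcases eq_or_ne (R u) 0 with h0 | h0
  · rw [h0, norm_zero]; positivity
  · have := key u (R u)
    rw [inner_self_eq_norm_sq_to_K, norm_pow, RCLike.norm_ofReal, abs_norm, sq] at this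
    exact le_of_mul_le_mul_right this (norm_pos_iff.mpr h0)

end Packets

/-! ### Decay of the matrix elements between wave packets -/

noncomputable section MatrixElements

variable {n : ℕ}

theorem one_add_norm_le_mul (a b : EucSp n) : 1 + ‖a + b‖ ≤ (1 + ‖a‖) * (1 + ‖b‖) := by
  have := norm_add_le a b
  nlinarith [norm_nonneg a, norm_nonneg b, mul_nonneg (norm_nonneg a) (norm_nonneg b)]

theorem one_add_norm_sub_le_mul (a b c : EucSp n) :
    1 + ‖a - c‖ ≤ (1 + ‖a - b‖) * (1 + ‖b - c‖) := by
  simpa using one_add_norm_le_mul (a - b) (b - c)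

theorem SchwartzMap.integrable_one_add_norm_pow_mul_iteratedFDeriv (ψ : 𝓢(EucSp n, ℂ))
    (k j : ℕ) : Integrable fun x => (1 + ‖x‖) ^ k * ‖iteratedFDeriv ℝ j ψ x‖ := by
  have h0 := ψ.integrable_pow_mul_iteratedFDeriv volume 0 j
  have hk := ψ.integrable_pow_mul_iteratedFDeriv volume k j
  refine ((h0.add hk).const_mul (2 ^ k)).mono' ?_ (Filter.Eventually.of_forall fun x => ?_)
  · have : Continuous (iteratedFDeriv ℝ j ψ) :=
      (ψ.smooth ⊤).continuous_iteratedFDeriv (by exact_mod_cast le_top)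
    exact (by fun_prop : Continuous fun x => (1 + ‖x‖) ^ k *
      ‖iteratedFDeriv ℝ j ψ x‖).aestronglyMeasurable
  · rw [Real.norm_of_nonneg (by positivity)]
    have := one_add_pow_le_two_pow (norm_nonneg x) k
    calc _ ≤ 2 ^ k * (1 + ‖x‖ ^ k) * ‖iteratedFDeriv ℝ j ψ x‖ := by gcongr
      _ = _ := by simp; ring

/-- N integrations by parts. The linear growth of β around p is absorbed by the Schwartz factor
concentrated at q, at the price 1 + |q - p|. -/
theorem norm_fourier_mul_schwartz_le (ψ : 𝓢(EucSp n, ℂ)) (N : ℕ) : ∃ C : ℝ, 0 ≤ C ∧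
    ∀ (β : EucSp n → ℂ) (A : ℝ) (p q : EucSp n), ContDiff ℝ N β → 0 ≤ A →
    (∀ k ≤ N, ∀ x, ‖iteratedFDeriv ℝ k β x‖ ≤ A * (1 + ‖x - p‖)) → ∀ ζ,
    ‖𝓕 (fun x => β x * ψ (x - q)) ζ‖ ≤ C * A * (1 + ‖q - p‖) * ((1 + ‖ζ‖) ^ N)⁻¹ := by
  set S : EucSp n → ℝ := fun t => ∑ i ∈ Finset.range (N + 1), ‖iteratedFDeriv ℝ i ψ t‖ with hS
  have hSc : Continuous S := continuous_finsetSum _ fun i _ =>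
    ((ψ.smooth ⊤).continuous_iteratedFDeriv (by exact_mod_cast le_top)).norm
  have hS0 : ∀ t, 0 ≤ S t := fun t => Finset.sum_nonneg fun _ _ => norm_nonneg _
  have hSi : Integrable fun t => (1 + ‖t‖) * S t := by
    simp only [hS, Finset.mul_sum]
    exact integrable_finsetSum _ fun i _ => by
      simpa using ψ.integrable_one_add_norm_pow_mul_iteratedFDeriv 1 i
  refine ⟨2 * 4 ^ N * ((N + 1 : ℕ) * (2 ^ N * ∫ t, (1 + ‖t‖) * S t)), by
    have : 0 ≤ ∫ t, (1 + ‖t‖) * S t := integral_nonneg fun t => by have := hS0 t; positivity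
    positivity, ?_⟩
  intro β A p q hβ hA hb ζ
  have hψ : ContDiff ℝ N fun x => ψ (x - q) :=
    (ψ.smooth N).comp (contDiff_id.sub contDiff_const)
  have hle : ∀ j ≤ N, ∀ x, ‖iteratedFDeriv ℝ j (fun x => β x * ψ (x - q)) x‖ ≤
      2 ^ N * (A * (1 + ‖q - p‖)) * ((1 + ‖x - q‖) * S (x - q)) := by
    intro j hj x
    have h1 := norm_iteratedFDeriv_mul_le_of_le hβ hψ (x := x) (B := S (x - q))
      (fun k hk => hb k hk x) (fun k hk => by
        rw [iteratedFDeriv_comp_sub]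
        exact Finset.single_le_sum (f := fun i => ‖iteratedFDeriv ℝ i ψ (x - q)‖)
          (fun _ _ => norm_nonneg _) (by simpa [Nat.lt_succ_iff] using hk)) hj
    refine h1.trans ?_
    have h2 := one_add_norm_sub_le_mul x q p
    have h3 := hS0 (x - q)
    calc 2 ^ N * (A * (1 + ‖x - p‖) * S (x - q))
        ≤ 2 ^ N * (A * ((1 + ‖x - q‖) * (1 + ‖q - p‖)) * S (x - q)) := by gcongr
      _ = _ := by ring
  have hi := (hSi.comp_sub_right q).const_mul (2 ^ N * (A * (1 + ‖q - p‖)))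
  have hint : ∀ j ≤ N, Integrable fun v =>
      ‖iteratedFDeriv ℝ j (fun x => β x * ψ (x - q)) v‖ := fun j hj =>
    hi.mono' ((hβ.mul hψ).continuous_iteratedFDeriv
      (by exact_mod_cast hj)).norm.aestronglyMeasurable
      (Filter.Eventually.of_forall fun v => by simpa using hle j hj v)
  have h4 := one_add_norm_pow_mul_fourier_le N (hβ.mul hψ) hint ζ
  have h5 : ∑ j ∈ Finset.range (N + 1),
      ∫ v, ‖iteratedFDeriv ℝ j (fun x => β x * ψ (x - q)) v‖ ≤
      (N + 1 : ℕ) * (2 ^ N * (A * (1 + ‖q - p‖)) * ∫ t, (1 + ‖t‖) * S t) := by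
    calc _ ≤ ∑ j ∈ Finset.range (N + 1),
          (2 ^ N * (A * (1 + ‖q - p‖)) * ∫ t, (1 + ‖t‖) * S t) := by
          refine Finset.sum_le_sum fun j hj => ?_
          have hj' : j ≤ N := by simpa [Nat.lt_succ_iff] using hj
          refine (integral_mono (hint j hj') hi (hle j hj')).trans_eq ?_
          rw [integral_const_mul, integral_sub_right_eq_self (fun t => (1 + ‖t‖) * S t) q]
      _ = _ := by simp
  rw [← div_eq_mul_inv, le_div_iff₀ (by positivity)]
  calc ‖𝓕 (fun x => β x * ψ (x - q)) ζ‖ * (1 + ‖ζ‖) ^ N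
      = (1 + ‖ζ‖) ^ N * ‖𝓕 (fun x => β x * ψ (x - q)) ζ‖ := mul_comm _ _
    _ ≤ _ := h4
    _ ≤ 2 * 4 ^ N * ((N + 1 : ℕ) * (2 ^ N * (A * (1 + ‖q - p‖)) * ∫ t, (1 + ‖t‖) * S t)) := by
        gcongr
    _ = _ := by ring

/-- The inequality 1 + |p - q| ≤ (1 + |p - x|)(1 + |x - q|) converts decay around p into decay
between p and q; the Schwartz factor pays for the powers of 1 + |x - q|. -/
theorem integral_schwartz_mul_decay_le (ψ : 𝓢(EucSp n, ℂ)) (m : ℕ) : ∃ C : ℝ, 0 ≤ C ∧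
    ∀ p q : EucSp n,
    Integrable (fun x => ‖ψ (x - q)‖ * (1 + ‖x - q‖) * ((1 + ‖x - p‖) ^ m)⁻¹) ∧
    ∫ x, ‖ψ (x - q)‖ * (1 + ‖x - q‖) * ((1 + ‖x - p‖) ^ m)⁻¹ ≤
      C * ((1 + ‖p - q‖) ^ m)⁻¹ := by
  have hI := ψ.integrable_one_add_norm_pow_mul_iteratedFDeriv (m + 1) 0
  simp only [norm_iteratedFDeriv_zero] at hI
  refine ⟨∫ x, (1 + ‖x‖) ^ (m + 1) * ‖ψ x‖, integral_nonneg fun x => by positivity, ?_⟩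
  intro p q
  have hle : ∀ x, ‖ψ (x - q)‖ * (1 + ‖x - q‖) * ((1 + ‖x - p‖) ^ m)⁻¹ ≤
      ((1 + ‖x - q‖) ^ (m + 1) * ‖ψ (x - q)‖) * ((1 + ‖p - q‖) ^ m)⁻¹ := by
    intro x
    have h1 : (1 + ‖p - q‖) ^ m ≤ (1 + ‖x - p‖) ^ m * (1 + ‖x - q‖) ^ m := by
      rw [← mul_pow]
      gcongr
      have := one_add_norm_sub_le_mul p x q
      rwa [norm_sub_rev p x] at this
    have h2 : ((1 + ‖x - p‖) ^ m)⁻¹ ≤ (1 + ‖x - q‖) ^ m * ((1 + ‖p - q‖) ^ m)⁻¹ := by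
      rw [← div_eq_mul_inv, le_div_iff₀ (by positivity), inv_mul_le_iff₀ (by positivity)]
      exact h1
    calc _ ≤ ‖ψ (x - q)‖ * (1 + ‖x - q‖) *
          ((1 + ‖x - q‖) ^ m * ((1 + ‖p - q‖) ^ m)⁻¹) := by gcongr
      _ = _ := by ring
  have hi := (hI.comp_sub_right q).mul_const ((1 + ‖p - q‖) ^ m)⁻¹
  have hint : Integrable (fun x => ‖ψ (x - q)‖ * (1 + ‖x - q‖) * ((1 + ‖x - p‖) ^ m)⁻¹) := by
    refine hi.mono' ?_ (Filter.Eventually.of_forall fun x => ?_)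
    · have hc : Continuous fun x => ‖ψ (x - q)‖ := (ψ.continuous.comp (by fun_prop)).norm
      refine Continuous.aestronglyMeasurable ?_
      refine (hc.mul (by fun_prop)).mul (Continuous.inv₀ (by fun_prop) fun x => by positivity)
    · rw [Real.norm_of_nonneg (by positivity)]
      exact hle x
  refine ⟨hint, (integral_mono hint hi hle).trans_eq ?_⟩
  rw [integral_mul_const, integral_sub_right_eq_self (fun t => (1 + ‖t‖) ^ (m + 1) * ‖ψ t‖) q]

/-- The number of derivatives used in the estimates of the matrix elements. -/
def matrixOrder (n : ℕ) : ℕ := 2 * n + 6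

/-- Symbols with `matrixOrder n` derivatives separately in `x` and in `ξ`, growing at most
linearly away from the point `z` of phase space. -/
structure IsLocalSymbol (M : ℝ) (z : EucSp n × EucSp n) (b : EucSp n → EucSp n → ℂ) : Prop where
  meas : AEStronglyMeasurable (Function.uncurry b) (volume.prod volume)
  smooth_left : ∀ ξ, ContDiff ℝ (matrixOrder n) fun x => b x ξ
  smooth_right : ∀ x, ContDiff ℝ (matrixOrder n) (b x)
  bound_left : ∀ k ≤ matrixOrder n, ∀ x ξ, ‖iteratedFDeriv ℝ k (fun x => b x ξ) x‖ ≤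
    M * (1 + ‖x - z.1‖) * (1 + ‖ξ - z.2‖)
  bound_right : ∀ k ≤ matrixOrder n, ∀ x ξ, ‖iteratedFDeriv ℝ k (b x) ξ‖ ≤
    M * (1 + ‖x - z.1‖) * (1 + ‖ξ - z.2‖)

theorem packet_zero_apply (x : EucSp n) : packet (0 : EucSp n × EucSp n) x = window n x := by
  rw [packet_apply]
  simp

theorem packet_eq_mul (z : EucSp n × EucSp n) (x : EucSp n) :
    packet z x = Real.fourierChar (inner ℝ x z.2) • packet (0 : EucSp n × EucSp n) (x - z.1) := by
  rw [packet_apply, packet_zero_apply]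

theorem fourier_packet (z : EucSp n × EucSp n) (ξ : EucSp n) :
    𝓕 (packet z : EucSp n → ℂ) ξ = Real.fourierChar (-(inner ℝ z.1 (ξ - z.2))) •
      (𝓕 (packet (0 : EucSp n × EucSp n)) : 𝓢(EucSp n, ℂ)) (ξ - z.2) := by
  rw [SchwartzMap.fourier_coe, Real.fourier_eq, Real.fourier_eq, Circle.smul_def, ← integral_smul,
    ← integral_add_right_eq_self _ z.1]
  congr 1
  funext x
  rw [packet_eq_mul, add_sub_cancel_right]
  simp only [Circle.smul_def, smul_eq_mul]
  have h1 : (Real.fourierChar (-(inner ℝ (x + z.1) ξ)) : ℂ) *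
      Real.fourierChar (inner ℝ (x + z.1) z.2) =
      Real.fourierChar (-(inner ℝ z.1 (ξ - z.2))) * Real.fourierChar (-(inner ℝ x (ξ - z.2))) := by
    rw [← Circle.coe_mul, ← Circle.coe_mul, ← AddChar.map_add_eq_mul, ← AddChar.map_add_eq_mul]
    congr 2
    simp only [inner_add_left, inner_sub_right]
    ring
  linear_combination packet (0 : EucSp n × EucSp n) x * h1

/-- At a fixed x the value is, up to a phase, a Fourier transform in ξ evaluated at z.1 - x, so the
ξ-derivatives of the symbol give the decay. Of the 2n + 6 powers one is lost to the growth of the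
symbol in x. -/
theorem norm_knFun_packet_le (n : ℕ) : ∃ C : ℝ, 0 ≤ C ∧ ∀ (M : ℝ) (z : EucSp n × EucSp n)
    (b : EucSp n → EucSp n → ℂ), 0 ≤ M → IsLocalSymbol M z b → ∀ x,
    ‖knFun b (packet z) x‖ ≤ C * M * ((1 + ‖x - z.1‖) ^ (2 * n + 5))⁻¹ := by
  obtain ⟨C, hC, h⟩ := norm_fourier_mul_schwartz_le
    (𝓕 (packet (0 : EucSp n × EucSp n)) : 𝓢(EucSp n, ℂ)) (matrixOrder n)
  refine ⟨C, hC, fun M z b hM hb x => ?_⟩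
  have h1 := h (b x) (M * (1 + ‖x - z.1‖)) z.2 z.2 (hb.smooth_right x) (by positivity)
    (fun k hk ξ => hb.bound_right k hk x ξ) (z.1 - x)
  have h2 : knFun b (packet z) x = Real.fourierChar (inner ℝ z.1 z.2) •
      𝓕 (fun ξ => b x ξ * (𝓕 (packet (0 : EucSp n × EucSp n)) : 𝓢(EucSp n, ℂ)) (ξ - z.2))
        (z.1 - x) := by
    rw [knFun, Real.fourierInv_eq, Real.fourier_eq, Circle.smul_def, ← integral_smul]
    congr 1
    funext ξ
    rw [fourier_packet]
    simp only [Circle.smul_def, smul_eq_mul]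
    have h3 : (Real.fourierChar (inner ℝ ξ x) : ℂ) *
        Real.fourierChar (-(inner ℝ z.1 (ξ - z.2))) =
        Real.fourierChar (inner ℝ z.1 z.2) * Real.fourierChar (-(inner ℝ ξ (z.1 - x))) := by
      rw [← Circle.coe_mul, ← Circle.coe_mul, ← AddChar.map_add_eq_mul, ← AddChar.map_add_eq_mul]
      congr 2
      simp only [inner_sub_right, real_inner_comm ξ z.1]
      ring
    linear_combination (b x ξ *
      (𝓕 (packet (0 : EucSp n × EucSp n)) : 𝓢(EucSp n, ℂ)) (ξ - z.2)) * h3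
  rw [h2, Circle.norm_smul]
  refine h1.trans_eq ?_
  have e1 : ‖z.1 - x‖ = ‖x - z.1‖ := norm_sub_rev _ _
  rw [sub_self, norm_zero, e1, matrixOrder, pow_succ]
  have : (1 + ‖x - z.1‖) ≠ 0 := by positivity
  field_simp
  simp

theorem packetMatrix_eq_integral {b : EucSp n → EucSp n → ℂ} {T : L2Sp n →L[ℂ] L2Sp n}
    (hT : IsKN b T) (w z : EucSp n × EucSp n) :
    packetMatrix T w z = ∫ x, (starRingEnd ℂ) (packet w x) * knFun b (packet z) x := by
  rw [packetMatrix, L2.inner_def]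
  refine integral_congr_ae ?_
  filter_upwards [(packet w).coeFn_toLp 2 volume, hT (packet z)] with x h1 h2
  rw [h1, h2, RCLike.inner_apply, mul_comm]

theorem norm_packet (w : EucSp n × EucSp n) (x : EucSp n) :
    ‖packet w x‖ = ‖packet (0 : EucSp n × EucSp n) (x - w.1)‖ := by
  rw [packet_eq_mul, Circle.norm_smul]

theorem norm_packetMatrix_le_position (n : ℕ) : ∃ C : ℝ, 0 ≤ C ∧ ∀ (M : ℝ)
    (z w : EucSp n × EucSp n) (b : EucSp n → EucSp n → ℂ) (T : L2Sp n →L[ℂ] L2Sp n), 0 ≤ M →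
    IsLocalSymbol M z b → IsKN b T →
    ‖packetMatrix T w z‖ ≤ C * M * ((1 + ‖w.1 - z.1‖) ^ (2 * n + 5))⁻¹ := by
  obtain ⟨C₁, hC₁, h₁⟩ := norm_knFun_packet_le n
  obtain ⟨C₂, hC₂, h₂⟩ := integral_schwartz_mul_decay_le (packet (0 : EucSp n × EucSp n))
    (2 * n + 5)
  refine ⟨C₁ * C₂, by positivity, fun M z w b T hM hb hT => ?_⟩
  obtain ⟨h3, h4⟩ := h₂ z.1 w.1
  rw [packetMatrix_eq_integral hT]
  refine (norm_integral_le_of_norm_le (h3.const_mul (C₁ * M))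
    (Filter.Eventually.of_forall fun x => ?_)).trans ?_
  · rw [norm_mul, RCLike.norm_conj, norm_packet]
    calc _ ≤ ‖packet (0 : EucSp n × EucSp n) (x - w.1)‖ *
          (C₁ * M * ((1 + ‖x - z.1‖) ^ (2 * n + 5))⁻¹) := by
          gcongr
          exact h₁ M z b hM hb x
      _ ≤ ‖packet (0 : EucSp n × EucSp n) (x - w.1)‖ * (1 + ‖x - w.1‖) *
          (C₁ * M * ((1 + ‖x - z.1‖) ^ (2 * n + 5))⁻¹) := by
          gcongr
          exact le_mul_of_one_le_right (norm_nonneg _) (by simp)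
      _ = _ := by ring
  · rw [integral_const_mul]
    calc _ ≤ C₁ * M * (C₂ * ((1 + ‖z.1 - w.1‖) ^ (2 * n + 5))⁻¹) := by gcongr
      _ = _ := by rw [norm_sub_rev z.1 w.1]; ring

/-- The counterpart of the position estimate: after Fubini the inner integral in x is a Fourier
transform at w.2 - ξ, and now the x-derivatives give the decay. The growth of the symbol in x
survives as the factor 1 + |w.1 - z.1|. -/
theorem norm_packetMatrix_le_frequency (n : ℕ) : ∃ C : ℝ, 0 ≤ C ∧ ∀ (M : ℝ)
    (z w : EucSp n × EucSp n) (b : EucSp n → EucSp n → ℂ) (T : L2Sp n →L[ℂ] L2Sp n), 0 ≤ M →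
    IsLocalSymbol M z b → IsKN b T →
    ‖packetMatrix T w z‖ ≤
      C * M * (1 + ‖w.1 - z.1‖) * ((1 + ‖w.2 - z.2‖) ^ (2 * n + 6))⁻¹ := by
  set W : 𝓢(EucSp n, ℂ) := packet (0 : EucSp n × EucSp n) with hW
  set V : 𝓢(EucSp n, ℂ) := 𝓕 W with hV
  obtain ⟨C₁, hC₁, h₁⟩ := norm_fourier_mul_schwartz_le W (matrixOrder n)
  obtain ⟨C₂, hC₂, h₂⟩ := integral_schwartz_mul_decay_le V (2 * n + 6)
  refine ⟨C₁ * C₂, by positivity, fun M z w b T hM hb hT => ?_⟩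
  obtain ⟨h3, h4⟩ := h₂ w.2 z.2
  set Φ : EucSp n → EucSp n → ℂ := fun x ξ => (starRingEnd ℂ) (packet w x) *
    (Real.fourierChar (inner ℝ ξ x) • (b x ξ * 𝓕 (packet z : EucSp n → ℂ) ξ)) with hΦ
  have hΦn : ∀ x ξ, ‖Φ x ξ‖ = ‖W (x - w.1)‖ * (‖b x ξ‖ * ‖V (ξ - z.2)‖) := by
    intro x ξ
    rw [hΦ, norm_mul, RCLike.norm_conj, norm_packet, Circle.norm_smul, norm_mul, fourier_packet,
      Circle.norm_smul]
  have hfc : ∀ z : EucSp n × EucSp n, Continuous (𝓕 (packet z : EucSp n → ℂ)) := fun z => by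
    rw [← SchwartzMap.fourier_coe]; exact (𝓕 (packet z)).continuous
  have hΦm : AEStronglyMeasurable (Function.uncurry Φ) (volume.prod volume) := by
    have hc : Continuous fun p : EucSp n × EucSp n =>
      (Real.fourierChar (inner ℝ p.2 p.1) : Circle) := by fun_prop
    have hp : Continuous fun p : EucSp n × EucSp n => (starRingEnd ℂ) (packet w p.1) :=
      RCLike.continuous_conj.comp ((packet w).continuous.comp continuous_fst)
    exact hp.aestronglyMeasurable.mul (hc.aestronglyMeasurable.smul
      (hb.meas.mul ((hfc z).comp continuous_snd).aestronglyMeasurable))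
  have hW1 := W.integrable_one_add_norm_pow_mul_iteratedFDeriv 1 0
  have hV1 := V.integrable_one_add_norm_pow_mul_iteratedFDeriv 1 0
  simp only [norm_iteratedFDeriv_zero, pow_one] at hW1 hV1
  -- Fubini is justified by the Schwartz factors in x and ξ separately, which absorb the linear
  -- growth of the symbol.
  have hΦi : Integrable (Function.uncurry Φ) (volume.prod volume) := by
    have hdom := (((hW1.comp_sub_right w.1).mul_prod (hV1.comp_sub_right z.2)).const_mul
      (M * (1 + ‖w.1 - z.1‖)))
    refine hdom.mono' hΦm (Filter.Eventually.of_forall fun p => ?_)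
    have hb0 := hb.bound_left 0 (by omega) p.1 p.2
    rw [norm_iteratedFDeriv_zero] at hb0
    rw [Function.uncurry, hΦn]
    calc ‖W (p.1 - w.1)‖ * (‖b p.1 p.2‖ * ‖V (p.2 - z.2)‖)
        ≤ ‖W (p.1 - w.1)‖ * ((M * ((1 + ‖p.1 - w.1‖) * (1 + ‖w.1 - z.1‖)) *
            (1 + ‖p.2 - z.2‖)) * ‖V (p.2 - z.2)‖) := by
          gcongr
          refine hb0.trans ?_
          gcongr
          exact one_add_norm_sub_le_mul _ _ _
      _ = _ := by ring
  have e1 : packetMatrix T w z = ∫ ξ, ∫ x, Φ x ξ := by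
    rw [packetMatrix_eq_integral hT, ← integral_integral_swap hΦi]
    congr 1
    funext x
    rw [integral_const_mul, knFun, Real.fourierInv_eq]
  have e2 : ∀ ξ, ‖∫ x, Φ x ξ‖ ≤ ‖V (ξ - z.2)‖ * (C₁ * (M * (1 + ‖ξ - z.2‖)) *
      (1 + ‖w.1 - z.1‖) * ((1 + ‖w.2 - ξ‖) ^ (2 * n + 6))⁻¹) := by
    intro ξ
    have h5 := h₁ (fun x => b x ξ) (M * (1 + ‖ξ - z.2‖)) z.1 w.1 (hb.smooth_left ξ)
      (by positivity) (fun k hk x => (hb.bound_left k hk x ξ).trans_eq (by ring)) (w.2 - ξ)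
    have h6 : ∫ x, Φ x ξ = 𝓕 (packet z : EucSp n → ℂ) ξ *
        𝓕 (fun x => b x ξ * W (x - w.1)) (w.2 - ξ) := by
      rw [Real.fourier_eq (fun x => b x ξ * W (x - w.1)), ← integral_const_mul]
      congr 1
      funext x
      rw [hΦ]
      simp only [packet_eq_mul w, Circle.smul_def, smul_eq_mul, map_mul]
      have hreal : (starRingEnd ℂ) (W (x - w.1)) = W (x - w.1) := by
        rw [hW, packet_zero_apply, Complex.conj_ofReal]
      rw [← hW, hreal, ← Circle.coe_inv_eq_conj, ← AddChar.map_neg_eq_inv]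
      have h7 : (Real.fourierChar (-(inner ℝ x (w.2 - ξ))) : ℂ) =
          Real.fourierChar (-(inner ℝ x w.2)) * Real.fourierChar (inner ℝ ξ x) := by
        rw [← Circle.coe_mul, ← AddChar.map_add_eq_mul]
        congr 2
        rw [inner_sub_right, real_inner_comm x ξ]
        ring
      rw [h7]
      ring
    rw [h6, norm_mul, fourier_packet, Circle.norm_smul]
    gcongr
    exact h5
  rw [e1]
  refine (norm_integral_le_of_norm_le (h3.const_mul (C₁ * M * (1 + ‖w.1 - z.1‖)))
    (Filter.Eventually.of_forall fun ξ => ?_)).trans ?_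
  · refine (e2 ξ).trans_eq ?_
    rw [norm_sub_rev w.2 ξ]
    ring
  · rw [integral_const_mul]
    calc _ ≤ C₁ * M * (1 + ‖w.1 - z.1‖) * (C₂ * ((1 + ‖w.2 - z.2‖) ^ (2 * n + 6))⁻¹) := by
          gcongr
      _ = _ := by ring

/-- The profile of decay of the matrix elements. -/
def decayProfile (z : EucSp n × EucSp n) : ℝ :=
  ((1 + ‖z.1‖) ^ (n + 2))⁻¹ * ((1 + ‖z.2‖) ^ (n + 3))⁻¹

/-- The geometric mean of the position and the frequency estimate. With a = 1 + |w.1 - z.1| and c =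
1 + |w.2 - z.2| the product of the two is a^(-(2n+5)) · a · c^(-(2n+6)), the square of a^(-(n+2))
c^(-(n+3)). No mixed derivatives of the symbol are needed, and `matrixOrder` is chosen so that the
result is integrable even after a loss of one power of c. -/
theorem norm_packetMatrix_le (n : ℕ) : ∃ C : ℝ, 0 ≤ C ∧ ∀ (M : ℝ)
    (z w : EucSp n × EucSp n) (b : EucSp n → EucSp n → ℂ) (T : L2Sp n →L[ℂ] L2Sp n), 0 ≤ M →
    IsLocalSymbol M z b → IsKN b T → ‖packetMatrix T w z‖ ≤ C * M * decayProfile (w - z) := by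
  obtain ⟨C₁, hC₁, h₁⟩ := norm_packetMatrix_le_position n
  obtain ⟨C₂, hC₂, h₂⟩ := norm_packetMatrix_le_frequency n
  refine ⟨C₁ + C₂, by positivity, fun M z w b T hM hb hT => ?_⟩
  have e1 := h₁ M z w b T hM hb hT
  have e2 := h₂ M z w b T hM hb hT
  simp only [decayProfile, Prod.fst_sub, Prod.snd_sub]
  set a := 1 + ‖w.1 - z.1‖ with ha
  set c := 1 + ‖w.2 - z.2‖ with hc
  have ha0 : 0 < a := by positivity
  have hc0 : 0 < c := by positivity
  refine abs_le_of_sq_le_sq' ?_ (by positivity) |>.2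
  calc ‖packetMatrix T w z‖ ^ 2 = ‖packetMatrix T w z‖ * ‖packetMatrix T w z‖ := sq _
    _ ≤ (C₁ * M * (a ^ (2 * n + 5))⁻¹) * (C₂ * M * a * (c ^ (2 * n + 6))⁻¹) := by gcongr
    _ = (C₁ * C₂) * (M * ((a ^ (n + 2))⁻¹ * (c ^ (n + 3))⁻¹)) ^ 2 := by
        have e3 : a ^ (2 * n + 5) = (a ^ (n + 2)) ^ 2 * a := by ring
        have e4 : c ^ (2 * n + 6) = (c ^ (n + 3)) ^ 2 := by ring
        rw [e3, e4]
        field_simp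
    _ ≤ (C₁ + C₂) ^ 2 * (M * ((a ^ (n + 2))⁻¹ * (c ^ (n + 3))⁻¹)) ^ 2 := by
        gcongr
        nlinarith
    _ = _ := by ring

end MatrixElements

/-! ### The composition defect of slowly varying symbols -/

noncomputable section Composition

variable {n : ℕ}

theorem exists_clm_mul {g : EucSp n → ℂ} (hg : AEStronglyMeasurable g volume) {B : ℝ}
    (hB0 : 0 ≤ B) (hB : ∀ᵐ x, ‖g x‖ ≤ B) : ∃ G : L2Sp n →L[ℂ] L2Sp n,
    (∀ u : L2Sp n, G u =ᵐ[volume] fun x => g x * u x) ∧ ‖G‖ ≤ B := by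
  have hle : ∀ u : L2Sp n, ∀ᵐ x, ‖g x * u x‖ ≤ B * ‖u x‖ := fun u => by
    filter_upwards [hB] with x hx
    rw [norm_mul]
    gcongr
  have hm : ∀ u : L2Sp n, MemLp (fun x => g x * u x) 2 volume := fun u =>
    (Lp.memLp u).of_le_mul (hg.mul (Lp.aestronglyMeasurable u)) (hle u)
  let G : L2Sp n →ₗ[ℂ] L2Sp n :=
    { toFun := fun u => (hm u).toLp
      map_add' := fun u v => by
        rw [← MemLp.toLp_add]
        refine MemLp.toLp_congr _ _ ?_
        filter_upwards [Lp.coeFn_add u v] with x hx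
        rw [hx, Pi.add_apply, Pi.add_apply, mul_add]
      map_smul' := fun c u => by
        rw [RingHom.id_apply, ← MemLp.toLp_const_smul]
        refine MemLp.toLp_congr _ _ ?_
        filter_upwards [Lp.coeFn_smul c u] with x hx
        rw [hx, Pi.smul_apply, Pi.smul_apply, smul_eq_mul, smul_eq_mul, mul_left_comm] }
  refine ⟨G.mkContinuous B fun u => ?_, fun u => (hm u).coeFn_toLp,
    LinearMap.mkContinuous_norm_le _ hB0 _⟩
  refine Lp.norm_le_mul_norm_of_ae_le_mul ?_
  filter_upwards [hle u, (hm u).coeFn_toLp] with x h1 h2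
  change ‖((hm u).toLp : L2Sp n) x‖ ≤ _
  rw [h2]
  exact h1

theorem exists_clm_multiplier {H : EucSp n → ℂ} (hH : H.HasTemperateGrowth) {B : ℝ}
    (hB0 : 0 ≤ B) (hB : ∀ ξ, ‖H ξ‖ ≤ B) : ∃ S : L2Sp n →L[ℂ] L2Sp n,
    (∀ f : 𝓢(EucSp n, ℂ), S (f.toLp 2) = (SchwartzMap.fourierMultiplierCLM ℂ H f).toLp 2) ∧
    ‖S‖ ≤ B := by
  obtain ⟨G, hG, hGB⟩ := exists_clm_mul (g := H) hH.1.continuous.aestronglyMeasurable hB0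
    (Filter.Eventually.of_forall hB)
  let e := Lp.fourierTransformₗᵢ (EucSp n) ℂ
  refine ⟨e.symm.toContinuousLinearEquiv.toContinuousLinearMap ∘L G ∘L
    e.toContinuousLinearEquiv.toContinuousLinearMap, fun f => ?_, ?_⟩
  · change 𝓕⁻ (G (𝓕 (f.toLp 2 volume))) = _
    rw [SchwartzMap.toLp_fourier_eq, SchwartzMap.fourierMultiplierCLM_apply,
      ← SchwartzMap.toLp_fourierInv_eq]
    congr 1
    refine Lp.ext ?_
    filter_upwards [hG ((𝓕 f).toLp 2), (𝓕 f).coeFn_toLp 2 volume,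
      (SchwartzMap.smulLeftCLM ℂ H (𝓕 f)).coeFn_toLp 2 volume] with x h1 h2 h3
    rw [h1, h2, h3, SchwartzMap.smulLeftCLM_apply_apply hH, smul_eq_mul]
  · refine ContinuousLinearMap.opNorm_le_bound _ hB0 fun u => ?_
    change ‖e.symm (G (e u))‖ ≤ _
    rw [LinearIsometryEquiv.norm_map]
    refine (G.le_of_opNorm_le hGB _).trans_eq ?_
    rw [LinearIsometryEquiv.norm_map]

theorem isKN_of_mul {g : EucSp n → ℂ} {G : L2Sp n →L[ℂ] L2Sp n}
    (hG : ∀ u : L2Sp n, G u =ᵐ[volume] fun x => g x * u x) : IsKN (fun x _ => g x) G := by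
  intro f
  filter_upwards [hG (f.toLp 2), f.coeFn_toLp 2 volume] with x h1 h2
  rw [h1, h2, knFun_of_fun]

theorem isKN_of_multiplier {H : EucSp n → ℂ} (hH : H.HasTemperateGrowth)
    {S : L2Sp n →L[ℂ] L2Sp n}
    (hS : ∀ f : 𝓢(EucSp n, ℂ), S (f.toLp 2) = (SchwartzMap.fourierMultiplierCLM ℂ H f).toLp 2) :
    IsKN (fun _ ξ => H ξ) S := by
  intro f
  rw [hS]
  filter_upwards [(SchwartzMap.fourierMultiplierCLM ℂ H f).coeFn_toLp 2 volume] with x h1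
  rw [h1, knFun_of_multiplier hH]

theorem integrable_inv_one_add_norm_pow (n : ℕ) {m : ℕ} (hm : n < m) :
    Integrable fun x : EucSp n => ((1 + ‖x‖) ^ m)⁻¹ := by
  have h := integrable_one_add_norm (E := EucSp n) (μ := volume) (r := m) (by simpa using hm)
  refine h.congr (Filter.Eventually.of_forall fun x => ?_)
  simp only
  rw [Real.rpow_neg (by positivity), Real.rpow_natCast]

theorem decayProfile_nonneg (z : EucSp n × EucSp n) : 0 ≤ decayProfile z := by
  unfold decayProfile
  positivity

theorem continuous_decayProfile : Continuous (decayProfile (n := n)) := by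
  unfold decayProfile
  refine Continuous.mul (Continuous.inv₀ (by fun_prop) fun z => by positivity)
    (Continuous.inv₀ (by fun_prop) fun z => by positivity)

/-- The profile decays to the power n + 3 in frequency; the power beyond n + 2 pays for the growth 1
+ |ζ| of a symbol centered at another point. -/
theorem integrable_decayProfile_mul (n : ℕ) :
    Integrable fun z : EucSp n × EucSp n => (1 + ‖z.2‖) * decayProfile z := by
  have h := (integrable_inv_one_add_norm_pow n (m := n + 2) (by omega)).mul_prod
    (integrable_inv_one_add_norm_pow n (m := n + 2) (by omega))
  refine h.congr (Filter.Eventually.of_forall fun z => ?_)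
  simp only [decayProfile]
  have : 1 + ‖z.2‖ ≠ 0 := by positivity
  field_simp
  ring

theorem exists_lintegral_decayProfile (n : ℕ) : ∃ D : ℝ, 0 ≤ D ∧
    ∫⁻ z : EucSp n × EucSp n, ENNReal.ofReal ((1 + ‖z.2‖) * decayProfile z) ≤ ENNReal.ofReal D ∧
    ∫⁻ z : EucSp n × EucSp n, ENNReal.ofReal (decayProfile z) ≤ ENNReal.ofReal D := by
  have hp : ∀ z : EucSp n × EucSp n, 0 ≤ (1 + ‖z.2‖) * decayProfile z := fun z =>
    mul_nonneg (by positivity) (decayProfile_nonneg z)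
  have h1 : ∫⁻ z : EucSp n × EucSp n, ENNReal.ofReal ((1 + ‖z.2‖) * decayProfile z) ≤
      ENNReal.ofReal (∫ z : EucSp n × EucSp n, (1 + ‖z.2‖) * decayProfile z) :=
    (ofReal_integral_eq_lintegral_ofReal (integrable_decayProfile_mul n)
      (Filter.Eventually.of_forall hp)).ge
  refine ⟨_, integral_nonneg hp, h1, le_trans (lintegral_mono fun z => ?_) h1⟩
  gcongr
  exact le_mul_of_one_le_left (decayProfile_nonneg z) (by simp)

/-- The theorem of Calderón and Vaillancourt. -/
theorem norm_le_of_isLocalSymbol (n : ℕ) : ∃ C : ℝ, 0 ≤ C ∧ ∀ (M : ℝ)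
    (b : EucSp n → EucSp n → ℂ) (T : L2Sp n →L[ℂ] L2Sp n), 0 ≤ M →
    (∀ z, IsLocalSymbol M z b) → IsKN b T → ‖T‖ ≤ C * M := by
  obtain ⟨C, hC, h⟩ := norm_packetMatrix_le n
  obtain ⟨D, hD, -, h2⟩ := exists_lintegral_decayProfile n
  refine ⟨C * D, by positivity, fun M b T hM hb hT => ?_⟩
  refine norm_le_of_packetMatrix (K := fun z => ENNReal.ofReal (C * M * decayProfile z)) ?_
    (fun w z => ?_) (by positivity) ?_
  · exact (continuous_const.mul continuous_decayProfile).measurable.ennreal_ofReal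
  · rw [← ofReal_norm]
    exact ENNReal.ofReal_le_ofReal (h M z w b T hM (hb z) hT)
  · simp_rw [ENNReal.ofReal_mul (show 0 ≤ C * M by positivity)]
    rw [lintegral_const_mul' _ _ ENNReal.ofReal_ne_top]
    refine (mul_le_mul_right h2 _).trans_eq ?_
    rw [← ENNReal.ofReal_mul (by positivity)]
    ring_nf

/-- `b(x, ξ)` has bounded derivatives in `ξ` of positive order, and its derivatives in `x` vary
slowly with `ξ`. -/
structure IsSlowlyVarying (M : ℝ) (b : EucSp n → EucSp n → ℂ) : Prop where
  meas : AEStronglyMeasurable (Function.uncurry b) (volume.prod volume)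
  smooth_left : ∀ ξ, ContDiff ℝ (matrixOrder n) fun x => b x ξ
  smooth_right : ∀ x, ContDiff ℝ (matrixOrder n) (b x)
  bounded : ∃ B, ∀ x ξ, ‖b x ξ‖ ≤ B
  bound_left : ∀ k ≤ matrixOrder n, ∀ ξ ξ' x,
    ‖iteratedFDeriv ℝ k (fun x => b x ξ - b x ξ') x‖ ≤ M * ‖ξ - ξ'‖
  bound_right : ∀ k, 1 ≤ k → k ≤ matrixOrder n → ∀ x ξ, ‖iteratedFDeriv ℝ k (b x) ξ‖ ≤ M

theorem IsSlowlyVarying.norm_sub_le {M : ℝ} {b : EucSp n → EucSp n → ℂ}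
    (hb : IsSlowlyVarying M b) (hM : 0 ≤ M) (ξ₀ : EucSp n) {k : ℕ} (hk : k ≤ matrixOrder n)
    (x ξ : EucSp n) : ‖iteratedFDeriv ℝ k (fun ξ => b x ξ - b x ξ₀) ξ‖ ≤ M * (1 + ‖ξ - ξ₀‖) := by
  rcases Nat.eq_zero_or_pos k with rfl | h
  · have := hb.bound_left 0 (by omega) ξ ξ₀ x
    rw [norm_iteratedFDeriv_zero] at this ⊢
    refine this.trans ?_
    gcongr
    simp
  · have h1 : iteratedFDeriv ℝ k (fun ξ => b x ξ - b x ξ₀) ξ = iteratedFDeriv ℝ k (b x) ξ := by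
      have h2 := iteratedFDeriv_sub_apply (x := ξ) (f := b x) (g := fun _ => b x ξ₀)
        ((hb.smooth_right x).of_le (by exact_mod_cast hk)).contDiffAt
        (contDiff_const (n := (k : WithTop ℕ∞))).contDiffAt
      rw [iteratedFDeriv_const_of_ne (by omega)] at h2
      rw [show (fun ξ => b x ξ - b x ξ₀) = b x - fun _ => b x ξ₀ from rfl, h2]
      simp
    rw [h1]
    refine (hb.bound_right k h hk x ξ).trans ?_
    exact le_mul_of_one_le_right hM (by simp)

/-- After centering at ξ₀ the symbol is O(1 + |ξ - ξ₀|). Seen from a packet at u, this is linear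
growth away from u with a constant enlarged by 1 + |u.2 - ξ₀|. -/
theorem IsSlowlyVarying.isLocalSymbol_sub {M : ℝ} {b : EucSp n → EucSp n → ℂ}
    (hb : IsSlowlyVarying M b) (hM : 0 ≤ M) (ξ₀ : EucSp n)
    (hm : AEStronglyMeasurable (Function.uncurry fun x (_ : EucSp n) => b x ξ₀)
      (volume.prod volume)) (u : EucSp n × EucSp n) :
    IsLocalSymbol (M * (1 + ‖u.2 - ξ₀‖)) u fun x ξ => b x ξ - b x ξ₀ where
  meas := hb.meas.sub hm
  smooth_left ξ := (hb.smooth_left ξ).sub (hb.smooth_left ξ₀)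
  smooth_right x := (hb.smooth_right x).sub contDiff_const
  bound_left k hk x ξ := by
    refine (hb.bound_left k hk ξ ξ₀ x).trans ?_
    have h1 := one_add_norm_sub_le_mul ξ u.2 ξ₀
    calc M * ‖ξ - ξ₀‖ ≤ M * ((1 + ‖ξ - u.2‖) * (1 + ‖u.2 - ξ₀‖)) := by gcongr; linarith
      _ = M * (1 + ‖u.2 - ξ₀‖) * 1 * (1 + ‖ξ - u.2‖) := by ring
      _ ≤ _ := by gcongr; simp
  bound_right k hk x ξ := by
    refine (hb.norm_sub_le hM ξ₀ hk x ξ).trans ?_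
    have h1 := one_add_norm_sub_le_mul ξ u.2 ξ₀
    calc M * (1 + ‖ξ - ξ₀‖) ≤ M * ((1 + ‖ξ - u.2‖) * (1 + ‖u.2 - ξ₀‖)) := by gcongr
      _ = M * (1 + ‖u.2 - ξ₀‖) * 1 * (1 + ‖ξ - u.2‖) := by ring
      _ ≤ _ := by gcongr; simp

/-- Position and frequency play symmetric roles in `IsLocalSymbol`. The second symbol, which is
slowly varying with the two variables exchanged, can thus be treated by the lemma for the first. -/
theorem IsLocalSymbol.swap {M : ℝ} {z : EucSp n × EucSp n} {b : EucSp n → EucSp n → ℂ}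
    (hb : IsLocalSymbol M z b) : IsLocalSymbol M z.swap fun ξ x => b x ξ where
  meas := hb.meas.prod_swap
  smooth_left := hb.smooth_right
  smooth_right := hb.smooth_left
  bound_left k hk x ξ := (hb.bound_right k hk ξ x).trans_eq
    (by simp only [Prod.fst_swap, Prod.snd_swap]; ring)
  bound_right k hk x ξ := (hb.bound_left k hk ξ x).trans_eq
    (by simp only [Prod.fst_swap, Prod.snd_swap]; ring)

/-- Each centered factor grows linearly in its own variable: the first in ξ, the second in x. The
product has exactly the growth (1 + |x - x₀|)(1 + |ξ - ξ₀|) that `IsLocalSymbol` allows. -/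
theorem isLocalSymbol_mul {M₁ M₂ : ℝ} {b₁ b₂ : EucSp n → EucSp n → ℂ}
    (hb₁ : IsSlowlyVarying M₁ b₁) (hM₁ : 0 ≤ M₁) (hb₂ : IsSlowlyVarying M₂ fun ξ x => b₂ x ξ)
    (hM₂ : 0 ≤ M₂) (z : EucSp n × EucSp n)
    (hm : AEStronglyMeasurable (Function.uncurry fun x ξ =>
      (b₁ x ξ - b₁ x z.2) * (b₂ x ξ - b₂ z.1 ξ)) (volume.prod volume)) :
    IsLocalSymbol (2 ^ matrixOrder n * (M₁ * M₂)) z fun x ξ =>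
      (b₁ x ξ - b₁ x z.2) * (b₂ x ξ - b₂ z.1 ξ) where
  meas := hm
  smooth_left ξ := ((hb₁.smooth_left ξ).sub (hb₁.smooth_left z.2)).mul
    ((hb₂.smooth_right ξ).sub contDiff_const)
  smooth_right x := ((hb₁.smooth_right x).sub contDiff_const).mul
    ((hb₂.smooth_left x).sub (hb₂.smooth_left z.1))
  bound_left k hk x ξ := by
    refine (norm_iteratedFDeriv_mul_le_of_le ((hb₁.smooth_left ξ).sub (hb₁.smooth_left z.2))
      ((hb₂.smooth_right ξ).sub contDiff_const)
      (fun j hj => hb₁.bound_left j hj ξ z.2 x)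
      (fun j hj => hb₂.norm_sub_le hM₂ z.1 hj ξ x) hk).trans ?_
    calc _ ≤ 2 ^ matrixOrder n * ((M₁ * (1 + ‖ξ - z.2‖)) * (M₂ * (1 + ‖x - z.1‖))) := by
          gcongr; simp
      _ = _ := by ring
  bound_right k hk x ξ := by
    refine (norm_iteratedFDeriv_mul_le_of_le ((hb₁.smooth_right x).sub contDiff_const)
      ((hb₂.smooth_left x).sub (hb₂.smooth_left z.1))
      (fun j hj => hb₁.norm_sub_le hM₁ z.2 hj x ξ)
      (fun j hj => hb₂.bound_left j hj x z.1 ξ) hk).trans ?_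
    calc _ ≤ 2 ^ matrixOrder n * ((M₁ * (1 + ‖ξ - z.2‖)) * (M₂ * (1 + ‖x - z.1‖))) := by
          gcongr; simp
      _ = _ := by ring

theorem packetMatrix_sub (R S : L2Sp n →L[ℂ] L2Sp n) (w z : EucSp n × EucSp n) :
    packetMatrix (R - S) w z = packetMatrix R w z - packetMatrix S w z := by
  simp [packetMatrix, inner_sub_right]

/-- The operators with the symbols `b₁ - b₁(·, ξ₀)`, `b₂ - b₂(x₀, ·)` and their product have the
same composition defect as those with the symbols `b₁` and `b₂`. -/
theorem exists_isKN_centered {M₁ M₂ : ℝ} {b₁ b₂ : EucSp n → EucSp n → ℂ}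
    {T₁ T₂ T₁₂ : L2Sp n →L[ℂ] L2Sp n}
    (hb₁ : IsSlowlyVarying M₁ b₁) (hb₂ : IsSlowlyVarying M₂ fun ξ x => b₂ x ξ)
    (hg₂ : ∀ x, (b₂ x).HasTemperateGrowth)
    (hT₁ : IsKN b₁ T₁) (hT₂ : IsKN b₂ T₂) (hT₁₂ : IsKN (fun x ξ => b₁ x ξ * b₂ x ξ) T₁₂)
    (z : EucSp n × EucSp n) : ∃ S₁ S₂ S₁₂ : L2Sp n →L[ℂ] L2Sp n,
    IsKN (fun x ξ => b₁ x ξ - b₁ x z.2) S₁ ∧ IsKN (fun x ξ => b₂ x ξ - b₂ z.1 ξ) S₂ ∧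
    IsKN (fun x ξ => (b₁ x ξ - b₁ x z.2) * (b₂ x ξ - b₂ z.1 ξ)) S₁₂ ∧
    T₁ ∘L T₂ - T₁₂ = S₁ ∘L S₂ - S₁₂ := by
  obtain ⟨B₁, hB₁⟩ := hb₁.bounded
  obtain ⟨B₂, hB₂⟩ := hb₂.bounded
  have hB₁0 : 0 ≤ B₁ := (norm_nonneg _).trans (hB₁ 0 0)
  have hB₂0 : 0 ≤ B₂ := (norm_nonneg _).trans (hB₂ 0 0)
  obtain ⟨G, hG, -⟩ := exists_clm_mul (g := fun x => b₁ x z.2)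
    (hb₁.smooth_left z.2).continuous.aestronglyMeasurable hB₁0
    (Filter.Eventually.of_forall fun x => hB₁ x z.2)
  obtain ⟨S, hS, -⟩ := exists_clm_multiplier (hg₂ z.1) hB₂0 fun ξ => hB₂ ξ z.1
  have a₁ : IsAEBounded b₁ := Filter.Eventually.of_forall fun x =>
    ⟨(hb₁.smooth_right x).continuous, B₁, hB₁ x⟩
  have a₂ : IsAEBounded b₂ := Filter.Eventually.of_forall fun x =>
    ⟨(hb₂.smooth_left x).continuous, B₂, fun ξ => hB₂ ξ x⟩
  have a₃ : IsAEBounded fun x (_ : EucSp n) => b₁ x z.2 := Filter.Eventually.of_forall fun x =>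
    ⟨continuous_const, B₁, fun _ => hB₁ x z.2⟩
  have a₄ : IsAEBounded fun (_ : EucSp n) ξ => b₂ z.1 ξ := Filter.Eventually.of_forall fun x =>
    ⟨(hg₂ z.1).1.continuous, B₂, fun ξ => hB₂ ξ z.1⟩
  have kG := isKN_of_mul hG
  have kS := isKN_of_multiplier (hg₂ z.1) hS
  -- G is the multiplication by b₁(·, ξ₀) and S the multiplier b₂(x₀, ·). Expanding (b₁ - g)(b₂ -
  -- H), the three extra products are quantized exactly by G T₂, T₁ S and G S, so they cancel in the
  -- defect.
  refine ⟨T₁ - G, T₂ - S, T₁₂ - G ∘L T₂ - (T₁ ∘L S - G ∘L S), hT₁.sub kG a₁ a₃,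
    hT₂.sub kS a₂ a₄, ?_, ?_⟩
  · refine (((hT₁₂.sub (isKN_mul_left hG hT₂) (a₁.mul a₂) (a₃.mul a₂)).sub
      ((isKN_comp_multiplier (hg₂ z.1) hT₁ hS).sub (isKN_mul_left hG kS) (a₁.mul a₄) (a₃.mul a₄))
      ?_ ?_)).congr_ae (Filter.Eventually.of_forall fun x ξ => by ring)
    · simpa only [sub_eq_add_neg] using (a₁.mul a₂).add (a₃.mul a₂).neg
    · simpa only [sub_eq_add_neg] using (a₁.mul a₄).add (a₃.mul a₄).neg
  · simp only [ContinuousLinearMap.comp_sub, ContinuousLinearMap.sub_comp]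
    abel

/-- The column of the packet matrix at z is estimated with the symbols centered at z, which changes
the operators but not the defect. For the centered symbols the composition and the product are each
of size M₁M₂, so no cancellation between them is needed. The resulting bound depends only on w - z,
and Schur's test applies. -/
theorem norm_comp_sub_le (n : ℕ) : ∃ C : ℝ, 0 ≤ C ∧ ∀ (M₁ M₂ : ℝ)
    (b₁ b₂ : EucSp n → EucSp n → ℂ) (T₁ T₂ T₁₂ : L2Sp n →L[ℂ] L2Sp n), 0 ≤ M₁ → 0 ≤ M₂ →
    IsSlowlyVarying M₁ b₁ → IsSlowlyVarying M₂ (fun ξ x => b₂ x ξ) →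
    (∀ x, (b₂ x).HasTemperateGrowth) →
    IsKN b₁ T₁ → IsKN b₂ T₂ → IsKN (fun x ξ => b₁ x ξ * b₂ x ξ) T₁₂ →
    ‖T₁ ∘L T₂ - T₁₂‖ ≤ C * (M₁ * M₂) := by
  obtain ⟨C, hC, h⟩ := norm_packetMatrix_le n
  obtain ⟨D, hD, hD1, hD2⟩ := exists_lintegral_decayProfile n
  refine ⟨C * D * (C * D) + C * 2 ^ matrixOrder n * D, by positivity, ?_⟩
  intro M₁ M₂ b₁ b₂ T₁ T₂ T₁₂ hM₁ hM₂ hb₁ hb₂ hg₂ hT₁ hT₂ hT₁₂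
  set E : EucSp n × EucSp n → ℝ≥0∞ := fun v => ENNReal.ofReal (decayProfile v) with hE
  set E' : EucSp n × EucSp n → ℝ≥0∞ := fun v => ENNReal.ofReal ((1 + ‖v.2‖) * decayProfile v)
    with hE'
  have mE : Measurable E := continuous_decayProfile.measurable.ennreal_ofReal
  have mE' : Measurable E' :=
    (Continuous.mul (by fun_prop) continuous_decayProfile).measurable.ennreal_ofReal
  set a : ℝ≥0∞ := ENNReal.ofReal (C * M₁) with ha
  set c : ℝ≥0∞ := ENNReal.ofReal (C * M₂) with hc
  set e : ℝ≥0∞ := ENNReal.ofReal (C * (2 ^ matrixOrder n * (M₁ * M₂))) with he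
  have mI : Measurable fun v : EucSp n × EucSp n => ∫⁻ u, E (v - u) * E' u := by
    have : Measurable fun p : (EucSp n × EucSp n) × (EucSp n × EucSp n) =>
        E (p.1 - p.2) * E' p.2 :=
      (mE.comp (measurable_fst.sub measurable_snd)).mul (mE'.comp measurable_snd)
    exact this.lintegral_prod_right'
  refine norm_le_of_packetMatrix (K := fun v => a * c * (∫⁻ u, E (v - u) * E' u) + e * E v)
    ?_ (fun w z => ?_) (by positivity) ?_
  · exact (mI.const_mul _).add (mE.const_mul _)
  · obtain ⟨S₁, S₂, S₁₂, k₁, k₂, k₁₂, hR⟩ :=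
      exists_isKN_centered hb₁ hb₂ hg₂ hT₁ hT₂ hT₁₂ z
    have m₁ : AEStronglyMeasurable (Function.uncurry fun x (_ : EucSp n) => b₁ x z.2)
        ((volume : Measure (EucSp n)).prod (volume : Measure (EucSp n))) :=
      ((hb₁.smooth_left z.2).continuous.comp continuous_fst).aestronglyMeasurable
    have m₂ : AEStronglyMeasurable (Function.uncurry fun ξ (_ : EucSp n) => b₂ z.1 ξ)
        ((volume : Measure (EucSp n)).prod (volume : Measure (EucSp n))) :=
      ((hb₂.smooth_left z.1).continuous.comp continuous_fst).aestronglyMeasurable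
    have l₁ := fun u => hb₁.isLocalSymbol_sub hM₁ z.2 m₁ u
    have l₂ := (hb₂.isLocalSymbol_sub hM₂ z.1 m₂ z.swap).swap
    -- The second operator acts on the packet at z itself, the point of centering, so its constant
    -- is M₂ without loss. The first operator acts on packets at u and loses 1 + |u.2 - z.2|, which
    -- is why `E'` carries that weight.
    rw [Prod.swap_swap, Prod.snd_swap, sub_self, norm_zero, add_zero, mul_one] at l₂
    have l₁₂ := isLocalSymbol_mul hb₁ hM₁ hb₂ hM₂ z ((l₁ z).meas.mul l₂.meas)
    rw [hR, packetMatrix_sub]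
    refine (enorm_sub_le).trans (add_le_add ?_ ?_)
    · refine (enorm_packetMatrix_comp_le S₁ S₂ w z).trans ?_
      -- Translating the intermediate point by z makes the bound a function of w - z.
      rw [← lintegral_sub_right_eq_self (fun u => E (w - z - u) * E' u) z, ← lintegral_const_mul' _ _
        (ENNReal.mul_ne_top ENNReal.ofReal_ne_top ENNReal.ofReal_ne_top)]
      refine lintegral_mono fun u => ?_
      have q₁ := h _ u w _ S₁ (by positivity) (l₁ u) k₁
      have q₂ := h _ z u _ S₂ hM₂ l₂ k₂
      calc ‖packetMatrix S₁ w u‖ₑ * ‖packetMatrix S₂ u z‖ₑ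
          ≤ ENNReal.ofReal (C * (M₁ * (1 + ‖u.2 - z.2‖)) * decayProfile (w - u)) *
            ENNReal.ofReal (C * M₂ * decayProfile (u - z)) := by
            rw [← ofReal_norm, ← ofReal_norm]
            gcongr
        _ = a * c * (E (w - u) * E' (u - z)) := by
            have p1 := decayProfile_nonneg (w - u)
            have p2 := decayProfile_nonneg (u - z)
            rw [ha, hc, hE, hE']
            simp only
            rw [← ENNReal.ofReal_mul (by positivity), ← ENNReal.ofReal_mul (by positivity),
              ← ENNReal.ofReal_mul (by positivity), ← ENNReal.ofReal_mul (by positivity)]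
            congr 1
            simp only [Prod.snd_sub]
            ring
        _ = _ := by rw [sub_sub_sub_cancel_right]
    · rw [← ofReal_norm, he, hE]
      simp only
      rw [← ENNReal.ofReal_mul (by positivity)]
      exact ENNReal.ofReal_le_ofReal (h _ z w _ S₁₂ (by positivity) l₁₂ k₁₂)
  · rw [lintegral_add_left (mI.const_mul _), lintegral_const_mul _ mI, lintegral_const_mul _ mE]
    have hI : ∫⁻ v, ∫⁻ u, E (v - u) * E' u = (∫⁻ v, E v) * ∫⁻ u, E' u := by
      rw [lintegral_lintegral_swap]
      · rw [← lintegral_const_mul _ mE']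
        refine lintegral_congr fun u => ?_
        rw [lintegral_mul_const (E' u) (show Measurable fun v => E (v - u) from
          mE.comp (measurable_id.sub_const u)),
          lintegral_sub_right_eq_self E]
      · exact ((mE.comp (measurable_fst.sub measurable_snd)).mul
          (mE'.comp measurable_snd)).aemeasurable
    rw [hI]
    calc _ ≤ a * c * (ENNReal.ofReal D * ENNReal.ofReal D) + e * ENNReal.ofReal D := by gcongr
      _ = _ := by
        rw [ha, hc, he, ← ENNReal.ofReal_mul (by positivity), ← ENNReal.ofReal_mul (by positivity),
          ← ENNReal.ofReal_mul (by positivity), ← ENNReal.ofReal_mul (by positivity),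
          ← ENNReal.ofReal_add (by positivity) (by positivity)]
        congr 1
        ring

end Composition

/-! ### Regularization in position of functions with bounded weak derivatives -/

noncomputable section Smoothing

variable {n : ℕ}

theorem HasCompactSupport.partialD {f : EucSp n → ℝ} (hf : HasCompactSupport f) (i : Fin n) :
    HasCompactSupport (partialD i f) := hf.fderiv_apply ℝ _

theorem HasCompactSupport.multiD {f : EucSp n → ℝ} (hs : ContDiff ℝ ∞ f)
    (hf : HasCompactSupport f) (α : MultiIdx n) : HasCompactSupport (multiD α f) := by
  induction h : α.len generalizing α with
  | zero =>
    have : α = 0 := by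
      funext i
      simpa using (Finset.sum_eq_zero_iff.mp h) i (Finset.mem_univ i)
    rwa [this, multiD_zero]
  | succ m ih =>
    obtain ⟨i, β, rfl, hβ⟩ := MultiIdx.exists_eq_add_single h
    rw [← partialD_multiD hs]
    exact (ih β hβ).partialD i

/-- The convolution of a real kernel with a complex function. -/
def kernelConv (k : EucSp n → ℝ) (u : EucSp n → ℂ) (x : EucSp n) : ℂ := ∫ y, k (x - y) • u y

theorem kernelConv_eq_convolution (k : EucSp n → ℝ) (u : EucSp n → ℂ) :
    kernelConv k u = convolution k u (ContinuousLinearMap.lsmul ℝ ℝ) volume := by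
  funext x
  rw [convolution_eq_swap]
  rfl

theorem HasCompactSupport.comp_const_sub {F : Type*} [Zero F] {k : EucSp n → F}
    (hk : HasCompactSupport k) (x : EucSp n) : HasCompactSupport fun y => k (x - y) :=
  hk.comp_homeomorph (Homeomorph.subLeft x)

theorem integrable_kernel_smul {k : EucSp n → ℝ} (hk : HasCompactSupport k) (hc : Continuous k)
    {u : EucSp n → ℂ} (hu : LocallyIntegrable u) (x : EucSp n) :
    Integrable fun y => k (x - y) • u y :=
  hu.integrable_smul_left_of_hasCompactSupport (hc.comp (by fun_prop)) (hk.comp_const_sub x)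

theorem contDiff_kernelConv {k : EucSp n → ℝ} (hk : HasCompactSupport k) (hs : ContDiff ℝ ∞ k)
    {u : EucSp n → ℂ} (hu : LocallyIntegrable u) : ContDiff ℝ ∞ (kernelConv k u) := by
  rw [kernelConv_eq_convolution]
  exact hk.contDiff_convolution_left (n := ⊤) _ hs hu

theorem partialD_kernelConv {k : EucSp n → ℝ} (hk : HasCompactSupport k) (hs : ContDiff ℝ ∞ k)
    {u : EucSp n → ℂ} (hu : LocallyIntegrable u) (i : Fin n) :
    partialD i (kernelConv k u) = kernelConv (partialD i k) u := by
  funext x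
  rw [kernelConv_eq_convolution, kernelConv_eq_convolution, partialD,
    (hk.hasFDerivAt_convolution_left _ (hs.of_le (by simp)) hu x).fderiv, convolution,
    ContinuousLinearMap.integral_apply]
  · rfl
  · exact (hk.fderiv ℝ).convolutionExists_left _ (hs.continuous_fderiv (by simp)) hu x

theorem multiD_kernelConv {k : EucSp n → ℝ} (hk : HasCompactSupport k) (hs : ContDiff ℝ ∞ k)
    {u : EucSp n → ℂ} (hu : LocallyIntegrable u) (α : MultiIdx n) :
    multiD α (kernelConv k u) = kernelConv (multiD α k) u := by
  have h := multiD_family (c := fun γ => kernelConv (multiD γ k) u) (fun γ i => by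
    rw [partialD_kernelConv (hk.multiD hs γ) (hs.multiD γ) hu, partialD_multiD hs]) α 0
  simpa using h

/-! ### Functions with bounded weak derivatives -/

theorem IsFunSymbol.nonneg {μ : ℕ} {A : MultiIdx n → ℝ} {u : EucSp n → ℂ}
    (hu : IsFunSymbol μ A u) {β : MultiIdx n} (hβ : β.len ≤ μ) : 0 ≤ A β := by
  obtain ⟨v, -, hv⟩ := hu β hβ
  obtain ⟨x, hx⟩ := hv.exists
  exact (norm_nonneg _).trans hx

theorem IsFunSymbol.locallyIntegrable {μ : ℕ} {A : MultiIdx n → ℝ} {u : EucSp n → ℂ}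
    (hu : IsFunSymbol μ A u) : LocallyIntegrable u := by
  obtain ⟨v, hv, -⟩ := hu 0 (by simp)
  exact hv.locallyIntegrable_left

/-- A weak derivative of order zero agrees with the function almost everywhere, by the fundamental
lemma of the calculus of variations. -/
theorem IsFunSymbol.ae_norm_le {μ : ℕ} {A : MultiIdx n → ℝ} {u : EucSp n → ℂ}
    (hu : IsFunSymbol μ A u) : ∀ᵐ x, ‖u x‖ ≤ A 0 := by
  obtain ⟨v, hv, hb⟩ := hu 0 (by simp)
  have h := ae_eq_of_integral_contDiff_smul_eq hv.locallyIntegrable_left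
    hv.locallyIntegrable_right fun g h1 h2 => by simpa using hv.integral_eq g h1 h2
  filter_upwards [h, hb] with x h1 h2
  rwa [h1]

/-- Derivatives falling on the kernel can be moved to the function. -/
theorem IsFunSymbol.norm_kernelConv_le {μ : ℕ} {A : MultiIdx n → ℝ} {u : EucSp n → ℂ}
    (hu : IsFunSymbol μ A u) {k : EucSp n → ℝ} (hk : HasCompactSupport k) (hs : ContDiff ℝ ∞ k)
    {β : MultiIdx n} (hβ : β.len ≤ μ) (δ : MultiIdx n) (x : EucSp n) :
    ‖kernelConv (multiD (β + δ) k) u x‖ ≤ (∫ y, ‖multiD δ k y‖) * A β := by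
  obtain ⟨v, hv, hb⟩ := hu β hβ
  have hkδ := hk.multiD hs δ
  have hsδ := hs.multiD δ
  -- The test function is y ↦ ∂^δ k(x - y). The sign from the reflection and the sign in the
  -- definition of weak derivatives cancel.
  have h1 := hv.integral_eq (fun y => multiD δ k (x - y))
    (hsδ.comp (contDiff_const.sub contDiff_id)) (hkδ.comp_const_sub x)
  have h2 : multiD β (multiD δ k) = multiD (β + δ) k := by
    rw [add_comm]
    exact multiD_family (c := fun γ => multiD γ k) (fun γ i => partialD_multiD hs i γ) β δ
  rw [multiD_comp_const_sub, h2] at h1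
  have h3 : kernelConv (multiD (β + δ) k) u x = ∫ y, multiD δ k (x - y) • v y := by
    have h4 : ((-1 : ℂ) ^ β.len) * ((-1 : ℂ) ^ β.len) = 1 := by
      rw [← mul_pow]; simp
    rw [kernelConv, ← one_mul (∫ y, multiD δ k (x - y) • v y), ← h4, mul_assoc, ← h1,
      ← integral_const_mul]
    congr 1
    funext y
    simp only [Complex.real_smul, smul_eq_mul]
    push_cast
    rw [← mul_assoc, ← mul_assoc, h4, one_mul]
  have hi : Integrable fun y => ‖multiD δ k y‖ := (hsδ.continuous.integrable_of_hasCompactSupport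
    hkδ).norm
  rw [h3, ← integral_sub_left_eq_self (fun y => ‖multiD δ k y‖) volume x, ← integral_mul_const]
  refine norm_integral_le_of_norm_le ((hi.comp_sub_left x).mul_const _) ?_
  filter_upwards [hb] with y hy
  rw [norm_smul]
  gcongr

/-! ### Finite differences and the smoothing kernel -/

theorem contDiff_fwdDiff {F : Type*} [NormedAddCommGroup F] [NormedSpace ℝ F] {w : EucSp n → F}
    (hw : ContDiff ℝ ∞ w) (t : EucSp n) : ContDiff ℝ ∞ (fwdDiff t w) := by
  have : fwdDiff t w = fun x => w (x + t) - w x := rfl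
  rw [this]
  exact (hw.comp (contDiff_id.add contDiff_const)).sub hw

theorem norm_iterate_fwdDiff_le {F : Type*} [NormedAddCommGroup F] [NormedSpace ℝ F] (m : ℕ)
    (t : EucSp n) {w : EucSp n → F} (hw : ContDiff ℝ ∞ w) {A : ℝ}
    (hA : ∀ x, ‖iteratedFDeriv ℝ m w x‖ ≤ A) (x : EucSp n) :
    ‖(fwdDiff t)^[m] w x‖ ≤ ‖t‖ ^ m * A := by
  induction m generalizing w A with
  | zero => simpa using hA x
  | succ m ih =>
    rw [Function.iterate_succ_apply, pow_succ, mul_assoc]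
    refine ih (contDiff_fwdDiff hw t) fun y => ?_
    have h1 : iteratedFDeriv ℝ m (fwdDiff t w) y =
        iteratedFDeriv ℝ m w (y + t) - iteratedFDeriv ℝ m w y := by
      have h2 := iteratedFDeriv_sub_apply (x := y) (f := fun x => w (x + t)) (g := w) (i := m)
        (𝕜 := ℝ) ((hw.comp (contDiff_id.add contDiff_const)).of_le
          (by exact_mod_cast le_top)).contDiffAt
        (hw.of_le (by exact_mod_cast le_top)).contDiffAt
      rw [iteratedFDeriv_comp_add_right] at h2
      exact h2
    rw [h1]
    have h3 := Convex.norm_image_sub_le_of_norm_fderiv_le (𝕜 := ℝ) (s := Set.univ)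
      (f := iteratedFDeriv ℝ m w) (C := A) (x := y) (y := y + t)
      (fun z _ => (hw.differentiable_iteratedFDeriv (by exact_mod_cast WithTop.coe_lt_top _)) z)
      (fun z _ => by rw [norm_fderiv_iteratedFDeriv]; exact hA z) convex_univ trivial trivial
    rw [add_sub_cancel_left] at h3
    linarith

/-- A normalized bump function supported in the unit ball. -/
def unitBump (n : ℕ) : EucSp n → ℝ :=
  (⟨1 / 2, 1, by norm_num, by norm_num⟩ : ContDiffBump (0 : EucSp n)).normed volume

theorem contDiff_unitBump (n : ℕ) : ContDiff ℝ ∞ (unitBump n) :=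
  ContDiffBump.contDiff_normed _

theorem hasCompactSupport_unitBump (n : ℕ) : HasCompactSupport (unitBump n) :=
  ContDiffBump.hasCompactSupport_normed _

theorem integral_unitBump (n : ℕ) : ∫ x, unitBump n x = 1 := ContDiffBump.integral_normed _

theorem unitBump_nonneg (x : EucSp n) : 0 ≤ unitBump n x := ContDiffBump.nonneg_normed _ _

theorem unitBump_eq_zero {x : EucSp n} (hx : 1 < ‖x‖) : unitBump n x = 0 := by
  by_contra h
  have h1 : x ∈ Function.support (unitBump n) := h
  rw [unitBump, ContDiffBump.support_normed_eq] at h1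
  simp at h1
  linarith

theorem integrable_unitBump (n : ℕ) : Integrable (unitBump n) :=
  (contDiff_unitBump n).continuous.integrable_of_hasCompactSupport (hasCompactSupport_unitBump n)

/-- A smoothing kernel, the convolution with which reproduces functions up to differences of
order `μ`. -/
def smoothingKernel (n μ : ℕ) (y : EucSp n) : ℝ :=
  ∑ j ∈ Finset.range μ, (-1) ^ j * (μ.choose (j + 1) : ℝ) *
    ((((j + 1 : ℕ) : ℝ) ^ n)⁻¹ * unitBump n (((j + 1 : ℕ) : ℝ)⁻¹ • y))

theorem contDiff_smoothingKernel (n μ : ℕ) : ContDiff ℝ ∞ (smoothingKernel n μ) := by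
  refine ContDiff.sum fun j _ => ?_
  exact contDiff_const.mul (contDiff_const.mul ((contDiff_unitBump n).comp
    (contDiff_const_smul _)))

theorem hasCompactSupport_smoothingKernel (n μ : ℕ) : HasCompactSupport (smoothingKernel n μ) := by
  refine HasCompactSupport.of_support_subset_isCompact
    (isCompact_closedBall (0 : EucSp n) (μ + 1)) fun y hy => ?_
  by_contra h
  refine hy (Finset.sum_eq_zero fun j hj => ?_)
  rw [unitBump_eq_zero, mul_zero, mul_zero]
  have h1 : (μ + 1 : ℝ) < ‖y‖ := by simpa using h
  have h2 : ((j + 1 : ℕ) : ℝ) ≤ μ := by exact_mod_cast Finset.mem_range.mp hj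
  have h3 : 0 < ((j + 1 : ℕ) : ℝ) := by positivity
  rw [norm_smul, norm_inv, Real.norm_of_nonneg h3.le, ← div_eq_inv_mul, lt_div_iff₀ h3]
  linarith

theorem integral_dilated_unitBump_smul {j : ℕ} (w : EucSp n → ℂ)
    (x : EucSp n) : ∫ y, ((((j + 1 : ℕ) : ℝ) ^ n)⁻¹ *
      unitBump n (((j + 1 : ℕ) : ℝ)⁻¹ • (x - y))) • w y =
      ∫ t, unitBump n t • w (x - ((j + 1 : ℕ) : ℝ) • t) := by
  have hj : ((j + 1 : ℕ) : ℝ) ≠ 0 := by positivity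
  set c : ℝ := ((j + 1 : ℕ) : ℝ) with hc
  have hc0 : 0 < c := by positivity
  have h1 := Measure.integral_comp_smul (volume : Measure (EucSp n))
    (fun s => (((c ^ n)⁻¹ * unitBump n (c⁻¹ • s)) • w (x - s))) c
  rw [← integral_sub_left_eq_self _ volume x]
  simp only [sub_sub_cancel]
  simp only [finrank_euclideanSpace, Fintype.card_fin, smul_smul, inv_mul_cancel₀ hj,
    one_smul] at h1
  rw [abs_of_pos (by positivity)] at h1
  have h2 : ∀ s, ((c ^ n)⁻¹ * unitBump n s) • w (x - c • s) =
      (c ^ n)⁻¹ • (unitBump n s • w (x - c • s)) := fun s => by rw [smul_smul]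
  simp only [h2] at h1
  rw [integral_smul] at h1
  exact ((smul_right_injective _ (show (c ^ n)⁻¹ ≠ 0 by positivity)) h1).symm

/-- Expand (-1)^μ times the μ-th difference in the direction -t by the binomial formula and average
over t against the bump. The undisplaced term gives w(x), and the term displaced by (j + 1)t is a
convolution with the bump dilated by j + 1. The coefficients of `smoothingKernel` are the resulting
binomial coefficients. -/
theorem sub_kernelConv_smoothingKernel (μ : ℕ) {w : EucSp n → ℂ} (hw : Continuous w)
    (x : EucSp n) : w x - kernelConv (smoothingKernel n μ) w x =
      ∫ t, unitBump n t • ((-1) ^ μ * (fwdDiff (-t))^[μ] w x) := by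
  have hint : ∀ c : ℝ, Integrable fun t => unitBump n t • w (x - c • t) := fun c =>
    Continuous.integrable_of_hasCompactSupport
      ((contDiff_unitBump n).continuous.smul (hw.comp (by fun_prop)))
      ((hasCompactSupport_unitBump n).smul_right)
  have e1 : kernelConv (smoothingKernel n μ) w x = ∑ j ∈ Finset.range μ,
      ((-1) ^ j * (μ.choose (j + 1) : ℝ)) •
        ∫ t, unitBump n t • w (x - ((j + 1 : ℕ) : ℝ) • t) := by
    simp only [kernelConv, smoothingKernel, Finset.sum_smul]
    rw [integral_finsetSum]
    · refine Finset.sum_congr rfl fun j _ => ?_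
      rw [← integral_dilated_unitBump_smul, ← integral_smul]
      simp only [smul_smul]
    · intro j _
      refine Continuous.integrable_of_hasCompactSupport ?_ ?_
      · have := (contDiff_unitBump n).continuous
        exact (continuous_const.mul (continuous_const.mul (this.comp (by fun_prop)))).smul hw
      · have h2 : ((j + 1 : ℕ) : ℝ)⁻¹ ≠ 0 := by positivity
        have h3 := (((hasCompactSupport_unitBump n).comp_smul h2).mul_left
          (f := fun _ => (((j + 1 : ℕ) : ℝ) ^ n)⁻¹)).mul_left
          (f := fun _ => (-1) ^ j * (μ.choose (j + 1) : ℝ))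
        exact (h3.comp_const_sub x).smul_right (f' := w)
  have e2 : w x = ∫ t, unitBump n t • w (x - (0 : ℝ) • t) := by
    simp only [zero_smul, sub_zero]
    rw [integral_smul_const, integral_unitBump, one_smul]
  have e3 : ∀ t, unitBump n t • ((-1) ^ μ * (fwdDiff (-t))^[μ] w x) =
      unitBump n t • w (x - (0 : ℝ) • t) - ∑ j ∈ Finset.range μ,
        ((-1) ^ j * (μ.choose (j + 1) : ℝ)) •
          (unitBump n t • w (x - ((j + 1 : ℕ) : ℝ) • t)) := by
    intro t
    rw [fwdDiff_iter_eq_sum_shift, Finset.sum_range_succ', mul_add, smul_add, Finset.mul_sum,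
      Finset.smul_sum, add_comm, sub_eq_add_neg, ← Finset.sum_neg_distrib]
    congr 1
    · simp [← mul_assoc, ← mul_pow]
    · refine Finset.sum_congr rfl fun j hj => ?_
      have hj' : j + 1 ≤ μ := Finset.mem_range.mp hj
      have e4 : x + (j + 1) • -t = x - ((j + 1 : ℕ) : ℝ) • t := by
        rw [smul_neg, ← sub_eq_add_neg, Nat.cast_smul_eq_nsmul]
      rw [e4]
      -- The parity of μ drops out, leaving the alternating sign of the kernel, negated because the
      -- convolution is subtracted.
      have e5 : (-1 : ℂ) ^ μ * (-1) ^ (μ - (j + 1)) = - (-1) ^ j := by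
        obtain ⟨m, rfl⟩ := Nat.exists_eq_add_of_le hj'
        rw [Nat.add_sub_cancel_left, pow_add, mul_assoc, ← mul_pow]
        simp [pow_succ]
      simp only [zsmul_eq_mul, Complex.real_smul]
      push_cast
      linear_combination (unitBump n t : ℂ) * (μ.choose (j + 1) : ℂ) *
        w (x - ((j : ℝ) + 1) • t) * e5
  simp only [e3]
  have e6 : ∀ j : ℕ, Integrable fun t => ((-1) ^ j * (μ.choose (j + 1) : ℝ)) •
      (unitBump n t • w (x - ((j + 1 : ℕ) : ℝ) • t)) := fun j => by
    exact Integrable.smul ((-1) ^ j * (μ.choose (j + 1) : ℝ)) (hint ((j + 1 : ℕ) : ℝ))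
  rw [integral_sub (hint 0) (integrable_finsetSum _ fun j _ => e6 j),
    integral_finsetSum _ fun j _ => e6 j, ← e2, e1]
  simp only [integral_smul]

theorem norm_sub_kernelConv_le_of_smooth (μ : ℕ) {w : EucSp n → ℂ} (hw : ContDiff ℝ ∞ w) {A : ℝ}
    (hA : ∀ x, ‖iteratedFDeriv ℝ μ w x‖ ≤ A) (x : EucSp n) :
    ‖w x - kernelConv (smoothingKernel n μ) w x‖ ≤ A := by
  have hA0 : 0 ≤ A := (norm_nonneg _).trans (hA 0)
  rw [sub_kernelConv_smoothingKernel μ hw.continuous]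
  refine (norm_integral_le_of_norm_le ((integrable_unitBump n).mul_const A)
    (Filter.Eventually.of_forall fun t => ?_)).trans_eq
    (by rw [integral_mul_const, integral_unitBump, one_mul])
  rcases lt_or_ge 1 ‖t‖ with h | h
  · simp [unitBump_eq_zero h]
  · rw [norm_smul, Real.norm_of_nonneg (unitBump_nonneg t), norm_mul, norm_pow, norm_neg,
      norm_one, one_pow, one_mul]
    refine mul_le_mul_of_nonneg_left ?_ (unitBump_nonneg t)
    refine (norm_iterate_fwdDiff_le μ (-t) hw hA x).trans ?_
    rw [norm_neg]
    exact mul_le_of_le_one_left hA0 (pow_le_one₀ (norm_nonneg _) h)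

/-- A sequence of mollifiers. -/
def mollifier (n i : ℕ) : ContDiffBump (0 : EucSp n) :=
  ⟨1 / (i + 1 : ℝ) / 2, 1 / (i + 1 : ℝ), by positivity, half_lt_self (by positivity)⟩

/-- For smooth functions this is the estimate of a μ-th difference with steps of length at most 1.
In general u is mollified: the mollifiers have mass one, so the derivative bounds persist with the
same constants. The limit is taken almost everywhere at Lebesgue points, and by dominated
convergence inside the smoothing. -/
theorem IsFunSymbol.ae_norm_sub_le {μ : ℕ} {A : MultiIdx n → ℝ} {u : EucSp n → ℂ}
    (hu : IsFunSymbol μ A u) : ∀ᵐ x, ‖u x - kernelConv (smoothingKernel n μ) u x‖ ≤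
      n ^ μ * ∑ β ∈ idxEq n μ, A β := by
  set η : ℕ → EucSp n → ℝ := fun i => (mollifier n i).normed volume with hη
  have hηs : ∀ i, ContDiff ℝ ∞ (η i) := fun i => ContDiffBump.contDiff_normed _
  have hηc : ∀ i, HasCompactSupport (η i) := fun i => ContDiffBump.hasCompactSupport_normed _
  have hη1 : ∀ i, ∫ y, ‖η i y‖ = 1 := fun i => by
    have h0 : ∀ y, ‖η i y‖ = η i y := fun y =>
      Real.norm_of_nonneg (ContDiffBump.nonneg_normed (mollifier n i) _)
    simp only [h0]
    exact ContDiffBump.integral_normed _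
  have hsu := hu.locallyIntegrable
  have hws : ∀ i, ContDiff ℝ ∞ (kernelConv (η i) u) := fun i =>
    contDiff_kernelConv (hηc i) (hηs i) hsu
  have hb : ∀ i β, β.len ≤ μ → ∀ x, ‖multiD β (kernelConv (η i) u) x‖ ≤ A β := by
    intro i β hβ x
    have := hu.norm_kernelConv_le (hηc i) (hηs i) hβ 0 x
    rwa [add_zero, multiD_zero, hη1, one_mul, ← multiD_kernelConv (hηc i) (hηs i) hsu] at this
  have h1 : ∀ i x, ‖kernelConv (η i) u x -
      kernelConv (smoothingKernel n μ) (kernelConv (η i) u) x‖ ≤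
      n ^ μ * ∑ β ∈ idxEq n μ, A β := by
    intro i x
    refine norm_sub_kernelConv_le_of_smooth μ (hws i) (fun y => ?_) x
    refine (norm_iteratedFDeriv_le_sum_multiD μ (hws i) y).trans ?_
    gcongr with β hβ
    exact hb i β (mem_idxEq.mp hβ).le y
  have hlim : ∀ᵐ x, Filter.Tendsto (fun i => kernelConv (η i) u x) Filter.atTop (nhds (u x)) := by
    simp only [kernelConv_eq_convolution]
    refine ContDiffBump.ae_convolution_tendsto_right_of_locallyIntegrable (K := 2) ?_ ?_ hsu
    · exact tendsto_one_div_add_atTop_nhds_zero_nat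
    · refine Filter.Eventually.of_forall fun i => ?_
      simp only [mollifier]
      linarith
  have hlim2 : ∀ x, Filter.Tendsto
      (fun i => kernelConv (smoothingKernel n μ) (kernelConv (η i) u) x) Filter.atTop
      (nhds (kernelConv (smoothingKernel n μ) u x)) := by
    intro x
    have hk : Continuous fun y => smoothingKernel n μ (x - y) :=
      (contDiff_smoothingKernel n μ).continuous.comp (by fun_prop)
    refine tendsto_integral_of_dominated_convergence
      (fun y => ‖smoothingKernel n μ (x - y)‖ * A 0) ?_ ?_ ?_ ?_
    · exact fun i => (hk.smul (hws i).continuous).aestronglyMeasurable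
    · exact ((hk.integrable_of_hasCompactSupport
        ((hasCompactSupport_smoothingKernel n μ).comp_const_sub x)).norm).mul_const _
    · intro i
      refine Filter.Eventually.of_forall fun y => ?_
      rw [norm_smul]
      have := hb i 0 (by simp) y
      rw [multiD_zero] at this
      gcongr
    · filter_upwards [hlim] with y hy
      exact hy.const_smul _
  filter_upwards [hlim] with x hx
  exact le_of_tendsto (hx.sub (hlim2 x)).norm (Filter.Eventually.of_forall fun i => h1 i x)

end Smoothing

/-! ### Dilated symbols and their smoothing in x -/

noncomputable section ScaledSymbols

variable {n : ℕ}

/-! ### Bounds in the frequency variable -/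

/-- `f` satisfies the bounds of a symbol of order `κ` at the frequency scale `lam⁻¹`, with the
constant `B j` for the derivatives of order `j`. -/
structure HasFreqBounds (lam κ : ℝ) (B : ℕ → ℝ) (f : EucSp n → ℂ) : Prop where
  smooth : ContDiff ℝ ∞ f
  bound : ∀ j ξ, ‖iteratedFDeriv ℝ j f ξ‖ ≤ B j * lam ^ j * japBr (lam • ξ) ^ (κ - j)

/-- The constant comparing the operator norm of the derivative of order `j` with partial
derivatives. -/
def idxConst (n j : ℕ) : ℝ := n ^ j * (idxEq n j).card

theorem idxConst_nonneg (n j : ℕ) : 0 ≤ idxConst n j := by unfold idxConst; positivity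

theorem norm_iteratedFDeriv_le_of_multiD {F : Type*} [NormedAddCommGroup F] [NormedSpace ℝ F]
    {f : EucSp n → F} (hf : ContDiff ℝ ∞ f) (j : ℕ) (x : EucSp n) {A : ℝ}
    (h : ∀ α : MultiIdx n, α.len = j → ‖multiD α f x‖ ≤ A) :
    ‖iteratedFDeriv ℝ j f x‖ ≤ idxConst n j * A := by
  refine (norm_iteratedFDeriv_le_sum_multiD j hf x).trans ?_
  rw [idxConst, mul_assoc]
  gcongr
  refine (Finset.sum_le_sum fun α hα => h α (mem_idxEq.mp hα)).trans_eq ?_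
  rw [Finset.sum_const, nsmul_eq_mul]

theorem HasFreqBounds.of_multiD {lam κ : ℝ} {A : ℕ → ℝ} {f : EucSp n → ℂ}
    (hf : ContDiff ℝ ∞ f)
    (h : ∀ α ξ, ‖multiD α f ξ‖ ≤ A α.len * lam ^ α.len * japBr (lam • ξ) ^ (κ - α.len)) :
    HasFreqBounds lam κ (fun j => idxConst n j * A j) f where
  smooth := hf
  bound j ξ := by
    refine (norm_iteratedFDeriv_le_of_multiD hf j ξ
      (A := A j * lam ^ j * japBr (lam • ξ) ^ (κ - j)) fun α hα => ?_).trans_eq (by ring)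
    subst hα
    exact h α ξ

theorem continuous_japBr_smul_rpow (lam s : ℝ) :
    Continuous fun ξ : EucSp n => japBr (lam • ξ) ^ s := by
  refine Continuous.rpow_const ?_ fun ξ => Or.inl (japBr_pos _).ne'
  unfold japBr
  fun_prop

/-! ### Scaled symbols -/

/-- The symbols obtained from `S^k_μ` by the dilation with the factor `lam`. -/
structure IsScaledSymbol (lam k : ℝ) (μ : ℕ) (C : MultiIdx n → MultiIdx n → ℝ)
    (b : EucSp n → EucSp n → ℂ) : Prop where
  smooth : ∀ x, ContDiff ℝ ∞ (b x)
  bound : ∀ α ξ, IsFunSymbol μ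
    (fun β => lam ^ (α.len + β.len) * C α β * japBr (lam • ξ) ^ (k - α.len))
    fun x => multiD α (b x) ξ

/-- The sum of the constants of order `j` in the frequency and `m` in the position. -/
def derivSum (C : MultiIdx n → MultiIdx n → ℝ) (j m : ℕ) : ℝ :=
  ∑ α ∈ idxEq n j, ∑ β ∈ idxEq n m, C α β

section

variable {lam k : ℝ} {μ : ℕ} {C : MultiIdx n → MultiIdx n → ℝ} {b : EucSp n → EucSp n → ℂ}

/-- The constants dominate norms of weak derivatives almost everywhere, in particular at some point
and at ξ = 0; their sign therefore need not be assumed. -/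
theorem IsScaledSymbol.nonneg (hb : IsScaledSymbol lam k μ C b) (hlam : 0 < lam)
    (α : MultiIdx n) {β : MultiIdx n} (hβ : β.len ≤ μ) : 0 ≤ C α β := by
  have h := (hb.bound α 0).nonneg hβ
  have h1 : 0 < japBr (lam • (0 : EucSp n)) ^ (k - α.len) := Real.rpow_pos_of_pos (japBr_pos _) _
  have h2 : 0 < lam ^ (α.len + β.len) := by positivity
  exact (mul_nonneg_iff_of_pos_left h2).mp ((mul_nonneg_iff_of_pos_right h1).mp h)

theorem IsScaledSymbol.derivSum_nonneg (hb : IsScaledSymbol lam k μ C b) (hlam : 0 < lam)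
    (j : ℕ) {m : ℕ} (hm : m ≤ μ) : 0 ≤ derivSum C j m :=
  Finset.sum_nonneg fun α _ => Finset.sum_nonneg fun _ hβ =>
    hb.nonneg hlam α ((mem_idxEq.mp hβ).trans_le hm)

theorem IsScaledSymbol.le_derivSum (hb : IsScaledSymbol lam k μ C b) (hlam : 0 < lam)
    (α : MultiIdx n) {β : MultiIdx n} (hβ : β.len ≤ μ) : C α β ≤ derivSum C α.len β.len := by
  have h0 : ∀ α' : MultiIdx n, ∀ β' ∈ idxEq n β.len, 0 ≤ C α' β' := fun α' β' h' =>
    hb.nonneg hlam α' ((mem_idxEq.mp h').trans_le hβ)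
  exact (Finset.single_le_sum (h0 α) (mem_idxEq.mpr rfl)).trans
    (Finset.single_le_sum (f := fun α' => ∑ β' ∈ idxEq n β.len, C α' β')
      (fun α' _ => Finset.sum_nonneg (h0 α')) (mem_idxEq.mpr rfl))

/-- The exceptional null set in x depends on ξ. Using only a countable dense set of frequencies
gives one null set, and continuity in ξ extends the bound to all frequencies. -/
theorem ae_forall_norm_le {F : EucSp n → EucSp n → ℂ} {g : EucSp n → ℝ}
    (hF : ∀ x, Continuous (F x)) (hg : Continuous g) (h : ∀ ξ, ∀ᵐ x, ‖F x ξ‖ ≤ g ξ) :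
    ∀ᵐ x, ∀ ξ, ‖F x ξ‖ ≤ g ξ := by
  have h1 : ∀ᵐ x, ∀ i : ℕ, ‖F x (TopologicalSpace.denseSeq (EucSp n) i)‖ ≤
      g (TopologicalSpace.denseSeq (EucSp n) i) := ae_all_iff.mpr fun i => h _
  filter_upwards [h1] with x hx ξ
  have hcl : IsClosed {ξ | ‖F x ξ‖ ≤ g ξ} := isClosed_le (hF x).norm hg
  have hd : Dense {ξ | ‖F x ξ‖ ≤ g ξ} :=
    (TopologicalSpace.denseRange_denseSeq (EucSp n)).mono (by rintro _ ⟨i, rfl⟩; exact hx i)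
  have := hd.closure_eq
  rw [hcl.closure_eq] at this
  exact this.symm.subset (Set.mem_univ ξ)

theorem IsScaledSymbol.ae_norm_multiD_le (hb : IsScaledSymbol lam k μ C b) :
    ∀ᵐ x, ∀ α ξ, ‖multiD α (b x) ξ‖ ≤
      lam ^ α.len * C α 0 * japBr (lam • ξ) ^ (k - α.len) := by
  rw [ae_all_iff]
  intro α
  refine ae_forall_norm_le (fun x => ((hb.smooth x).multiD α).continuous)
    (continuous_const.mul (continuous_japBr_smul_rpow _ _)) fun ξ => ?_
  simpa using (hb.bound α ξ).ae_norm_le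

/-- A Carathéodory function is jointly measurable. Here measurability in x holds only up to null
sets, so b is first corrected on one null set serving a countable dense set of frequencies. -/
theorem aestronglyMeasurable_uncurry {b : EucSp n → EucSp n → ℂ} (hc : ∀ x, Continuous (b x))
    (hm : ∀ ξ, AEStronglyMeasurable (fun x => b x ξ) volume) :
    AEStronglyMeasurable (Function.uncurry b) (volume.prod volume) := by
  set q := TopologicalSpace.denseSeq (EucSp n) with hq
  have h1 : ∀ᵐ x, ∀ i : ℕ, b x (q i) = (hm (q i)).mk _ x :=
    ae_all_iff.mpr fun i => (hm (q i)).ae_eq_mk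
  obtain ⟨s, hs, hsm, hs0⟩ := exists_measurable_superset_of_null (ae_iff.mp h1)
  have h2 : ∀ x ∉ s, ∀ i : ℕ, b x (q i) = (hm (q i)).mk _ x := fun x hx => by
    by_contra h
    exact hx (hs h)
  -- Killing b on the null set s keeps continuity in ξ and makes the slices at the dense frequencies
  -- genuinely measurable; all other slices are pointwise limits of these.
  set b' : EucSp n → EucSp n → ℂ := fun ξ => sᶜ.indicator fun x => b x ξ with hb'
  have hc' : ∀ x, Continuous fun ξ => b' ξ x := fun x => by
    by_cases hx : x ∈ s
    · simpa [hb', hx] using continuous_const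
    · simpa [hb', hx] using hc x
  have hq' : ∀ i, StronglyMeasurable (b' (q i)) := fun i => by
    have : b' (q i) = sᶜ.indicator ((hm (q i)).mk _) := by
      funext x
      by_cases hx : x ∈ s
      · simp [hb', hx]
      · simp [hb', hx, h2 x hx i]
    rw [this]
    exact (hm (q i)).stronglyMeasurable_mk.indicator hsm.compl
  have hm' : ∀ ξ, StronglyMeasurable (b' ξ) := fun ξ => by
    obtain ⟨u, hu, hlim⟩ := mem_closure_iff_seq_limit.mp
      ((TopologicalSpace.denseRange_denseSeq (EucSp n)) ξ)
    refine stronglyMeasurable_of_tendsto (f := fun i => b' (u i)) Filter.atTop (fun i => ?_)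
      (tendsto_pi_nhds.mpr fun x => ((hc' x).tendsto ξ).comp hlim)
    obtain ⟨j, hj⟩ := hu i
    rw [← hj]
    exact hq' j
  have hM := stronglyMeasurable_uncurry_of_continuous_of_stronglyMeasurable hc' hm'
  have hM' : StronglyMeasurable fun p : EucSp n × EucSp n => b' p.2 p.1 :=
    hM.comp_measurable measurable_swap
  refine hM'.aestronglyMeasurable.congr ?_
  have h3 : ∀ᵐ p : EucSp n × EucSp n ∂(volume.prod volume), p.1 ∉ s :=
    Measure.quasiMeasurePreserving_fst.ae (measure_eq_zero_iff_ae_notMem.mp hs0)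
  filter_upwards [h3] with p hp
  simp [hb', hp, Function.uncurry]

theorem IsScaledSymbol.aestronglyMeasurable (hb : IsScaledSymbol lam k μ C b) :
    AEStronglyMeasurable (Function.uncurry b) (volume.prod volume) :=
  aestronglyMeasurable_uncurry (fun x => (hb.smooth x).continuous) fun ξ => by
    simpa using (hb.bound 0 ξ).locallyIntegrable.aestronglyMeasurable

/-! ### Smoothing in the position variable -/

/-- The convolution of `∂_ξ^α b(·, ξ)` with the derivative `∂^γ` of the smoothing kernel. -/
def smoothedDeriv (μ : ℕ) (b : EucSp n → EucSp n → ℂ) (γ α : MultiIdx n) (x ξ : EucSp n) : ℂ :=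
  kernelConv (multiD γ (smoothingKernel n μ)) (fun y => multiD α (b y) ξ) x

/-- The symbol `b` smoothed in `x`. -/
def smoothed (μ : ℕ) (b : EucSp n → EucSp n → ℂ) (x ξ : EucSp n) : ℂ :=
  kernelConv (smoothingKernel n μ) (fun y => b y ξ) x

theorem smoothedDeriv_zero (μ : ℕ) (b : EucSp n → EucSp n → ℂ) :
    smoothedDeriv μ b 0 0 = smoothed μ b := by
  funext x ξ
  simp [smoothedDeriv, smoothed]

/-- A family stable under differentiation is smooth: the order of smoothness is raised for all
members simultaneously. -/
theorem contDiff_of_hasFDerivAt_family {F : Type*} [NormedAddCommGroup F] [NormedSpace ℝ F]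
    {c : MultiIdx n → EucSp n → F}
    (h : ∀ α ξ, HasFDerivAt (c α) (∑ i, (EuclideanSpace.proj (𝕜 := ℝ) i).smulRight
      (c (α + Pi.single i 1) ξ)) ξ) (α : MultiIdx n) : ContDiff ℝ ∞ (c α) := by
  have hm : ∀ m : ℕ, ∀ α, ContDiff ℝ m (c α) := by
    intro m
    induction m with
    | zero =>
      intro α
      rw [Nat.cast_zero, contDiff_zero]
      exact Differentiable.continuous (𝕜 := ℝ) fun ξ => (h α ξ).differentiableAt
    | succ m ih =>
      intro α
      push_cast
      rw [contDiff_succ_iff_fderiv]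
      refine ⟨fun ξ => (h α ξ).differentiableAt, by simp, ?_⟩
      have : fderiv ℝ (c α) = fun ξ => ∑ i, (EuclideanSpace.proj (𝕜 := ℝ) i).smulRight
          (c (α + Pi.single i 1) ξ) := funext fun ξ => (h α ξ).fderiv
      rw [this]
      exact ContDiff.sum fun i _ => contDiff_const.smulRight (ih _)
  exact contDiff_infty.mpr fun m => hm m α

theorem partialD_of_hasFDerivAt_family {F : Type*} [NormedAddCommGroup F] [NormedSpace ℝ F]
    {c : MultiIdx n → EucSp n → F}
    (h : ∀ α ξ, HasFDerivAt (c α) (∑ i, (EuclideanSpace.proj (𝕜 := ℝ) i).smulRight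
      (c (α + Pi.single i 1) ξ)) ξ) (α : MultiIdx n) (i : Fin n) :
    partialD i (c α) = c (α + Pi.single i 1) := by
  funext ξ
  rw [partialD, (h α ξ).fderiv]
  simp

theorem IsScaledSymbol.locallyIntegrable (hb : IsScaledSymbol lam k μ C b) (α : MultiIdx n)
    (ξ : EucSp n) : LocallyIntegrable fun y => multiD α (b y) ξ :=
  (hb.bound α ξ).locallyIntegrable

theorem IsScaledSymbol.contDiff_smoothedDeriv_left (hb : IsScaledSymbol lam k μ C b)
    (γ α : MultiIdx n) (ξ : EucSp n) : ContDiff ℝ ∞ fun x => smoothedDeriv μ b γ α x ξ :=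
  contDiff_kernelConv ((hasCompactSupport_smoothingKernel n μ).multiD
    (contDiff_smoothingKernel n μ) γ) ((contDiff_smoothingKernel n μ).multiD γ)
    (hb.locallyIntegrable α ξ)

theorem IsScaledSymbol.multiD_smoothedDeriv_left (hb : IsScaledSymbol lam k μ C b)
    (γ α δ : MultiIdx n) (ξ : EucSp n) : multiD δ (fun x => smoothedDeriv μ b γ α x ξ) =
      fun x => smoothedDeriv μ b (γ + δ) α x ξ :=
  multiD_family (c := fun γ x => smoothedDeriv μ b γ α x ξ) (fun γ i => by
    have h := partialD_kernelConv ((hasCompactSupport_smoothingKernel n μ).multiD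
      (contDiff_smoothingKernel n μ) γ) ((contDiff_smoothingKernel n μ).multiD γ)
      (hb.locallyIntegrable α ξ) i
    rw [partialD_multiD (contDiff_smoothingKernel n μ)] at h
    exact h) δ γ

/-- The linear form `c dx_i` as a function of `c`. -/
def coordForm (i : Fin n) : ℂ →L[ℝ] EucSp n →L[ℝ] ℂ :=
  ContinuousLinearMap.smulRightL ℝ (EucSp n) ℂ (EuclideanSpace.proj i)

theorem coordForm_apply (i : Fin n) (v : ℂ) :
    coordForm i v = (EuclideanSpace.proj (𝕜 := ℝ) i).smulRight v := rfl

theorem norm_coordForm_le (i : Fin n) (v : ℂ) : ‖coordForm i v‖ ≤ ‖v‖ := by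
  rw [coordForm_apply, ContinuousLinearMap.norm_smulRight_apply]
  exact mul_le_of_le_one_left (norm_nonneg _) (EuclideanSpace.norm_proj_le i)

theorem integrable_sum_clm {G : Type*} [NormedAddCommGroup G] [NormedSpace ℝ G]
    (L : Fin n → ℂ →L[ℝ] G) {φ : Fin n → EucSp n → ℂ} (h : ∀ i, Integrable (φ i)) :
    Integrable fun y => ∑ i, L i (φ i y) :=
  integrable_finsetSum _ fun i _ => (L i).integrable_comp (h i)

theorem integral_sum_clm {G : Type*} [NormedAddCommGroup G] [NormedSpace ℝ G] [CompleteSpace G]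
    (L : Fin n → ℂ →L[ℝ] G) {φ : Fin n → EucSp n → ℂ} (h : ∀ i, Integrable (φ i)) :
    ∫ y, ∑ i, L i (φ i y) = ∑ i, L i (∫ y, φ i y) := by
  rw [integral_finsetSum _ fun i _ => (L i).integrable_comp (h i)]
  exact Finset.sum_congr rfl fun i _ => (L i).integral_comp_comm (h i)

/-- Differentiation under the integral for a whole family at once. Almost everywhere in y the
integrands have bounds g that are uniform in y and continuous in ξ, hence bounded on the unit ball
around ξ₀, where they provide the dominating function. -/
theorem hasFDerivAt_integral_family {f : MultiIdx n → EucSp n → EucSp n → ℂ} {κ : EucSp n → ℝ}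
    (hκ : Integrable κ) (hint : ∀ α ξ, Integrable fun y => κ y • f α y ξ)
    (hf : ∀ α y ξ, HasFDerivAt (f α y) (∑ i, coordForm i (f (α + Pi.single i 1) y ξ)) ξ)
    {g : MultiIdx n → EucSp n → ℝ} (hg : ∀ α, Continuous (g α))
    (hb : ∀ᵐ y, ∀ α ξ, ‖f α y ξ‖ ≤ g α ξ) (α : MultiIdx n) (ξ₀ : EucSp n) :
    HasFDerivAt (fun ξ => ∫ y, κ y • f α y ξ)
      (∑ i, coordForm i (∫ y, κ y • f (α + Pi.single i 1) y ξ₀)) ξ₀ := by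
  have hG : ∀ i : Fin n, ∃ G : ℝ, ∀ ξ ∈ Metric.closedBall ξ₀ 1,
      ‖g (α + Pi.single i 1) ξ‖ ≤ G := fun i =>
    (isCompact_closedBall ξ₀ 1).exists_bound_of_continuousOn (hg _).continuousOn
  choose G hG using hG
  have h1 : ∀ ξ, Integrable fun y => ∑ i, coordForm i (κ y • f (α + Pi.single i 1) y ξ) :=
    fun ξ => integrable_sum_clm coordForm (φ := fun i y => κ y • f (α + Pi.single i 1) y ξ)
      fun i => hint (α + Pi.single i 1) ξ
  have h2 : ∀ᵐ y, ∀ ξ ∈ Metric.ball ξ₀ 1,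
      ‖∑ i, coordForm i (κ y • f (α + Pi.single i 1) y ξ)‖ ≤ ∑ i, ‖κ y‖ * G i := by
    filter_upwards [hb] with y hy ξ hξ
    refine (norm_sum_le _ _).trans (Finset.sum_le_sum fun i _ =>
      (norm_coordForm_le _ _).trans ?_)
    rw [norm_smul]
    gcongr
    exact (hy (α + Pi.single i 1) ξ).trans ((le_abs_self _).trans (hG i ξ (Metric.ball_subset_closedBall hξ)))
  have h3 : Integrable fun y => ∑ i, ‖κ y‖ * G i :=
    integrable_finsetSum _ fun i _ => hκ.norm.mul_const _
  have h4 : ∀ y, ∀ ξ ∈ Metric.ball ξ₀ 1, HasFDerivAt (fun ξ => κ y • f α y ξ)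
      (∑ i, coordForm i (κ y • f (α + Pi.single i 1) y ξ)) ξ := by
    intro y ξ _
    refine ((hf α y ξ).const_smul (κ y)).congr_fderiv ?_
    rw [Finset.smul_sum]
    exact Finset.sum_congr rfl fun i _ => ((coordForm i).map_smul _ _).symm
  set F : EucSp n → EucSp n → ℂ := fun ξ y => κ y • f α y ξ with hF
  set F' : EucSp n → EucSp n → EucSp n →L[ℝ] ℂ :=
    fun ξ y => ∑ i, coordForm i (κ y • f (α + Pi.single i 1) y ξ) with hF'
  have h6 : AEStronglyMeasurable (F' ξ₀) volume := (h1 ξ₀).aestronglyMeasurable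
  have h7 : ∀ᶠ ξ in nhds ξ₀, AEStronglyMeasurable (F ξ) volume :=
    Filter.Eventually.of_forall fun ξ => (hint α ξ).aestronglyMeasurable
  have h8 : Integrable (F ξ₀) := hint α ξ₀
  have h9 : ∀ᵐ y, ∀ ξ ∈ Metric.ball ξ₀ 1, HasFDerivAt (fun ξ => F ξ y) (F' ξ y) ξ :=
    Filter.Eventually.of_forall h4
  have h10 : ∀ᵐ y, ∀ ξ ∈ Metric.ball ξ₀ 1, ‖F' ξ y‖ ≤ ∑ i, ‖κ y‖ * G i := h2
  clear_value F F'
  have h5 := hasFDerivAt_integral_of_dominated_of_fderiv_le (Metric.ball_mem_nhds ξ₀ one_pos)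
    h7 h8 h6 h10 h3 h9
  subst hF hF'
  refine h5.congr_fderiv ?_
  exact integral_sum_clm coordForm (φ := fun i y => κ y • f (α + Pi.single i 1) y ξ₀)
    fun i => hint (α + Pi.single i 1) ξ₀

theorem hasFDerivAt_multiD {f : EucSp n → ℂ} (hf : ContDiff ℝ ∞ f) (α : MultiIdx n)
    (ξ : EucSp n) : HasFDerivAt (multiD α f)
      (∑ i, coordForm i (multiD (α + Pi.single i 1) f ξ)) ξ := by
  refine ((hf.multiD α).differentiable (by simp) ξ).hasFDerivAt.congr_fderiv ?_
  rw [EuclideanSpace.clm_eq_sum (fderiv ℝ (multiD α f) ξ)]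
  refine Finset.sum_congr rfl fun i _ => ?_
  rw [coordForm_apply, ← partialD_multiD hf]
  rfl

theorem IsScaledSymbol.hasFDerivAt_smoothedDeriv (hb : IsScaledSymbol lam k μ C b)
    (γ α : MultiIdx n) (x ξ₀ : EucSp n) : HasFDerivAt (smoothedDeriv μ b γ α x)
      (∑ i, coordForm i (smoothedDeriv μ b γ (α + Pi.single i 1) x ξ₀)) ξ₀ := by
  have hκs : ContDiff ℝ ∞ (multiD γ (smoothingKernel n μ)) :=
    (contDiff_smoothingKernel n μ).multiD γ
  have hκc : HasCompactSupport (multiD γ (smoothingKernel n μ)) :=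
    (hasCompactSupport_smoothingKernel n μ).multiD (contDiff_smoothingKernel n μ) γ
  exact hasFDerivAt_integral_family (f := fun α y => multiD α (b y))
    ((hκs.continuous.integrable_of_hasCompactSupport hκc).comp_sub_left x)
    (fun α ξ => integrable_kernel_smul hκc hκs.continuous (hb.locallyIntegrable α ξ) x)
    (fun α y ξ => hasFDerivAt_multiD (hb.smooth y) α ξ)
    (fun α => continuous_const.mul (continuous_japBr_smul_rpow _ _)) hb.ae_norm_multiD_le α ξ₀

theorem IsScaledSymbol.contDiff_smoothedDeriv_right (hb : IsScaledSymbol lam k μ C b)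
    (γ α : MultiIdx n) (x : EucSp n) : ContDiff ℝ ∞ (smoothedDeriv μ b γ α x) :=
  contDiff_of_hasFDerivAt_family (c := fun α => smoothedDeriv μ b γ α x)
    (fun α ξ => hb.hasFDerivAt_smoothedDeriv γ α x ξ) α

theorem IsScaledSymbol.multiD_smoothedDeriv_right (hb : IsScaledSymbol lam k μ C b)
    (γ α δ : MultiIdx n) (x : EucSp n) :
    multiD δ (smoothedDeriv μ b γ α x) = smoothedDeriv μ b γ (α + δ) x :=
  multiD_family (c := fun α => smoothedDeriv μ b γ α x)
    (partialD_of_hasFDerivAt_family fun α ξ => hb.hasFDerivAt_smoothedDeriv γ α x ξ) δ α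

/-- The constant in the estimates for at most `N` derivatives of smoothed symbols. -/
def smoothingConst (n μ N : ℕ) : ℝ :=
  ∑ δ ∈ idxLE n N, ∫ y, ‖multiD δ (smoothingKernel n μ) y‖

theorem smoothingConst_nonneg (n μ N : ℕ) : 0 ≤ smoothingConst n μ N :=
  Finset.sum_nonneg fun _ _ => integral_nonneg fun _ => norm_nonneg _

/-- Of the derivatives ∂^γ in x, min(|γ|, μ) are transferred to the symbol, each giving a factor λ;
the surplus stays on the unit-scale kernel and costs only a constant. -/
theorem IsScaledSymbol.norm_smoothedDeriv_le (hb : IsScaledSymbol lam k μ C b) (hlam : 0 < lam)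
    {N : ℕ} {γ : MultiIdx n} (hγ : γ.len ≤ N) (α : MultiIdx n) (x ξ : EucSp n) :
    ‖smoothedDeriv μ b γ α x ξ‖ ≤ smoothingConst n μ N *
      (lam ^ (α.len + min γ.len μ) * derivSum C α.len (min γ.len μ) *
        japBr (lam • ξ) ^ (k - α.len)) := by
  obtain ⟨β, δ, rfl, hβ⟩ := MultiIdx.exists_decomposition γ μ
  have hβμ : β.len ≤ μ := hβ.trans_le (min_le_right _ _)
  have h1 := (hb.bound α ξ).norm_kernelConv_le (hasCompactSupport_smoothingKernel n μ)
    (contDiff_smoothingKernel n μ) hβμ δ x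
  have h2 : ∫ y, ‖multiD δ (smoothingKernel n μ) y‖ ≤ smoothingConst n μ N :=
    Finset.single_le_sum (f := fun δ => ∫ y, ‖multiD δ (smoothingKernel n μ) y‖)
      (fun _ _ => integral_nonneg fun _ => norm_nonneg _)
      (mem_idxLE.mpr (by rw [MultiIdx.len_add] at hγ; omega))
  rw [← hβ]
  refine h1.trans ?_
  have h3 := (hb.bound α ξ).nonneg hβμ
  have h4 := japBr_pos (lam • ξ)
  have h5 := hb.le_derivSum hlam α hβμ
  refine mul_le_mul h2 ?_ h3 (smoothingConst_nonneg n μ N)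
  gcongr

end

end ScaledSymbols

/-! ### Frequency bounds for products, weights and smoothing remainders -/

noncomputable section SymbolEstimates

variable {n : ℕ}

/-! ### Products and weights -/

/-- The constants of a product of functions with the constants `A` and `B`. -/
def freqConv (A B : ℕ → ℝ) (j : ℕ) : ℝ :=
  ∑ i ∈ Finset.range (j + 1), (j.choose i : ℝ) * (A i * B (j - i))

theorem HasFreqBounds.mul {lam κ₁ κ₂ : ℝ} {A B : ℕ → ℝ} {f g : EucSp n → ℂ}
    (hf : HasFreqBounds lam κ₁ A f) (hg : HasFreqBounds lam κ₂ B g) :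
    HasFreqBounds lam (κ₁ + κ₂) (freqConv A B) fun ξ => f ξ * g ξ where
  smooth := hf.smooth.mul hg.smooth
  bound j ξ := by
    refine (norm_iteratedFDeriv_mul_le (hf.smooth.of_le (by exact_mod_cast le_top))
      (hg.smooth.of_le (by exact_mod_cast le_top)) ξ le_rfl).trans ?_
    rw [freqConv, Finset.sum_mul, Finset.sum_mul]
    refine Finset.sum_le_sum fun i hi => ?_
    have hi' : i ≤ j := Nat.lt_succ_iff.mp (Finset.mem_range.mp hi)
    have hJ := japBr_pos (lam • ξ)
    have h1 := hf.bound i ξ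
    have h2 := hg.bound (j - i) ξ
    have h3 := (norm_nonneg _).trans h1
    calc (j.choose i : ℝ) * ‖iteratedFDeriv ℝ i f ξ‖ * ‖iteratedFDeriv ℝ (j - i) g ξ‖
        ≤ (j.choose i : ℝ) * (A i * lam ^ i * japBr (lam • ξ) ^ (κ₁ - i)) *
          (B (j - i) * lam ^ (j - i) * japBr (lam • ξ) ^ (κ₂ - (j - i : ℕ))) := by gcongr
      _ = (j.choose i : ℝ) * (A i * B (j - i)) * (lam ^ i * lam ^ (j - i)) *
          (japBr (lam • ξ) ^ (κ₁ - i) * japBr (lam • ξ) ^ (κ₂ - (j - i : ℕ))) := by ring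
      _ = _ := by
        rw [← pow_add, Nat.add_sub_cancel' hi', ← Real.rpow_add hJ, Nat.cast_sub hi']
        ring_nf

/-- From D⟨ξ⟩^s = s⟨ξ⟩^(s-2)⟨ξ, ·⟩, a derivative of order j + 1 reduces by Leibniz to derivatives of
order at most j of ⟨ξ⟩^(s-2) times a linear map. The exponent changes along the way, so the
induction runs over all s. -/
theorem norm_iteratedFDeriv_japBr_rpow_le (n j : ℕ) : ∀ s : ℝ, ∃ B : ℝ, 0 ≤ B ∧
    ∀ ξ : EucSp n, ‖iteratedFDeriv ℝ j (fun ξ : EucSp n => japBr ξ ^ s) ξ‖ ≤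
      B * japBr ξ ^ (s - j) := by
  have hform : ∀ s : ℝ, (fun ξ : EucSp n => japBr ξ ^ s) =
      fun ξ => (1 + ‖ξ‖ ^ 2) ^ (s / 2) := fun s => by
    funext ξ
    rw [japBr, Real.sqrt_eq_rpow, ← Real.rpow_mul (by positivity)]
    ring_nf
  have hsm : ∀ s : ℝ, ContDiff ℝ ∞ fun ξ : EucSp n => japBr ξ ^ s := fun s => by
    rw [hform]
    exact (contDiff_const.add (contDiff_norm_sq ℝ)).rpow_const_of_ne fun ξ => by positivity
  have hder : ∀ s : ℝ, fderiv ℝ (fun ξ : EucSp n => japBr ξ ^ s) =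
      fun ξ => japBr ξ ^ (s - 2) • (s • innerSL ℝ ξ) := fun s => by
    funext ξ
    rw [hform]
    have h1 : HasFDerivAt (fun ξ : EucSp n => 1 + ‖ξ‖ ^ 2) (2 • innerSL ℝ ξ) ξ :=
      (hasStrictFDerivAt_norm_sq ξ).hasFDerivAt.const_add 1
    have h2 := h1.rpow_const (p := s / 2) (Or.inl (by positivity))
    have h3 := congrFun (hform (s - 2)) ξ
    rw [h2.fderiv, h3]
    ext v
    simp only [smul_apply, smul_eq_mul, nsmul_eq_mul]
    rw [show s / 2 - 1 = (s - 2) / 2 by ring]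
    push_cast
    ring
  induction j using Nat.strong_induction_on with
  | _ j ih =>
    intro s
    rcases j with _ | j
    · refine ⟨1, zero_le_one, fun ξ => ?_⟩
      rw [norm_iteratedFDeriv_zero, Real.norm_of_nonneg (Real.rpow_nonneg (japBr_pos ξ).le _)]
      simp
    · choose B hB0 hB using fun i (hi : i < j + 1) => ih i hi (s - 2)
      set L : EucSp n →L[ℝ] (EucSp n →L[ℝ] ℝ) := s • innerSL ℝ with hL
      have hLb : ∀ (i : ℕ) (ξ : EucSp n), ‖iteratedFDeriv ℝ i L ξ‖ ≤
          |s| * japBr ξ ^ (1 - (i : ℝ)) := by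
        intro i ξ
        have hJ := japBr_pos ξ
        have hLn : ‖L‖ ≤ |s| := by
          refine ContinuousLinearMap.opNorm_le_bound _ (abs_nonneg s) fun v => ?_
          rw [hL, smul_apply, norm_smul, innerSL_apply_norm]
          rfl
        rcases i with _ | _ | i
        · rw [norm_iteratedFDeriv_zero]
          refine (L.le_of_opNorm_le hLn ξ).trans ?_
          simp only [CharP.cast_eq_zero, sub_zero, Real.rpow_one]
          gcongr
          exact norm_le_japBr ξ
        · rw [← norm_iteratedFDeriv_fderiv, norm_iteratedFDeriv_zero, L.fderiv]
          simpa using hLn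
        · rw [← norm_iteratedFDeriv_fderiv]
          have : fderiv ℝ L = fun _ => L := funext fun x => L.fderiv
          rw [this, iteratedFDeriv_const_of_ne (by omega)]
          simp only [Pi.zero_apply, norm_zero]
          positivity
      refine ⟨∑ i : Fin (j + 1), (j.choose i : ℝ) * (B i i.2 * |s|),
        Finset.sum_nonneg fun i _ => by have := hB0 i i.2; positivity, fun ξ => ?_⟩
      have hJ := japBr_pos ξ
      rw [← norm_iteratedFDeriv_fderiv, hder]
      refine (norm_iteratedFDeriv_smul_le (f := fun ξ : EucSp n => japBr ξ ^ (s - 2)) (g := L)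
        (N := (j : ℕ)) ((hsm _).of_le (by exact_mod_cast le_top)) L.contDiff ξ (n := j)
        le_rfl).trans ?_
      rw [Finset.sum_mul, Finset.sum_range]
      refine Finset.sum_le_sum fun i _ => ?_
      have h1 := hB i i.2 ξ
      have h2 := hLb (j - i) ξ
      have h0 := hB0 i i.2
      calc (j.choose i : ℝ) * ‖iteratedFDeriv ℝ i (fun ξ : EucSp n => japBr ξ ^ (s - 2)) ξ‖ *
            ‖iteratedFDeriv ℝ (j - i) L ξ‖
          ≤ (j.choose i : ℝ) * (B i i.2 * japBr ξ ^ (s - 2 - (i : ℕ))) *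
            (|s| * japBr ξ ^ (1 - ((j - i : ℕ) : ℝ))) := by gcongr
        _ = (j.choose i : ℝ) * (B i i.2 * |s|) *
            (japBr ξ ^ (s - 2 - (i : ℕ)) * japBr ξ ^ (1 - ((j - i : ℕ) : ℝ))) := by ring
        _ = _ := by
          rw [← Real.rpow_add hJ, Nat.cast_sub (Nat.lt_succ_iff.mp i.2)]
          push_cast
          ring_nf

/-- The weight `⟨lam ξ⟩^s`. -/
def freqWeight (lam s : ℝ) (ξ : EucSp n) : ℂ := ((japBr (lam • ξ) ^ s : ℝ) : ℂ)

theorem exists_hasFreqBounds_freqWeight (n : ℕ) (s : ℝ) : ∃ B : ℕ → ℝ, (∀ j, 0 ≤ B j) ∧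
    ∀ lam : ℝ, 0 < lam → HasFreqBounds lam s B (freqWeight (n := n) lam s) := by
  choose B hB0 hB using fun j => norm_iteratedFDeriv_japBr_rpow_le n j s
  have hsm : ContDiff ℝ ∞ fun ξ : EucSp n => japBr ξ ^ s := by
    have hform : (fun ξ : EucSp n => japBr ξ ^ s) = fun ξ => (1 + ‖ξ‖ ^ 2) ^ (s / 2) := by
      funext ξ
      rw [japBr, Real.sqrt_eq_rpow, ← Real.rpow_mul (by positivity)]
      ring_nf
    rw [hform]
    exact (contDiff_const.add (contDiff_norm_sq ℝ)).rpow_const_of_ne fun ξ => by positivity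
  refine ⟨B, hB0, fun lam hlam => ⟨?_, fun j ξ => ?_⟩⟩
  · exact Complex.ofRealCLM.contDiff.comp (hsm.comp (contDiff_const_smul lam))
  · have h1 : freqWeight (n := n) lam s =
        Complex.ofRealLI ∘ fun ξ : EucSp n => japBr (lam • ξ) ^ s := rfl
    have h2 : ContDiff ℝ ∞ fun ξ : EucSp n => japBr (lam • ξ) ^ s :=
      hsm.comp (contDiff_const_smul lam)
    rw [h1, LinearIsometry.norm_iteratedFDeriv_comp_left _
      (n := (j : ℕ)) (h2.of_le (by exact_mod_cast le_top)).contDiffAt le_rfl,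
      norm_iteratedFDeriv_comp_smul lam (g := fun ξ : EucSp n => japBr ξ ^ s)
        (hsm.of_le (by exact_mod_cast le_top)), abs_of_pos hlam]
    calc lam ^ j * ‖iteratedFDeriv ℝ j (fun ξ : EucSp n => japBr ξ ^ s) (lam • ξ)‖
        ≤ lam ^ j * (B j * japBr (lam • ξ) ^ (s - j)) := by gcongr; exact hB j _
      _ = _ := by ring

theorem HasFreqBounds.hasTemperateGrowth {lam κ : ℝ} {B : ℕ → ℝ} {f : EucSp n → ℂ}
    (hlam : 0 < lam) (hf : HasFreqBounds lam κ B f) (hκ : κ ≤ 0) : f.HasTemperateGrowth := by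
  refine ⟨hf.smooth, fun j => ⟨0, |B j| * lam ^ j, fun ξ => ?_⟩⟩
  refine (hf.bound j ξ).trans ?_
  have h1 : japBr (lam • ξ) ^ (κ - j) ≤ 1 :=
    japBr_rpow_le_one _ (by have : (0 : ℝ) ≤ j := by positivity
                            linarith)
  have h2 : 0 ≤ japBr (lam • ξ) ^ (κ - j) := Real.rpow_nonneg (japBr_pos _).le _
  rw [pow_zero, mul_one]
  calc B j * lam ^ j * japBr (lam • ξ) ^ (κ - j) ≤ |B j| * lam ^ j * 1 := by
        gcongr
        exact le_abs_self _
    _ = _ := mul_one _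

theorem isSchurSymbol_of_hasFreqBounds {lam κ : ℝ} {B : ℕ → ℝ} {b : EucSp n → EucSp n → ℂ}
    (hlam : 0 < lam) (hB : ∀ j, 0 ≤ B j)
    (hm : AEStronglyMeasurable (Function.uncurry b) (volume.prod volume))
    (hb : ∀ᵐ x, HasFreqBounds lam κ B (b x)) :
    IsSchurSymbol lam κ (∑ j ∈ Finset.range (n + 2), B j) b where
  meas := hm
  bound := by
    filter_upwards [hb] with x hx
    refine ⟨hx.smooth.of_le (by exact_mod_cast le_top), fun j hj ξ => (hx.bound j ξ).trans ?_⟩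
    have h2 : 0 ≤ japBr (lam • ξ) ^ (κ - j) := Real.rpow_nonneg (japBr_pos _).le _
    gcongr
    exact Finset.single_le_sum (fun i _ => hB i) (Finset.mem_range.mpr (by omega))

/-! ### Estimates for the smoothed symbol and the remainder -/

theorem multiD_sub {F : Type*} [NormedAddCommGroup F] [NormedSpace ℝ F] {f g : EucSp n → F}
    (hf : ContDiff ℝ ∞ f) (hg : ContDiff ℝ ∞ g) (α : MultiIdx n) :
    multiD α (fun x => f x - g x) = fun x => multiD α f x - multiD α g x := by
  have h := multiD_family (c := fun γ x => multiD γ f x - multiD γ g x) (fun γ i => by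
    funext x
    rw [← partialD_multiD hf, ← partialD_multiD hg, partialD,
      fderiv_fun_sub ((hf.multiD γ).differentiable (by simp) x)
        ((hg.multiD γ).differentiable (by simp) x)]
    rfl) α 0
  simpa using h

section

variable {lam k : ℝ} {μ : ℕ} {C : MultiIdx n → MultiIdx n → ℝ} {b : EucSp n → EucSp n → ℂ}

theorem IsScaledSymbol.ae_hasFreqBounds (hb : IsScaledSymbol lam k μ C b) (hlam : 0 < lam) :
    ∀ᵐ x, HasFreqBounds lam k (fun j => idxConst n j * derivSum C j 0) (b x) := by
  filter_upwards [hb.ae_norm_multiD_le] with x hx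
  refine HasFreqBounds.of_multiD (hb.smooth x) fun α ξ => (hx α ξ).trans ?_
  have h := hb.le_derivSum hlam α (β := 0) (by simp)
  rw [MultiIdx.len_zero] at h
  have h2 : 0 ≤ japBr (lam • ξ) ^ (k - α.len) := Real.rpow_nonneg (japBr_pos _).le _
  rw [mul_comm (lam ^ α.len)]
  gcongr

theorem IsScaledSymbol.hasFreqBounds_smoothed (hb : IsScaledSymbol lam k μ C b) (hlam : 0 < lam)
    (x : EucSp n) : HasFreqBounds lam k
      (fun j => idxConst n j * (smoothingConst n μ 0 * derivSum C j 0)) (smoothed μ b x) := by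
  rw [← smoothedDeriv_zero]
  refine HasFreqBounds.of_multiD (hb.contDiff_smoothedDeriv_right 0 0 x) fun α ξ => ?_
  rw [hb.multiD_smoothedDeriv_right, zero_add]
  refine (hb.norm_smoothedDeriv_le hlam (N := 0) (by simp) α x ξ).trans_eq ?_
  simp only [MultiIdx.len_zero, Nat.zero_min, add_zero]
  ring

/-- Smoothing in x commutes with ∂_ξ, so each ξ-derivative of the remainder is the smoothing
remainder of ∂_ξ^α b. It gains λ^μ from the derivatives of order μ in x, while the order k in ξ is
preserved. -/
theorem IsScaledSymbol.ae_hasFreqBounds_sub (hb : IsScaledSymbol lam k μ C b) (hlam : 0 < lam) :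
    ∀ᵐ x, HasFreqBounds lam k
      (fun j => idxConst n j * ((n : ℝ) ^ μ * (lam ^ μ * derivSum C j μ)))
      fun ξ => b x ξ - smoothed μ b x ξ := by
  have h1 : ∀ α, ∀ᵐ x, ∀ ξ, ‖multiD α (b x) ξ - smoothedDeriv μ b 0 α x ξ‖ ≤
      (n : ℝ) ^ μ * (lam ^ μ * ∑ β ∈ idxEq n μ, C α β) * lam ^ α.len *
        japBr (lam • ξ) ^ (k - α.len) := by
    intro α
    refine ae_forall_norm_le (fun x => ((hb.smooth x).multiD α).continuous.sub
      (hb.contDiff_smoothedDeriv_right 0 α x).continuous)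
      (continuous_const.mul (continuous_japBr_smul_rpow _ _)) fun ξ => ?_
    filter_upwards [(hb.bound α ξ).ae_norm_sub_le] with x hx
    rw [smoothedDeriv, multiD_zero]
    refine hx.trans_eq ?_
    have h2 : ∀ β ∈ idxEq n μ, lam ^ (α.len + β.len) * C α β * japBr (lam • ξ) ^ (k - α.len) =
        lam ^ μ * lam ^ α.len * japBr (lam • ξ) ^ (k - α.len) * C α β := fun β hβ => by
      rw [mem_idxEq.mp hβ]
      ring
    rw [Finset.sum_congr rfl h2, ← Finset.mul_sum]
    ring
  filter_upwards [ae_all_iff.mpr h1] with x hx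
  have hsm : ContDiff ℝ ∞ (smoothed μ b x) := by
    rw [← smoothedDeriv_zero]
    exact hb.contDiff_smoothedDeriv_right 0 0 x
  refine HasFreqBounds.of_multiD ((hb.smooth x).sub hsm) fun α ξ => ?_
  rw [multiD_sub (hb.smooth x) hsm, ← smoothedDeriv_zero, hb.multiD_smoothedDeriv_right, zero_add]
  refine (hx α ξ).trans ?_
  have h2 : 0 ≤ japBr (lam • ξ) ^ (k - α.len) := Real.rpow_nonneg (japBr_pos _).le _
  have h3 : ∑ β ∈ idxEq n μ, C α β ≤ derivSum C α.len μ :=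
    Finset.single_le_sum (f := fun α' => ∑ β ∈ idxEq n μ, C α' β)
      (fun α' _ => Finset.sum_nonneg fun _ hβ => hb.nonneg hlam α' (mem_idxEq.mp hβ).le)
      (mem_idxEq.mpr rfl)
  gcongr

end

end SymbolEstimates

/-! ### Smoothed symbols are slowly varying and satisfy Calderón-Vaillancourt bounds -/

noncomputable section SmoothedSymbols

variable {n : ℕ}

/-- The sum of the constants with the derivatives counted in `J` and `M`, weighted by powers of
`lam`. -/
def weightedSum (lam : ℝ) (C : MultiIdx n → MultiIdx n → ℝ) (J M : Finset ℕ) : ℝ :=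
  ∑ j ∈ J, ∑ m ∈ M, lam ^ (j + m) * derivSum C j m

/-- A bound for the constants `idxConst n j` with `j ≤ N`. -/
def idxConstSum (n N : ℕ) : ℝ := ∑ j ∈ Finset.range (N + 1), idxConst n j

theorem idxConstSum_nonneg (n N : ℕ) : 0 ≤ idxConstSum n N :=
  Finset.sum_nonneg fun _ _ => idxConst_nonneg _ _

theorem idxConst_le_sum {N j : ℕ} (hj : j ≤ N) : idxConst n j ≤ idxConstSum n N :=
  Finset.single_le_sum (f := idxConst n) (fun _ _ => idxConst_nonneg _ _)
    (Finset.mem_range.mpr (by omega))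

theorem norm_sub_le_of_partialD {F : Type*} [NormedAddCommGroup F] [NormedSpace ℝ F]
    {f : EucSp n → F} (hf : ContDiff ℝ ∞ f) {A : ℝ} (hA : ∀ i x, ‖partialD i f x‖ ≤ A)
    (x y : EucSp n) : ‖f x - f y‖ ≤ n * A * ‖x - y‖ := by
  refine Convex.norm_image_sub_le_of_norm_fderiv_le (𝕜 := ℝ) (s := Set.univ)
    (fun z _ => hf.differentiable (by simp) z) (fun z _ => ?_) convex_univ trivial trivial
  refine (norm_fderiv_le_sum_partialD f z).trans ?_
  refine (Finset.sum_le_sum fun i _ => hA i z).trans_eq ?_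
  simp

theorem japBr_rpow_sub_natCast_le (ξ : EucSp n) (κ : ℝ) (j : ℕ) :
    japBr ξ ^ (κ - j) ≤ japBr ξ ^ κ :=
  Real.rpow_le_rpow_of_exponent_le (one_le_japBr ξ) (by simp)

section

variable {lam k : ℝ} {μ : ℕ} {C : MultiIdx n → MultiIdx n → ℝ} {b : EucSp n → EucSp n → ℂ}

theorem IsScaledSymbol.weightedSum_nonneg (hb : IsScaledSymbol lam k μ C b) (hlam : 0 < lam)
    (J : Finset ℕ) {M : Finset ℕ} (hM : ∀ m ∈ M, m ≤ μ) : 0 ≤ weightedSum lam C J M :=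
  Finset.sum_nonneg fun j _ => Finset.sum_nonneg fun m hm =>
    mul_nonneg (by positivity) (hb.derivSum_nonneg hlam j (hM m hm))

theorem IsScaledSymbol.le_weightedSum (hb : IsScaledSymbol lam k μ C b) (hlam : 0 < lam)
    {J M : Finset ℕ} (hM : ∀ m ∈ M, m ≤ μ) {j m : ℕ} (hj : j ∈ J) (hm : m ∈ M) :
    lam ^ (j + m) * derivSum C j m ≤ weightedSum lam C J M := by
  have h0 : ∀ j', ∀ m' ∈ M, 0 ≤ lam ^ (j' + m') * derivSum C j' m' := fun j' m' hm' =>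
    mul_nonneg (by positivity) (hb.derivSum_nonneg hlam j' (hM m' hm'))
  exact (Finset.single_le_sum (f := fun m' => lam ^ (j + m') * derivSum C j m') (h0 j) hm).trans
    (Finset.single_le_sum (f := fun j' => ∑ m' ∈ M, lam ^ (j' + m') * derivSum C j' m')
      (fun j' _ => Finset.sum_nonneg (h0 j')) hj)

theorem IsScaledSymbol.contDiff_smoothed_left (hb : IsScaledSymbol lam k μ C b) (ξ : EucSp n) :
    ContDiff ℝ ∞ fun x => smoothed μ b x ξ := by
  rw [← smoothedDeriv_zero]
  exact hb.contDiff_smoothedDeriv_left 0 0 ξ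

theorem IsScaledSymbol.contDiff_smoothed_right (hb : IsScaledSymbol lam k μ C b) (x : EucSp n) :
    ContDiff ℝ ∞ (smoothed μ b x) := by
  rw [← smoothedDeriv_zero]
  exact hb.contDiff_smoothedDeriv_right 0 0 x

theorem IsScaledSymbol.aestronglyMeasurable_smoothed (hb : IsScaledSymbol lam k μ C b) :
    AEStronglyMeasurable (Function.uncurry (smoothed μ b)) (volume.prod volume) :=
  aestronglyMeasurable_uncurry (fun x => (hb.contDiff_smoothed_right x).continuous) fun ξ =>
    (hb.contDiff_smoothed_left ξ).continuous.aestronglyMeasurable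

/-- Derivatives in the position of the smoothed symbol. -/
theorem IsScaledSymbol.norm_iteratedFDeriv_smoothed_left (hb : IsScaledSymbol lam k μ C b)
    (hlam : 0 < lam) {N i : ℕ} (hi : i ≤ N) (x ξ : EucSp n) :
    ‖iteratedFDeriv ℝ i (fun x => smoothed μ b x ξ) x‖ ≤ idxConstSum n N *
      (smoothingConst n μ N * (lam ^ min i μ * derivSum C 0 (min i μ) * japBr (lam • ξ) ^ k)) := by
  have h0 : 0 ≤ derivSum C 0 (min i μ) := hb.derivSum_nonneg hlam 0 (min_le_right _ _)
  have hJ := japBr_pos (lam • ξ)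
  have hS := smoothingConst_nonneg n μ N
  refine (norm_iteratedFDeriv_le_of_multiD (hb.contDiff_smoothed_left ξ) i x
    (fun γ hγ => ?_)).trans (mul_le_mul_of_nonneg_right (idxConst_le_sum hi) (by positivity))
  have h1 := hb.norm_smoothedDeriv_le hlam (N := N) (γ := γ) (by omega) 0 x ξ
  rw [← smoothedDeriv_zero, hb.multiD_smoothedDeriv_left, zero_add]
  simpa [hγ] using h1

/-- Derivatives in the position of the smoothed symbol vary slowly with the frequency. -/
theorem IsScaledSymbol.norm_iteratedFDeriv_smoothed_sub_left (hb : IsScaledSymbol lam k μ C b)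
    (hlam : 0 < lam) (hk : k ≤ 0) {N i : ℕ} (hi : i ≤ N) (x ξ ξ' : EucSp n) :
    ‖iteratedFDeriv ℝ i (fun x => smoothed μ b x ξ - smoothed μ b x ξ') x‖ ≤ idxConstSum n N *
      (n * (smoothingConst n μ N * (lam ^ (1 + min i μ) * derivSum C 1 (min i μ))) *
        ‖ξ - ξ'‖) := by
  have h0 : 0 ≤ derivSum C 1 (min i μ) := hb.derivSum_nonneg hlam 1 (min_le_right _ _)
  have hS := smoothingConst_nonneg n μ N
  have hs1 := hb.contDiff_smoothed_left ξ
  have hs2 := hb.contDiff_smoothed_left ξ'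
  refine (norm_iteratedFDeriv_le_of_multiD (hs1.sub hs2) i x (fun γ hγ => ?_)).trans
    (mul_le_mul_of_nonneg_right (idxConst_le_sum hi) (by positivity))
  rw [multiD_sub hs1 hs2, ← smoothedDeriv_zero, hb.multiD_smoothedDeriv_left,
    hb.multiD_smoothedDeriv_left, zero_add]
  refine norm_sub_le_of_partialD (hb.contDiff_smoothedDeriv_right γ 0 x) (fun l ζ => ?_) ξ ξ'
  rw [← multiD_single, hb.multiD_smoothedDeriv_right, zero_add]
  refine (hb.norm_smoothedDeriv_le hlam (N := N) (by omega) _ x ζ).trans ?_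
  rw [MultiIdx.len_single, hγ]
  have h1 : japBr (lam • ζ) ^ (k - ((1 : ℕ) : ℝ)) ≤ 1 :=
    japBr_rpow_le_one _ (by push_cast; linarith)
  exact mul_le_mul_of_nonneg_left (mul_le_of_le_one_right (by positivity) h1) hS

/-- Derivatives in the frequency of the smoothed symbol vary slowly with the position. -/
theorem IsScaledSymbol.norm_iteratedFDeriv_smoothed_sub_right (hb : IsScaledSymbol lam k μ C b)
    (hlam : 0 < lam) (hμ : 1 ≤ μ) {N j : ℕ} (hN : 1 ≤ N) (hj : j ≤ N) (x x' ξ : EucSp n) :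
    ‖iteratedFDeriv ℝ j (fun ξ => smoothed μ b x ξ - smoothed μ b x' ξ) ξ‖ ≤ idxConstSum n N *
      (n * (smoothingConst n μ N * (lam ^ (j + 1) * derivSum C j 1 * japBr (lam • ξ) ^ k)) *
        ‖x - x'‖) := by
  have h0 : 0 ≤ derivSum C j 1 := hb.derivSum_nonneg hlam j hμ
  have hS := smoothingConst_nonneg n μ N
  have hJ := japBr_pos (lam • ξ)
  have hs1 := hb.contDiff_smoothed_right x
  have hs2 := hb.contDiff_smoothed_right x'
  refine (norm_iteratedFDeriv_le_of_multiD (hs1.sub hs2) j ξ (fun α hα => ?_)).trans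
    (mul_le_mul_of_nonneg_right (idxConst_le_sum hj) (by positivity))
  rw [multiD_sub hs1 hs2, ← smoothedDeriv_zero, hb.multiD_smoothedDeriv_right,
    hb.multiD_smoothedDeriv_right, zero_add]
  refine norm_sub_le_of_partialD (hb.contDiff_smoothedDeriv_left 0 α ξ) (fun l y => ?_) x x'
  rw [← multiD_single, hb.multiD_smoothedDeriv_left, zero_add]
  refine (hb.norm_smoothedDeriv_le hlam (N := N) (by simpa using hN) _ y ξ).trans ?_
  rw [MultiIdx.len_single, hα, min_eq_left hμ]
  have h1 := japBr_rpow_sub_natCast_le (lam • ξ) k j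
  gcongr

end

/-- Differences in ξ are controlled by the mean value inequality through one derivative in ξ, so
every constant entering the bound has at least one frequency derivative; this is why the range
starts at 1. The supremum of the symbol itself enters only qualitatively. -/
theorem exists_isSlowlyVarying_smoothed (n μ : ℕ) : ∃ K : ℝ, 0 ≤ K ∧
    ∀ (lam k : ℝ) (C : MultiIdx n → MultiIdx n → ℝ) (b : EucSp n → EucSp n → ℂ), 0 < lam →
    k ≤ 0 → IsScaledSymbol lam k μ C b →
    IsSlowlyVarying (K * weightedSum lam C (Finset.Icc 1 (matrixOrder n))
      (Finset.range (min (matrixOrder n) μ + 1))) (smoothed μ b) := by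
  set N := matrixOrder n with hN
  have hN1 : 1 ≤ N := by rw [hN, matrixOrder]; omega
  have hS := smoothingConst_nonneg n μ N
  have hS0 := smoothingConst_nonneg n μ 0
  have hI := idxConstSum_nonneg n N
  refine ⟨idxConstSum n N * (n * smoothingConst n μ N + smoothingConst n μ 0), by positivity, ?_⟩
  intro lam k C b hlam hk hb
  set M : Finset ℕ := Finset.range (min N μ + 1) with hM
  have hMμ : ∀ m ∈ M, m ≤ μ := fun m hm => by
    have := Finset.mem_range.mp hm
    omega
  set W := weightedSum lam C (Finset.Icc 1 N) M with hW
  have hW0 : 0 ≤ W := hb.weightedSum_nonneg hlam _ hMμ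
  refine ⟨hb.aestronglyMeasurable_smoothed,
    fun ξ => (hb.contDiff_smoothed_left ξ).of_le (by exact_mod_cast le_top),
    fun x => (hb.contDiff_smoothed_right x).of_le (by exact_mod_cast le_top), ?_, ?_, ?_⟩
  · refine ⟨idxConst n 0 * (smoothingConst n μ 0 * derivSum C 0 0), fun x ξ => ?_⟩
    have h1 := (hb.hasFreqBounds_smoothed hlam x).bound 0 ξ
    rw [norm_iteratedFDeriv_zero, pow_zero, mul_one] at h1
    have h2 := hb.derivSum_nonneg hlam 0 (m := 0) (by omega)
    have h3 := idxConst_nonneg n 0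
    exact h1.trans (mul_le_of_le_one_right (by positivity) (japBr_rpow_le_one _ (by simpa using hk)))
  · intro i hi ξ ξ' x
    refine (hb.norm_iteratedFDeriv_smoothed_sub_left hlam hk hi x ξ ξ').trans ?_
    have h1 : lam ^ (1 + min i μ) * derivSum C 1 (min i μ) ≤ W :=
      hb.le_weightedSum hlam hMμ (Finset.mem_Icc.mpr ⟨le_rfl, hN1⟩)
        (Finset.mem_range.mpr (by omega))
    calc _ ≤ idxConstSum n N * (n * (smoothingConst n μ N * W) * ‖ξ - ξ'‖) := by gcongr
      _ = idxConstSum n N * (n * smoothingConst n μ N + 0) * W * ‖ξ - ξ'‖ := by ring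
      _ ≤ _ := by gcongr
  · intro j hj1 hj x ξ
    refine ((hb.hasFreqBounds_smoothed hlam x).bound j ξ).trans ?_
    have h1 : lam ^ (j + 0) * derivSum C j 0 ≤ W :=
      hb.le_weightedSum hlam hMμ (Finset.mem_Icc.mpr ⟨hj1, hj⟩) (Finset.mem_range.mpr (by omega))
    have h2 : japBr (lam • ξ) ^ (k - j) ≤ 1 :=
      japBr_rpow_le_one _ (by have : (0 : ℝ) ≤ j := by positivity
                              linarith)
    have h3 := hb.derivSum_nonneg hlam j (m := 0) (by omega)
    have h4 := idxConst_nonneg n j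
    have h5 : 0 ≤ n * smoothingConst n μ N := by positivity
    calc idxConst n j * (smoothingConst n μ 0 * derivSum C j 0) * lam ^ j *
          japBr (lam • ξ) ^ (k - j)
        ≤ idxConst n j * (smoothingConst n μ 0 * derivSum C j 0) * lam ^ j * 1 := by gcongr
      _ = idxConst n j * smoothingConst n μ 0 * (lam ^ (j + 0) * derivSum C j 0) := by
        rw [add_zero]; ring
      _ ≤ idxConstSum n N * (0 + smoothingConst n μ 0) * W := by
        rw [zero_add]
        gcongr
        exact idxConst_le_sum hj
      _ ≤ _ := by gcongr

/-- A bound for the constants of a weight with at most `N` derivatives. -/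
def weightConst (N : ℕ) (B : ℕ → ℝ) : ℝ := ∑ j ∈ Finset.range (N + 1), B j * 3 ^ N

theorem weightConst_nonneg (N : ℕ) {B : ℕ → ℝ} (hB : ∀ j, 0 ≤ B j) : 0 ≤ weightConst N B :=
  Finset.sum_nonneg fun j _ => mul_nonneg (hB j) (by positivity)

/-- The weight should not contribute powers of λ to the estimate; they are discarded by means of λ ≤
3. -/
theorem HasFreqBounds.le_weightConst {lam s : ℝ} {B : ℕ → ℝ} {m : EucSp n → ℂ} {N : ℕ}
    (hlam : 0 < lam) (hlam3 : lam ≤ 3) (hB : ∀ j, 0 ≤ B j) (hm : HasFreqBounds lam s B m) {j : ℕ}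
    (hj : j ≤ N) (ξ : EucSp n) :
    ‖iteratedFDeriv ℝ j m ξ‖ ≤ weightConst N B * japBr (lam • ξ) ^ s := by
  have hJ := japBr_pos (lam • ξ)
  have hBj := hB j
  have h1 : lam ^ j ≤ 3 ^ N := (pow_le_pow_left₀ hlam.le hlam3 j).trans
    (pow_le_pow_right₀ (by norm_num) hj)
  calc _ ≤ B j * lam ^ j * japBr (lam • ξ) ^ (s - j) := hm.bound j ξ
    _ ≤ B j * 3 ^ N * japBr (lam • ξ) ^ s := by
      have := japBr_rpow_sub_natCast_le (lam • ξ) s j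
      gcongr
    _ ≤ _ := by
      gcongr
      exact Finset.single_le_sum (f := fun j => B j * 3 ^ N)
        (fun i _ => mul_nonneg (hB i) (by positivity)) (Finset.mem_range.mpr (by omega))

theorem iteratedFDeriv_mul_const_norm {f : EucSp n → ℂ} {i : ℕ} (hf : ContDiff ℝ i f) (c : ℂ)
    (x : EucSp n) : ‖iteratedFDeriv ℝ i (fun x => f x * c) x‖ = ‖c‖ * ‖iteratedFDeriv ℝ i f x‖ := by
  have h : (fun x => f x * c) = c • f := by
    funext x
    simp [mul_comm]
  rw [h, iteratedFDeriv_const_smul_apply hf.contDiffAt, norm_smul]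

section

variable {N μ : ℕ} {lam k s : ℝ} {C : MultiIdx n → MultiIdx n → ℝ} {b : EucSp n → EucSp n → ℂ}
  {B : ℕ → ℝ} {m : EucSp n → ℂ}

theorem IsScaledSymbol.norm_iteratedFDeriv_smoothed_mul_left (hb : IsScaledSymbol lam k μ C b)
    (hlam : 0 < lam) (hlam3 : lam ≤ 3) (hks : k + s ≤ 0) (hB : ∀ j, 0 ≤ B j)
    (hm : HasFreqBounds lam s B m) {i : ℕ} (hi : i ≤ N) (x ξ : EucSp n) :
    ‖iteratedFDeriv ℝ i (fun x => smoothed μ b x ξ * m ξ) x‖ ≤ weightConst N B * idxConstSum n N *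
      (smoothingConst n μ N * (lam ^ (0 + min i μ) * derivSum C 0 (min i μ))) := by
  rw [iteratedFDeriv_mul_const_norm ((hb.contDiff_smoothed_left ξ).of_le
    (by exact_mod_cast le_top)), zero_add]
  have h0 := hb.derivSum_nonneg hlam 0 (min_le_right i μ)
  have hI := idxConstSum_nonneg n N
  have hS := smoothingConst_nonneg n μ N
  have hw := weightConst_nonneg N hB
  have hJ := japBr_pos (lam • ξ)
  have h1 := hb.norm_iteratedFDeriv_smoothed_left hlam hi x ξ
  have h2 := hm.le_weightConst hlam hlam3 hB (N := N) (Nat.zero_le _) ξ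
  rw [norm_iteratedFDeriv_zero] at h2
  have h3 : japBr (lam • ξ) ^ s * japBr (lam • ξ) ^ k ≤ 1 := by
    rw [← Real.rpow_add hJ]
    exact japBr_rpow_le_one _ (by linarith)
  calc _ ≤ (weightConst N B * japBr (lam • ξ) ^ s) * (idxConstSum n N * (smoothingConst n μ N *
        (lam ^ min i μ * derivSum C 0 (min i μ) * japBr (lam • ξ) ^ k))) := by gcongr
    _ = weightConst N B * idxConstSum n N *
      (smoothingConst n μ N * (lam ^ min i μ * derivSum C 0 (min i μ))) *
        (japBr (lam • ξ) ^ s * japBr (lam • ξ) ^ k) := by ring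
    _ ≤ _ := mul_le_of_le_one_right (by positivity) h3

theorem HasFreqBounds.norm_iteratedFDeriv_mul_le (hlam : 0 < lam) (hlam3 : lam ≤ 3)
    (hks : k + s ≤ 0) (hB : ∀ j, 0 ≤ B j) (hm : HasFreqBounds lam s B m) {f : EucSp n → ℂ}
    (hf : ContDiff ℝ N f) {A : ℝ} (hA0 : 0 ≤ A) {ξ : EucSp n}
    (hA : ∀ j ≤ N, ‖iteratedFDeriv ℝ j f ξ‖ ≤ A * japBr (lam • ξ) ^ k) {j : ℕ} (hj : j ≤ N) :
    ‖iteratedFDeriv ℝ j (fun ξ => f ξ * m ξ) ξ‖ ≤ 2 ^ N * (A * weightConst N B) := by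
  have hw := weightConst_nonneg N hB
  have hJ := japBr_pos (lam • ξ)
  refine (norm_iteratedFDeriv_mul_le_of_le hf (hm.smooth.of_le (by exact_mod_cast le_top)) hA
    (fun j hj => hm.le_weightConst hlam hlam3 hB hj ξ) hj).trans ?_
  have h3 : japBr (lam • ξ) ^ k * japBr (lam • ξ) ^ s ≤ 1 := by
    rw [← Real.rpow_add hJ]
    exact japBr_rpow_le_one _ hks
  refine mul_le_mul_of_nonneg_left ?_ (by positivity)
  calc _ = A * weightConst N B * (japBr (lam • ξ) ^ k * japBr (lam • ξ) ^ s) := by ring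
    _ ≤ _ := mul_le_of_le_one_right (by positivity) h3

end

/-- The mirror image of `exists_isSlowlyVarying_smoothed`, with x and ξ exchanged: now each constant
carries at least one derivative in x. The weight m of order s is paired with the symbol of order k,
and k + s ≤ 0 makes the product of the brackets at most 1. -/
theorem exists_isSlowlyVarying_smoothed_mul (n μ : ℕ) (hμ : 1 ≤ μ) {B : ℕ → ℝ}
    (hB : ∀ j, 0 ≤ B j) : ∃ K : ℝ, 0 ≤ K ∧
    ∀ (lam k s : ℝ) (C : MultiIdx n → MultiIdx n → ℝ) (b : EucSp n → EucSp n → ℂ)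
    (m : EucSp n → ℂ), 0 < lam → lam ≤ 3 → k + s ≤ 0 → IsScaledSymbol lam k μ C b →
    HasFreqBounds lam s B m →
    IsSlowlyVarying (K * weightedSum lam C (Finset.range (matrixOrder n + 1))
      (Finset.Icc 1 (min (matrixOrder n) μ))) fun ξ x => smoothed μ b x ξ * m ξ := by
  set N := matrixOrder n with hN
  have hN1 : 1 ≤ N := by rw [hN, matrixOrder]; omega
  have hS := smoothingConst_nonneg n μ N
  have hI := idxConstSum_nonneg n N
  have hw := weightConst_nonneg N hB
  refine ⟨2 ^ N * (idxConstSum n N * (n * smoothingConst n μ N) * weightConst N B) +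
    weightConst N B * idxConstSum n N * smoothingConst n μ N, by positivity, ?_⟩
  intro lam k s C b m hlam hlam3 hks hb hm
  set M : Finset ℕ := Finset.Icc 1 (min N μ) with hM
  have hMμ : ∀ m ∈ M, m ≤ μ := fun m hm => by
    have := Finset.mem_Icc.mp hm
    omega
  set W := weightedSum lam C (Finset.range (N + 1)) M with hW
  have hW0 : 0 ≤ W := hb.weightedSum_nonneg hlam _ hMμ
  have hsl : ∀ ξ, ContDiff ℝ N fun x => smoothed μ b x ξ * m ξ := fun ξ =>
    ((hb.contDiff_smoothed_left ξ).mul contDiff_const).of_le (by exact_mod_cast le_top)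
  have hsr : ∀ x, ContDiff ℝ N fun ξ => smoothed μ b x ξ * m ξ := fun x =>
    ((hb.contDiff_smoothed_right x).mul hm.smooth).of_le (by exact_mod_cast le_top)
  refine ⟨aestronglyMeasurable_uncurry (fun ξ => (hsl ξ).continuous)
    fun x => (hsr x).continuous.aestronglyMeasurable, hsr, hsl, ?_, ?_, ?_⟩
  · refine ⟨weightConst N B * idxConstSum n N * (smoothingConst n μ N *
      (lam ^ (0 + min 0 μ) * derivSum C 0 (min 0 μ))), fun ξ x => ?_⟩
    have h := hb.norm_iteratedFDeriv_smoothed_mul_left hlam hlam3 hks hB hm (N := N)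
      (Nat.zero_le N) x ξ
    rwa [norm_iteratedFDeriv_zero] at h
  · intro j hj x x' ξ
    have h1 : (fun ξ => smoothed μ b x ξ * m ξ - smoothed μ b x' ξ * m ξ) =
        fun ξ => (smoothed μ b x ξ - smoothed μ b x' ξ) * m ξ := by
      funext ξ
      ring
    rw [h1]
    have h2 : ∀ i ≤ N, ‖iteratedFDeriv ℝ i (fun ξ => smoothed μ b x ξ - smoothed μ b x' ξ) ξ‖ ≤
        idxConstSum n N * (n * (smoothingConst n μ N * W) * ‖x - x'‖) * japBr (lam • ξ) ^ k := by
      intro i hi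
      refine (hb.norm_iteratedFDeriv_smoothed_sub_right hlam hμ hN1 hi x x' ξ).trans ?_
      have h3 : lam ^ (i + 1) * derivSum C i 1 ≤ W :=
        hb.le_weightedSum hlam hMμ (Finset.mem_range.mpr (by omega))
          (Finset.mem_Icc.mpr ⟨le_rfl, by omega⟩)
      have hJ := japBr_pos (lam • ξ)
      calc _ ≤ idxConstSum n N * (n * (smoothingConst n μ N * (W * japBr (lam • ξ) ^ k)) *
            ‖x - x'‖) := by gcongr
        _ = _ := by ring
    refine (hm.norm_iteratedFDeriv_mul_le hlam hlam3 hks hB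
      (((hb.contDiff_smoothed_right x).sub (hb.contDiff_smoothed_right x')).of_le
        (by exact_mod_cast le_top)) (by positivity) h2 hj).trans ?_
    calc _ = (2 ^ N * (idxConstSum n N * (n * smoothingConst n μ N) * weightConst N B) + 0) * W *
          ‖x - x'‖ := by ring
      _ ≤ _ := by gcongr; positivity
  · intro i hi1 hi ξ x
    refine (hb.norm_iteratedFDeriv_smoothed_mul_left hlam hlam3 hks hB hm hi x ξ).trans ?_
    -- Here i ≥ 1 and μ ≥ 1 place min i μ in the range starting at 1.
    have h3 : lam ^ (0 + min i μ) * derivSum C 0 (min i μ) ≤ W :=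
      hb.le_weightedSum hlam hMμ (Finset.mem_range.mpr (by omega))
        (Finset.mem_Icc.mpr (by omega))
    calc _ ≤ weightConst N B * idxConstSum n N * (smoothingConst n μ N * W) := by gcongr
      _ = (0 + weightConst N B * idxConstSum n N * smoothingConst n μ N) * W := by ring
      _ ≤ _ := by gcongr; positivity

-- The input for the plain norm bound of a smoothed symbol. Nothing is centered, so the constants of
-- order zero are included and the estimate is uniform in the reference point z.
set_option maxHeartbeats 1000000 in
theorem exists_isLocalSymbol_smoothed_mul (n μ : ℕ) {B : ℕ → ℝ}
    (hB : ∀ j, 0 ≤ B j) : ∃ K : ℝ, 0 ≤ K ∧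
    ∀ (lam k s : ℝ) (C : MultiIdx n → MultiIdx n → ℝ) (b : EucSp n → EucSp n → ℂ)
    (m : EucSp n → ℂ), 0 < lam → lam ≤ 3 → k + s ≤ 0 → IsScaledSymbol lam k μ C b →
    HasFreqBounds lam s B m → ∀ z,
    IsLocalSymbol (K * weightedSum lam C (Finset.range (matrixOrder n + 1))
      (Finset.range (min (matrixOrder n) μ + 1))) z fun x ξ => smoothed μ b x ξ * m ξ := by
  set N := matrixOrder n with hN
  have hS := smoothingConst_nonneg n μ N
  have hS0 := smoothingConst_nonneg n μ 0
  have hI := idxConstSum_nonneg n N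
  have hw := weightConst_nonneg N hB
  set K := 2 ^ N * (idxConstSum n N * smoothingConst n μ 0 * weightConst N B) +
    weightConst N B * idxConstSum n N * smoothingConst n μ N with hK
  have hK0 : 0 ≤ K := by positivity
  refine ⟨K, hK0, ?_⟩
  intro lam k s C b m hlam hlam3 hks hb hm z
  set M : Finset ℕ := Finset.range (min N μ + 1) with hM
  have hMμ : ∀ m ∈ M, m ≤ μ := fun m hm => by
    have := Finset.mem_range.mp hm
    omega
  set W := weightedSum lam C (Finset.range (N + 1)) M with hW
  have hW0 : 0 ≤ W := hb.weightedSum_nonneg hlam _ hMμ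
  have hsl : ∀ ξ, ContDiff ℝ N fun x => smoothed μ b x ξ * m ξ := fun ξ =>
    ((hb.contDiff_smoothed_left ξ).mul contDiff_const).of_le (by exact_mod_cast le_top)
  have hsr : ∀ x, ContDiff ℝ N fun ξ => smoothed μ b x ξ * m ξ := fun x =>
    ((hb.contDiff_smoothed_right x).mul hm.smooth).of_le (by exact_mod_cast le_top)
  have hfin : ∀ x ξ : EucSp n, K * W ≤ K * W * (1 + ‖x - z.1‖) * (1 + ‖ξ - z.2‖) := by
    intro x ξ
    rw [mul_assoc]
    refine le_mul_of_one_le_right (by positivity) ?_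
    nlinarith [norm_nonneg (x - z.1), norm_nonneg (ξ - z.2),
      mul_nonneg (norm_nonneg (x - z.1)) (norm_nonneg (ξ - z.2))]
  refine ⟨aestronglyMeasurable_uncurry (fun x => (hsr x).continuous)
    fun ξ => (hsl ξ).continuous.aestronglyMeasurable, hsl, hsr, ?_, ?_⟩
  · intro i hi x ξ
    refine ((hb.norm_iteratedFDeriv_smoothed_mul_left hlam hlam3 hks hB hm hi x ξ).trans ?_).trans
      (hfin x ξ)
    have h3 : lam ^ (0 + min i μ) * derivSum C 0 (min i μ) ≤ W :=
      hb.le_weightedSum hlam hMμ (Finset.mem_range.mpr (by omega))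
        (Finset.mem_range.mpr (by omega))
    calc _ ≤ weightConst N B * idxConstSum n N * (smoothingConst n μ N * W) := by gcongr
      _ = (0 + weightConst N B * idxConstSum n N * smoothingConst n μ N) * W := by ring
      _ ≤ _ := by rw [hK]; gcongr; positivity
  · intro j hj x ξ
    have h2 : ∀ i ≤ N, ‖iteratedFDeriv ℝ i (smoothed μ b x) ξ‖ ≤
        idxConstSum n N * (smoothingConst n μ 0 * W) * japBr (lam • ξ) ^ k := by
      intro i hi
      refine ((hb.hasFreqBounds_smoothed hlam x).bound i ξ).trans ?_
      have h3 : lam ^ (i + 0) * derivSum C i 0 ≤ W :=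
        hb.le_weightedSum hlam hMμ (Finset.mem_range.mpr (by omega))
          (Finset.mem_range.mpr (by omega))
      have hJ := japBr_pos (lam • ξ)
      have h4 := hb.derivSum_nonneg hlam i (m := 0) (by omega)
      have h5 := idxConst_nonneg n i
      calc _ = idxConst n i * (smoothingConst n μ 0 * (lam ^ (i + 0) * derivSum C i 0)) *
            japBr (lam • ξ) ^ (k - i) := by rw [add_zero]; ring
        _ ≤ _ := by
          have := japBr_rpow_sub_natCast_le (lam • ξ) k i
          have := idxConst_le_sum (n := n) hi
          gcongr
    have h6 : ContDiff ℝ N (smoothed μ b x) :=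
      (hb.contDiff_smoothed_right x).of_le (by exact_mod_cast le_top)
    have h7 : 0 ≤ idxConstSum n N * (smoothingConst n μ 0 * W) := by positivity
    refine ((hm.norm_iteratedFDeriv_mul_le hlam hlam3 hks hB h6 h7 h2 hj).trans ?_).trans
      (hfin x ξ)
    calc _ = (2 ^ N * (idxConstSum n N * smoothingConst n μ 0 * weightConst N B) + 0) * W := by
          ring
      _ ≤ _ := by rw [hK]; gcongr; positivity

end SmoothedSymbols

/-! ### Composition of scaled symbols: the six terms -/

noncomputable section ScaledComposition

variable {n : ℕ}

/-! ### Sums of constants -/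

theorem freqConv_nonneg {A B : ℕ → ℝ} (hA : ∀ j, 0 ≤ A j) (hB : ∀ j, 0 ≤ B j) (j : ℕ) :
    0 ≤ freqConv A B j :=
  Finset.sum_nonneg fun i _ => mul_nonneg (by positivity) (mul_nonneg (hA i) (hB _))

/-- The sum of the products `a i * b l` with `i + l ≤ N`. -/
def pairSum (N : ℕ) (a b : ℕ → ℝ) : ℝ :=
  ∑ i ∈ Finset.range (N + 1), ∑ l ∈ Finset.range (N + 1 - i), a i * b l

theorem pairSum_nonneg (N : ℕ) {a b : ℕ → ℝ} (ha : ∀ j, 0 ≤ a j) (hb : ∀ j, 0 ≤ b j) :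
    0 ≤ pairSum N a b :=
  Finset.sum_nonneg fun i _ => Finset.sum_nonneg fun l _ => mul_nonneg (ha i) (hb l)

theorem le_pairSum {N : ℕ} {a b : ℕ → ℝ} (ha : ∀ j, 0 ≤ a j) (hb : ∀ j, 0 ≤ b j) {i l : ℕ}
    (h : i + l ≤ N) : a i * b l ≤ pairSum N a b :=
  (Finset.single_le_sum (f := fun l => a i * b l) (fun l _ => mul_nonneg (ha i) (hb l))
    (Finset.mem_range.mpr (by omega))).trans
    (Finset.single_le_sum (f := fun i => ∑ l ∈ Finset.range (N + 1 - i), a i * b l)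
      (fun i _ => Finset.sum_nonneg fun l _ => mul_nonneg (ha i) (hb l))
      (Finset.mem_range.mpr (by omega)))

/-- The constants `t * a j`, with the dimensional factor `idxConst n j`. -/
def freqSeq (n : ℕ) (t : ℝ) (a : ℕ → ℝ) (j : ℕ) : ℝ := idxConst n j * (t * a j)

theorem freqSeq_nonneg {t : ℝ} (ht : 0 ≤ t) {a : ℕ → ℝ} (ha : ∀ j, 0 ≤ a j) (j : ℕ) :
    0 ≤ freqSeq n t a j :=
  mul_nonneg (idxConst_nonneg n j) (mul_nonneg ht (ha j))

theorem sum_freqSeq_le {t : ℝ} (ht : 0 ≤ t) {a : ℕ → ℝ} (ha : ∀ j, 0 ≤ a j) (N : ℕ) :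
    ∑ j ∈ Finset.range (N + 1), freqSeq n t a j ≤
      idxConstSum n N * (t * ∑ j ∈ Finset.range (N + 1), a j) := by
  rw [Finset.mul_sum, Finset.mul_sum]
  refine Finset.sum_le_sum fun j hj => ?_
  exact mul_le_mul_of_nonneg_right
    (idxConst_le_sum (Nat.lt_succ_iff.mp (Finset.mem_range.mp hj))) (mul_nonneg ht (ha j))

theorem freqConv_freqSeq_le {t : ℝ} {a B : ℕ → ℝ} (ht : 0 ≤ t)
    (hB : ∀ j, 0 ≤ B j) {X : ℝ} {j : ℕ} (hX : ∀ i ≤ j, a i ≤ X) :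
    freqConv (freqSeq n t a) B j ≤ freqConv (idxConst n) B j * (t * X) := by
  rw [freqConv, freqConv, Finset.sum_mul]
  refine Finset.sum_le_sum fun i hi => ?_
  have h1 := hX i (Nat.lt_succ_iff.mp (Finset.mem_range.mp hi))
  have h2 := idxConst_nonneg n i
  have h3 := hB (j - i)
  calc (j.choose i : ℝ) * (freqSeq n t a i * B (j - i))
      = (j.choose i : ℝ) * (idxConst n i * B (j - i)) * (t * a i) := by rw [freqSeq]; ring
    _ ≤ _ := by gcongr

theorem sum_freqConv_freqSeq_le {t : ℝ} {a B : ℕ → ℝ} (ht : 0 ≤ t) (ha : ∀ j, 0 ≤ a j)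
    (hB : ∀ j, 0 ≤ B j) (N : ℕ) :
    ∑ j ∈ Finset.range (N + 1), freqConv (freqSeq n t a) B j ≤
      (∑ j ∈ Finset.range (N + 1), freqConv (idxConst n) B j) *
        (t * ∑ j ∈ Finset.range (N + 1), a j) := by
  rw [Finset.sum_mul]
  refine Finset.sum_le_sum fun j hj => freqConv_freqSeq_le ht hB fun i hi => ?_
  exact Finset.single_le_sum (fun i _ => ha i)
    (Finset.mem_range.mpr (by have := Finset.mem_range.mp hj; omega))

/-- By Leibniz the derivatives of a product are shared between the factors, at most N in total. This
produces the constraint |α₁| + |α₂| ≤ d in the final bound, where N = n + 1 = d; the derivatives of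
the weight go into the constant. -/
theorem sum_freqConv_freqConv_le {t t' : ℝ} {a a' B : ℕ → ℝ} (ht : 0 ≤ t) (ht' : 0 ≤ t')
    (ha : ∀ j, 0 ≤ a j) (ha' : ∀ j, 0 ≤ a' j) (hB : ∀ j, 0 ≤ B j) (N : ℕ) :
    ∑ j ∈ Finset.range (N + 1), freqConv (freqSeq n t a) (freqConv (freqSeq n t' a') B) j ≤
      (∑ j ∈ Finset.range (N + 1), freqConv (idxConst n) (freqConv (idxConst n) B) j) *
        (t * t' * pairSum N a a') := by
  rw [Finset.sum_mul]
  refine Finset.sum_le_sum fun j hj => ?_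
  have hj' : j ≤ N := Nat.lt_succ_iff.mp (Finset.mem_range.mp hj)
  rw [freqConv, freqConv, Finset.sum_mul]
  refine Finset.sum_le_sum fun i hi => ?_
  have hi' : i ≤ j := Nat.lt_succ_iff.mp (Finset.mem_range.mp hi)
  have h2 := idxConst_nonneg n i
  have h4 : a i * freqConv (freqSeq n t' a') B (j - i) ≤
      freqConv (idxConst n) B (j - i) * (t' * pairSum N a a') := by
    have h5 : a i * freqConv (freqSeq n t' a') B (j - i) =
        freqConv (freqSeq n t' fun l => a i * a' l) B (j - i) := by
      rw [freqConv, freqConv, Finset.mul_sum]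
      refine Finset.sum_congr rfl fun l _ => ?_
      rw [freqSeq, freqSeq]
      ring
    rw [h5]
    exact freqConv_freqSeq_le ht' hB fun l hl => le_pairSum ha ha' (by omega)
  calc _ = (j.choose i : ℝ) * idxConst n i * t * (a i * freqConv (freqSeq n t' a') B (j - i)) := by
        rw [freqSeq]; ring
    _ ≤ (j.choose i : ℝ) * idxConst n i * t *
        (freqConv (idxConst n) B (j - i) * (t' * pairSum N a a')) := by gcongr
    _ = _ := by ring

theorem add_le_add_mul_add {a b K L x y : ℝ} (ha : a ≤ K * x) (hb : b ≤ L * y) (hK : 0 ≤ K)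
    (hL : 0 ≤ L) (hx : 0 ≤ x) (hy : 0 ≤ y) : a + b ≤ (K + L) * (x + y) := by
  nlinarith [mul_nonneg hK hy, mul_nonneg hL hx]

theorem sum_six_le {a b c d e f K₁ K₂ K₃ K₄ K₅ K₆ x₁ x₂ x₃ x₄ x₅ x₆ : ℝ} (ha : a ≤ K₁ * x₁)
    (hb : b ≤ K₂ * x₂) (hc : c ≤ K₃ * x₃) (hd : d ≤ K₄ * x₄) (he : e ≤ K₅ * x₅)
    (hf : f ≤ K₆ * x₆) (k₁ : 0 ≤ K₁) (k₂ : 0 ≤ K₂) (k₃ : 0 ≤ K₃) (k₄ : 0 ≤ K₄) (k₅ : 0 ≤ K₅)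
    (k₆ : 0 ≤ K₆) (y₁ : 0 ≤ x₁) (y₂ : 0 ≤ x₂) (y₃ : 0 ≤ x₃) (y₄ : 0 ≤ x₄) (y₅ : 0 ≤ x₅)
    (y₆ : 0 ≤ x₆) : a + b + c + d + e + f ≤
      (K₁ + K₂ + K₃ + K₄ + K₅ + K₆) * (x₁ + x₂ + x₃ + x₄ + x₅ + x₆) := by
  refine add_le_add_mul_add ?_ hf (by positivity) k₆ (by positivity) y₆
  refine add_le_add_mul_add ?_ he (by positivity) k₅ (by positivity) y₅
  refine add_le_add_mul_add ?_ hd (by positivity) k₄ (by positivity) y₄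
  refine add_le_add_mul_add ?_ hc (by positivity) k₃ (by positivity) y₃
  exact add_le_add_mul_add ha hb k₁ k₂ y₁ y₂

/-! ### Operators -/

theorem isAEBounded_of_hasFreqBounds {lam κ : ℝ} {B : ℕ → ℝ} {b : EucSp n → EucSp n → ℂ}
    (hκ : κ ≤ 0) (hB : ∀ j, 0 ≤ B j) (hb : ∀ᵐ x, HasFreqBounds lam κ B (b x)) :
    IsAEBounded b := by
  filter_upwards [hb] with x hx
  refine ⟨hx.smooth.continuous, B 0, fun ξ => ?_⟩
  have h := hx.bound 0 ξ
  rw [norm_iteratedFDeriv_zero, pow_zero, mul_one] at h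
  exact h.trans (mul_le_of_le_one_right (hB 0) (japBr_rpow_le_one _ (by simpa using hκ)))

theorem exists_isKN_of_hasFreqBounds (n : ℕ) {κ : ℝ} (hκ : κ < 0) : ∃ K : ℝ, 0 ≤ K ∧
    ∀ (lam : ℝ) (B : ℕ → ℝ) (b : EucSp n → EucSp n → ℂ), 0 < lam → (∀ j, 0 ≤ B j) →
    AEStronglyMeasurable (Function.uncurry b) (volume.prod volume) →
    (∀ᵐ x, HasFreqBounds lam κ B (b x)) →
    ∃ T, IsKN b T ∧ ‖T‖ ≤ K * ∑ j ∈ Finset.range (n + 1 + 1), B j := by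
  obtain ⟨K, hK, h⟩ := exists_isKN_of_isSchurSymbol n hκ
  exact ⟨K, hK, fun lam B b hlam hB hm hb => h lam _ b hlam (Finset.sum_nonneg fun j _ => hB j)
    (isSchurSymbol_of_hasFreqBounds hlam hB hm hb)⟩

/-- The constants of the function `1`. -/
def oneSeq (j : ℕ) : ℝ := if j = 0 then 1 else 0

theorem oneSeq_nonneg (j : ℕ) : 0 ≤ oneSeq j := by unfold oneSeq; split_ifs <;> norm_num

theorem hasFreqBounds_one (lam : ℝ) : HasFreqBounds lam 0 oneSeq fun _ : EucSp n => (1 : ℂ) where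
  smooth := contDiff_const
  bound j ξ := by
    rcases Nat.eq_zero_or_pos j with rfl | h
    · simp [oneSeq]
    · rw [iteratedFDeriv_const_of_ne (by omega)]
      simp [oneSeq, h.ne']

/-- The bound for the operator with a smoothed symbol. -/
def fullSum (lam : ℝ) (C : MultiIdx n → MultiIdx n → ℝ) (μ : ℕ) : ℝ :=
  weightedSum lam C (Finset.range (matrixOrder n + 1)) (Finset.range (min (matrixOrder n) μ + 1))

theorem exists_norm_smoothed_mul_le (n μ : ℕ) {B : ℕ → ℝ} (hB : ∀ j, 0 ≤ B j) :
    ∃ K : ℝ, 0 ≤ K ∧ ∀ (lam k s : ℝ) (C : MultiIdx n → MultiIdx n → ℝ)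
    (b : EucSp n → EucSp n → ℂ) (m : EucSp n → ℂ) (T : L2Sp n →L[ℂ] L2Sp n), 0 < lam →
    lam ≤ 3 → k + s ≤ 0 → IsScaledSymbol lam k μ C b → HasFreqBounds lam s B m →
    IsKN (fun x ξ => smoothed μ b x ξ * m ξ) T → ‖T‖ ≤ K * fullSum lam C μ := by
  obtain ⟨K, hK, h⟩ := exists_isLocalSymbol_smoothed_mul n μ hB
  obtain ⟨K', hK', h'⟩ := norm_le_of_isLocalSymbol n
  refine ⟨K' * K, by positivity, fun lam k s C b m T hlam hlam3 hks hb hm hT => ?_⟩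
  have h0 : 0 ≤ fullSum lam C μ := hb.weightedSum_nonneg hlam _ fun m hm => by
    have := Finset.mem_range.mp hm
    omega
  rw [mul_assoc]
  exact h' _ _ T (mul_nonneg hK h0) (h lam k s C b m hlam hlam3 hks hb hm) hT

theorem exists_norm_smoothed_le (n μ : ℕ) : ∃ K : ℝ, 0 ≤ K ∧ ∀ (lam k : ℝ)
    (C : MultiIdx n → MultiIdx n → ℝ) (b : EucSp n → EucSp n → ℂ) (T : L2Sp n →L[ℂ] L2Sp n),
    0 < lam → lam ≤ 3 → k ≤ 0 → IsScaledSymbol lam k μ C b →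
    IsKN (smoothed μ b) T → ‖T‖ ≤ K * fullSum lam C μ := by
  obtain ⟨K, hK, h⟩ := exists_norm_smoothed_mul_le n μ oneSeq_nonneg
  refine ⟨K, hK, fun lam k C b T hlam hlam3 hk hb hT => ?_⟩
  refine h lam k 0 C b (fun _ => 1) T hlam hlam3 (by linarith) hb (hasFreqBounds_one lam) ?_
  simpa only [mul_one] using hT

/-- The part of `fullSum` with derivatives in the frequency. -/
def freqSum (lam : ℝ) (C : MultiIdx n → MultiIdx n → ℝ) (μ : ℕ) : ℝ :=
  weightedSum lam C (Finset.Icc 1 (matrixOrder n)) (Finset.range (min (matrixOrder n) μ + 1))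

/-- The part of `fullSum` with derivatives in the position. -/
def posSum (lam : ℝ) (C : MultiIdx n → MultiIdx n → ℝ) (μ : ℕ) : ℝ :=
  weightedSum lam C (Finset.range (matrixOrder n + 1)) (Finset.Icc 1 (min (matrixOrder n) μ))

/-- The bound for the operator with the remainder of the smoothing as symbol. -/
def topSum (lam : ℝ) (C : MultiIdx n → MultiIdx n → ℝ) (μ : ℕ) : ℝ :=
  lam ^ μ * ∑ j ∈ Finset.range (n + 1 + 1), derivSum C j μ

section

variable {lam k : ℝ} {μ : ℕ} {C : MultiIdx n → MultiIdx n → ℝ} {b : EucSp n → EucSp n → ℂ}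

theorem IsScaledSymbol.fullSum_nonneg (hb : IsScaledSymbol lam k μ C b) (hlam : 0 < lam) :
    0 ≤ fullSum lam C μ :=
  hb.weightedSum_nonneg hlam _ fun m hm => by have := Finset.mem_range.mp hm; omega

theorem IsScaledSymbol.freqSum_nonneg (hb : IsScaledSymbol lam k μ C b) (hlam : 0 < lam) :
    0 ≤ freqSum lam C μ :=
  hb.weightedSum_nonneg hlam _ fun m hm => by have := Finset.mem_range.mp hm; omega

theorem IsScaledSymbol.posSum_nonneg (hb : IsScaledSymbol lam k μ C b) (hlam : 0 < lam) :
    0 ≤ posSum lam C μ :=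
  hb.weightedSum_nonneg hlam _ fun m hm => by have := Finset.mem_Icc.mp hm; omega

theorem IsScaledSymbol.topSum_nonneg (hb : IsScaledSymbol lam k μ C b) (hlam : 0 < lam) :
    0 ≤ topSum lam C μ :=
  mul_nonneg (by positivity) (Finset.sum_nonneg fun j _ => hb.derivSum_nonneg hlam j le_rfl)

theorem IsScaledSymbol.ae_freqSeq (hb : IsScaledSymbol lam k μ C b) (hlam : 0 < lam) :
    ∀ᵐ x, HasFreqBounds lam k (freqSeq n 1 fun j => derivSum C j 0) (b x) := by
  have h : freqSeq n 1 (fun j => derivSum C j 0) = fun j => idxConst n j * derivSum C j 0 := by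
    funext j
    rw [freqSeq, one_mul]
  rw [h]
  exact hb.ae_hasFreqBounds hlam

theorem IsScaledSymbol.freqSeq_smoothed (hb : IsScaledSymbol lam k μ C b) (hlam : 0 < lam)
    (x : EucSp n) : HasFreqBounds lam k
      (freqSeq n (smoothingConst n μ 0) fun j => derivSum C j 0) (smoothed μ b x) :=
  hb.hasFreqBounds_smoothed hlam x

theorem IsScaledSymbol.ae_freqSeq_sub (hb : IsScaledSymbol lam k μ C b) (hlam : 0 < lam) :
    ∀ᵐ x, HasFreqBounds lam k (freqSeq n ((n : ℝ) ^ μ * lam ^ μ) fun j => derivSum C j μ)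
      fun ξ => b x ξ - smoothed μ b x ξ := by
  have h : freqSeq n ((n : ℝ) ^ μ * lam ^ μ) (fun j => derivSum C j μ) =
      fun j => idxConst n j * ((n : ℝ) ^ μ * (lam ^ μ * derivSum C j μ)) := by
    funext j
    rw [freqSeq, mul_assoc ((n : ℝ) ^ μ)]
  rw [h]
  exact hb.ae_hasFreqBounds_sub hlam

end

-- With bᵢ = bᵢ♯ + rᵢ the defect is the sum of six operators. The defect of the smooth parts is
-- bounded by slow variation. The compositions b₁♯·r₂, r₁·b₂♯ and r₁·r₂ are bounded by products of
-- norms, each remainder through its top-order constants. The quantized products b₁♯r₂ and r₁b₂ are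
-- bounded as single symbols of negative order k₁ + k₂ + s.
set_option maxHeartbeats 1000000 in
theorem exists_norm_comp_sub_le (n : ℕ) {k₁ k₂ s : ℝ} (hk₁ : k₁ < 0) (hk₂ : k₂ + s < 0)
    {μ₁ μ₂ : ℕ} (hμ₂ : 1 ≤ μ₂) : ∃ K : ℝ, 0 ≤ K ∧
    ∀ (lam : ℝ) (C₁ C₂ : MultiIdx n → MultiIdx n → ℝ) (b₁ b₂ : EucSp n → EucSp n → ℂ),
    0 < lam → lam ≤ 3 → IsScaledSymbol lam k₁ μ₁ C₁ b₁ → IsScaledSymbol lam k₂ μ₂ C₂ b₂ →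
    ∃ T₁ T₂ T₁₂ : L2Sp n →L[ℂ] L2Sp n, IsKN b₁ T₁ ∧
      IsKN (fun x ξ => b₂ x ξ * freqWeight lam s ξ) T₂ ∧
      IsKN (fun x ξ => b₁ x ξ * (b₂ x ξ * freqWeight lam s ξ)) T₁₂ ∧
      ‖T₁ ∘L T₂ - T₁₂‖ ≤ K * (freqSum lam C₁ μ₁ * posSum lam C₂ μ₂ +
        fullSum lam C₁ μ₁ * topSum lam C₂ μ₂ +
        lam ^ μ₂ * pairSum (n + 1) (fun j => derivSum C₁ j 0) (fun j => derivSum C₂ j μ₂) +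
        topSum lam C₁ μ₁ * fullSum lam C₂ μ₂ + topSum lam C₁ μ₁ * topSum lam C₂ μ₂ +
        lam ^ μ₁ * pairSum (n + 1) (fun j => derivSum C₁ j μ₁) (fun j => derivSum C₂ j 0)) := by
  obtain ⟨B, hB, hBm⟩ := exists_hasFreqBounds_freqWeight n s
  obtain ⟨KS₁, hKS₁, hS₁⟩ := exists_isKN_of_hasFreqBounds n hk₁
  obtain ⟨KS₂, hKS₂, hS₂⟩ := exists_isKN_of_hasFreqBounds n hk₂
  obtain ⟨KS₃, hKS₃, hS₃⟩ := exists_isKN_of_hasFreqBounds n (add_neg hk₁ hk₂)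
  obtain ⟨KA, hKA, hA⟩ := exists_isSlowlyVarying_smoothed n μ₁
  obtain ⟨KD, hKD, hD⟩ := exists_isSlowlyVarying_smoothed_mul n μ₂ hμ₂ hB
  obtain ⟨KR, hKR, hR⟩ := norm_comp_sub_le n
  obtain ⟨KV₁, hKV₁, hV₁⟩ := exists_norm_smoothed_le n μ₁
  obtain ⟨KV₂, hKV₂, hV₂⟩ := exists_norm_smoothed_mul_le n μ₂ hB
  have hS0₁ := smoothingConst_nonneg n μ₁ 0
  have hS0₂ := smoothingConst_nonneg n μ₂ 0
  have hI := idxConstSum_nonneg n (n + 1)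
  have hIs := idxConst_nonneg n
  set F₁ : ℝ := ∑ j ∈ Finset.range (n + 1 + 1), freqConv (idxConst n) B j with hF₁
  set F₂ : ℝ := ∑ j ∈ Finset.range (n + 1 + 1), freqConv (idxConst n) (freqConv (idxConst n) B) j
    with hF₂
  have hF₁0 : 0 ≤ F₁ := Finset.sum_nonneg fun j _ => freqConv_nonneg hIs hB j
  have hF₂0 : 0 ≤ F₂ := Finset.sum_nonneg fun j _ =>
    freqConv_nonneg hIs (freqConv_nonneg hIs hB) j
  refine ⟨KR * (KA * KD) + KV₁ * (KS₂ * (F₁ * (n : ℝ) ^ μ₂)) +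
    KS₃ * (F₂ * (smoothingConst n μ₁ 0 * (n : ℝ) ^ μ₂)) +
    KS₁ * (idxConstSum n (n + 1) * (n : ℝ) ^ μ₁) * KV₂ +
    KS₁ * (idxConstSum n (n + 1) * (n : ℝ) ^ μ₁) * (KS₂ * (F₁ * (n : ℝ) ^ μ₂)) +
    KS₃ * (F₂ * (n : ℝ) ^ μ₁), by positivity, ?_⟩
  have c1 : 0 ≤ KR * (KA * KD) := by positivity
  have c2 : 0 ≤ KV₁ * (KS₂ * (F₁ * (n : ℝ) ^ μ₂)) := by positivity
  have c3 : 0 ≤ KS₃ * (F₂ * (smoothingConst n μ₁ 0 * (n : ℝ) ^ μ₂)) := by positivity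
  have c4 : 0 ≤ KS₁ * (idxConstSum n (n + 1) * (n : ℝ) ^ μ₁) * KV₂ := by positivity
  have c5 : 0 ≤ KS₁ * (idxConstSum n (n + 1) * (n : ℝ) ^ μ₁) *
    (KS₂ * (F₁ * (n : ℝ) ^ μ₂)) := by positivity
  have c6 : 0 ≤ KS₃ * (F₂ * (n : ℝ) ^ μ₁) := by positivity
  intro lam C₁ C₂ b₁ b₂ hlam hlam3 hb₁ hb₂
  have hm := hBm lam hlam
  set m : EucSp n → ℂ := freqWeight lam s with hmdef
  have d₁ : ∀ j, 0 ≤ derivSum C₁ j 0 := fun j => hb₁.derivSum_nonneg hlam j (Nat.zero_le _)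
  have d₂ : ∀ j, 0 ≤ derivSum C₂ j 0 := fun j => hb₂.derivSum_nonneg hlam j (Nat.zero_le _)
  have e₁ : ∀ j, 0 ≤ derivSum C₁ j μ₁ := fun j => hb₁.derivSum_nonneg hlam j le_rfl
  have e₂ : ∀ j, 0 ≤ derivSum C₂ j μ₂ := fun j => hb₂.derivSum_nonneg hlam j le_rfl
  have t₁ : 0 ≤ (n : ℝ) ^ μ₁ * lam ^ μ₁ := by positivity
  have t₂ : 0 ≤ (n : ℝ) ^ μ₂ * lam ^ μ₂ := by positivity
  have mm : AEStronglyMeasurable (fun p : EucSp n × EucSp n => m p.2)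
      ((volume : Measure (EucSp n)).prod (volume : Measure (EucSp n))) :=
    (hm.smooth.continuous.comp continuous_snd).aestronglyMeasurable
  have ms₁ := hb₁.aestronglyMeasurable_smoothed
  have ms₂ := hb₂.aestronglyMeasurable_smoothed
  have mr₁ := hb₁.aestronglyMeasurable.sub ms₁
  have mr₂ := hb₂.aestronglyMeasurable.sub ms₂
  have q₁ := hb₁.freqSeq_smoothed hlam
  have q₂ : ∀ x, HasFreqBounds lam (k₂ + s)
    (freqConv (freqSeq n (smoothingConst n μ₂ 0) fun j => derivSum C₂ j 0) B)
    fun ξ => smoothed μ₂ b₂ x ξ * m ξ := fun x => (hb₂.freqSeq_smoothed hlam x).mul hm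
  have q₃ : ∀ᵐ x, HasFreqBounds lam (k₂ + s)
      (freqConv (freqSeq n ((n : ℝ) ^ μ₂ * lam ^ μ₂) fun j => derivSum C₂ j μ₂) B)
      fun ξ => (b₂ x ξ - smoothed μ₂ b₂ x ξ) * m ξ := by
    filter_upwards [hb₂.ae_freqSeq_sub hlam] with x hx
    exact hx.mul hm
  have q₄ : ∀ᵐ x, HasFreqBounds lam (k₂ + s)
      (freqConv (freqSeq n 1 fun j => derivSum C₂ j 0) B) fun ξ => b₂ x ξ * m ξ := by
    filter_upwards [hb₂.ae_freqSeq hlam] with x hx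
    exact hx.mul hm
  have q₅ := hb₁.ae_freqSeq_sub hlam
  have n₁ := freqSeq_nonneg (n := n) hS0₁ d₁
  have n₂ := freqConv_nonneg (freqSeq_nonneg (n := n) hS0₂ d₂) hB
  have n₃ := freqConv_nonneg (freqSeq_nonneg (n := n) t₂ e₂) hB
  have n₄ := freqConv_nonneg (freqSeq_nonneg (n := n) zero_le_one d₂) hB
  have n₅ := freqSeq_nonneg (n := n) t₁ e₁
  obtain ⟨T₁, hT₁, -⟩ := hS₁ lam _ _ hlam n₁ ms₁ (Filter.Eventually.of_forall q₁)
  obtain ⟨R₁, hR₁, nR₁⟩ := hS₁ lam _ (fun x ξ => b₁ x ξ - smoothed μ₁ b₁ x ξ) hlam n₅ mr₁ q₅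
  obtain ⟨T₂, hT₂, -⟩ := hS₂ lam _ (fun x ξ => smoothed μ₂ b₂ x ξ * m ξ) hlam n₂ (ms₂.mul mm)
    (Filter.Eventually.of_forall q₂)
  obtain ⟨R₂, hR₂, nR₂⟩ := hS₂ lam _ (fun x ξ => (b₂ x ξ - smoothed μ₂ b₂ x ξ) * m ξ) hlam n₃
    (mr₂.mul mm) q₃
  obtain ⟨U, hU, -⟩ := hS₃ lam _ (fun x ξ => smoothed μ₁ b₁ x ξ * (smoothed μ₂ b₂ x ξ * m ξ))
    hlam (freqConv_nonneg n₁ n₂) (ms₁.mul (ms₂.mul mm))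
    (Filter.Eventually.of_forall fun x => (q₁ x).mul (q₂ x))
  obtain ⟨V, hV, nV⟩ := hS₃ lam _
    (fun x ξ => smoothed μ₁ b₁ x ξ * ((b₂ x ξ - smoothed μ₂ b₂ x ξ) * m ξ))
    hlam (freqConv_nonneg n₁ n₃) (ms₁.mul (mr₂.mul mm))
    (by filter_upwards [q₃] with x hx; exact (q₁ x).mul hx)
  -- The factor b₂ is left unsmoothed here, so that r₁b₂ covers both r₁b₂♯ and r₁r₂.
  obtain ⟨W, hW, nW⟩ := hS₃ lam _
    (fun x ξ => (b₁ x ξ - smoothed μ₁ b₁ x ξ) * (b₂ x ξ * m ξ))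
    hlam (freqConv_nonneg n₅ n₄) (mr₁.mul (hb₂.aestronglyMeasurable.mul mm))
    (by filter_upwards [q₅, q₄] with x hx hx'; exact hx.mul hx')
  have aT₁ := isAEBounded_of_hasFreqBounds hk₁.le n₁ (Filter.Eventually.of_forall q₁)
  have aR₁ := isAEBounded_of_hasFreqBounds hk₁.le n₅ q₅
  have aT₂ := isAEBounded_of_hasFreqBounds hk₂.le n₂ (Filter.Eventually.of_forall q₂)
  have aR₂ := isAEBounded_of_hasFreqBounds hk₂.le n₃ q₃
  have aB₂ := isAEBounded_of_hasFreqBounds hk₂.le n₄ q₄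
  refine ⟨T₁ + R₁, T₂ + R₂, U + V + W, ?_, ?_, ?_, ?_⟩
  · exact (hT₁.add hR₁ aT₁ aR₁).congr_ae (Filter.Eventually.of_forall fun x ξ => by ring)
  · exact (hT₂.add hR₂ aT₂ aR₂).congr_ae (Filter.Eventually.of_forall fun x ξ => by ring)
  · exact ((hU.add hV (aT₁.mul aT₂) (aT₁.mul aR₂)).add hW
      ((aT₁.mul aT₂).add (aT₁.mul aR₂)) (aR₁.mul aB₂)).congr_ae
      (Filter.Eventually.of_forall fun x ξ => by ring)
  have f₁ := hb₁.fullSum_nonneg hlam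
  have f₂ := hb₂.fullSum_nonneg hlam
  have g₁ := hb₁.topSum_nonneg hlam
  have g₂ := hb₂.topSum_nonneg hlam
  have w₁ := hb₁.freqSum_nonneg hlam
  have w₂ := hb₂.posSum_nonneg hlam
  have p₁ := pairSum_nonneg (n + 1) d₁ e₂
  have p₂ := pairSum_nonneg (n + 1) e₁ d₂
  have b1 : ‖T₁ ∘L T₂ - U‖ ≤ KR * (KA * KD) * (freqSum lam C₁ μ₁ * posSum lam C₂ μ₂) := by
    refine (hR _ _ _ _ T₁ T₂ U (mul_nonneg hKA w₁) (mul_nonneg hKD w₂)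
      (hA lam k₁ C₁ b₁ hlam hk₁.le hb₁) (hD lam k₂ s C₂ b₂ m hlam hlam3 hk₂.le hb₂ hm)
      (fun x => (q₂ x).hasTemperateGrowth hlam hk₂.le) hT₁ hT₂ hU).trans_eq ?_
    rw [freqSum, posSum]
    ring
  have bT₁ : ‖T₁‖ ≤ KV₁ * fullSum lam C₁ μ₁ := hV₁ lam k₁ C₁ b₁ T₁ hlam hlam3 hk₁.le hb₁ hT₁
  have bT₂ : ‖T₂‖ ≤ KV₂ * fullSum lam C₂ μ₂ :=
    hV₂ lam k₂ s C₂ b₂ m T₂ hlam hlam3 hk₂.le hb₂ hm hT₂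
  have bR₁ : ‖R₁‖ ≤ KS₁ * (idxConstSum n (n + 1) * (n : ℝ) ^ μ₁) * topSum lam C₁ μ₁ := by
    refine nR₁.trans ?_
    have := sum_freqSeq_le (n := n) t₁ e₁ (n + 1)
    calc _ ≤ KS₁ * (idxConstSum n (n + 1) * ((n : ℝ) ^ μ₁ * lam ^ μ₁ *
          ∑ j ∈ Finset.range (n + 1 + 1), derivSum C₁ j μ₁)) := by gcongr
      _ = _ := by rw [topSum]; ring
  have bR₂ : ‖R₂‖ ≤ KS₂ * (F₁ * (n : ℝ) ^ μ₂) * topSum lam C₂ μ₂ := by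
    refine nR₂.trans ?_
    have := sum_freqConv_freqSeq_le (n := n) t₂ e₂ hB (n + 1)
    calc _ ≤ KS₂ * (F₁ * ((n : ℝ) ^ μ₂ * lam ^ μ₂ *
          ∑ j ∈ Finset.range (n + 1 + 1), derivSum C₂ j μ₂)) := by gcongr
      _ = _ := by rw [topSum]; ring
  have b2 : ‖T₁ ∘L R₂‖ ≤ KV₁ * (KS₂ * (F₁ * (n : ℝ) ^ μ₂)) *
      (fullSum lam C₁ μ₁ * topSum lam C₂ μ₂) := by
    refine (ContinuousLinearMap.opNorm_comp_le _ _).trans ?_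
    calc _ ≤ (KV₁ * fullSum lam C₁ μ₁) *
          (KS₂ * (F₁ * (n : ℝ) ^ μ₂) * topSum lam C₂ μ₂) := by gcongr
      _ = _ := by ring
  have b3 : ‖V‖ ≤ KS₃ * (F₂ * (smoothingConst n μ₁ 0 * (n : ℝ) ^ μ₂)) * (lam ^ μ₂ *
      pairSum (n + 1) (fun j => derivSum C₁ j 0) (fun j => derivSum C₂ j μ₂)) := by
    refine nV.trans ?_
    have := sum_freqConv_freqConv_le (n := n) hS0₁ t₂ d₁ e₂ hB (n + 1)
    calc _ ≤ KS₃ * (F₂ * (smoothingConst n μ₁ 0 * ((n : ℝ) ^ μ₂ * lam ^ μ₂) *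
          pairSum (n + 1) (fun j => derivSum C₁ j 0) (fun j => derivSum C₂ j μ₂))) := by gcongr
      _ = _ := by ring
  have b4 : ‖R₁ ∘L T₂‖ ≤ KS₁ * (idxConstSum n (n + 1) * (n : ℝ) ^ μ₁) * KV₂ *
      (topSum lam C₁ μ₁ * fullSum lam C₂ μ₂) := by
    refine (ContinuousLinearMap.opNorm_comp_le _ _).trans ?_
    calc _ ≤ (KS₁ * (idxConstSum n (n + 1) * (n : ℝ) ^ μ₁) * topSum lam C₁ μ₁) *
          (KV₂ * fullSum lam C₂ μ₂) := by gcongr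
      _ = _ := by ring
  have b5 : ‖R₁ ∘L R₂‖ ≤ KS₁ * (idxConstSum n (n + 1) * (n : ℝ) ^ μ₁) *
      (KS₂ * (F₁ * (n : ℝ) ^ μ₂)) * (topSum lam C₁ μ₁ * topSum lam C₂ μ₂) := by
    refine (ContinuousLinearMap.opNorm_comp_le _ _).trans ?_
    calc _ ≤ (KS₁ * (idxConstSum n (n + 1) * (n : ℝ) ^ μ₁) * topSum lam C₁ μ₁) *
          (KS₂ * (F₁ * (n : ℝ) ^ μ₂) * topSum lam C₂ μ₂) := by gcongr
      _ = _ := by ring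
  have b6 : ‖W‖ ≤ KS₃ * (F₂ * (n : ℝ) ^ μ₁) * (lam ^ μ₁ *
      pairSum (n + 1) (fun j => derivSum C₁ j μ₁) (fun j => derivSum C₂ j 0)) := by
    refine nW.trans ?_
    have := sum_freqConv_freqConv_le (n := n) t₁ zero_le_one e₁ d₂ hB (n + 1)
    calc _ ≤ KS₃ * (F₂ * ((n : ℝ) ^ μ₁ * lam ^ μ₁ * 1 *
          pairSum (n + 1) (fun j => derivSum C₁ j μ₁) (fun j => derivSum C₂ j 0))) := by gcongr
      _ = _ := by ring
  -- Only the difference T₁T₂ - U exploits cancellation; the other five terms are estimated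
  -- separately.
  have hsplit : (T₁ + R₁) ∘L (T₂ + R₂) - (U + V + W) = (T₁ ∘L T₂ - U) + T₁ ∘L R₂ + -V +
      R₁ ∘L T₂ + R₁ ∘L R₂ + -W := by
    simp only [ContinuousLinearMap.comp_add, ContinuousLinearMap.add_comp]
    abel
  rw [hsplit]
  have hn : ‖(T₁ ∘L T₂ - U) + T₁ ∘L R₂ + -V + R₁ ∘L T₂ + R₁ ∘L R₂ + -W‖ ≤
      ‖T₁ ∘L T₂ - U‖ + ‖T₁ ∘L R₂‖ + ‖V‖ + ‖R₁ ∘L T₂‖ + ‖R₁ ∘L R₂‖ + ‖W‖ := by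
    refine (norm_add_le _ _).trans (add_le_add ?_ (norm_neg W).le)
    refine (norm_add_le _ _).trans (add_le_add ?_ le_rfl)
    refine (norm_add_le _ _).trans (add_le_add ?_ le_rfl)
    refine (norm_add_le _ _).trans (add_le_add ?_ (norm_neg V).le)
    exact norm_add_le _ _
  exact hn.trans (sum_six_le b1 b2 b3 b4 b5 b6 c1 c2 c3 c4 c5 c6 (mul_nonneg w₁ w₂)
    (mul_nonneg f₁ g₂) (mul_nonneg (pow_nonneg hlam.le _) p₁) (mul_nonneg g₁ f₂)
    (mul_nonneg g₁ g₂) (mul_nonneg (pow_nonneg hlam.le _) p₂))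

end ScaledComposition

/-! ### Composition with a multiplication operator -/

noncomputable section ScaledCommutator

variable {n : ℕ}

/-! ### Functions as symbols -/

theorem multiD_const_eq_zero {c : ℂ} {α : MultiIdx n} (hα : α ≠ 0) (ξ : EucSp n) :
    multiD α (fun _ => c) ξ = 0 := by
  -- A constant is its own composition with the dilation of factor 0, so the chain rule produces
  -- 0^|α|.
  have h := congrFun (multiD_comp_smul (c := 0) (fun _ : EucSp n => c) α) ξ
  have h1 : α.len ≠ 0 := fun h1 => hα (funext fun i =>
    Finset.sum_eq_zero_iff.mp h1 i (Finset.mem_univ i))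
  rw [h, zero_pow h1, zero_smul]

theorem hasWeakDeriv_zero (β : MultiIdx n) : HasWeakDeriv β (fun _ : EucSp n => (0 : ℂ))
    fun _ => 0 where
  locallyIntegrable_left := locallyIntegrable_const 0
  locallyIntegrable_right := locallyIntegrable_const 0
  integral_eq φ _ _ := by simp

/-- The constants of a function `g(x)`, viewed as a symbol. -/
def funConst (C : MultiIdx n → ℝ) (α β : MultiIdx n) : ℝ := if α = 0 then C β else 0

theorem IsFunSymbol.isScaledSymbol {lam : ℝ} {μ : ℕ} {C : MultiIdx n → ℝ} {g : EucSp n → ℂ}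
    (hg : IsFunSymbol μ (fun β => lam ^ β.len * C β) g) :
    IsScaledSymbol lam 0 μ (funConst C) fun x _ => g x where
  smooth _ := contDiff_const
  bound α ξ := by
    by_cases hα : α = 0
    · subst hα
      simpa [funConst, multiD_zero] using hg
    · intro β _
      refine ⟨fun _ => 0, ?_, ?_⟩
      · simp only [multiD_const_eq_zero hα]
        exact hasWeakDeriv_zero β
      · simp [funConst, hα]

theorem idxEq_zero : idxEq n 0 = {0} := by
  ext α
  rw [mem_idxEq, Finset.mem_singleton]
  exact ⟨fun h => funext fun i => Finset.sum_eq_zero_iff.mp h i (Finset.mem_univ i),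
    fun h => by rw [h, MultiIdx.len_zero]⟩

theorem derivSum_funConst_zero (C : MultiIdx n → ℝ) (m : ℕ) :
    derivSum (funConst C) 0 m = ∑ β ∈ idxEq n m, C β := by
  rw [derivSum, idxEq_zero, Finset.sum_singleton]
  simp [funConst]

theorem derivSum_funConst_of_ne {j : ℕ} (hj : j ≠ 0) (C : MultiIdx n → ℝ) (m : ℕ) :
    derivSum (funConst C) j m = 0 := by
  refine Finset.sum_eq_zero fun α hα => Finset.sum_eq_zero fun β _ => ?_
  rw [funConst, if_neg]
  rintro rfl
  rw [mem_idxEq, MultiIdx.len_zero] at hα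
  exact hj hα.symm

theorem posSum_funConst (lam : ℝ) (C : MultiIdx n → ℝ) (μ : ℕ) :
    posSum lam (funConst C) μ =
      ∑ m ∈ Finset.Icc 1 (min (matrixOrder n) μ), lam ^ m * ∑ β ∈ idxEq n m, C β := by
  rw [posSum, weightedSum, Finset.sum_eq_single_of_mem 0 (by simp)]
  · simp only [derivSum_funConst_zero, zero_add]
  · intro j _ hj
    simp [derivSum_funConst_of_ne hj]

theorem hasTemperateGrowth_const_fun (c : ℂ) :
    (fun _ : EucSp n => c).HasTemperateGrowth := by fun_prop

/-! ### Commutators -/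

theorem norm_comp_sub_comp_le (S G : L2Sp n →L[ℂ] L2Sp n) {a b : ℝ} (hS : ‖S‖ ≤ a) (hG : ‖G‖ ≤ b) :
    ‖S ∘L G - G ∘L S‖ ≤ 2 * (a * b) := by
  have h1 : ‖S ∘L G‖ ≤ a * b := (ContinuousLinearMap.opNorm_comp_le _ _).trans
    (mul_le_mul hS hG (norm_nonneg _) ((norm_nonneg _).trans hS))
  have h2 : ‖G ∘L S‖ ≤ b * a := (ContinuousLinearMap.opNorm_comp_le _ _).trans
    (mul_le_mul hG hS (norm_nonneg _) ((norm_nonneg _).trans hG))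
  refine (norm_sub_le _ _).trans ?_
  linarith

-- Multiplication by g after T quantizes b₁g exactly, so the defect is the commutator TG - GT. The
-- pair of smooth parts is handled by slow variation. The remaining commutators are bounded by twice
-- the product of the norms, and multiplications are bounded by suprema: hence only C₂ 0 accompanies
-- the remainder of b₁, and the remainder of g needs no decay in ξ.
set_option maxHeartbeats 400000 in
theorem exists_norm_commutator_le (n : ℕ) {k₁ : ℝ} (hk₁ : k₁ < 0) {μ₁ μ₂ : ℕ} (hμ₂ : 1 ≤ μ₂) :
    ∃ K : ℝ, 0 ≤ K ∧ ∀ (lam : ℝ) (C₁ : MultiIdx n → MultiIdx n → ℝ) (C₂ : MultiIdx n → ℝ)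
    (b₁ : EucSp n → EucSp n → ℂ) (g : EucSp n → ℂ), 0 < lam → lam ≤ 3 →
    IsScaledSymbol lam k₁ μ₁ C₁ b₁ → IsFunSymbol μ₂ (fun β => lam ^ β.len * C₂ β) g →
    ∃ T G T₁₂ : L2Sp n →L[ℂ] L2Sp n, IsKN b₁ T ∧ IsKN (fun x _ => g x) G ∧
      IsKN (fun x ξ => b₁ x ξ * g x) T₁₂ ∧
      ‖T ∘L G - T₁₂‖ ≤ K * (freqSum lam C₁ μ₁ * posSum lam (funConst C₂) μ₂ +
        fullSum lam C₁ μ₁ * (lam ^ μ₂ * ∑ β ∈ idxEq n μ₂, C₂ β) +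
        topSum lam C₁ μ₁ * C₂ 0) := by
  obtain ⟨KS, hKS, hS⟩ := exists_isKN_of_hasFreqBounds n hk₁
  obtain ⟨KA, hKA, hA⟩ := exists_isSlowlyVarying_smoothed n μ₁
  obtain ⟨KD, hKD, hD⟩ := exists_isSlowlyVarying_smoothed_mul n μ₂ hμ₂ oneSeq_nonneg
  obtain ⟨KR, hKR, hR⟩ := norm_comp_sub_le n
  obtain ⟨KV, hKV, hV⟩ := exists_norm_smoothed_le n μ₁
  have hS0 := smoothingConst_nonneg n μ₁ 0
  have hS0₂ := smoothingConst_nonneg n μ₂ 0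
  have hI := idxConstSum_nonneg n (n + 1)
  have c1 : 0 ≤ KR * (KA * KD) := by positivity
  have c2 : 0 ≤ 2 * (KV * (n : ℝ) ^ μ₂) := by positivity
  have c3 : 0 ≤ 2 * (KS * (idxConstSum n (n + 1) * (n : ℝ) ^ μ₁)) := by positivity
  refine ⟨KR * (KA * KD) + 2 * (KV * (n : ℝ) ^ μ₂) +
    2 * (KS * (idxConstSum n (n + 1) * (n : ℝ) ^ μ₁)), by positivity, ?_⟩
  intro lam C₁ C₂ b₁ g hlam hlam3 hb₁ hg
  have hb₂ := hg.isScaledSymbol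
  have d₁ : ∀ j, 0 ≤ derivSum C₁ j 0 := fun j => hb₁.derivSum_nonneg hlam j (Nat.zero_le _)
  have e₁ : ∀ j, 0 ≤ derivSum C₁ j μ₁ := fun j => hb₁.derivSum_nonneg hlam j le_rfl
  have e₂ := hb₂.derivSum_nonneg hlam 0 le_rfl
  rw [derivSum_funConst_zero] at e₂
  have hC0 : 0 ≤ C₂ 0 := by simpa using hg.nonneg (β := 0) (by simp)
  have t₁ : 0 ≤ (n : ℝ) ^ μ₁ * lam ^ μ₁ := by positivity
  have ms₁ := hb₁.aestronglyMeasurable_smoothed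
  have mr₁ := hb₁.aestronglyMeasurable.sub ms₁
  have q₁ := hb₁.freqSeq_smoothed hlam
  have q₅ := hb₁.ae_freqSeq_sub hlam
  have n₁ := freqSeq_nonneg (n := n) hS0 d₁
  have n₅ := freqSeq_nonneg (n := n) t₁ e₁
  obtain ⟨S, hTS, -⟩ := hS lam _ _ hlam n₁ ms₁ (Filter.Eventually.of_forall q₁)
  obtain ⟨R, hTR, nR⟩ := hS lam _ (fun x ξ => b₁ x ξ - smoothed μ₁ b₁ x ξ) hlam n₅ mr₁ q₅
  have aS := isAEBounded_of_hasFreqBounds hk₁.le n₁ (Filter.Eventually.of_forall q₁)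
  have aR := isAEBounded_of_hasFreqBounds hk₁.le n₅ q₅
  have hT : IsKN b₁ (S + R) :=
    (hTS.add hTR aS aR).congr_ae (Filter.Eventually.of_forall fun x ξ => by ring)
  set g' : EucSp n → ℂ := kernelConv (smoothingKernel n μ₂) g with hg'
  have mg := hg.locallyIntegrable.aestronglyMeasurable
  have mg' : AEStronglyMeasurable g' volume :=
    (hb₂.contDiff_smoothed_left 0).continuous.aestronglyMeasurable
  have bg' : ∀ᵐ x, ‖g' x‖ ≤ (∫ y, ‖smoothingKernel n μ₂ y‖) * C₂ 0 :=
    Filter.Eventually.of_forall fun x => by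
      have h := hg.norm_kernelConv_le (hasCompactSupport_smoothingKernel n μ₂)
        (contDiff_smoothingKernel n μ₂) (β := 0) (by simp) 0 x
      simpa [multiD_zero] using h
  have br : ∀ᵐ x, ‖g x - g' x‖ ≤ (n : ℝ) ^ μ₂ * (lam ^ μ₂ * ∑ β ∈ idxEq n μ₂, C₂ β) := by
    filter_upwards [hg.ae_norm_sub_le] with x hx
    refine hx.trans_eq ?_
    rw [Finset.mul_sum (idxEq n μ₂) C₂]
    congr 1
    refine Finset.sum_congr rfl fun β hβ => ?_
    rw [mem_idxEq.mp hβ]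
  obtain ⟨G, hG, nG⟩ := exists_clm_mul mg hC0 (by simpa using hg.ae_norm_le)
  obtain ⟨G', hG', -⟩ := exists_clm_mul mg'
    (mul_nonneg (integral_nonneg fun _ => norm_nonneg _) hC0) bg'
  obtain ⟨Gr, hGr, nGr⟩ := exists_clm_mul (mg.sub mg')
    (mul_nonneg (by positivity) (mul_nonneg (by positivity) e₂)) br
  have hGsplit : G = G' + Gr := by
    refine ContinuousLinearMap.ext fun u => Lp.ext ?_
    filter_upwards [hG u, hG' u, hGr u, Lp.coeFn_add (G' u) (Gr u)] with x h1 h2 h3 h4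
    rw [add_apply, h4, Pi.add_apply, h1, h2, h3, Pi.sub_apply]
    ring
  -- The quantized product is taken to be G ∘ T, which turns the defect into a commutator.
  refine ⟨S + R, G, G ∘L (S + R), hT, isKN_of_mul hG,
    (isKN_mul_left hG hT).congr_ae (Filter.Eventually.of_forall fun x ξ => mul_comm _ _), ?_⟩
  have b1 : ‖S ∘L G' - G' ∘L S‖ ≤
      KR * (KA * KD) * (freqSum lam C₁ μ₁ * posSum lam (funConst C₂) μ₂) := by
    have hsv := hD lam 0 0 (funConst C₂) (fun x _ => g x) (fun _ => 1) hlam hlam3 (by simp) hb₂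
      (hasFreqBounds_one lam)
    simp only [mul_one] at hsv
    have h12 : IsKN (fun x ξ => smoothed μ₁ b₁ x ξ * g' x) (G' ∘L S) :=
      (isKN_mul_left hG' hTS).congr_ae (Filter.Eventually.of_forall fun x ξ => mul_comm _ _)
    refine (hR _ _ _ (fun x _ => g' x) S G' (G' ∘L S)
      (mul_nonneg hKA (hb₁.freqSum_nonneg hlam)) (mul_nonneg hKD (hb₂.posSum_nonneg hlam))
      (hA lam k₁ C₁ b₁ hlam hk₁.le hb₁) hsv
      (fun x => hasTemperateGrowth_const_fun _) hTS (isKN_of_mul hG') h12).trans_eq ?_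
    rw [freqSum, posSum]
    ring
  have b2 := norm_comp_sub_comp_le S Gr (hV lam k₁ C₁ b₁ S hlam hlam3 hk₁.le hb₁ hTS) nGr
  have bR : ‖R‖ ≤ KS * (idxConstSum n (n + 1) * (n : ℝ) ^ μ₁) * topSum lam C₁ μ₁ := by
    refine nR.trans ?_
    have := sum_freqSeq_le (n := n) t₁ e₁ (n + 1)
    calc _ ≤ KS * (idxConstSum n (n + 1) * ((n : ℝ) ^ μ₁ * lam ^ μ₁ *
          ∑ j ∈ Finset.range (n + 1 + 1), derivSum C₁ j μ₁)) := by gcongr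
      _ = _ := by rw [topSum]; ring
  have b3 := norm_comp_sub_comp_le R G bR nG
  -- The remainder R is paired with all of G rather than with its two parts, so that its term
  -- contains only the supremum of g.
  have hsplit : (S + R) ∘L G - G ∘L (S + R) =
      (S ∘L G' - G' ∘L S) + (S ∘L Gr - Gr ∘L S) + (R ∘L G - G ∘L R) := by
    rw [hGsplit]
    simp only [ContinuousLinearMap.comp_add, ContinuousLinearMap.add_comp]
    abel
  rw [hsplit]
  have b2' : ‖S ∘L Gr - Gr ∘L S‖ ≤ 2 * (KV * (n : ℝ) ^ μ₂) *
      (fullSum lam C₁ μ₁ * (lam ^ μ₂ * ∑ β ∈ idxEq n μ₂, C₂ β)) := b2.trans_eq (by ring)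
  have b3' : ‖R ∘L G - G ∘L R‖ ≤ 2 * (KS * (idxConstSum n (n + 1) * (n : ℝ) ^ μ₁)) *
      (topSum lam C₁ μ₁ * C₂ 0) := b3.trans_eq (by ring)
  refine norm_add₃_le.trans ?_
  have w1 := mul_nonneg (hb₁.freqSum_nonneg hlam) (hb₂.posSum_nonneg hlam)
  have w2 := mul_nonneg (hb₁.fullSum_nonneg hlam) (mul_nonneg (pow_nonneg hlam.le μ₂) e₂)
  have w3 := mul_nonneg (hb₁.topSum_nonneg hlam) hC0
  exact add_le_add_mul_add (add_le_add_mul_add b1 b2' c1 c2 w1 w2) b3'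
    (add_nonneg c1 c2) c3 (add_nonneg w1 w2) w3

end ScaledCommutator

/-! ### Dilation to unit scale and reduction of Sobolev norms to L² -/

noncomputable section Dilation

variable {n : ℕ}

/-! ### Dilation of functions -/

theorem map_dilation {lam : ℝ} (hlam : lam ≠ 0) :
    Measure.map (fun x : EucSp n => lam • x) volume =
      ENNReal.ofReal |(lam ^ n)⁻¹| • (volume : Measure (EucSp n)) := by
  simpa using Measure.map_addHaar_smul (volume : Measure (EucSp n)) hlam

theorem quasiMeasurePreserving_dilation {lam : ℝ} (hlam : lam ≠ 0) :
    Measure.QuasiMeasurePreserving (fun x : EucSp n => lam • x) volume volume :=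
  ⟨(continuous_const_smul lam).measurable, by
    rw [map_dilation hlam]
    exact Measure.smul_absolutelyContinuous⟩

theorem ae_dilation {lam : ℝ} (hlam : lam ≠ 0) {P : EucSp n → Prop} (hP : ∀ᵐ x, P x) :
    ∀ᵐ x, P (lam • x) :=
  (quasiMeasurePreserving_dilation hlam).ae hP

theorem eLpNorm_dilation {lam : ℝ} (hlam : lam ≠ 0) (u : EucSp n → ℂ) :
    eLpNorm (fun x => u (lam • x)) 2 volume =
      ENNReal.ofReal (|(lam ^ n)⁻¹| ^ (1 / 2 : ℝ)) * eLpNorm u 2 volume := by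
  have h := (Homeomorph.smulOfNeZero lam hlam :
    EucSp n ≃ₜ EucSp n).measurableEmbedding.eLpNorm_map_measure (g := u) (p := 2)
    (μ := (volume : Measure (EucSp n)))
  change eLpNorm u 2 (Measure.map (fun x : EucSp n => lam • x) volume) =
    eLpNorm (fun x => u (lam • x)) 2 volume at h
  rw [← h, map_dilation hlam, eLpNorm_smul_measure_of_ne_top (by simp), smul_eq_mul,
    ← ENNReal.ofReal_rpow_of_nonneg (abs_nonneg _) (by norm_num)]
  simp

theorem exists_clm_dilation {lam : ℝ} (hlam : lam ≠ 0) : ∃ D : L2Sp n →L[ℂ] L2Sp n,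
    (∀ u : L2Sp n, D u =ᵐ[volume] fun x => u (lam • x)) ∧
    ‖D‖ ≤ |(lam ^ n)⁻¹| ^ (1 / 2 : ℝ) := by
  have hq := quasiMeasurePreserving_dilation (n := n) hlam
  have hm : ∀ u : L2Sp n, MemLp (fun x => u (lam • x)) 2 volume := fun u =>
    ⟨(Lp.aestronglyMeasurable u).comp_quasiMeasurePreserving hq, by
      rw [eLpNorm_dilation hlam]
      exact ENNReal.mul_lt_top ENNReal.ofReal_lt_top (Lp.memLp u).2⟩
  let D : L2Sp n →ₗ[ℂ] L2Sp n :=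
    { toFun := fun u => (hm u).toLp
      map_add' := fun u v => by
        rw [← MemLp.toLp_add]
        refine MemLp.toLp_congr _ _ ?_
        filter_upwards [ae_dilation hlam (Lp.coeFn_add u v)] with x hx
        rw [hx, Pi.add_apply, Pi.add_apply]
      map_smul' := fun c u => by
        rw [RingHom.id_apply, ← MemLp.toLp_const_smul]
        refine MemLp.toLp_congr _ _ ?_
        filter_upwards [ae_dilation hlam (Lp.coeFn_smul c u)] with x hx
        rw [hx, Pi.smul_apply, Pi.smul_apply] }
  refine ⟨D.mkContinuous (|(lam ^ n)⁻¹| ^ (1 / 2 : ℝ)) fun u => ?_, fun u => (hm u).coeFn_toLp,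
    LinearMap.mkContinuous_norm_le _ (by positivity) _⟩
  change ‖(hm u).toLp‖ ≤ _
  rw [Lp.norm_toLp, eLpNorm_dilation hlam, ENNReal.toReal_mul,
    ENNReal.toReal_ofReal (by positivity), Lp.norm_def]

theorem locallyIntegrable_dilation {lam : ℝ} (hlam : lam ≠ 0) {u : EucSp n → ℂ}
    (hu : LocallyIntegrable u) : LocallyIntegrable fun x => u (lam • x) := by
  have h := locallyIntegrable_map_homeomorph (Homeomorph.smulOfNeZero lam hlam :
    EucSp n ≃ₜ EucSp n) (f := u) (μ := (volume : Measure (EucSp n)))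
  change LocallyIntegrable u (Measure.map (fun x : EucSp n => lam • x) volume) ↔
    LocallyIntegrable (fun x => u (lam • x)) volume at h
  rw [← h, map_dilation hlam]
  intro x
  obtain ⟨s, hs, hi⟩ := hu x
  refine ⟨s, hs, ?_⟩
  rw [IntegrableOn, Measure.restrict_smul]
  exact hi.smul_measure ENNReal.ofReal_ne_top

theorem HasWeakDeriv.dilation {β : MultiIdx n} {u v : EucSp n → ℂ} (h : HasWeakDeriv β u v)
    {lam : ℝ} (hlam : lam ≠ 0) (c : ℝ) :
    HasWeakDeriv β (fun x => c • u (lam • x)) fun x => (c * lam ^ β.len) • v (lam • x) where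
  locallyIntegrable_left := (locallyIntegrable_dilation hlam h.locallyIntegrable_left).smul c
  locallyIntegrable_right :=
    (locallyIntegrable_dilation hlam h.locallyIntegrable_right).smul (c * lam ^ β.len)
  integral_eq φ hφ hc := by
    -- The weak identity for u is tested with the inversely dilated function; the Jacobians agree on
    -- both sides and each derivative leaves one factor lam.
    set ψ : EucSp n → ℝ := fun y => φ (lam⁻¹ • y) with hψ
    have h1 := h.integral_eq ψ (hφ.comp (contDiff_const_smul _))
      (hc.comp_homeomorph (Homeomorph.smulOfNeZero lam⁻¹ (inv_ne_zero hlam)))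
    have e1 : ∀ x : EucSp n, multiD β φ x • c • u (lam • x) =
        (fun y => c • lam ^ β.len • (multiD β ψ y • u y)) (lam • x) := by
      intro x
      have h2 := congrFun (multiD_comp_smul (c := lam⁻¹) φ β) (lam • x)
      simp only [hψ] at h2 ⊢
      rw [h2, smul_smul lam⁻¹ lam, inv_mul_cancel₀ hlam, one_smul, smul_eq_mul, inv_pow,
        smul_smul (lam ^ β.len), mul_inv_cancel_left₀ (pow_ne_zero _ hlam), smul_comm]
    have e2 : ∀ x : EucSp n, φ x • (c * lam ^ β.len) • v (lam • x) =
        (fun y => c • lam ^ β.len • (ψ y • v y)) (lam • x) := by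
      intro x
      simp only [hψ]
      rw [smul_smul lam⁻¹ lam, inv_mul_cancel₀ hlam, one_smul, smul_comm, mul_smul]
    rw [integral_congr_ae (Filter.Eventually.of_forall e1),
      integral_congr_ae (Filter.Eventually.of_forall e2),
      Measure.integral_comp_smul volume (fun y => c • lam ^ β.len • (multiD β ψ y • u y)),
      Measure.integral_comp_smul volume (fun y => c • lam ^ β.len • (ψ y • v y)), integral_smul,
      integral_smul, integral_smul, integral_smul, h1]
    simp only [Complex.real_smul]
    push_cast
    ring

/-! ### Dilation of symbols -/

/-- By the chain rule each derivative in x or ξ contributes a factor of modulus λ. The reflection in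
ξ comes from the sign in the phase of `opFun` and is invisible in the estimates, which involve only
|ξ|. -/
theorem IsSymbol.isScaledSymbol {k : ℝ} {μ : ℕ} {C : MultiIdx n → MultiIdx n → ℝ}
    {a : EucSp n → EucSp n → ℂ} (ha : IsSymbol k μ C a) {lam : ℝ} (hlam : 0 < lam) :
    IsScaledSymbol lam k μ C fun x ξ => a (lam • x) ((-lam) • ξ) where
  smooth x := (ha.smooth _).comp (contDiff_const_smul _)
  bound α ξ β hβ := by
    obtain ⟨v, hv, hb⟩ := ha.bound α β hβ ((-lam) • ξ)
    refine ⟨fun x => ((-lam) ^ α.len * lam ^ β.len) • v (lam • x), ?_, ?_⟩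
    · have h := hv.dilation hlam.ne' ((-lam) ^ α.len)
      have e : ∀ x, multiD α (fun ξ => a (lam • x) ((-lam) • ξ)) ξ =
          (-lam) ^ α.len • multiD α (a (lam • x)) ((-lam) • ξ) := fun x =>
        congrFun (multiD_comp_smul (c := -lam) (a (lam • x)) α) ξ
      simpa only [e] using h
    · filter_upwards [ae_dilation hlam.ne' hb] with x hx
      have hj : japBr ((-lam) • ξ) = japBr (lam • ξ) := by simp [japBr, norm_smul]
      rw [hj] at hx
      rw [norm_smul, norm_mul, norm_pow, norm_pow, norm_neg, Real.norm_of_nonneg hlam.le, ← pow_add,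
        mul_assoc]
      gcongr

theorem IsFunSymbol.dilation {μ : ℕ} {C : MultiIdx n → ℝ} {g : EucSp n → ℂ}
    (hg : IsFunSymbol μ C g) {lam : ℝ} (hlam : 0 < lam) :
    IsFunSymbol μ (fun β => lam ^ β.len * C β) fun x => g (lam • x) := by
  intro β hβ
  obtain ⟨v, hv, hb⟩ := hg β hβ
  refine ⟨fun x => (1 * lam ^ β.len) • v (lam • x),
    by simpa only [one_smul] using hv.dilation hlam.ne' 1, ?_⟩
  filter_upwards [ae_dilation hlam.ne' hb] with x hx
  rw [one_mul, norm_smul, norm_pow, Real.norm_of_nonneg hlam.le]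
  gcongr

/-! ### Dilation of operators -/

/-- The substitution ξ = -2πhη converts the phase of `opFun` into the two Fourier phases, and its
Jacobian cancels the prefactor (2πh)^(-n). -/
theorem opFun_eq_knFun {h : ℝ} (hh : 0 < h) (a : EucSp n → EucSp n → ℂ) (f : 𝓢(EucSp n, ℂ)) :
    opFun h a f = knFun (fun x η => a x ((-(2 * Real.pi * h)) • η)) f := by
  funext x
  have hc : 0 < 2 * Real.pi * h := by positivity
  rw [knFun, Real.fourierInv_eq']
  set G : EucSp n → ℂ := fun ξ => ∫ y, Complex.exp (-(Complex.I / (h : ℂ)) *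
    ((inner ℝ (x - y) ξ : ℝ) : ℂ)) * a x ξ * f y with hG
  have key : ∀ η : EucSp n, Complex.exp (((2 * Real.pi * inner ℝ η x : ℝ) : ℂ) * Complex.I) •
      (a x ((-(2 * Real.pi * h)) • η) * 𝓕 (f : EucSp n → ℂ) η) =
        G ((-(2 * Real.pi * h)) • η) := by
    intro η
    rw [Real.fourier_eq', hG]
    simp only [smul_eq_mul]
    rw [← integral_const_mul, ← integral_const_mul]
    congr 1
    funext y
    have he : Complex.exp (-(Complex.I / (h : ℂ)) *
          ((inner ℝ (x - y) ((-(2 * Real.pi * h)) • η) : ℝ) : ℂ)) =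
        Complex.exp (((2 * Real.pi * inner ℝ η x : ℝ) : ℂ) * Complex.I) *
          Complex.exp (((-2 * Real.pi * inner ℝ y η : ℝ) : ℂ) * Complex.I) := by
      rw [← Complex.exp_add]
      congr 1
      rw [real_inner_smul_right, inner_sub_left, real_inner_comm x η]
      have : (h : ℂ) ≠ 0 := by exact_mod_cast hh.ne'
      push_cast
      field_simp
      ring
    rw [he]
    ring
  have h2 := Measure.integral_comp_smul (volume : Measure (EucSp n)) G (-(2 * Real.pi * h))
  simp_rw [key]
  rw [h2]
  simp only [opFun, finrank_euclideanSpace, Fintype.card_fin]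
  congr 1
  rw [abs_inv, abs_pow, abs_neg, abs_of_pos hc]

theorem fourier_dilation {lam : ℝ} (hlam : lam ≠ 0) (f : EucSp n → ℂ) (ξ : EucSp n) :
    𝓕 (fun x => f (lam • x)) ξ = |(lam ^ n)⁻¹| • 𝓕 f (lam⁻¹ • ξ) := by
  rw [Real.fourier_eq', Real.fourier_eq']
  have h := Measure.integral_comp_smul (volume : Measure (EucSp n)) (fun y =>
    Complex.exp (((-2 * Real.pi * inner ℝ y (lam⁻¹ • ξ) : ℝ) : ℂ) * Complex.I) • f y) lam
  rw [finrank_euclideanSpace, Fintype.card_fin] at h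
  rw [← h]
  congr 1
  funext x
  rw [inner_smul_left, inner_smul_right]
  simp only [conj_trivial]
  rw [mul_inv_cancel_left₀ hlam]

/-- The dilated Schwartz function `f(lam x)`. -/
def dilateSchwartz {lam : ℝ} (hlam : lam ≠ 0) (f : 𝓢(EucSp n, ℂ)) : 𝓢(EucSp n, ℂ) :=
  SchwartzMap.compCLMOfContinuousLinearEquiv ℂ
    (ContinuousLinearEquiv.smulLeft (Units.mk0 lam hlam)) f

theorem dilateSchwartz_apply {lam : ℝ} (hlam : lam ≠ 0) (f : 𝓢(EucSp n, ℂ)) (x : EucSp n) :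
    dilateSchwartz hlam f x = f (lam • x) := rfl

theorem knFun_dilation {lam : ℝ} (hlam : lam ≠ 0) (c : EucSp n → EucSp n → ℂ)
    (f : 𝓢(EucSp n, ℂ)) (x : EucSp n) :
    knFun (fun x ξ => c (lam • x) (lam⁻¹ • ξ)) (dilateSchwartz hlam f) x =
      knFun c f (lam • x) := by
  have hF : 𝓕 ((dilateSchwartz hlam f : 𝓢(EucSp n, ℂ)) : EucSp n → ℂ) =
      fun ξ => |(lam ^ n)⁻¹| • 𝓕 (f : EucSp n → ℂ) (lam⁻¹ • ξ) :=
    funext fun ξ => fourier_dilation hlam f ξ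
  rw [knFun, knFun, hF, Real.fourierInv_eq', Real.fourierInv_eq']
  have h := Measure.integral_comp_smul (volume : Measure (EucSp n)) (fun η =>
    Complex.exp (((2 * Real.pi * inner ℝ η (lam • x) : ℝ) : ℂ) * Complex.I) •
      (c (lam • x) η * 𝓕 (f : EucSp n → ℂ) η)) lam⁻¹
  rw [finrank_euclideanSpace, Fintype.card_fin] at h
  have h0 : |(lam ^ n)⁻¹| * |(lam⁻¹ ^ n)⁻¹| = 1 := by
    rw [← abs_mul, inv_pow, inv_inv, inv_mul_cancel₀ (pow_ne_zero _ hlam), abs_one]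
  have h1 := congrArg (fun z => |(lam ^ n)⁻¹| • z) h
  simp only [smul_smul |(lam ^ n)⁻¹|, h0, one_smul] at h1
  rw [← h1, ← integral_smul]
  congr 1
  funext ξ
  rw [inner_smul_left, inner_smul_right]
  simp only [conj_trivial, smul_eq_mul, Complex.real_smul]
  rw [inv_mul_cancel_left₀ hlam]
  ring

/-- Conjugation by the dilation transforms the quantization with `h = 1 / 2π` into `Op_h`. -/
theorem exists_dilation_conjugation {h : ℝ} (hh : 0 < h) :
    ∃ D E : L2Sp n →L[ℂ] L2Sp n, D ∘L E = ContinuousLinearMap.id ℂ _ ∧ ‖D‖ * ‖E‖ ≤ 1 ∧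
    ∀ (a : EucSp n → EucSp n → ℂ) (T : L2Sp n →L[ℂ] L2Sp n),
      IsKN (fun x ξ => a (√(2 * Real.pi * h) • x) ((-√(2 * Real.pi * h)) • ξ)) T →
      IsOpL2 h a (E ∘L T ∘L D) := by
  have hc : 0 < 2 * Real.pi * h := by positivity
  set lam : ℝ := √(2 * Real.pi * h) with hlamdef
  have hlam : 0 < lam := Real.sqrt_pos.mpr hc
  -- The frequency scale 2πh is distributed evenly over position and frequency; this makes all
  -- derivatives gain the same factor lam.
  have hlam2 : lam * lam = 2 * Real.pi * h := Real.mul_self_sqrt hc.le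
  obtain ⟨D, hD, nD⟩ := exists_clm_dilation (n := n) hlam.ne'
  obtain ⟨E, hE, nE⟩ := exists_clm_dilation (n := n) (inv_ne_zero hlam.ne')
  refine ⟨D, E, ?_, ?_, ?_⟩
  · refine ContinuousLinearMap.ext fun u => Lp.ext ?_
    filter_upwards [hD (E u), ae_dilation hlam.ne' (hE u)] with x h1 h2
    rw [ContinuousLinearMap.comp_apply, h1, h2, smul_smul, inv_mul_cancel₀ hlam.ne', one_smul]
    rfl
  · refine (mul_le_mul nD nE (norm_nonneg _) (by positivity)).trans_eq ?_
    rw [← Real.mul_rpow (abs_nonneg _) (abs_nonneg _), ← abs_mul, inv_pow, inv_inv,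
      inv_mul_cancel₀ (by positivity), abs_one, Real.one_rpow]
  · intro a T hT f
    have hDf : D (f.toLp 2) = (dilateSchwartz hlam.ne' f).toLp 2 := by
      refine Lp.ext ?_
      filter_upwards [hD (f.toLp 2), ae_dilation hlam.ne' (f.coeFn_toLp 2 volume),
        (dilateSchwartz hlam.ne' f).coeFn_toLp 2 volume] with x h1 h2 h3
      rw [h1, h2, h3, dilateSchwartz_apply]
    filter_upwards [hE (T (D (f.toLp 2))), ae_dilation (inv_ne_zero hlam.ne')
      (hT (dilateSchwartz hlam.ne' f))] with x h1 h2
    rw [ContinuousLinearMap.comp_apply, ContinuousLinearMap.comp_apply, h1, hDf, h2,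
      opFun_eq_knFun hh]
    have h3 := knFun_dilation hlam.ne' (fun x η => a x ((-(2 * Real.pi * h)) • η)) f (lam⁻¹ • x)
    rw [smul_smul lam, mul_inv_cancel₀ hlam.ne', one_smul] at h3
    rw [← h3]
    congr 1
    funext y ξ
    rw [smul_smul, neg_mul, ← hlam2, mul_inv_cancel_right₀ hlam.ne']

/-- The inner D ∘ E cancels, so conjugation acts on the whole defect at once, and ‖D‖‖E‖ ≤ 1
expresses that the dilation is an isometry up to normalization. -/
theorem norm_conjugation_sub_le {D E T₁ T₂ T₁₂ : L2Sp n →L[ℂ] L2Sp n}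
    (hDE : D ∘L E = ContinuousLinearMap.id ℂ _) (hn : ‖D‖ * ‖E‖ ≤ 1) :
    ‖(E ∘L T₁ ∘L D) ∘L (E ∘L T₂ ∘L D) - E ∘L T₁₂ ∘L D‖ ≤ ‖T₁ ∘L T₂ - T₁₂‖ := by
  have h : (E ∘L T₁ ∘L D) ∘L (E ∘L T₂ ∘L D) - E ∘L T₁₂ ∘L D = E ∘L (T₁ ∘L T₂ - T₁₂) ∘L D := by
    refine ContinuousLinearMap.ext fun u => ?_
    have := DFunLike.congr_fun hDE (T₂ (D u))
    simp only [ContinuousLinearMap.comp_apply, ContinuousLinearMap.id_apply, sub_apply,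
      map_sub] at this ⊢
    rw [this]
  rw [h]
  calc _ ≤ ‖E‖ * (‖T₁ ∘L T₂ - T₁₂‖ * ‖D‖) :=
        (ContinuousLinearMap.opNorm_comp_le _ _).trans
          (mul_le_mul_of_nonneg_left (ContinuousLinearMap.opNorm_comp_le _ _) (norm_nonneg _))
    _ = ‖T₁ ∘L T₂ - T₁₂‖ * (‖D‖ * ‖E‖) := by ring
    _ ≤ _ := mul_le_of_le_one_right (norm_nonneg _) hn

/-! ### Sobolev spaces -/

/-- The isometry `Op_h(⟨ξ⟩^s) : H_h^s → L²`. -/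
def ScSobolev.toL2CLM (n : ℕ) (h s : ℝ) : ScSobolev n h s →L[ℂ] L2Sp n :=
  (ScSobolev.toL2 n h s).mkContinuous 1 fun u => by rw [one_mul, ScSobolev.norm_eq]

theorem ScSobolev.norm_toL2CLM_le (n : ℕ) (h s : ℝ) : ‖ScSobolev.toL2CLM n h s‖ ≤ 1 :=
  LinearMap.mkContinuous_norm_le _ zero_le_one _

theorem ScSobolev.toL2CLM_ofSchwartz (h s : ℝ) (f : 𝓢(EucSp n, ℂ)) :
    ScSobolev.toL2CLM n h s (ScSobolev.ofSchwartz h s f) = (SchwartzMap.fourierMultiplierCLM ℂ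
      (fun η => ((japBr ((2 * Real.pi * h) • η) ^ s : ℝ) : ℂ)) f).toLp 2 := by
  apply l2ToDistr_injective
  change l2ToDistr n (ScSobolev.toL2 n h s _) = _
  rw [ScSobolev.l2ToDistr_toL2]
  exact (TemperedDistribution.fourierMultiplierCLM_toTemperedDistributionCLM_eq
    (hasTemperateGrowth_japBr n h s) f).trans (Lp.toTemperedDistribution_toLp_eq _).symm

/-- The isometry onto L² is the multiplier ⟨ξ⟩^s acting first, so it cancels the weight ⟨ξ⟩^(-s)
placed in the symbol. -/
theorem IsOpL2.isOpSobolev {h s : ℝ} (hh : 0 < h) {a : EucSp n → EucSp n → ℂ}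
    {T : L2Sp n →L[ℂ] L2Sp n}
    (hT : IsOpL2 h (fun x ξ => a x ξ * ((japBr ξ ^ (-s) : ℝ) : ℂ)) T) :
    IsOpSobolev h s a (T ∘L ScSobolev.toL2CLM n h s) := by
  intro f
  rw [ContinuousLinearMap.comp_apply, ScSobolev.toL2CLM_ofSchwartz]
  refine (hT _).trans (Filter.Eventually.of_forall fun x => ?_)
  rw [opFun_eq_knFun hh, opFun_eq_knFun hh, knFun_multiplier (hasTemperateGrowth_japBr n h s)]
  congr 1
  funext y η
  have hj : japBr ((-(2 * Real.pi * h)) • η) = japBr ((2 * Real.pi * h) • η) := by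
    simp [japBr, norm_smul]
  rw [hj, mul_assoc, ← Complex.ofReal_mul, ← Real.rpow_add (japBr_pos _), neg_add_cancel,
    Real.rpow_zero, Complex.ofReal_one, mul_one]

theorem norm_comp_toL2CLM_sub_le {h s : ℝ} (A₁ A₂ A₁₂ : L2Sp n →L[ℂ] L2Sp n) :
    ‖A₁ ∘L (A₂ ∘L ScSobolev.toL2CLM n h s) - A₁₂ ∘L ScSobolev.toL2CLM n h s‖ ≤
      ‖A₁ ∘L A₂ - A₁₂‖ := by
  have e : A₁ ∘L (A₂ ∘L ScSobolev.toL2CLM n h s) - A₁₂ ∘L ScSobolev.toL2CLM n h s =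
      (A₁ ∘L A₂ - A₁₂) ∘L ScSobolev.toL2CLM n h s := by
    ext u
    simp
  rw [e]
  exact (ContinuousLinearMap.opNorm_comp_le _ _).trans
    (mul_le_of_le_one_right (norm_nonneg _) (ScSobolev.norm_toL2CLM_le n h s))

end Dilation

/-! ### Comparison of the sums of constants -/

noncomputable section BoundComparison

variable {n : ℕ}

/-! ### Rearrangement of sums over multi-indices -/

theorem sum_biUnion_idxEq (J : Finset ℕ) (f : MultiIdx n → ℝ) :
    ∑ j ∈ J, ∑ α ∈ idxEq n j, f α = ∑ α ∈ J.biUnion (idxEq n), f α := by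
  refine (Finset.sum_biUnion fun i _ j _ hij => ?_).symm
  rw [Function.onFun, Finset.disjoint_left]
  intro α h1 h2
  exact hij ((mem_idxEq.mp h1).symm.trans (mem_idxEq.mp h2))

theorem mem_biUnion_idxEq {J : Finset ℕ} {α : MultiIdx n} :
    α ∈ J.biUnion (idxEq n) ↔ α.len ∈ J := by
  simp [mem_idxEq]

theorem weightedSum_eq (r : ℝ) (C : MultiIdx n → MultiIdx n → ℝ) (J M : Finset ℕ) :
    weightedSum r C J M = ∑ α ∈ J.biUnion (idxEq n), ∑ β ∈ M.biUnion (idxEq n),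
      r ^ (α.len + β.len) * C α β := by
  rw [weightedSum, ← sum_biUnion_idxEq]
  refine Finset.sum_congr rfl fun j _ => ?_
  simp_rw [derivSum, Finset.mul_sum]
  rw [Finset.sum_comm]
  refine Finset.sum_congr rfl fun α hα => ?_
  rw [← sum_biUnion_idxEq]
  refine Finset.sum_congr rfl fun m _ => Finset.sum_congr rfl fun β hβ => ?_
  rw [mem_idxEq.mp hα, mem_idxEq.mp hβ]

theorem sum_derivSum_eq (C : MultiIdx n → MultiIdx n → ℝ) (d m : ℕ) :
    ∑ j ∈ Finset.range (d + 1), derivSum C j m = ∑ α ∈ idxLE n d, ∑ β ∈ idxEq n m, C α β :=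
  sum_biUnion_idxEq _ _

theorem filter_idxLE_eq {d : ℕ} {α : MultiIdx n} (hα : α.len ≤ d) :
    (idxLE n d).filter (fun γ => α.len + γ.len ≤ d) =
      (Finset.range (d + 1 - α.len)).biUnion (idxEq n) := by
  ext γ
  rw [Finset.mem_filter, mem_idxLE, mem_biUnion_idxEq, Finset.mem_range]
  omega

/-- For a fixed α₁ the condition |α₁| + |α₂| ≤ d confines |α₂| to the inner range of `pairSum`, so
grouping by lengths turns one sum into the other. -/
theorem pairSum_derivSum_eq (C₁ C₂ : MultiIdx n → MultiIdx n → ℝ) (d m₁ m₂ : ℕ) :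
    pairSum d (fun j => derivSum C₁ j m₁) (fun j => derivSum C₂ j m₂) =
      ∑ α₁ ∈ idxLE n d, ∑ α₂ ∈ idxLE n d with α₁.len + α₂.len ≤ d,
        (∑ β₁ ∈ idxEq n m₁, C₁ α₁ β₁) * ∑ β₂ ∈ idxEq n m₂, C₂ α₂ β₂ := by
  rw [pairSum, idxLE, ← sum_biUnion_idxEq]
  refine Finset.sum_congr rfl fun i hi => ?_
  simp_rw [derivSum, Finset.sum_mul]
  rw [Finset.sum_comm]
  refine Finset.sum_congr rfl fun α hα => ?_
  have h := filter_idxLE_eq (d := d) (α := α) (by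
    have := Finset.mem_range.mp hi
    rw [mem_idxEq.mp hα]
    omega)
  rw [idxLE] at h
  rw [h, ← sum_biUnion_idxEq, mem_idxEq.mp hα]
  refine Finset.sum_congr rfl fun l _ => ?_
  rw [← Finset.sum_mul, Finset.mul_sum]
  refine Finset.sum_congr rfl fun γ _ => ?_
  rw [Finset.sum_mul]

theorem sum_le_sum_of_subset {ι : Type*} {A A' : Finset ι} {f g : ι → ℝ} (hA : A ⊆ A')
    (h : ∀ a ∈ A, f a ≤ g a) (h0 : ∀ a ∈ A', 0 ≤ g a) : ∑ a ∈ A, f a ≤ ∑ a ∈ A', g a :=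
  (Finset.sum_le_sum h).trans
    (Finset.sum_le_sum_of_subset_of_nonneg hA fun a ha _ => h0 a ha)

/-! ### Comparison of the bounds -/

section

variable {C C₁ C₂ : MultiIdx n → MultiIdx n → ℝ} {μ μ₁ μ₂ : ℕ} {r lam : ℝ}

/-- Passage from the dilation factor to r, which will be √h: at most 2N factors occur in each term,
so the ratio costs at most 3^(2N). -/
theorem weightedSum_le_pow_mul (hC : ∀ α β, β.len ≤ μ → 0 ≤ C α β) {N : ℕ} {J M : Finset ℕ}
    (hJ : ∀ j ∈ J, j ≤ N) (hM : ∀ m ∈ M, m ≤ N ∧ m ≤ μ) (hlam : 0 ≤ lam) (hr : 0 ≤ r)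
    (h : lam ≤ 3 * r) : weightedSum lam C J M ≤ 3 ^ (2 * N) * weightedSum r C J M := by
  rw [weightedSum, weightedSum, Finset.mul_sum]
  refine Finset.sum_le_sum fun j hj => ?_
  rw [Finset.mul_sum]
  refine Finset.sum_le_sum fun m hm => ?_
  have hd : 0 ≤ derivSum C j m := Finset.sum_nonneg fun α _ => Finset.sum_nonneg fun β hβ =>
    hC α β ((mem_idxEq.mp hβ).trans_le (hM m hm).2)
  have h1 := hJ j hj
  have h2 := (hM m hm).1
  rw [← mul_assoc]
  refine mul_le_mul_of_nonneg_right ?_ hd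
  calc lam ^ (j + m) ≤ (3 * r) ^ (j + m) := by gcongr
    _ = 3 ^ (j + m) * r ^ (j + m) := mul_pow _ _ _
    _ ≤ _ := by
      gcongr
      · norm_num
      · omega

/-- The sum over all derivatives of total order at most `S`. -/
def orderSum (r : ℝ) (C : MultiIdx n → MultiIdx n → ℝ) (S μ : ℕ) : ℝ :=
  ∑ α ∈ idxLE n S, ∑ β ∈ idxLE n S with α.len + β.len ≤ S ∧ β.len ≤ μ,
    r ^ (α.len + β.len) * C α β

theorem orderSum_nonneg (hC : ∀ α β, β.len ≤ μ → 0 ≤ C α β) (hr : 0 ≤ r) (S : ℕ) :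
    0 ≤ orderSum r C S μ :=
  Finset.sum_nonneg fun α _ => Finset.sum_nonneg fun β hβ =>
    mul_nonneg (pow_nonneg hr _) (hC α β (Finset.mem_filter.mp hβ).2.2)

/-- Separate bounds `matrixOrder n` on the orders in ξ and in x imply a bound on the total order;
the added terms are nonnegative. -/
theorem fullSum_le_orderSum (hC : ∀ α β, β.len ≤ μ → 0 ≤ C α β) {S : ℕ}
    (hS : 2 * matrixOrder n ≤ S) (hlam : 0 ≤ lam) (hr : 0 ≤ r) (h : lam ≤ 3 * r) :
    fullSum lam C μ ≤ 3 ^ (2 * matrixOrder n) * orderSum r C S μ := by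
  refine (weightedSum_le_pow_mul hC (N := matrixOrder n) (fun j hj => ?_) (fun m hm => ?_) hlam hr
    h).trans ?_
  · have := Finset.mem_range.mp hj
    omega
  · have := Finset.mem_range.mp hm
    omega
  · refine mul_le_mul_of_nonneg_left ?_ (by positivity)
    rw [weightedSum_eq, orderSum]
    refine sum_le_sum_of_subset (fun α hα => ?_) (fun α hα => ?_) fun α _ => ?_
    · rw [mem_biUnion_idxEq, Finset.mem_range] at hα
      rw [mem_idxLE]
      omega
    · rw [mem_biUnion_idxEq, Finset.mem_range] at hα
      refine sum_le_sum_of_subset (fun β hβ => ?_) (fun _ _ => le_rfl) fun β hβ =>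
        mul_nonneg (pow_nonneg hr _) (hC α β (Finset.mem_filter.mp hβ).2.2)
      rw [mem_biUnion_idxEq, Finset.mem_range] at hβ
      rw [Finset.mem_filter, mem_idxLE]
      omega
    · exact Finset.sum_nonneg fun β hβ =>
        mul_nonneg (pow_nonneg hr _) (hC α β (Finset.mem_filter.mp hβ).2.2)

theorem topSum_le (hC : ∀ α β, β.len ≤ μ → 0 ≤ C α β) (hlam : 0 ≤ lam) (h : lam ≤ 3 * r) :
    topSum lam C μ ≤ 3 ^ μ * (r ^ μ * ∑ α ∈ idxLE n (n + 1), ∑ β ∈ idxEq n μ, C α β) := by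
  rw [topSum, sum_derivSum_eq, ← mul_assoc, ← mul_pow]
  exact mul_le_mul_of_nonneg_right (pow_le_pow_left₀ hlam h μ) (Finset.sum_nonneg fun α _ =>
    Finset.sum_nonneg fun β hβ => hC α β (mem_idxEq.mp hβ).le)

/-- Four orders, each at most `matrixOrder n`, have a sum at most S. The ranges with |α₁| ≥ 1 in
`freqSum` and |β₂| ≥ 1 in `posSum` lie inside the conditions that each symbol be differentiated at
least once. -/
theorem freqSum_mul_posSum_le (hC₁ : ∀ α β, β.len ≤ μ₁ → 0 ≤ C₁ α β)
    (hC₂ : ∀ α β, β.len ≤ μ₂ → 0 ≤ C₂ α β) {S : ℕ} (hS : 4 * matrixOrder n ≤ S)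
    (hlam : 0 ≤ lam) (hr : 0 ≤ r) (h : lam ≤ 3 * r) :
    freqSum lam C₁ μ₁ * posSum lam C₂ μ₂ ≤
      3 ^ (2 * matrixOrder n) * 3 ^ (2 * matrixOrder n) *
        ∑ α₁ ∈ idxLE n S, ∑ β₁ ∈ idxLE n S, ∑ α₂ ∈ idxLE n S, ∑ β₂ ∈ idxLE n S with
          α₁.len + β₁.len + α₂.len + β₂.len ≤ S ∧ β₁.len ≤ μ₁ ∧ β₂.len ≤ μ₂ ∧
          1 ≤ α₁.len + β₁.len ∧ 1 ≤ α₂.len + β₂.len,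
        r ^ (α₁.len + β₁.len + α₂.len + β₂.len) * C₁ α₁ β₁ * C₂ α₂ β₂ := by
  have h1 : freqSum lam C₁ μ₁ ≤ 3 ^ (2 * matrixOrder n) * freqSum r C₁ μ₁ :=
    weightedSum_le_pow_mul hC₁ (fun j hj => (Finset.mem_Icc.mp hj).2)
      (fun m hm => by have := Finset.mem_range.mp hm; omega) hlam hr h
  have h2 : posSum lam C₂ μ₂ ≤ 3 ^ (2 * matrixOrder n) * posSum r C₂ μ₂ :=
    weightedSum_le_pow_mul hC₂ (fun j hj => by have := Finset.mem_range.mp hj; omega)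
      (fun m hm => by have := Finset.mem_Icc.mp hm; omega) hlam hr h
  have hpos : ∀ t, 0 ≤ t → 0 ≤ posSum t C₂ μ₂ := fun t ht => by
    rw [posSum, weightedSum_eq]
    refine Finset.sum_nonneg fun α _ => Finset.sum_nonneg fun β hβ =>
      mul_nonneg (pow_nonneg ht _) (hC₂ α β ?_)
    rw [mem_biUnion_idxEq, Finset.mem_Icc] at hβ
    omega
  have hfreq : 0 ≤ freqSum r C₁ μ₁ := by
    rw [freqSum, weightedSum_eq]
    refine Finset.sum_nonneg fun α _ => Finset.sum_nonneg fun β hβ =>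
      mul_nonneg (pow_nonneg hr _) (hC₁ α β ?_)
    rw [mem_biUnion_idxEq, Finset.mem_range] at hβ
    omega
  refine (mul_le_mul h1 h2 (hpos lam hlam) (by positivity)).trans ?_
  rw [mul_mul_mul_comm]
  refine mul_le_mul_of_nonneg_left ?_ (by positivity)
  have h0 : ∀ α₁ β₁ α₂ β₂ : MultiIdx n, β₁.len ≤ μ₁ → β₂.len ≤ μ₂ →
      0 ≤ r ^ (α₁.len + β₁.len + α₂.len + β₂.len) * C₁ α₁ β₁ * C₂ α₂ β₂ :=
    fun α₁ β₁ α₂ β₂ i₁ i₂ =>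
      mul_nonneg (mul_nonneg (pow_nonneg hr _) (hC₁ _ _ i₁)) (hC₂ _ _ i₂)
  rw [freqSum, posSum, weightedSum_eq, weightedSum_eq, Finset.sum_mul]
  refine sum_le_sum_of_subset (fun α hα => ?_) (fun α₁ hα₁ => ?_) fun α₁ _ =>
    Finset.sum_nonneg fun β₁ _ => Finset.sum_nonneg fun α₂ _ => Finset.sum_nonneg fun β₂ hβ₂ => ?_
  · rw [mem_biUnion_idxEq, Finset.mem_Icc] at hα
    rw [mem_idxLE]
    omega
  · rw [mem_biUnion_idxEq, Finset.mem_Icc] at hα₁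
    rw [Finset.sum_mul]
    refine sum_le_sum_of_subset (fun β hβ => ?_) (fun β₁ hβ₁ => ?_) fun β₁ _ =>
      Finset.sum_nonneg fun α₂ _ => Finset.sum_nonneg fun β₂ hβ₂ => ?_
    · rw [mem_biUnion_idxEq, Finset.mem_range] at hβ
      rw [mem_idxLE]
      omega
    · rw [mem_biUnion_idxEq, Finset.mem_range] at hβ₁
      rw [Finset.mul_sum]
      refine sum_le_sum_of_subset (fun α hα => ?_) (fun α₂ hα₂ => ?_) fun α₂ _ =>
        Finset.sum_nonneg fun β₂ hβ₂ => ?_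
      · rw [mem_biUnion_idxEq, Finset.mem_range] at hα
        rw [mem_idxLE]
        omega
      · rw [mem_biUnion_idxEq, Finset.mem_range] at hα₂
        rw [Finset.mul_sum]
        refine sum_le_sum_of_subset (fun β₂ hβ₂ => ?_) (fun β₂ _ => le_of_eq (by ring))
          fun β₂ hβ₂ => ?_
        · rw [mem_biUnion_idxEq, Finset.mem_Icc] at hβ₂
          rw [Finset.mem_filter, mem_idxLE]
          omega
        · rw [Finset.mem_filter] at hβ₂
          exact h0 _ _ _ _ hβ₂.2.2.1 hβ₂.2.2.2.1
      · rw [Finset.mem_filter] at hβ₂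
        exact h0 _ _ _ _ hβ₂.2.2.1 hβ₂.2.2.2.1
    · rw [Finset.mem_filter] at hβ₂
      exact h0 _ _ _ _ hβ₂.2.2.1 hβ₂.2.2.2.1
  · rw [Finset.mem_filter] at hβ₂
    exact h0 _ _ _ _ hβ₂.2.2.1 hβ₂.2.2.2.1

theorem freqSum_mul_posSum_funConst_le {D : MultiIdx n → ℝ}
    (hC₁ : ∀ α β, β.len ≤ μ₁ → 0 ≤ C₁ α β)
    (hD : ∀ β : MultiIdx n, β.len ≤ μ₂ → 0 ≤ D β) {S : ℕ} (hS : 4 * matrixOrder n ≤ S)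
    (hlam : 0 ≤ lam) (hr : 0 ≤ r) (h : lam ≤ 3 * r) :
    freqSum lam C₁ μ₁ * posSum lam (funConst D) μ₂ ≤
      3 ^ (2 * matrixOrder n) * 3 ^ (2 * matrixOrder n) *
        ∑ α₁ ∈ idxLE n S, ∑ β₁ ∈ idxLE n S, ∑ β₂ ∈ idxLE n S with
          α₁.len + β₁.len + β₂.len ≤ S ∧ 1 ≤ α₁.len + β₁.len ∧ β₁.len ≤ μ₁ ∧
          1 ≤ β₂.len ∧ β₂.len ≤ μ₂,
        r ^ (α₁.len + β₁.len + β₂.len) * C₁ α₁ β₁ * D β₂ := by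
  have hC₂ : ∀ α β : MultiIdx n, β.len ≤ μ₂ → 0 ≤ funConst D α β := fun α β hβ => by
    unfold funConst
    split_ifs
    exacts [hD β hβ, le_rfl]
  have h1 : freqSum lam C₁ μ₁ ≤ 3 ^ (2 * matrixOrder n) * freqSum r C₁ μ₁ :=
    weightedSum_le_pow_mul hC₁ (fun j hj => (Finset.mem_Icc.mp hj).2)
      (fun m hm => by have := Finset.mem_range.mp hm; omega) hlam hr h
  have h2 : posSum lam (funConst D) μ₂ ≤ 3 ^ (2 * matrixOrder n) * posSum r (funConst D) μ₂ :=
    weightedSum_le_pow_mul hC₂ (fun j hj => by have := Finset.mem_range.mp hj; omega)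
      (fun m hm => by have := Finset.mem_Icc.mp hm; omega) hlam hr h
  have hp : ∀ t, posSum t (funConst D) μ₂ =
      ∑ β ∈ (Finset.Icc 1 (min (matrixOrder n) μ₂)).biUnion (idxEq n), t ^ β.len * D β := by
    intro t
    rw [posSum_funConst, ← sum_biUnion_idxEq]
    refine Finset.sum_congr rfl fun m _ => ?_
    rw [Finset.mul_sum]
    refine Finset.sum_congr rfl fun β hβ => ?_
    rw [mem_idxEq.mp hβ]
  have hpos : ∀ t, 0 ≤ t → 0 ≤ posSum t (funConst D) μ₂ := fun t ht => by
    rw [hp]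
    refine Finset.sum_nonneg fun β hβ => mul_nonneg (pow_nonneg ht _) (hD β ?_)
    rw [mem_biUnion_idxEq, Finset.mem_Icc] at hβ
    omega
  have hfreq : 0 ≤ freqSum r C₁ μ₁ := by
    rw [freqSum, weightedSum_eq]
    refine Finset.sum_nonneg fun α _ => Finset.sum_nonneg fun β hβ =>
      mul_nonneg (pow_nonneg hr _) (hC₁ α β ?_)
    rw [mem_biUnion_idxEq, Finset.mem_range] at hβ
    omega
  refine (mul_le_mul h1 h2 (hpos lam hlam) (by positivity)).trans ?_
  rw [mul_mul_mul_comm]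
  refine mul_le_mul_of_nonneg_left ?_ (by positivity)
  have h0 : ∀ α₁ β₁ β₂ : MultiIdx n, β₁.len ≤ μ₁ → β₂.len ≤ μ₂ →
      0 ≤ r ^ (α₁.len + β₁.len + β₂.len) * C₁ α₁ β₁ * D β₂ := fun α₁ β₁ β₂ i₁ i₂ =>
    mul_nonneg (mul_nonneg (pow_nonneg hr _) (hC₁ _ _ i₁)) (hD _ i₂)
  rw [freqSum, hp, weightedSum_eq, Finset.sum_mul]
  refine sum_le_sum_of_subset (fun α hα => ?_) (fun α₁ hα₁ => ?_) fun α₁ _ =>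
    Finset.sum_nonneg fun β₁ _ => Finset.sum_nonneg fun β₂ hβ₂ => ?_
  · rw [mem_biUnion_idxEq, Finset.mem_Icc] at hα
    rw [mem_idxLE]
    omega
  · rw [mem_biUnion_idxEq, Finset.mem_Icc] at hα₁
    rw [Finset.sum_mul]
    refine sum_le_sum_of_subset (fun β hβ => ?_) (fun β₁ hβ₁ => ?_) fun β₁ _ =>
      Finset.sum_nonneg fun β₂ hβ₂ => ?_
    · rw [mem_biUnion_idxEq, Finset.mem_range] at hβ
      rw [mem_idxLE]
      omega
    · rw [mem_biUnion_idxEq, Finset.mem_range] at hβ₁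
      rw [Finset.mul_sum]
      refine sum_le_sum_of_subset (fun β₂ hβ₂ => ?_) (fun β₂ _ => le_of_eq (by ring))
        fun β₂ hβ₂ => ?_
      · rw [mem_biUnion_idxEq, Finset.mem_Icc] at hβ₂
        rw [Finset.mem_filter, mem_idxLE]
        omega
      · rw [Finset.mem_filter] at hβ₂
        exact h0 _ _ _ hβ₂.2.2.2.1 hβ₂.2.2.2.2.2
    · rw [Finset.mem_filter] at hβ₂
      exact h0 _ _ _ hβ₂.2.2.2.1 hβ₂.2.2.2.2.2
  · rw [Finset.mem_filter] at hβ₂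
    exact h0 _ _ _ hβ₂.2.2.2.1 hβ₂.2.2.2.2.2

/-! ### Products of sums -/

theorem orderSum_mul_eq (S d m : ℕ) : orderSum r C₁ S μ₁ *
      (∑ α₂ ∈ idxLE n d, ∑ β₂ ∈ idxEq n m, C₂ α₂ β₂) =
    ∑ α₁ ∈ idxLE n S, ∑ β₁ ∈ idxLE n S with α₁.len + β₁.len ≤ S ∧ β₁.len ≤ μ₁,
      ∑ α₂ ∈ idxLE n d, ∑ β₂ ∈ idxEq n m, r ^ (α₁.len + β₁.len) * C₁ α₁ β₁ * C₂ α₂ β₂ := by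
  rw [orderSum, Finset.sum_mul]
  refine Finset.sum_congr rfl fun α₁ _ => ?_
  rw [Finset.sum_mul]
  refine Finset.sum_congr rfl fun β₁ _ => ?_
  rw [Finset.mul_sum]
  refine Finset.sum_congr rfl fun α₂ _ => ?_
  rw [Finset.mul_sum]

theorem mul_orderSum_eq (S d m : ℕ) : (∑ α₁ ∈ idxLE n d, ∑ β₁ ∈ idxEq n m, C₁ α₁ β₁) *
      orderSum r C₂ S μ₂ =
    ∑ α₁ ∈ idxLE n d, ∑ β₁ ∈ idxEq n m, ∑ α₂ ∈ idxLE n S,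
      ∑ β₂ ∈ idxLE n S with α₂.len + β₂.len ≤ S ∧ β₂.len ≤ μ₂,
        r ^ (α₂.len + β₂.len) * C₁ α₁ β₁ * C₂ α₂ β₂ := by
  rw [Finset.sum_mul]
  refine Finset.sum_congr rfl fun α₁ _ => ?_
  rw [Finset.sum_mul]
  refine Finset.sum_congr rfl fun β₁ _ => ?_
  rw [orderSum, Finset.mul_sum]
  refine Finset.sum_congr rfl fun α₂ _ => ?_
  rw [Finset.mul_sum]
  exact Finset.sum_congr rfl fun β₂ _ => by ring

theorem sum_mul_sum_eq (d m₁ m₂ : ℕ) : (∑ α₁ ∈ idxLE n d, ∑ β₁ ∈ idxEq n m₁, C₁ α₁ β₁) *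
      (∑ α₂ ∈ idxLE n d, ∑ β₂ ∈ idxEq n m₂, C₂ α₂ β₂) =
    ∑ α₁ ∈ idxLE n d, ∑ β₁ ∈ idxEq n m₁, ∑ α₂ ∈ idxLE n d, ∑ β₂ ∈ idxEq n m₂,
      C₁ α₁ β₁ * C₂ α₂ β₂ := by
  rw [Finset.sum_mul]
  refine Finset.sum_congr rfl fun α₁ _ => ?_
  rw [Finset.sum_mul]
  refine Finset.sum_congr rfl fun β₁ _ => ?_
  rw [Finset.mul_sum]
  refine Finset.sum_congr rfl fun α₂ _ => ?_
  rw [Finset.mul_sum]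

theorem pairSum_zero_left_eq (d m : ℕ) :
    pairSum d (fun j => derivSum C₁ j 0) (fun j => derivSum C₂ j m) =
      ∑ α₁ ∈ idxLE n d, ∑ α₂ ∈ idxLE n d with α₁.len + α₂.len ≤ d, ∑ β₂ ∈ idxEq n m,
        C₁ α₁ 0 * C₂ α₂ β₂ := by
  rw [pairSum_derivSum_eq]
  simp only [idxEq_zero, Finset.sum_singleton, Finset.mul_sum]

theorem pairSum_zero_right_eq (d m : ℕ) :
    pairSum d (fun j => derivSum C₁ j m) (fun j => derivSum C₂ j 0) =
      ∑ α₁ ∈ idxLE n d, ∑ β₁ ∈ idxEq n m, ∑ α₂ ∈ idxLE n d with α₁.len + α₂.len ≤ d,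
        C₁ α₁ β₁ * C₂ α₂ 0 := by
  rw [pairSum_derivSum_eq]
  refine Finset.sum_congr rfl fun α₁ _ => ?_
  rw [Finset.sum_comm]
  simp only [idxEq_zero, Finset.sum_singleton, Finset.sum_mul]

end

end BoundComparison

/-! ### From the scaled bounds to the bounds in h -/

noncomputable section CompositionBounds

variable {n : ℕ}

theorem rpow_natCast_div_two {h : ℝ} (hh : 0 ≤ h) (j : ℕ) : h ^ ((j : ℝ) / 2) = √h ^ j := by
  rw [Real.sqrt_eq_rpow, ← Real.rpow_natCast, ← Real.rpow_mul hh]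
  ring_nf

/-- For h ≤ 1 the logarithm is at least log 2 > 1/2. Through this inequality the logarithmic factors
enter the final bound, as weights at least 1 up to a constant. -/
theorem one_le_two_mul_log {h : ℝ} (hh : 0 < h) (h1 : h ≤ 1) : 1 ≤ 2 * Real.log (1 + h⁻¹) := by
  have h2 : (2 : ℝ) ≤ 1 + h⁻¹ := by
    have := (one_le_inv₀ hh).mpr h1
    linarith
  have h3 := Real.log_le_log (by norm_num) h2
  have := Real.log_two_gt_d9
  linarith

/-- 2π < 9; this is the source of the constant 3 in the conditions on lam. -/
theorem sqrt_two_pi_mul_le {h : ℝ} : √(2 * Real.pi * h) ≤ 3 * √h := by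
  rw [Real.sqrt_mul (by positivity)]
  refine mul_le_mul_of_nonneg_right ?_ (Real.sqrt_nonneg h)
  rw [Real.sqrt_le_left (by norm_num)]
  have := Real.pi_lt_d2
  linarith

/-- Integer powers of √h replace half powers of h, and the multiple sums are factored or written as
`pairSum`, so that the scaled estimate can be compared term by term. -/
theorem compBound_eq {d : ℕ} (S S' μ₁ μ₂ : ℕ)
    (C₁ C₂ : MultiIdx (d - 1) → MultiIdx (d - 1) → ℝ) {h : ℝ} (hh : 0 < h) :
    compBound d S S' μ₁ μ₂ C₁ C₂ h =
      (∑ α₁ ∈ idxLE (d - 1) S', ∑ β₁ ∈ idxLE (d - 1) S', ∑ α₂ ∈ idxLE (d - 1) S',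
        ∑ β₂ ∈ idxLE (d - 1) S' with
          α₁.len + β₁.len + α₂.len + β₂.len ≤ S' ∧ β₁.len ≤ μ₁ ∧ β₂.len ≤ μ₂ ∧
          1 ≤ α₁.len + β₁.len ∧ 1 ≤ α₂.len + β₂.len,
        √h ^ (α₁.len + β₁.len + α₂.len + β₂.len) * C₁ α₁ β₁ * C₂ α₂ β₂) +
      √h ^ μ₁ * Real.log (1 + h⁻¹) *
        ((∑ α ∈ idxLE (d - 1) d, ∑ β ∈ idxEq (d - 1) μ₁, C₁ α β) * orderSum √h C₂ S μ₂) +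
      √h ^ μ₁ * Real.log (1 + h⁻¹) *
        pairSum d (fun j => derivSum C₁ j μ₁) (fun j => derivSum C₂ j 0) +
      √h ^ μ₂ * Real.log (1 + h⁻¹) *
        (orderSum √h C₁ S μ₁ * ∑ α ∈ idxLE (d - 1) d, ∑ β ∈ idxEq (d - 1) μ₂, C₂ α β) +
      √h ^ μ₂ * Real.log (1 + h⁻¹) *
        pairSum d (fun j => derivSum C₁ j 0) (fun j => derivSum C₂ j μ₂) +
      √h ^ (μ₁ + μ₂) * Real.log (1 + h⁻¹) ^ 2 *
        ((∑ α ∈ idxLE (d - 1) d, ∑ β ∈ idxEq (d - 1) μ₁, C₁ α β) *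
          ∑ α ∈ idxLE (d - 1) d, ∑ β ∈ idxEq (d - 1) μ₂, C₂ α β) := by
  rw [mul_orderSum_eq, orderSum_mul_eq, sum_mul_sum_eq, pairSum_zero_left_eq,
    pairSum_zero_right_eq]
  simp only [compBound, rpow_natCast_div_two hh.le]

theorem compBoundFun_eq {d : ℕ} (S S' μ₁ μ₂ : ℕ)
    (C₁ : MultiIdx (d - 1) → MultiIdx (d - 1) → ℝ) (C₂ : MultiIdx (d - 1) → ℝ) {h : ℝ}
    (hh : 0 < h) :
    compBoundFun d S S' μ₁ μ₂ C₁ C₂ h =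
      (∑ α₁ ∈ idxLE (d - 1) S', ∑ β₁ ∈ idxLE (d - 1) S', ∑ β₂ ∈ idxLE (d - 1) S' with
          α₁.len + β₁.len + β₂.len ≤ S' ∧ 1 ≤ α₁.len + β₁.len ∧ β₁.len ≤ μ₁ ∧
          1 ≤ β₂.len ∧ β₂.len ≤ μ₂,
        √h ^ (α₁.len + β₁.len + β₂.len) * C₁ α₁ β₁ * C₂ β₂) +
      √h ^ μ₁ * Real.log (1 + h⁻¹) *
        ((∑ α ∈ idxLE (d - 1) d, ∑ β ∈ idxEq (d - 1) μ₁, C₁ α β) * C₂ 0) +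
      √h ^ μ₂ * (orderSum √h C₁ S μ₁ * ∑ β ∈ idxEq (d - 1) μ₂, C₂ β) := by
  have e1 : (∑ α ∈ idxLE (d - 1) d, ∑ β ∈ idxEq (d - 1) μ₁, C₁ α β) * C₂ 0 =
      ∑ α ∈ idxLE (d - 1) d, ∑ β ∈ idxEq (d - 1) μ₁, C₁ α β * C₂ 0 := by
    simp only [Finset.sum_mul]
  have e2 : orderSum √h C₁ S μ₁ * ∑ β ∈ idxEq (d - 1) μ₂, C₂ β =
      ∑ α₁ ∈ idxLE (d - 1) S, ∑ β₁ ∈ idxLE (d - 1) S with α₁.len + β₁.len ≤ S ∧ β₁.len ≤ μ₁,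
        ∑ β₂ ∈ idxEq (d - 1) μ₂, √h ^ (α₁.len + β₁.len) * C₁ α₁ β₁ * C₂ β₂ := by
    rw [orderSum]
    simp only [Finset.sum_mul, ← Finset.mul_sum]
  rw [e1, e2]
  simp only [compBoundFun, rpow_natCast_div_two hh.le]

/-- The inequality between the bounds for the dilated symbols and the bounds for `Op_h`. -/
theorem scaled_bound_le_compBound {d : ℕ} (hd : 2 ≤ d) {S S' μ₁ μ₂ : ℕ}
    (hS : 2 * matrixOrder (d - 1) ≤ S) (hS' : 4 * matrixOrder (d - 1) ≤ S') :
    ∃ K : ℝ, 0 ≤ K ∧ ∀ (C₁ C₂ : MultiIdx (d - 1) → MultiIdx (d - 1) → ℝ) (h lam : ℝ),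
    (∀ α β, β.len ≤ μ₁ → 0 ≤ C₁ α β) → (∀ α β, β.len ≤ μ₂ → 0 ≤ C₂ α β) → 0 < h → h ≤ 1 →
    0 ≤ lam → lam ≤ 3 * √h →
    freqSum lam C₁ μ₁ * posSum lam C₂ μ₂ + fullSum lam C₁ μ₁ * topSum lam C₂ μ₂ +
      lam ^ μ₂ * pairSum (d - 1 + 1) (fun j => derivSum C₁ j 0) (fun j => derivSum C₂ j μ₂) +
      topSum lam C₁ μ₁ * fullSum lam C₂ μ₂ + topSum lam C₁ μ₁ * topSum lam C₂ μ₂ +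
      lam ^ μ₁ * pairSum (d - 1 + 1) (fun j => derivSum C₁ j μ₁) (fun j => derivSum C₂ j 0) ≤
    K * compBound d S S' μ₁ μ₂ C₁ C₂ h := by
  set Q : ℝ := 3 ^ (2 * matrixOrder (d - 1)) with hQ
  have hQ0 : 0 ≤ Q := by positivity
  clear_value Q
  have hd1 : d - 1 + 1 = d := by omega
  refine ⟨Q * Q + 2 * Q * 3 ^ μ₂ + 2 * 3 ^ μ₂ + 2 * Q * 3 ^ μ₁ + 4 * 3 ^ μ₁ * 3 ^ μ₂ +
    2 * 3 ^ μ₁, by positivity, ?_⟩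
  intro C₁ C₂ h lam hC₁ hC₂ hh h1 hlam hlam3
  rw [compBound_eq S S' μ₁ μ₂ C₁ C₂ hh, hd1]
  have hr : 0 ≤ √h := Real.sqrt_nonneg h
  have hL := one_le_two_mul_log hh h1
  set L := Real.log (1 + h⁻¹) with hLdef
  clear_value L
  have hL0 : 0 ≤ L := by linarith
  have b1 := freqSum_mul_posSum_le hC₁ hC₂ hS' hlam hr hlam3
  have f₁ := fullSum_le_orderSum hC₁ hS hlam hr hlam3
  have f₂ := fullSum_le_orderSum hC₂ hS hlam hr hlam3
  have g₁ := topSum_le hC₁ hlam hlam3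
  have g₂ := topSum_le hC₂ hlam hlam3
  rw [hd1] at g₁ g₂
  rw [← hQ] at b1 f₁ f₂
  have o₁ := orderSum_nonneg hC₁ hr S
  have o₂ := orderSum_nonneg hC₂ hr S
  have d₁ : ∀ j m, m ≤ μ₁ → 0 ≤ derivSum C₁ j m := fun j m hm =>
    Finset.sum_nonneg fun α _ => Finset.sum_nonneg fun β hβ =>
      hC₁ α β ((mem_idxEq.mp hβ).trans_le hm)
  have d₂ : ∀ j m, m ≤ μ₂ → 0 ≤ derivSum C₂ j m := fun j m hm =>
    Finset.sum_nonneg fun α _ => Finset.sum_nonneg fun β hβ =>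
      hC₂ α β ((mem_idxEq.mp hβ).trans_le hm)
  have p₁ := pairSum_nonneg d (fun j => d₁ j 0 (Nat.zero_le _)) fun j => d₂ j μ₂ le_rfl
  have p₂ := pairSum_nonneg d (fun j => d₁ j μ₁ le_rfl) fun j => d₂ j 0 (Nat.zero_le _)
  have t₁ : 0 ≤ topSum lam C₁ μ₁ := mul_nonneg (pow_nonneg hlam _)
    (Finset.sum_nonneg fun j _ => d₁ j μ₁ le_rfl)
  have t₂ : 0 ≤ topSum lam C₂ μ₂ := mul_nonneg (pow_nonneg hlam _)
    (Finset.sum_nonneg fun j _ => d₂ j μ₂ le_rfl)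
  have u₂ : 0 ≤ fullSum lam C₂ μ₂ := by
    rw [fullSum, weightedSum]
    refine Finset.sum_nonneg fun j _ => Finset.sum_nonneg fun m hm =>
      mul_nonneg (pow_nonneg hlam _) (d₂ j m ?_)
    have := Finset.mem_range.mp hm
    omega
  have P₁ : 0 ≤ ∑ α ∈ idxLE (d - 1) d, ∑ β ∈ idxEq (d - 1) μ₁, C₁ α β :=
    Finset.sum_nonneg fun α _ => Finset.sum_nonneg fun β hβ => hC₁ α β (mem_idxEq.mp hβ).le
  have P₂ : 0 ≤ ∑ α ∈ idxLE (d - 1) d, ∑ β ∈ idxEq (d - 1) μ₂, C₂ α β :=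
    Finset.sum_nonneg fun α _ => Finset.sum_nonneg fun β hβ => hC₂ α β (mem_idxEq.mp hβ).le
  have S₁ : 0 ≤ ∑ α₁ ∈ idxLE (d - 1) S', ∑ β₁ ∈ idxLE (d - 1) S', ∑ α₂ ∈ idxLE (d - 1) S',
      ∑ β₂ ∈ idxLE (d - 1) S' with
        α₁.len + β₁.len + α₂.len + β₂.len ≤ S' ∧ β₁.len ≤ μ₁ ∧ β₂.len ≤ μ₂ ∧
        1 ≤ α₁.len + β₁.len ∧ 1 ≤ α₂.len + β₂.len,
      √h ^ (α₁.len + β₁.len + α₂.len + β₂.len) * C₁ α₁ β₁ * C₂ α₂ β₂ :=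
    Finset.sum_nonneg fun α₁ _ => Finset.sum_nonneg fun β₁ _ => Finset.sum_nonneg fun α₂ _ =>
      Finset.sum_nonneg fun β₂ hβ₂ => by
        rw [Finset.mem_filter] at hβ₂
        exact mul_nonneg (mul_nonneg (pow_nonneg hr _) (hC₁ _ _ hβ₂.2.2.1))
          (hC₂ _ _ hβ₂.2.2.2.1)
  -- From here on the sums matter only through their signs and the inequalities already collected;
  -- what remains is real arithmetic.
  generalize (∑ α₁ ∈ idxLE (d - 1) S', ∑ β₁ ∈ idxLE (d - 1) S', ∑ α₂ ∈ idxLE (d - 1) S',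
      ∑ β₂ ∈ idxLE (d - 1) S' with
        α₁.len + β₁.len + α₂.len + β₂.len ≤ S' ∧ β₁.len ≤ μ₁ ∧ β₂.len ≤ μ₂ ∧
        1 ≤ α₁.len + β₁.len ∧ 1 ≤ α₂.len + β₂.len,
      √h ^ (α₁.len + β₁.len + α₂.len + β₂.len) * C₁ α₁ β₁ * C₂ α₂ β₂) = X₁ at *
  generalize (∑ α ∈ idxLE (d - 1) d, ∑ β ∈ idxEq (d - 1) μ₁, C₁ α β) = X₂ at *
  generalize (∑ α ∈ idxLE (d - 1) d, ∑ β ∈ idxEq (d - 1) μ₂, C₂ α β) = X₃ at *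
  generalize orderSum √h C₁ S μ₁ = O₁ at *
  generalize orderSum √h C₂ S μ₂ = O₂ at *
  generalize fullSum lam C₁ μ₁ = F₁ at *
  generalize fullSum lam C₂ μ₂ = F₂ at *
  generalize topSum lam C₁ μ₁ = T₁ at *
  generalize topSum lam C₂ μ₂ = T₂ at *
  generalize pairSum d (fun j => derivSum C₁ j 0) (fun j => derivSum C₂ j μ₂) = V₁ at *
  generalize pairSum d (fun j => derivSum C₁ j μ₁) (fun j => derivSum C₂ j 0) = V₂ at *
  generalize √h = r at *
  have hpow : ∀ μ : ℕ, lam ^ μ ≤ 3 ^ μ * r ^ μ := fun μ =>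
    (pow_le_pow_left₀ hlam hlam3 μ).trans_eq (mul_pow _ _ _)
  have hL2 : 1 ≤ 4 * L ^ 2 := by nlinarith
  -- Inserts the logarithms, as 2L ≥ 1 or, for the product of two remainders, 4L² ≥ 1.
  have absorb : ∀ x y : ℝ, 0 ≤ x → 1 ≤ y → x ≤ x * y := fun x y hx hy =>
    le_mul_of_one_le_right hx hy
  have b2 : F₁ * T₂ ≤ 2 * Q * 3 ^ μ₂ * (r ^ μ₂ * L * (O₁ * X₃)) := by
    calc F₁ * T₂ ≤ (Q * O₁) * (3 ^ μ₂ * (r ^ μ₂ * X₃)) := mul_le_mul f₁ g₂ t₂ (by positivity)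
      _ ≤ (Q * O₁) * (3 ^ μ₂ * (r ^ μ₂ * X₃)) * (2 * L) := absorb _ _ (by positivity) hL
      _ = _ := by ring
  have b3 : lam ^ μ₂ * V₁ ≤ 2 * 3 ^ μ₂ * (r ^ μ₂ * L * V₁) := by
    calc lam ^ μ₂ * V₁ ≤ 3 ^ μ₂ * r ^ μ₂ * V₁ := mul_le_mul_of_nonneg_right (hpow _) p₁
      _ ≤ 3 ^ μ₂ * r ^ μ₂ * V₁ * (2 * L) := absorb _ _ (by positivity) hL
      _ = _ := by ring
  have b4 : T₁ * F₂ ≤ 2 * Q * 3 ^ μ₁ * (r ^ μ₁ * L * (X₂ * O₂)) := by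
    calc T₁ * F₂ ≤ (3 ^ μ₁ * (r ^ μ₁ * X₂)) * (Q * O₂) := mul_le_mul g₁ f₂ u₂ (by positivity)
      _ ≤ (3 ^ μ₁ * (r ^ μ₁ * X₂)) * (Q * O₂) * (2 * L) := absorb _ _ (by positivity) hL
      _ = _ := by ring
  have b5 : T₁ * T₂ ≤ 4 * 3 ^ μ₁ * 3 ^ μ₂ * (r ^ (μ₁ + μ₂) * L ^ 2 * (X₂ * X₃)) := by
    calc T₁ * T₂ ≤ (3 ^ μ₁ * (r ^ μ₁ * X₂)) * (3 ^ μ₂ * (r ^ μ₂ * X₃)) :=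
          mul_le_mul g₁ g₂ t₂ (by positivity)
      _ ≤ (3 ^ μ₁ * (r ^ μ₁ * X₂)) * (3 ^ μ₂ * (r ^ μ₂ * X₃)) * (4 * L ^ 2) :=
          absorb _ _ (by positivity) hL2
      _ = _ := by ring
  have b6 : lam ^ μ₁ * V₂ ≤ 2 * 3 ^ μ₁ * (r ^ μ₁ * L * V₂) := by
    calc lam ^ μ₁ * V₂ ≤ 3 ^ μ₁ * r ^ μ₁ * V₂ := mul_le_mul_of_nonneg_right (hpow _) p₂
      _ ≤ 3 ^ μ₁ * r ^ μ₁ * V₂ * (2 * L) := absorb _ _ (by positivity) hL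
      _ = _ := by ring
  refine (sum_six_le b1 b2 b3 b4 b5 b6 (by positivity) (by positivity) (by positivity)
    (by positivity) (by positivity) (by positivity) (by positivity) (by positivity)
    (by positivity) (by positivity) (by positivity) (by positivity)).trans_eq ?_
  ring

theorem scaled_bound_le_compBoundFun {d : ℕ} (hd : 2 ≤ d) {S S' μ₁ μ₂ : ℕ}
    (hS : 2 * matrixOrder (d - 1) ≤ S) (hS' : 4 * matrixOrder (d - 1) ≤ S') :
    ∃ K : ℝ, 0 ≤ K ∧ ∀ (C₁ : MultiIdx (d - 1) → MultiIdx (d - 1) → ℝ)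
    (C₂ : MultiIdx (d - 1) → ℝ) (h lam : ℝ),
    (∀ α β, β.len ≤ μ₁ → 0 ≤ C₁ α β) → (∀ β : MultiIdx (d - 1), β.len ≤ μ₂ → 0 ≤ C₂ β) →
    0 < h → h ≤ 1 → 0 ≤ lam → lam ≤ 3 * √h →
    freqSum lam C₁ μ₁ * posSum lam (funConst C₂) μ₂ +
      fullSum lam C₁ μ₁ * (lam ^ μ₂ * ∑ β ∈ idxEq (d - 1) μ₂, C₂ β) +
      topSum lam C₁ μ₁ * C₂ 0 ≤
    K * compBoundFun d S S' μ₁ μ₂ C₁ C₂ h := by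
  set Q : ℝ := 3 ^ (2 * matrixOrder (d - 1)) with hQ
  have hQ0 : 0 ≤ Q := by positivity
  clear_value Q
  have hd1 : d - 1 + 1 = d := by omega
  refine ⟨Q * Q + Q * 3 ^ μ₂ + 2 * 3 ^ μ₁, by positivity, ?_⟩
  intro C₁ C₂ h lam hC₁ hC₂ hh h1 hlam hlam3
  rw [compBoundFun_eq S S' μ₁ μ₂ C₁ C₂ hh]
  have hr : 0 ≤ √h := Real.sqrt_nonneg h
  have hL := one_le_two_mul_log hh h1
  set L := Real.log (1 + h⁻¹) with hLdef
  clear_value L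
  have hL0 : 0 ≤ L := by linarith
  have b1 := freqSum_mul_posSum_funConst_le hC₁ hC₂ hS' hlam hr hlam3
  have f₁ := fullSum_le_orderSum hC₁ hS hlam hr hlam3
  have g₁ := topSum_le hC₁ hlam hlam3
  rw [hd1] at g₁
  rw [← hQ] at b1 f₁
  have o₁ := orderSum_nonneg hC₁ hr S
  have hC0 : 0 ≤ C₂ 0 := hC₂ 0 (by simp)
  have P₁ : 0 ≤ ∑ α ∈ idxLE (d - 1) d, ∑ β ∈ idxEq (d - 1) μ₁, C₁ α β :=
    Finset.sum_nonneg fun α _ => Finset.sum_nonneg fun β hβ => hC₁ α β (mem_idxEq.mp hβ).le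
  have P₂ : 0 ≤ ∑ β ∈ idxEq (d - 1) μ₂, C₂ β :=
    Finset.sum_nonneg fun β hβ => hC₂ β (mem_idxEq.mp hβ).le
  have S₁ : 0 ≤ ∑ α₁ ∈ idxLE (d - 1) S', ∑ β₁ ∈ idxLE (d - 1) S',
      ∑ β₂ ∈ idxLE (d - 1) S' with
        α₁.len + β₁.len + β₂.len ≤ S' ∧ 1 ≤ α₁.len + β₁.len ∧ β₁.len ≤ μ₁ ∧
        1 ≤ β₂.len ∧ β₂.len ≤ μ₂,
      √h ^ (α₁.len + β₁.len + β₂.len) * C₁ α₁ β₁ * C₂ β₂ :=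
    Finset.sum_nonneg fun α₁ _ => Finset.sum_nonneg fun β₁ _ =>
      Finset.sum_nonneg fun β₂ hβ₂ => by
        rw [Finset.mem_filter] at hβ₂
        exact mul_nonneg (mul_nonneg (pow_nonneg hr _) (hC₁ _ _ hβ₂.2.2.2.1))
          (hC₂ _ hβ₂.2.2.2.2.2)
  generalize (∑ α₁ ∈ idxLE (d - 1) S', ∑ β₁ ∈ idxLE (d - 1) S',
      ∑ β₂ ∈ idxLE (d - 1) S' with
        α₁.len + β₁.len + β₂.len ≤ S' ∧ 1 ≤ α₁.len + β₁.len ∧ β₁.len ≤ μ₁ ∧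
        1 ≤ β₂.len ∧ β₂.len ≤ μ₂,
      √h ^ (α₁.len + β₁.len + β₂.len) * C₁ α₁ β₁ * C₂ β₂) = X₁ at *
  generalize (∑ α ∈ idxLE (d - 1) d, ∑ β ∈ idxEq (d - 1) μ₁, C₁ α β) = X₂ at *
  generalize (∑ β ∈ idxEq (d - 1) μ₂, C₂ β) = X₃ at *
  generalize orderSum √h C₁ S μ₁ = O₁ at *
  generalize fullSum lam C₁ μ₁ = F₁ at *
  generalize topSum lam C₁ μ₁ = T₁ at *
  generalize C₂ 0 = c at *
  generalize √h = r at *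
  have b2 : F₁ * (lam ^ μ₂ * X₃) ≤ Q * 3 ^ μ₂ * (r ^ μ₂ * (O₁ * X₃)) := by
    calc F₁ * (lam ^ μ₂ * X₃) ≤ (Q * O₁) * ((3 * r) ^ μ₂ * X₃) :=
          mul_le_mul f₁ (mul_le_mul_of_nonneg_right (pow_le_pow_left₀ hlam hlam3 _) P₂)
            (by positivity) (by positivity)
      _ = _ := by rw [mul_pow]; ring
  have b3 : T₁ * c ≤ 2 * 3 ^ μ₁ * (r ^ μ₁ * L * (X₂ * c)) := by
    calc T₁ * c ≤ (3 ^ μ₁ * (r ^ μ₁ * X₂)) * c := mul_le_mul_of_nonneg_right g₁ hC0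
      _ ≤ (3 ^ μ₁ * (r ^ μ₁ * X₂)) * c * (2 * L) := le_mul_of_one_le_right (by positivity) hL
      _ = _ := by ring
  refine (add_le_add_mul_add (add_le_add_mul_add b1 b2 (by positivity) (by positivity)
    (by positivity) (by positivity)) b3 (by positivity) (by positivity) (by positivity)
    (by positivity)).trans_eq ?_
  ring

end CompositionBounds

theorem proposition2p6 (d : ℕ) (hd : 2 ≤ d) :
    ∃ sd : ℕ,
      (∀ (k₁ k₂ k' : ℝ) (μ₁ μ₂ : ℕ), k₁ < 0 → k₂ < k' → 1 ≤ μ₁ → 1 ≤ μ₂ →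
        ∃ K : ℝ, ∀ (C₁ C₂ : MultiIdx (d - 1) → MultiIdx (d - 1) → ℝ)
          (a₁ a₂ : EucSp (d - 1) → EucSp (d - 1) → ℂ) (h : ℝ),
          IsSymbol k₁ μ₁ C₁ a₁ → IsSymbol k₂ μ₂ C₂ a₂ → 0 < h → h ≤ 1 →
          ∃ (A₁ : L2Sp (d - 1) →L[ℂ] L2Sp (d - 1))
            (A₂ A₁₂ : ScSobolev (d - 1) h k' →L[ℂ] L2Sp (d - 1)),
            IsOpL2 h a₁ A₁ ∧ IsOpSobolev h k' a₂ A₂ ∧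
            IsOpSobolev h k' (fun x ξ => a₁ x ξ * a₂ x ξ) A₁₂ ∧
            ‖A₁ ∘L A₂ - A₁₂‖ ≤ K * compBound d sd (2 * d + 5 + sd) μ₁ μ₂ C₁ C₂ h) ∧
      (∀ (k₁ : ℝ) (μ₁ μ₂ : ℕ), k₁ < 0 → 1 ≤ μ₁ → 1 ≤ μ₂ →
        ∃ K : ℝ, ∀ (C₁ : MultiIdx (d - 1) → MultiIdx (d - 1) → ℝ) (C₂ : MultiIdx (d - 1) → ℝ)
          (a₁ : EucSp (d - 1) → EucSp (d - 1) → ℂ) (a₂ : EucSp (d - 1) → ℂ) (h : ℝ),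
          IsSymbol k₁ μ₁ C₁ a₁ → IsFunSymbol μ₂ C₂ a₂ → 0 < h → h ≤ 1 →
          ∃ A₁ A₂ A₁₂ : L2Sp (d - 1) →L[ℂ] L2Sp (d - 1),
            IsOpL2 h a₁ A₁ ∧ IsOpL2 h (fun x _ => a₂ x) A₂ ∧
            IsOpL2 h (fun x ξ => a₁ x ξ * a₂ x) A₁₂ ∧
            ‖A₁ ∘L A₂ - A₁₂‖ ≤
              K * compBoundFun d sd (2 * d + 5 + sd) μ₁ μ₂ C₁ C₂ h) := by
  have hlam3 : ∀ h : ℝ, h ≤ 1 → √(2 * Real.pi * h) ≤ 3 := fun h h1 =>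
    sqrt_two_pi_mul_le.trans (mul_le_of_le_one_right (by norm_num) (Real.sqrt_le_one.mpr h1))
  -- With this choice both requirements of the comparison hold: the norm bounds use total order 2
  -- `matrixOrder (d - 1)`, and the smooth defect uses 4 `matrixOrder (d - 1)`, which is at most 2d
  -- + 5 + s_d.
  refine ⟨4 * matrixOrder (d - 1), ?_, ?_⟩
  · intro k₁ k₂ k' μ₁ μ₂ hk₁ hk₂ _ hμ₂
    -- The weight ⟨ξ⟩^(-k') makes the order k₂ - k' of the second symbol negative.
    obtain ⟨K, hK, hA⟩ := exists_norm_comp_sub_le (d - 1) (k₂ := k₂) (s := -k') hk₁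
      (by linarith) (μ₁ := μ₁) hμ₂
    obtain ⟨K', hK', hB⟩ := scaled_bound_le_compBound hd (S := 4 * matrixOrder (d - 1))
      (S' := 2 * d + 5 + 4 * matrixOrder (d - 1)) (μ₁ := μ₁) (μ₂ := μ₂) (by omega) (by omega)
    refine ⟨K * K', fun C₁ C₂ a₁ a₂ h ha₁ ha₂ hh h1 => ?_⟩
    have hlam : 0 < √(2 * Real.pi * h) := Real.sqrt_pos.mpr (by positivity)
    have hb₁ := ha₁.isScaledSymbol hlam
    have hb₂ := ha₂.isScaledSymbol hlam
    obtain ⟨T₁, T₂, T₁₂, h₁, h₂, h₁₂, hn⟩ := hA _ C₁ C₂ _ _ hlam (hlam3 h h1) hb₁ hb₂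
    obtain ⟨D, E, hDE, hDE1, hop⟩ := exists_dilation_conjugation (n := d - 1) hh
    -- The weight is even in ξ, so the reflection in the scaled symbols does not affect it.
    have hw : ∀ ξ : EucSp (d - 1), freqWeight √(2 * Real.pi * h) (-k') ξ =
        ((japBr ((-√(2 * Real.pi * h)) • ξ) ^ (-k') : ℝ) : ℂ) := fun ξ => by
      simp [freqWeight, japBr, norm_smul]
    refine ⟨E ∘L T₁ ∘L D, (E ∘L T₂ ∘L D) ∘L ScSobolev.toL2CLM _ h k',
      (E ∘L T₁₂ ∘L D) ∘L ScSobolev.toL2CLM _ h k', hop a₁ T₁ h₁,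
      (hop (fun x ξ => a₂ x ξ * ((japBr ξ ^ (-k') : ℝ) : ℂ)) T₂ ?_).isOpSobolev hh,
      (hop (fun x ξ => a₁ x ξ * a₂ x ξ * ((japBr ξ ^ (-k') : ℝ) : ℂ)) T₁₂ ?_).isOpSobolev hh, ?_⟩
    · simpa only [hw] using h₂
    · simp only [hw, ← mul_assoc] at h₁₂
      exact h₁₂
    · refine (norm_comp_toL2CLM_sub_le _ _ _).trans ((norm_conjugation_sub_le hDE hDE1).trans ?_)
      rw [mul_assoc]
      exact hn.trans (mul_le_mul_of_nonneg_left (hB C₁ C₂ h _ (fun α β => hb₁.nonneg hlam α)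
        (fun α β => hb₂.nonneg hlam α) hh h1 hlam.le sqrt_two_pi_mul_le) hK)
  · intro k₁ μ₁ μ₂ hk₁ _ hμ₂
    obtain ⟨K, hK, hA⟩ := exists_norm_commutator_le (d - 1) hk₁ (μ₁ := μ₁) hμ₂
    obtain ⟨K', hK', hB⟩ := scaled_bound_le_compBoundFun hd (S := 4 * matrixOrder (d - 1))
      (S' := 2 * d + 5 + 4 * matrixOrder (d - 1)) (μ₁ := μ₁) (μ₂ := μ₂) (by omega) (by omega)
    refine ⟨K * K', fun C₁ C₂ a₁ a₂ h ha₁ ha₂ hh h1 => ?_⟩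
    have hlam : 0 < √(2 * Real.pi * h) := Real.sqrt_pos.mpr (by positivity)
    have hb₁ := ha₁.isScaledSymbol hlam
    obtain ⟨T₁, T₂, T₁₂, h₁, h₂, h₁₂, hn⟩ :=
      hA _ C₁ C₂ _ _ hlam (hlam3 h h1) hb₁ (ha₂.dilation hlam)
    obtain ⟨D, E, hDE, hDE1, hop⟩ := exists_dilation_conjugation (n := d - 1) hh
    refine ⟨E ∘L T₁ ∘L D, E ∘L T₂ ∘L D, E ∘L T₁₂ ∘L D, hop a₁ T₁ h₁,
      hop (fun x _ => a₂ x) T₂ h₂, hop (fun x ξ => a₁ x ξ * a₂ x) T₁₂ h₁₂, ?_⟩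
    refine (norm_conjugation_sub_le hDE hDE1).trans ?_
    rw [mul_assoc]
    exact hn.trans (mul_le_mul_of_nonneg_left (hB C₁ C₂ h _ (fun α β => hb₁.nonneg hlam α)
      (fun β => ha₂.nonneg) hh h1 hlam.le sqrt_two_pi_mul_le) hK)
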